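/- Let $d\in\{2,3\}$, let $\Omega\subset\mathbb R^d$ be a bounded domain and let $b$ be a $C^\infty$ vector field on $\overline\Omega$ (the restriction of a $C^\infty$ field on $\mathbb R^d$) with $|b|=1$ on $\Omega$. Let $n$ be the outward unit normal at the points near which $\partial\Omega$ is a $C^1$ hypersurface with $\Omega$ on one side, and, among these points, let $\partial\Omega_D$, $\partial\Omega_{in}$, $\partial\Omega_{out}$ be the sets where $b\cdot n=0$, $b\cdot n<0$, $b\cdot n>0$ respectively. Assume: 1. $\partial\Omega=\overline{\partial\Omega_D}\cup\overline{\partial\Omega_{in}}\cup\overline{\partial\Omega_{out}}$, and $\overline{\partial\Omega_{in}}\cap\overline{\partial\Omega_{out}}=\varnothing$; 2. there is $\alpha>0$ with $b\cdot n\le-\alpha$ on $\partial\Omega_{in}$ and $b\cdot n\ge\alpha$ on $\partial\Omega_{out}$; 3. there are a bounded domain $\Gamma_{in}\subset\mathbb R^{d-1}$ and a map $h_{in}\in C^2(\overline{\Gamma}_{in};\mathbb R^d)$ (the restriction of a $C^2$ map on $\mathbb R^{d-1}$), one-to-one on $\Gamma_{in}$, with $h_{in}(\Gamma_{in})=\partial\Omega_{in}$,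 such that $n\circ h_{in}$ extends continuously to $\overline\Gamma_{in}$ and the vectors $\partial_{\xi_1}h_{in},\dots,\partial_{\xi_{d-1}}h_{in},n$ are linearly independent at every point of $\overline\Gamma_{in}$; and the same holds for $\partial\Omega_{out}$ with some $\Gamma_{out},h_{out}$; 4. every $x\in\Omega$ lies on an integral curve of $b$ which starts at a point of $\partial\Omega_{in}$, runs inside $\Omega$ and ends at a point of $\partial\Omega_{out}$, and the lengths of these curves are bounded by a constant independent of $x$. Write $\nabla_\parallel\phi=(b\cdot\nabla\phi)b$, $\nabla_\perp\phi=\nabla\phi-\nabla_\parallel\phi$ (weak derivatives), let $(\cdot,\cdot)$ be the inner product of $L^2(\Omega)$ and $\sigma$ the surface measure. Let $\mathcal V=\{\phi\in H^1(\Omega):\phi|_{\partial\Omega_D}=0\}$ (that is, the $H^1$-closure of the functions in $C^1(\overline\Omega)$ that vanish on $\partial\Omega_D$; here $C^1(\overline\Omega)$ consists of the restrictions of $C^1$ functions on $\mathbb R^d$), with the $H^1$ norm, and $$\mathcal G=\{\phi\in\mathcal V:\nabla_\parallel\phi=0\},\qquad \mathcal A=\{\phi\in\mathcal V:(\phi,\psi)=0\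 \ \forall\psi\in\mathcal G\}.$$ Let $\tilde{\mathcal V}=\{\phi\in L^2(\Omega):\nabla_\parallel\phi\in L^2(\Omega)\}$ with inner product $(\phi,\psi)+(\nabla_\parallel\phi,\nabla_\parallel\psi)$, and $\tilde{\mathcal G}=\{\phi\in\tilde{\mathcal V}:\nabla_\parallel\phi=0\}$. Then: (B) $\mathcal V=\mathcal G\oplus\mathcal A$ (an $L^2$-orthogonal direct sum). There is a linear map $P:\mathcal V\to\mathcal G$ with $(P\phi,\psi)=(\phi,\psi)$ for all $\phi\in\mathcal V$, $\psi\in\mathcal G$, which is continuous in the $H^1$ norm, and there is a constant $C$ such that for all $\phi\in\mathcal V$ $$\|\nabla_\perp(P\phi)\|_{L^2(\Omega)}\le C\|\nabla\phi\|_{L^2(\Omega)},\qquad \|\phi-P\phi\|_{L^2(\Omega)}\le C\|\nabla_\parallel\phi\|_{L^2(\Omega)} .$$ (B') There is exactly one continuous linear map $\tilde{\mathcal V}\to L^2(\partial\Omega_{in},\sigma)$, $u\mapsto u|_{\partial\Omega_{in}}$ (the inflow trace), which is the ordinary restriction for $u\in C^1(\overline\Omega)$. With $\mathcal L=\{\lambda\in\tilde{\mathcal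 V}:\lambda|_{\partial\Omega_{in}}=0\}$ one has $\tilde{\mathcal V}=\tilde{\mathcal G}\oplus\mathcal L$. Moreover, if $g\in\tilde{\mathcal G}$ satisfies $\int_{\partial\Omega_{in}}\eta\,g\,d\sigma=0$ for all $\eta\in\mathcal G$, then $g=0$. -/

import Mathlib

open MeasureTheory Set Filter Topology
open scoped NNReal ENNReal ContDiff Gradient RealInnerProductSpace

noncomputable section

namespace Aligned

/-- Euclidean space `ℝⁿ`. -/
abbrev E (n : ℕ) : Type := EuclideanSpace ℝ (Fin n)

/-! ### The boundary of the domain -/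

/-- `n` is the outward unit normal to `Ω` at the boundary point `x`, and the boundary of `Ω` is of
class `C¹` near `x`: there `Ω = {ρ < 0}` with `ρ` of class `C¹`, `ρ x = 0`, and `∇ρ(x) ≠ 0` is a
positive multiple of `n`. -/
def IsOuterNormal {d : ℕ} (Ω : Set (E d)) (x n : E d) : Prop :=
  ‖n‖ = 1 ∧ ∃ ρ : E d → ℝ, ContDiffAt ℝ 1 ρ x ∧ ρ x = 0 ∧
    (∃ c : ℝ, 0 < c ∧ ∇ ρ x = c • n) ∧ ∀ᶠ y in 𝓝 x, (y ∈ Ω ↔ ρ y < 0)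

/-- `∂Ω_D`: the boundary points with `b · n = 0`. -/
def tangentialBdry {d : ℕ} (Ω : Set (E d)) (b : E d → E d) : Set (E d) :=
  {x | x ∈ frontier Ω ∧ ∃ n, IsOuterNormal Ω x n ∧ ⟪b x, n⟫ = 0}

/-- `∂Ω_in`: the boundary points with `b · n < 0`. -/
def inflowBdry {d : ℕ} (Ω : Set (E d)) (b : E d → E d) : Set (E d) :=
  {x | x ∈ frontier Ω ∧ ∃ n, IsOuterNormal Ω x n ∧ ⟪b x, n⟫ < 0}

/-- `∂Ω_out`: the boundary points with `b · n > 0`. -/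
def outflowBdry {d : ℕ} (Ω : Set (E d)) (b : E d → E d) : Set (E d) :=
  {x | x ∈ frontier Ω ∧ ∃ n, IsOuterNormal Ω x n ∧ 0 < ⟪b x, n⟫}

/-- The piece `S` of the boundary of `Ω` has a global `C²` system of coordinates: it is the
one-to-one image under `h ∈ C²(closure Γ)` of a bounded domain `Γ` in `ℝᵐ`, and
the vectors `∂h/∂ξ₁, …, ∂h/∂ξₘ, n` form an invertible matrix at every point of `closure Γ`, where
`n` is the outward normal along `S`, extended continuously to `closure Γ`. -/
def HasGlobalParam {m : ℕ} (Ω S : Set (E (m + 1))) : Prop :=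
  ∃ (Γ : Set (E m)) (h n : E m → E (m + 1)),
    IsOpen Γ ∧ IsConnected Γ ∧ Bornology.IsBounded Γ ∧
    ContDiff ℝ 2 h ∧ InjOn h Γ ∧ h '' Γ = S ∧
    ContinuousOn n (closure Γ) ∧ (∀ ξ ∈ Γ, IsOuterNormal Ω (h ξ) (n ξ)) ∧
    ∀ ξ ∈ closure Γ, LinearIndependent ℝ
      (Fin.snoc (fun i : Fin m => fderiv ℝ h ξ (EuclideanSpace.single i 1)) (n ξ) :
        Fin (m + 1) → E (m + 1))

/-- `γ` is, on the parameter interval `[0, L]`, a field line of `b` which starts on `∂Ω_in`, runs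
inside `Ω` and ends on `∂Ω_out`. -/
def IsTraversingLine {d : ℕ} (Ω : Set (E d)) (b : E d → E d) (γ : ℝ → E d) (L : ℝ) : Prop :=
  0 < L ∧ γ 0 ∈ inflowBdry Ω b ∧ γ L ∈ outflowBdry Ω b ∧ (∀ t ∈ Ioo 0 L, γ t ∈ Ω) ∧
    ∀ t ∈ Icc 0 L, HasDerivWithinAt γ (b (γ t)) (Icc 0 L) t

/-- The assumptions on the domain and on the way in which the field lines of `b` cross it. The
boundary may have edges (points without normal) where the three pieces meet. -/
structure IsCrossedBy {m : ℕ} (Ω : Set (E (m + 1))) (b : E (m + 1) → E (m + 1)) : Prop where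
  isOpen : IsOpen Ω
  isConnected : IsConnected Ω
  isBounded : Bornology.IsBounded Ω
  norm_eq_one : ∀ x ∈ Ω, ‖b x‖ = 1
  frontier_eq : frontier Ω =
    closure (tangentialBdry Ω b) ∪ closure (inflowBdry Ω b) ∪ closure (outflowBdry Ω b)
  disjoint : Disjoint (closure (inflowBdry Ω b)) (closure (outflowBdry Ω b))
  transversal : ∃ α : ℝ, 0 < α ∧ ∀ x n, IsOuterNormal Ω x n →
    (x ∈ inflowBdry Ω b → ⟪b x, n⟫ ≤ -α) ∧ (x ∈ outflowBdry Ω b → α ≤ ⟪b x, n⟫)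
  param_in : HasGlobalParam Ω (inflowBdry Ω b)
  param_out : HasGlobalParam Ω (outflowBdry Ω b)
  lines : ∃ Λ : ℝ, ∀ x ∈ Ω, ∃ (γ : ℝ → E (m + 1)) (L : ℝ),
    L ≤ Λ ∧ IsTraversingLine Ω b γ L ∧ ∃ t ∈ Ioo 0 L, γ t = x

/-! ### The function spaces -/

/-- `L²(Ω)`. -/
abbrev L2 {d : ℕ} (Ω : Set (E d)) : Type := Lp ℝ 2 (volume.restrict Ω)

/-- `L²(Ω)ᵈ`. -/
abbrev L2V {d : ℕ} (Ω : Set (E d)) : Type := Lp (E d) 2 (volume.restrict Ω)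

/-- A smooth function with compact support in `Ω`. -/
def IsTest {d : ℕ} (Ω : Set (E d)) (ψ : E d → ℝ) : Prop :=
  ContDiff ℝ ∞ ψ ∧ HasCompactSupport ψ ∧ tsupport ψ ⊆ Ω

/-- The divergence of a vector field. -/
def divergence {d : ℕ} (v : E d → E d) (x : E d) : ℝ :=
  ∑ i : Fin d, (fderiv ℝ v x (EuclideanSpace.single i 1)) i

/-- `G = ∇u` in the sense of distributions on `Ω`. -/
def IsWeakGradient {d : ℕ} (Ω : Set (E d)) (u : E d → ℝ) (G : E d → E d) : Prop :=
  ∀ ψ, IsTest Ω ψ → ∫ x in Ω, u x • ∇ ψ x = -∫ x in Ω, ψ x • G x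

/-- `g = b · ∇u` in the sense of distributions on `Ω`. -/
def IsWeakDirDeriv {d : ℕ} (Ω : Set (E d)) (b : E d → E d) (u g : E d → ℝ) : Prop :=
  ∀ ψ, IsTest Ω ψ → ∫ x in Ω, u x * divergence (fun y => ψ y • b y) x = -∫ x in Ω, ψ x * g x

lemma integrable_smul_of_test {d : ℕ} {Ω : Set (E d)} {F : Type*} [NormedAddCommGroup F]
    [NormedSpace ℝ F] {ψ : E d → ℝ} (hc : Continuous ψ) (hs : HasCompactSupport ψ)
    (G : Lp F 2 (volume.restrict Ω)) : Integrable (fun x => ψ x • G x) (volume.restrict Ω) := by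
  have h1 : MemLp ψ 2 (volume.restrict Ω) := (hc.memLp_of_hasCompactSupport hs).restrict Ω
  have h2 := (Lp.memLp G).smul (r := 1) h1
  exact memLp_one_iff_integrable.1 h2

lemma integrable_smul_of_test' {d : ℕ} {Ω : Set (E d)} {F : Type*} [NormedAddCommGroup F]
    [NormedSpace ℝ F] {v : E d → F} (hc : Continuous v) (hs : HasCompactSupport v)
    (u : L2 Ω) : Integrable (fun x => u x • v x) (volume.restrict Ω) := by
  have h1 : MemLp v 2 (volume.restrict Ω) := (hc.memLp_of_hasCompactSupport hs).restrict Ω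
  have h2 := h1.smul (r := 1) (Lp.memLp u)
  exact memLp_one_iff_integrable.1 h2

lemma IsTest.continuous_gradient {d : ℕ} {Ω : Set (E d)} {ψ : E d → ℝ} (h : IsTest Ω ψ) :
    Continuous (∇ ψ) :=
  (InnerProductSpace.toDual ℝ (E d)).symm.continuous.comp (h.1.continuous_fderiv (by simp))

lemma IsTest.hasCompactSupport_gradient {d : ℕ} {Ω : Set (E d)} {ψ : E d → ℝ}
    (h : IsTest Ω ψ) : HasCompactSupport (∇ ψ) :=
  (h.2.1.fderiv (𝕜 := ℝ)).comp_left (g := (InnerProductSpace.toDual ℝ (E d)).symm) (by simp)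

lemma IsTest.continuous_div {d : ℕ} {Ω : Set (E d)} {ψ : E d → ℝ} (h : IsTest Ω ψ)
    {b : E d → E d} (hb : ContDiff ℝ ∞ b) : Continuous (divergence (fun y => ψ y • b y)) := by
  have h1 : Continuous (fderiv ℝ (fun y => ψ y • b y)) :=
    (h.1.smul hb).continuous_fderiv (by simp)
  unfold divergence
  fun_prop

lemma IsTest.hasCompactSupport_div {d : ℕ} {Ω : Set (E d)} {ψ : E d → ℝ} (h : IsTest Ω ψ)
    (b : E d → E d) : HasCompactSupport (divergence (fun y => ψ y • b y)) := by
  have h1 : HasCompactSupport (fun y => ψ y • b y) := h.2.1.smul_right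
  exact (h1.fderiv (𝕜 := ℝ)).comp_left
    (g := fun A : E d →L[ℝ] E d => ∑ i : Fin d, (A (EuclideanSpace.single i 1)) i) (by simp)

/-- `H¹(Ω)`, as the Hilbert space of the pairs `(u, ∇u) ∈ L²(Ω) × L²(Ω)ᵈ`; its norm is
`(‖u‖² + ‖∇u‖²)^{1/2}`. -/
def H1 {d : ℕ} (Ω : Set (E d)) : Submodule ℝ (WithLp 2 (L2 Ω × L2V Ω)) where
  carrier := {w | IsWeakGradient Ω w.fst w.snd}
  zero_mem' := by
    intro ψ hψ
    have e1 : ∫ x in Ω, (0 : L2 Ω) x • ∇ ψ x = 0 := by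
      rw [← integral_zero (E d) (E d) (μ := volume.restrict Ω)]
      refine integral_congr_ae ?_
      filter_upwards [Lp.coeFn_zero ℝ 2 (volume.restrict Ω)] with x hx
      rw [hx]; simp
    have e2 : ∫ x in Ω, ψ x • (0 : L2V Ω) x = 0 := by
      rw [← integral_zero (E d) (E d) (μ := volume.restrict Ω)]
      refine integral_congr_ae ?_
      filter_upwards [Lp.coeFn_zero (E d) 2 (volume.restrict Ω)] with x hx
      rw [hx]; simp
    rw [WithLp.zero_fst, WithLp.zero_snd, e1, e2, neg_zero]
  add_mem' := by
    intro w z hw hz ψ hψ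
    have e1 : ∫ x in Ω, (w.fst + z.fst) x • ∇ ψ x
        = (∫ x in Ω, w.fst x • ∇ ψ x) + ∫ x in Ω, z.fst x • ∇ ψ x := by
      rw [← integral_add
        (integrable_smul_of_test' hψ.continuous_gradient hψ.hasCompactSupport_gradient _)
        (integrable_smul_of_test' hψ.continuous_gradient hψ.hasCompactSupport_gradient _)]
      refine integral_congr_ae ?_
      filter_upwards [Lp.coeFn_add w.fst z.fst] with x hx
      rw [hx, Pi.add_apply, add_smul]
    have e2 : ∫ x in Ω, ψ x • (w.snd + z.snd) x
        = (∫ x in Ω, ψ x • w.snd x) + ∫ x in Ω, ψ x • z.snd x := by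
      rw [← integral_add (integrable_smul_of_test hψ.1.continuous hψ.2.1 _)
        (integrable_smul_of_test hψ.1.continuous hψ.2.1 _)]
      refine integral_congr_ae ?_
      filter_upwards [Lp.coeFn_add w.snd z.snd] with x hx
      rw [hx, Pi.add_apply, smul_add]
    rw [WithLp.add_fst, WithLp.add_snd, e1, e2, hw ψ hψ, hz ψ hψ]
    abel
  smul_mem' := by
    intro c w hw ψ hψ
    have e1 : ∫ x in Ω, (c • w.fst) x • ∇ ψ x = c • ∫ x in Ω, w.fst x • ∇ ψ x := by
      rw [← integral_smul]
      refine integral_congr_ae ?_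
      filter_upwards [Lp.coeFn_smul c w.fst] with x hx
      rw [hx]; simp [mul_smul]
    have e2 : ∫ x in Ω, ψ x • (c • w.snd) x = c • ∫ x in Ω, ψ x • w.snd x := by
      rw [← integral_smul]
      refine integral_congr_ae ?_
      filter_upwards [Lp.coeFn_smul c w.snd] with x hx
      simp only [hx, Pi.smul_apply]
      exact smul_comm _ _ _
    rw [WithLp.smul_fst, WithLp.smul_snd, e1, e2, hw ψ hψ, smul_neg]

/-- The pairs `(φ, ∇φ)` with `φ ∈ C¹(closure Ω)` (a restriction of a `C¹` function on `ℝᵈ`) and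
`φ = 0` on `∂Ω_D`. -/
def classicalV {d : ℕ} (Ω : Set (E d)) (b : E d → E d) :
    Submodule ℝ (WithLp 2 (L2 Ω × L2V Ω)) where
  carrier := {w | ∃ φ : E d → ℝ, ContDiff ℝ 1 φ ∧ (∀ x ∈ tangentialBdry Ω b, φ x = 0) ∧
    w.fst =ᵐ[volume.restrict Ω] φ ∧ w.snd =ᵐ[volume.restrict Ω] ∇ φ}
  zero_mem' := by
    refine ⟨fun _ => 0, contDiff_const, fun _ _ => rfl, ?_, ?_⟩
    · exact Lp.coeFn_zero ℝ 2 (volume.restrict Ω)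
    · filter_upwards [Lp.coeFn_zero (E d) 2 (volume.restrict Ω)] with x hx
      rw [WithLp.zero_snd, hx]; simp [gradient]
  add_mem' := by
    rintro w z ⟨φ, h1, h2, h3, h4⟩ ⟨η, k1, k2, k3, k4⟩
    refine ⟨φ + η, h1.add k1, fun x hx => by simp [h2 x hx, k2 x hx], ?_, ?_⟩
    · rw [WithLp.add_fst]
      exact (Lp.coeFn_add w.fst z.fst).trans (h3.add k3)
    · rw [WithLp.add_snd]
      filter_upwards [Lp.coeFn_add w.snd z.snd, h4, k4] with x hx hx1 hx2
      rw [hx, Pi.add_apply, hx1, hx2]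
      simp only [gradient]
      rw [fderiv_add (h1.differentiable (by simp) x) (k1.differentiable (by simp) x), map_add]
  smul_mem' := by
    rintro c w ⟨φ, h1, h2, h3, h4⟩
    refine ⟨c • φ, h1.const_smul c, fun x hx => by simp [h2 x hx], ?_, ?_⟩
    · rw [WithLp.smul_fst]
      exact (Lp.coeFn_smul c w.fst).trans (h3.const_smul c)
    · rw [WithLp.smul_snd]
      filter_upwards [Lp.coeFn_smul c w.snd, h4] with x hx hx1
      rw [hx, Pi.smul_apply, hx1]
      simp only [gradient]
      rw [fderiv_const_smul (h1.differentiable (by simp) x)]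
      simp

/-- `𝒱 = {φ ∈ H¹(Ω) : φ = 0 on ∂Ω_D}`, the boundary condition being understood in the sense
that `φ` is the limit in `H¹(Ω)` of functions in `C¹(closure Ω)` which vanish on `∂Ω_D`. It carries
the norm of `H¹(Ω)`. -/
def spaceV {d : ℕ} (Ω : Set (E d)) (b : E d → E d) : Submodule ℝ (WithLp 2 (L2 Ω × L2V Ω)) :=
  H1 Ω ⊓ (classicalV Ω b).topologicalClosure

/-- The parallel part `(b · v) b` of a vector field `v`. -/
def par {d : ℕ} (b v : E d → E d) (x : E d) : E d := ⟪b x, v x⟫ • b x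

/-- The perpendicular part `v - (b · v) b` of a vector field `v`. -/
def perp {d : ℕ} (b v : E d → E d) (x : E d) : E d := v x - par b v x

/-- `𝒢 = {φ ∈ 𝒱 : ∇_∥ φ = 0}`. -/
def spaceG {d : ℕ} (Ω : Set (E d)) (b : E d → E d) : Submodule ℝ (spaceV Ω b) where
  carrier := {w | par b w.1.snd =ᵐ[volume.restrict Ω] 0}
  zero_mem' := by
    filter_upwards [Lp.coeFn_zero (E d) 2 (volume.restrict Ω)] with x hx
    have h : (0 : spaceV Ω b).1.snd x = (0 : L2V Ω) x := rfl
    simp only [par, h, hx]; simp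
  add_mem' := by
    intro w z hw hz
    simp only [mem_ofPred_eq] at hw hz ⊢
    filter_upwards [Lp.coeFn_add w.1.snd z.1.snd, hw, hz] with x hx hx1 hx2
    simp only [par, Pi.zero_apply] at hx1 hx2
    have h : (w + z).1.snd x = (w.1.snd + z.1.snd) x := rfl
    simp only [par, h, hx]; simp [inner_add_right, add_smul, hx1, hx2]
  smul_mem' := by
    intro c w hw
    simp only [mem_ofPred_eq] at hw ⊢
    filter_upwards [Lp.coeFn_smul c w.1.snd, hw] with x hx hx1
    simp only [par, Pi.zero_apply] at hx1
    have h : (c • w).1.snd x = (c • w.1.snd) x := rfl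
    simp only [par, h, hx]; simp [inner_smul_right, mul_smul, hx1]

/-- `𝒜 = {φ ∈ 𝒱 : (φ, ψ)_{L²} = 0 for all ψ ∈ 𝒢}`. -/
def spaceA {d : ℕ} (Ω : Set (E d)) (b : E d → E d) : Submodule ℝ (spaceV Ω b) where
  carrier := {w | ∀ ψ ∈ spaceG Ω b, ⟪w.1.fst, ψ.1.fst⟫ = 0}
  zero_mem' := by intro ψ _; simp
  add_mem' := by
    intro w z hw hz ψ hψ
    simp [inner_add_left, hw ψ hψ, hz ψ hψ]
  smul_mem' := by
    intro c w hw ψ hψ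
    simp [inner_smul_left, hw ψ hψ]

/-- `𝒱̃ = {φ ∈ L²(Ω) : ∇_∥ φ ∈ L²(Ω)}`, as the Hilbert space of the pairs `(φ, b · ∇φ)` in
`L²(Ω) × L²(Ω)`. Since `∇_∥ φ = (b · ∇φ) b` with `|b| = 1`, the inner product is
`(φ, ψ) + (∇_∥ φ, ∇_∥ ψ)`. -/
def spaceVt {d : ℕ} (Ω : Set (E d)) (b : E d → E d) (hb : ContDiff ℝ ∞ b) :
    Submodule ℝ (WithLp 2 (L2 Ω × L2 Ω)) where
  carrier := {w | IsWeakDirDeriv Ω b w.fst w.snd}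
  zero_mem' := by
    intro ψ hψ
    have e1 : ∫ x in Ω, (0 : L2 Ω) x * divergence (fun y => ψ y • b y) x = 0 := by
      rw [← integral_zero (E d) ℝ (μ := volume.restrict Ω)]
      refine integral_congr_ae ?_
      filter_upwards [Lp.coeFn_zero ℝ 2 (volume.restrict Ω)] with x hx
      rw [hx]; simp
    have e2 : ∫ x in Ω, ψ x * (0 : L2 Ω) x = 0 := by
      rw [← integral_zero (E d) ℝ (μ := volume.restrict Ω)]
      refine integral_congr_ae ?_
      filter_upwards [Lp.coeFn_zero ℝ 2 (volume.restrict Ω)] with x hx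
      rw [hx]; simp
    rw [WithLp.zero_fst, WithLp.zero_snd, e1, e2, neg_zero]
  add_mem' := by
    intro w z hw hz ψ hψ
    have e1 : ∫ x in Ω, (w.fst + z.fst) x * divergence (fun y => ψ y • b y) x
        = (∫ x in Ω, w.fst x * divergence (fun y => ψ y • b y) x)
          + ∫ x in Ω, z.fst x * divergence (fun y => ψ y • b y) x := by
      refine Eq.trans ?_ (integral_add
        (integrable_smul_of_test' (hψ.continuous_div hb) (hψ.hasCompactSupport_div b) w.fst)
        (integrable_smul_of_test' (hψ.continuous_div hb) (hψ.hasCompactSupport_div b) z.fst))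
      refine integral_congr_ae ?_
      filter_upwards [Lp.coeFn_add w.fst z.fst] with x hx
      rw [hx, Pi.add_apply, add_mul]
    have e2 : ∫ x in Ω, ψ x * (w.snd + z.snd) x
        = (∫ x in Ω, ψ x * w.snd x) + ∫ x in Ω, ψ x * z.snd x := by
      refine Eq.trans ?_ (integral_add (integrable_smul_of_test hψ.1.continuous hψ.2.1 w.snd)
        (integrable_smul_of_test hψ.1.continuous hψ.2.1 z.snd))
      refine integral_congr_ae ?_
      filter_upwards [Lp.coeFn_add w.snd z.snd] with x hx
      rw [hx, Pi.add_apply, mul_add]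
    rw [WithLp.add_fst, WithLp.add_snd, e1, e2, hw ψ hψ, hz ψ hψ]
    ring
  smul_mem' := by
    intro c w hw ψ hψ
    have e1 : ∫ x in Ω, (c • w.fst) x * divergence (fun y => ψ y • b y) x
        = c * ∫ x in Ω, w.fst x * divergence (fun y => ψ y • b y) x := by
      rw [← integral_const_mul]
      refine integral_congr_ae ?_
      filter_upwards [Lp.coeFn_smul c w.fst] with x hx
      rw [hx]; simp [mul_assoc]
    have e2 : ∫ x in Ω, ψ x * (c • w.snd) x = c * ∫ x in Ω, ψ x * w.snd x := by
      rw [← integral_const_mul]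
      refine integral_congr_ae ?_
      filter_upwards [Lp.coeFn_smul c w.snd] with x hx
      simp only [hx, Pi.smul_apply, smul_eq_mul]
      ring
    rw [WithLp.smul_fst, WithLp.smul_snd, e1, e2, hw ψ hψ]
    ring

/-- `𝒢̃ = {φ ∈ 𝒱̃ : ∇_∥ φ = 0}`. -/
def spaceGt {d : ℕ} (Ω : Set (E d)) (b : E d → E d) (hb : ContDiff ℝ ∞ b) :
    Submodule ℝ (spaceVt Ω b hb) where
  carrier := {w | w.1.snd = 0}
  zero_mem' := by simp
  add_mem' := by
    intro w z hw hz
    simp only [mem_ofPred_eq] at hw hz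
    simp [hw, hz]
  smul_mem' := by
    intro c w hw
    simp only [mem_ofPred_eq] at hw
    simp [hw]

/-- The surface measure `dσ` on `∂Ω_in`. -/
def inflowMeasure {m : ℕ} (Ω : Set (E (m + 1))) (b : E (m + 1) → E (m + 1)) :
    Measure (E (m + 1)) :=
  (μHE[m]).restrict (inflowBdry Ω b)

/-- The continuous linear map `T : 𝒱̃ → L²(∂Ω_in)` is an inflow trace operator: on (the restrictions
to `Ω` of) the functions `φ ∈ C¹(closure Ω)` it is the restriction `φ ↦ φ|∂Ω_in`. -/
def IsInflowTrace {m : ℕ} (Ω : Set (E (m + 1))) (b : E (m + 1) → E (m + 1))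
    (hb : ContDiff ℝ ∞ b) (T : spaceVt Ω b hb →L[ℝ] Lp ℝ 2 (inflowMeasure Ω b)) : Prop :=
  ∀ (φ : E (m + 1) → ℝ) (u : spaceVt Ω b hb), ContDiff ℝ 1 φ →
    u.1.fst =ᵐ[volume.restrict Ω] φ → T u =ᵐ[inflowMeasure Ω b] φ

end Aligned

end

open Aligned

/-!
The proof straightens the field. After cutting `b` off outside a neighbourhood of the closed domain
one has a globally Lipschitz smooth field, its flow, and, issuing from the inflow face, an orbit
through every point of `Ω`. Transversality of the field at the outflow face makes the exit time a
`C¹` function with bounded derivative, so that the time-rescaled orbits give coordinates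
`Y (ξ, s)` with `ξ ∈ Γ` and `0 < s < 1`, in which `b · ∇` is a multiple of `∂ / ∂s`. The density
`w` of Lebesgue measure in these coordinates is bounded above and below and has a bounded
derivative: its lower bound comes from transversality at the inflow face and from Liouville's
formula along the orbits. Hence `L²` norms over `Ω` and over `Γ × (0, 1)` are equivalent, and the
functions with vanishing parallel gradient are the functions of `ξ` alone.

The projection `P` replaces a function by its mean over each field line, with weight `w`. Fubini's
theorem gives the orthogonality to functions of `ξ`; the inequality of Poincaré on each line,
`abs_sub_mean_le_integral`, bounds `φ - Pφ` by the parallel derivative. Differentiating the mean in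
`ξ`, the derivative of the weight is multiplied by `φ` minus its mean, which is again bounded by the
parallel derivative; this is `exists_norm_fderiv_mean_le`, and it is why the gradient of `Pφ` is
bounded by the gradient of `φ` without a term of order zero. The mean has to vanish on the part of
the boundary tangential to `b`: a field line near the lateral boundary of the coordinate cylinder is
near that part (`X_mem_closure_tangentialBdry`), so the mean of a function vanishing there is small,
and its truncations, which are supported away from the lateral boundary, extend to `C¹` functions
(`exists_extension`, `mem_closure_classicalV`). Density then extends `P` to the whole space
(`exists_projection`).

For the larger space, the lemma of du Bois-Reymond in the straightened coordinates shows that an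
element with vanishing parallel derivative is a function of `ξ` (`exists_liftL_eq`), and an element
is determined by its parallel derivative up to such a function, the equation `b · ∇u = g` with zero
inflow values being solved by integration along the lines (`exists_snd_eq`). It follows that `C¹`
functions are dense (`spaceVt_eq`), so that the inflow trace extends by continuity from them and is
unique (`exists_trace`, `eq_of_isInflowTrace`), and the decomposition is `isCompl_spaceGt_ker`.
Finally, surface measure on the inflow face is equivalent to Lebesgue measure on `Γ`
(`exists_surf_le`, `absolutelyContinuous_surf`), and the functions of `ξ` given by compactly
supported test functions are admissible in the last assertion, which therefore reduces to the
fundamental lemma of the calculus of variations (`eq_zero_of_forall_integral_eq_zero`).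
-/

open scoped Manifold

noncomputable section

namespace Aligned

/-! ### The integral equation of a flow -/

section CurveOperators
open scoped BoundedContinuousFunction
variable {F : Type*} [NormedAddCommGroup F] [NormedSpace ℝ F]

/-- Pointwise application of a continuous family of continuous linear maps to a continuous
function, as a bounded bilinear map between spaces of continuous functions. -/
def pointwiseApply (F : Type*) [NormedAddCommGroup F] [NormedSpace ℝ F] :
    (unitInterval →ᵇ (F →L[ℝ] F)) →L[ℝ] (unitInterval →ᵇ F) →L[ℝ] (unitInterval →ᵇ F) :=
  LinearMap.mkContinuous₂
    (LinearMap.mk₂ ℝ (fun (A : (unitInterval →ᵇ (F →L[ℝ] F))) (γ : (unitInterval →ᵇ F)) =>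
        (BoundedContinuousFunction.mkOfCompact ⟨fun s => A s (γ s),
          A.continuous.clm_apply γ.continuous⟩ : (unitInterval →ᵇ F)))
      (fun _ _ _ => by ext; simp) (fun _ _ _ => by ext; simp)
      (fun _ _ _ => by ext; simp) (fun _ _ _ => by ext; simp)) 1
    (fun (A : (unitInterval →ᵇ (F →L[ℝ] F))) (γ : (unitInterval →ᵇ F)) => by
      rw [BoundedContinuousFunction.norm_le (by positivity)]
      intro s
      have h1 := (A s).le_opNorm (γ s)
      have h2 := A.norm_coe_le_norm s
      have h3 := γ.norm_coe_le_norm s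
      calc ‖A s (γ s)‖ ≤ ‖A s‖ * ‖γ s‖ := h1
        _ ≤ ‖A‖ * ‖γ‖ := by gcongr
        _ = 1 * ‖A‖ * ‖γ‖ := by ring)

lemma norm_pointwiseApply_le (A : (unitInterval →ᵇ (F →L[ℝ] F))) : ‖pointwiseApply F A‖ ≤ ‖A‖ := by
  refine ContinuousLinearMap.opNorm_le_bound _ (norm_nonneg (E := unitInterval →ᵇ (F →L[ℝ] F)) A) fun γ => ?_
  rw [BoundedContinuousFunction.norm_le (by positivity)]
  intro s
  exact ((A s).le_opNorm (γ s)).trans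
    (mul_le_mul (A.norm_coe_le_norm s) (γ.norm_coe_le_norm s) (norm_nonneg _)
      (norm_nonneg (E := unitInterval →ᵇ (F →L[ℝ] F)) A))

/-- Composition of a continuous curve with a continuous map. -/
def postcomp {F G : Type*} [NormedAddCommGroup F] [NormedAddCommGroup G] (v : F → G) (hv : Continuous v)
    (γ : unitInterval →ᵇ F) : unitInterval →ᵇ G :=
  BoundedContinuousFunction.mkOfCompact ((⟨v, hv⟩ : C(F, G)).comp γ.toContinuousMap)

lemma continuous_postcomp {F G : Type*} [NormedAddCommGroup F] [NormedAddCommGroup G] {v : F → G} (hv : Continuous v) :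
    Continuous (postcomp v hv) := by
  have h1 := (ContinuousMap.isometryEquivBoundedOfCompact unitInterval G).continuous
  have h2 := ContinuousMap.continuous_postcomp (X := unitInterval) (⟨v, hv⟩ : C(F, G))
  have h3 := (ContinuousMap.isometryEquivBoundedOfCompact unitInterval F).symm.continuous
  exact h1.comp (h2.comp h3)

/-- Composition with a continuously differentiable map is a `C¹` operation on the space of
continuous curves. -/
lemma contDiff_postcomp {v : F → F} (hv : ContDiff ℝ 1 v) :
    ContDiff ℝ 1 (fun γ : (unitInterval →ᵇ F) => postcomp v hv.continuous γ) ∧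
    ∀ γ : (unitInterval →ᵇ F),
      HasFDerivAt (fun γ : (unitInterval →ᵇ F) => postcomp v hv.continuous γ)
        (pointwiseApply F
          (postcomp (fderiv ℝ v) (hv.continuous_fderiv one_ne_zero) γ)) γ := by
  set D : (unitInterval →ᵇ F) → (unitInterval →ᵇ (F →L[ℝ] F)) :=
    postcomp (fderiv ℝ v) (hv.continuous_fderiv one_ne_zero) with hD
  have hcont : Continuous D := continuous_postcomp _
  have key : ∀ γ : (unitInterval →ᵇ F),
      HasFDerivAt (fun γ : (unitInterval →ᵇ F) => postcomp v hv.continuous γ)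
        (pointwiseApply F (D γ)) γ := by
    intro γ
    rw [hasFDerivAt_iff_isLittleO, Asymptotics.isLittleO_iff]
    intro ε hε
    have h1 := Metric.continuousAt_iff.1 (hcont.continuousAt (x := γ)) ε hε
    obtain ⟨δ, hδ, h1⟩ := h1
    filter_upwards [Metric.ball_mem_nhds γ hδ] with η hη
    rw [BoundedContinuousFunction.norm_le (by positivity)]
    intro s
    have h2 : ∀ z ∈ segment ℝ (γ s) (η s), ‖fderiv ℝ v z - fderiv ℝ v (γ s)‖ ≤ ε := by
      intro z hz
      rw [segment_eq_image'] at hz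
      obtain ⟨θ, hθ, rfl⟩ := hz
      have h3 : dist (γ + θ • (η - γ)) γ < δ := by
        rw [dist_eq_norm, add_sub_cancel_left, norm_smul, Real.norm_of_nonneg hθ.1]
        rw [Metric.mem_ball, dist_eq_norm] at hη
        calc θ * ‖η - γ‖ ≤ 1 * ‖η - γ‖ := by gcongr; exact hθ.2
          _ < δ := by simpa using hη
      have h4 := h1 h3
      have h5 := (BoundedContinuousFunction.dist_coe_le_dist (f := D (γ + θ • (η - γ))) (g := D γ) s).trans h4.le
      rw [dist_eq_norm] at h5
      exact h5
    have h3 := (convex_segment (𝕜 := ℝ) (γ s) (η s)).norm_image_sub_le_of_norm_hasFDerivWithin_le'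
      (f := v) (f' := fderiv ℝ v) (φ := fderiv ℝ v (γ s)) (C := ε)
      (fun z _ => ((hv.differentiable one_ne_zero z).hasFDerivAt).hasFDerivWithinAt) h2
      (left_mem_segment ℝ _ _) (right_mem_segment ℝ _ _)
    refine h3.trans ?_
    have h4 := (η - γ).norm_coe_le_norm s
    exact mul_le_mul_of_nonneg_left h4 hε.le
  refine ⟨contDiff_one_iff_fderiv.2 ⟨fun γ => (key γ).differentiableAt, ?_⟩, key⟩
  have : fderiv ℝ (fun γ : (unitInterval →ᵇ F) => postcomp v hv.continuous γ)
      = fun γ => pointwiseApply F (D γ) := funext fun γ => (key γ).fderiv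
  rw [this]
  exact (pointwiseApply F).continuous.comp hcont

/-- The primitive vanishing at `0`, as a continuous linear operator on continuous curves. -/
def primitiveL (F : Type*) [NormedAddCommGroup F] [NormedSpace ℝ F] :
    (unitInterval →ᵇ F) →L[ℝ] (unitInterval →ᵇ F) :=
  LinearMap.mkContinuous
    { toFun := fun γ => BoundedContinuousFunction.mkOfCompact ⟨fun s => ∫ σ in (0 : ℝ)..s, IccExtend zero_le_one γ σ, by
        have h : Continuous (IccExtend (zero_le_one (α := ℝ)) γ) := γ.continuous.Icc_extend'
        exact (intervalIntegral.continuous_primitive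
          (fun a b => h.intervalIntegrable a b) 0).comp continuous_subtype_val⟩
      map_add' := by
        intro γ η
        ext s
        have h : ∀ γ : (unitInterval →ᵇ F), Continuous (IccExtend (zero_le_one (α := ℝ)) γ) :=
          fun γ => γ.continuous.Icc_extend'
        exact intervalIntegral.integral_add ((h γ).intervalIntegrable _ _)
          ((h η).intervalIntegrable _ _)
      map_smul' := by
        intro c γ
        ext s
        exact intervalIntegral.integral_smul _ _ } 1
    (fun γ => by
      rw [BoundedContinuousFunction.norm_le (by positivity)]
      intro s
      have h := intervalIntegral.norm_integral_le_of_norm_le_const (a := (0 : ℝ)) (b := s)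
        (C := ‖γ‖) (f := IccExtend (zero_le_one (α := ℝ)) γ)
        (fun σ _ => γ.norm_coe_le_norm _)
      refine h.trans ?_
      rw [sub_zero, abs_of_nonneg s.2.1, one_mul]
      exact mul_le_of_le_one_right (norm_nonneg _) s.2.2)

lemma primitiveL_apply (γ : (unitInterval →ᵇ F)) (s : unitInterval) :
    primitiveL F γ s = ∫ σ in (0 : ℝ)..s, IccExtend zero_le_one γ σ := rfl

lemma norm_primitiveL_le : ‖primitiveL F‖ ≤ 1 :=
  LinearMap.mkContinuous_norm_le _ zero_le_one _

/-- The constant curves. -/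
def constL (F : Type*) [NormedAddCommGroup F] [NormedSpace ℝ F] : F →L[ℝ] (unitInterval →ᵇ F) :=
  LinearMap.mkContinuous
    { toFun := fun x => BoundedContinuousFunction.const _ x
      map_add' := fun _ _ => rfl
      map_smul' := fun _ _ => rfl } 1
    (fun x => by
      rw [BoundedContinuousFunction.norm_le (by positivity)]
      intro s
      exact (one_mul ‖x‖).ge)

/-- Evaluation at the end point. -/
def evalOneL (F : Type*) [NormedAddCommGroup F] [NormedSpace ℝ F] : (unitInterval →ᵇ F) →L[ℝ] F :=
  LinearMap.mkContinuous
    { toFun := fun γ => γ 1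
      map_add' := fun _ _ => rfl
      map_smul' := fun _ _ => rfl } 1
    (fun γ => by simpa using γ.norm_coe_le_norm 1)

/-- The rescaled integral equation `γ = x + t ∫ v ∘ γ` for the curve `s ↦ Φ(x, ts)`. -/
def integralEq (v : F → F) (hv : Continuous v) (p : (F × ℝ) × (unitInterval →ᵇ F)) :
    (unitInterval →ᵇ F) :=
  p.2 - constL F p.1.1 - p.1.2 • primitiveL F (postcomp v hv p.2)

lemma contDiff_integralEq {v : F → F} (hv : ContDiff ℝ 1 v) :
    ContDiff ℝ 1 (integralEq v hv.continuous) := by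
  have h1 := (contDiff_postcomp hv).1
  have h2 : ContDiff ℝ 1 (fun p : (F × ℝ) × (unitInterval →ᵇ F) =>
      primitiveL F (postcomp v hv.continuous p.2)) :=
    (primitiveL F).contDiff.comp (h1.comp contDiff_snd)
  unfold integralEq
  refine (contDiff_snd.sub ((constL F).contDiff.comp (contDiff_fst.comp contDiff_fst))).sub ?_
  exact (contDiff_snd.comp contDiff_fst).smul h2

/-- For short times the derivative with respect to the curve is a small perturbation of the identity. -/
lemma isInvertible_integralEq [CompleteSpace F] {v : F → F} (hv : ContDiff ℝ 1 v) {K : ℝ≥0}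
    (hK : LipschitzWith K v) (p : (F × ℝ) × (unitInterval →ᵇ F)) (hp : |p.1.2| * K < 1) :
    (fderiv ℝ (integralEq v hv.continuous) p ∘L .inr ℝ (F × ℝ) (unitInterval →ᵇ F)).IsInvertible := by
  set A : (unitInterval →ᵇ F) →L[ℝ] (unitInterval →ᵇ F) :=
    p.1.2 • (primitiveL F ∘L pointwiseApply F
      (postcomp (fderiv ℝ v) (hv.continuous_fderiv one_ne_zero) p.2)) with hA
  have h1 : HasFDerivAt (fun γ => integralEq v hv.continuous (p.1, γ))
      (ContinuousLinearMap.id ℝ _ - A) p.2 := by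
    unfold integralEq
    have h := ((primitiveL F).hasFDerivAt.comp p.2 ((contDiff_postcomp hv).2 p.2)).const_smul p.1.2
    exact ((hasFDerivAt_id p.2).sub_const (constL F p.1.1)).fun_sub h
  have h2 : HasFDerivAt (fun γ => integralEq v hv.continuous (p.1, γ))
      (fderiv ℝ (integralEq v hv.continuous) p ∘L .inr ℝ (F × ℝ) (unitInterval →ᵇ F)) p.2 := by
    have h3 : HasFDerivAt (integralEq v hv.continuous) (fderiv ℝ (integralEq v hv.continuous) p)
      ((p.1, p.2)) := ((contDiff_integralEq hv).differentiable one_ne_zero p).hasFDerivAt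
    exact h3.comp p.2 (hasFDerivAt_prodMk_right p.1 p.2)
  rw [h2.unique h1]
  have hn : ‖A‖ < 1 := by
    refine lt_of_le_of_lt ?_ hp
    rw [hA, norm_smul, Real.norm_eq_abs]
    gcongr
    refine (ContinuousLinearMap.opNorm_comp_le _ _).trans ?_
    refine (mul_le_mul norm_primitiveL_le (norm_pointwiseApply_le _) (norm_nonneg _)
      zero_le_one).trans ?_
    rw [one_mul, BoundedContinuousFunction.norm_le (by positivity)]
    intro s
    exact norm_fderiv_le_of_lipschitz ℝ hK
  have hu : IsUnit (1 - A) := isUnit_one_sub_of_norm_lt_one hn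
  obtain ⟨u, hu⟩ := hu
  exact ⟨ContinuousLinearEquiv.unitsEquiv ℝ _ u, by rw [← ContinuousLinearMap.one_def, ← hu]; rfl⟩

end CurveOperators

/-! ### Global flows -/

section Flow
open scoped BoundedContinuousFunction
variable {F : Type*} [NormedAddCommGroup F] [NormedSpace ℝ F]

/-- `Φ` is the global flow of the vector field `v`. -/
structure IsFlow (v : F → F) (Φ : F × ℝ → F) : Prop where
  apply_zero : ∀ x, Φ (x, 0) = x
  hasDerivAt : ∀ x t, HasDerivAt (fun t => Φ (x, t)) (v (Φ (x, t))) t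

namespace IsFlow
variable {v : F → F} {Φ : F × ℝ → F} {K : ℝ≥0}

/-- A global solution of `γ' = v ∘ γ` is an orbit of the flow. -/
lemma eq_of_hasDerivAt (hΦ : IsFlow v Φ) (hK : LipschitzWith K v) {γ : ℝ → F}
    (hγ : ∀ t, HasDerivAt γ (v (γ t)) t) (t : ℝ) : γ t = Φ (γ 0, t) := by
  have := ODE_solution_unique_univ (v := fun _ => v) (s := fun _ => univ) (K := K) (t₀ := 0)
    (f := γ) (g := fun t => Φ (γ 0, t)) (fun _ => hK.lipschitzOnWith)
    (fun t => ⟨hγ t, mem_univ _⟩) (fun t => ⟨hΦ.hasDerivAt _ t, mem_univ _⟩)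
    (hΦ.apply_zero _).symm
  exact congrFun this t

lemma apply_add (hΦ : IsFlow v Φ) (hK : LipschitzWith K v) (x : F) (s t : ℝ) :
    Φ (x, s + t) = Φ (Φ (x, s), t) := by
  have h := hΦ.eq_of_hasDerivAt hK (γ := fun t => Φ (x, s + t))
    (fun t => (hΦ.hasDerivAt x (s + t)).comp_const_add s t) t
  simpa using h

lemma apply_neg_apply (hΦ : IsFlow v Φ) (hK : LipschitzWith K v) (x : F) (t : ℝ) :
    Φ (Φ (x, t), -t) = x := by
  rw [← hΦ.apply_add hK, add_neg_cancel, hΦ.apply_zero]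

lemma continuous_right (hΦ : IsFlow v Φ) (x : F) : Continuous fun t => Φ (x, t) :=
  continuous_iff_continuousAt.2 fun t => (hΦ.hasDerivAt x t).continuousAt

/-- A solution on a compact interval is an arc of an orbit. -/
lemma eqOn_of_hasDerivWithinAt (hΦ : IsFlow v Φ) (hK : LipschitzWith K v) {γ : ℝ → F} {L : ℝ}
    (hγ : ∀ t ∈ Icc 0 L, HasDerivWithinAt γ (v (γ t)) (Icc 0 L) t) :
    ∀ t ∈ Icc 0 L, γ t = Φ (γ 0, t) := by
  refine ODE_solution_unique (v := fun _ => v) (K := K) (fun _ => hK)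
    (fun t ht => (hγ t ht).continuousWithinAt) (fun t ht => ?_)
    (hΦ.continuous_right _).continuousOn
    (fun t _ => (hΦ.hasDerivAt _ t).hasDerivWithinAt) (hΦ.apply_zero _).symm
  exact (hγ t ⟨ht.1, ht.2.le⟩).mono_of_mem_nhdsWithin (Icc_mem_nhdsGE_of_mem ht)

end IsFlow

/-- A bounded Lipschitz vector field has a global flow. -/
lemma exists_isFlow [CompleteSpace F] {v : F → F} {K B : ℝ≥0} (hK : LipschitzWith K v)
    (hB : ∀ x, ‖v x‖ ≤ B) : ∃ Φ, IsFlow v Φ := by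
  have h1 : ∀ (x : F) (T : ℝ), 0 < T → ∃ α : ℝ → F, α 0 = x ∧
      ∀ t ∈ Ioo (-T) T, HasDerivAt α (v (α t)) t := by
    intro x T hT
    have h : IsPicardLindelof (fun _ => v) (⟨0, by constructor <;> linarith⟩ : Icc (-T) T) x
        (B * ⟨T, hT.le⟩) 0 B K := by
      refine IsPicardLindelof.of_time_independent (fun y _ => hB y) hK.lipschitzOnWith ?_
      simp only [NNReal.coe_zero, sub_zero, zero_sub, neg_neg,
        max_self]
      exact le_rfl
    obtain ⟨α, h0, hα⟩ := h.exists_eq_forall_mem_Icc_hasDerivWithinAt₀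
    exact ⟨α, h0, fun t ht => (hα t (Ioo_subset_Icc_self ht)).hasDerivAt
      (Icc_mem_nhds ht.1 ht.2)⟩
  choose! α hα0 hα using h1
  -- The solutions on different symmetric intervals agree on the smaller one.
  have key : ∀ x T T', 0 < T → 0 < T' → ∀ t ∈ Ioo (-T) T, t ∈ Ioo (-T') T' →
      α x T t = α x T' t := by
    intro x T T' hT hT' t ht ht'
    have hm : 0 < min T T' := lt_min hT hT'
    have hsub1 : Ioo (-min T T') (min T T') ⊆ Ioo (-T) T :=
      Ioo_subset_Ioo (neg_le_neg (min_le_left _ _)) (min_le_left _ _)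
    have hsub2 : Ioo (-min T T') (min T T') ⊆ Ioo (-T') T' :=
      Ioo_subset_Ioo (neg_le_neg (min_le_right _ _)) (min_le_right _ _)
    refine ODE_solution_unique_of_mem_Ioo (v := fun _ => v) (s := fun _ => univ) (K := K)
      (a := -min T T') (b := min T T') (t₀ := 0) (fun _ _ => hK.lipschitzOnWith)
      ⟨by linarith, hm⟩ (fun s hs => ⟨hα x T hT s (hsub1 hs), mem_univ _⟩)
      (fun s hs => ⟨hα x T' hT' s (hsub2 hs), mem_univ _⟩) ?_ ?_
    · rw [hα0 x T hT, hα0 x T' hT']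
    · rw [mem_Ioo] at *
      constructor
      · rw [neg_lt, lt_min_iff]; constructor <;> linarith [ht.1, ht'.1]
      · exact lt_min ht.2 ht'.2
  refine ⟨fun p => α p.1 (|p.2| + 1) p.2, fun x => hα0 x _ (by positivity), fun x t => ?_⟩
  have hT : 0 < |t| + 2 := by positivity
  have h2 : HasDerivAt (α x (|t| + 2)) (v (α x (|t| + 2) t)) t :=
    hα x _ hT t (abs_lt.1 (by linarith))
  have h3 : ∀ᶠ s in 𝓝 t, α x (|s| + 1) s = α x (|t| + 2) s := by
    have : ∀ᶠ s in 𝓝 t, |s| < |t| + 2 :=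
      continuous_abs.continuousAt.eventually_lt continuousAt_const (by linarith)
    filter_upwards [this] with s hs
    exact key x _ _ (by positivity) hT s (abs_lt.1 (by linarith)) (abs_lt.1 hs)
  have h4 := h3.self_of_nhds
  rw [show v (α (x, t).1 (|(x, t).2| + 1) (x, t).2) = v (α x (|t| + 2) t) by rw [← h4]]
  exact h2.congr_of_eventuallyEq h3

/-- The arc of the orbit of `x` from time `0` to time `t`, parametrized over `[0, 1]`. -/
def IsFlow.arc {v : F → F} {Φ : F × ℝ → F} (hΦ : IsFlow v Φ) (p : F × ℝ) : unitInterval →ᵇ F :=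
  BoundedContinuousFunction.mkOfCompact ⟨fun s => Φ (p.1, p.2 * s),
    (hΦ.continuous_right p.1).comp (continuous_const.mul continuous_subtype_val)⟩

lemma IsFlow.integralEq_arc [CompleteSpace F] {v : F → F} {Φ : F × ℝ → F} (hΦ : IsFlow v Φ)
    (hv : Continuous v) (p : F × ℝ) : integralEq v hv (p, hΦ.arc p) = 0 := by
  ext s
  have hd : ∀ σ : ℝ, HasDerivAt (fun σ : ℝ => Φ (p.1, p.2 * σ)) (p.2 • v (Φ (p.1, p.2 * σ))) σ := by
    intro σ
    have := (hΦ.hasDerivAt p.1 (p.2 * σ)).scomp σ ((hasDerivAt_id σ).const_mul p.2)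
    simpa [Function.comp_def] using this
  have hc : Continuous fun σ : ℝ => p.2 • v (Φ (p.1, p.2 * σ)) := by
    have := (hΦ.continuous_right p.1).comp (continuous_const_mul p.2)
    exact continuous_const.smul (hv.comp this)
  have h1 : ∫ σ in (0 : ℝ)..s, p.2 • v (Φ (p.1, p.2 * σ)) = Φ (p.1, p.2 * s) - p.1 := by
    rw [intervalIntegral.integral_eq_sub_of_hasDerivAt (fun σ _ => hd σ)
      (hc.intervalIntegrable _ _)]
    simp [hΦ.apply_zero]
  have h2 : primitiveL F (postcomp v hv (hΦ.arc p)) s = ∫ σ in (0 : ℝ)..s, v (Φ (p.1, p.2 * σ)) := by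
    rw [primitiveL_apply]
    refine intervalIntegral.integral_congr fun σ hσ => ?_
    rw [uIcc_of_le s.2.1] at hσ
    have hσ' : σ ∈ Icc (0 : ℝ) 1 := ⟨hσ.1, hσ.2.trans s.2.2⟩
    simp only [IccExtend_of_mem _ _ hσ']
    rfl
  rw [intervalIntegral.integral_smul, ← h2] at h1
  change Φ (p.1, p.2 * s) - p.1 - p.2 • primitiveL F (postcomp v hv (hΦ.arc p)) s = 0
  rw [h1, sub_self]

/-- For short times the integral equation is a fixed point equation of a contraction. -/
lemma integralEq_unique {v : F → F} {K : ℝ≥0} (hK : LipschitzWith K v) {p : F × ℝ}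
    (hp : |p.2| * K < 1) {γ η : unitInterval →ᵇ F}
    (hγ : integralEq v hK.continuous (p, γ) = 0) (hη : integralEq v hK.continuous (p, η) = 0) :
    γ = η := by
  have h1 : γ - η = p.2 • primitiveL F (postcomp v hK.continuous γ - postcomp v hK.continuous η) := by
    rw [map_sub, smul_sub]
    simp only [integralEq] at hγ hη
    rw [← sub_eq_zero]
    calc _ = (γ - constL F p.1 - p.2 • primitiveL F (postcomp v hK.continuous γ))
        - (η - constL F p.1 - p.2 • primitiveL F (postcomp v hK.continuous η)) := by abel
      _ = 0 := by rw [hη, hγ, sub_zero]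
  have h2 : ‖postcomp v hK.continuous γ - postcomp v hK.continuous η‖ ≤ K * ‖γ - η‖ := by
    rw [BoundedContinuousFunction.norm_le (by positivity)]
    intro s
    have h3 := hK.dist_le_mul (γ s) (η s)
    rw [dist_eq_norm, dist_eq_norm] at h3
    exact h3.trans (by gcongr; exact (γ - η).norm_coe_le_norm s)
  have h3 : ‖γ - η‖ ≤ |p.2| * K * ‖γ - η‖ := by
    conv_lhs => rw [h1]
    rw [norm_smul, Real.norm_eq_abs, mul_assoc]
    gcongr
    refine ((primitiveL F).le_opNorm _).trans ?_
    calc _ ≤ 1 * (K * ‖γ - η‖) := by gcongr; exact norm_primitiveL_le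
      _ = _ := one_mul _
  have h4 : ‖γ - η‖ = 0 := by
    by_contra h
    have : 0 < ‖γ - η‖ := lt_of_le_of_ne (norm_nonneg _) (Ne.symm h)
    nlinarith
  exact sub_eq_zero.1 (norm_eq_zero.1 h4)

/-- The flow of a bounded Lipschitz `C¹` field is `C¹` jointly in the point and the time. For
small times the arcs of the orbits solve an integral equation to which the implicit function
theorem applies in the space of continuous curves; large times follow by doubling. -/
theorem IsFlow.contDiff [CompleteSpace F] {v : F → F} {Φ : F × ℝ → F} (hΦ : IsFlow v Φ)
    {K : ℝ≥0} (hK : LipschitzWith K v) (hv : ContDiff ℝ 1 v) : ContDiff ℝ 1 Φ := by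
  -- for short times the arc of the orbit is the implicit function of the integral equation
  have hsmall : ∀ p : F × ℝ, |p.2| * K < 1 → ContDiffAt ℝ 1 Φ p := by
    intro p hp
    have cdf : ContDiffAt ℝ 1 (integralEq v hv.continuous) (p, hΦ.arc p) :=
      (contDiff_integralEq hv).contDiffAt
    have hinv := isInvertible_integralEq hv hK (p, hΦ.arc p) hp
    have h1 := cdf.eventually_apply_implicitFunction one_ne_zero hinv
    have h2 := cdf.contDiffAt_implicitFunction one_ne_zero hinv
    have h3 : ∀ᶠ q : F × ℝ in 𝓝 p, |q.2| * K < 1 :=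
      ContinuousAt.eventually_lt (by fun_prop) continuousAt_const hp
    have h4 : Φ =ᶠ[𝓝 p] fun q => evalOneL F (cdf.implicitFunction one_ne_zero hinv q) := by
      filter_upwards [h1, h3] with q hq1 hq3
      rw [hΦ.integralEq_arc hv.continuous p] at hq1
      rw [integralEq_unique hK hq3 hq1 (hΦ.integralEq_arc hv.continuous q)]
      change Φ (q.1, q.2) = Φ (q.1, q.2 * ((1 : unitInterval) : ℝ))
      simp
    exact ((evalOneL F).contDiff.contDiffAt.comp p h2).congr_of_eventuallyEq h4
  -- `Φ(x, t) = Φ(Φ(x, t/2), t/2)`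
  have hpow : ∀ n : ℕ, ∀ p : F × ℝ, |p.2| * K < 2 ^ n → ContDiffAt ℝ 1 Φ p := by
    intro n
    induction n with
    | zero => simpa using hsmall
    | succ n ih =>
      intro p hp
      have h1 : |p.2 / 2| * K < 2 ^ n := by
        rw [abs_div, abs_two]
        rw [pow_succ] at hp
        linarith
      have h2 : Φ = fun q => Φ (Φ (q.1, q.2 / 2), q.2 / 2) := by
        funext q
        rw [← hΦ.apply_add hK, add_halves]
      rw [h2]
      have h3 : ContDiffAt ℝ 1 (fun q : F × ℝ => (q.1, q.2 / 2)) p := by fun_prop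
      have h4 : ContDiffAt ℝ 1 (fun q : F × ℝ => Φ (q.1, q.2 / 2)) p :=
        ContDiffAt.comp p (ih (p.1, p.2 / 2) h1) h3
      have h5 : ContDiffAt ℝ 1 (fun q : F × ℝ => (Φ (q.1, q.2 / 2), q.2 / 2)) p :=
        h4.prodMk (by fun_prop)
      exact ContDiffAt.comp p (ih (Φ (p.1, p.2 / 2), p.2 / 2) h1) h5
  refine contDiff_iff_contDiffAt.2 fun p => ?_
  obtain ⟨n, hn⟩ := pow_unbounded_of_one_lt (|p.2| * K) (one_lt_two (α := ℝ))
  exact hpow n p hn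

end Flow

/-! ### Integrals depending on a parameter -/

section Parametric
variable {P G : Type*} [NormedAddCommGroup P] [NormedSpace ℝ P] [NormedAddCommGroup G]
  [NormedSpace ℝ G]

/-- Around each parameter a continuous function is bounded, uniformly over a compact interval. -/
lemma exists_bound_nhds_prod_Icc {P G : Type*} [NormedAddCommGroup P] [NormedAddCommGroup G]
    {g : P × ℝ → G} {U : Set P} (hU : IsOpen U)
    (hg : ContinuousOn g (U ×ˢ univ)) {y : P} (hy : y ∈ U) (a b : ℝ) :
    ∃ M : ℝ, ∃ N ∈ 𝓝 y, N ⊆ U ∧ ∀ x ∈ N, ∀ s ∈ Icc a b, ‖g (x, s)‖ ≤ M := by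
  have hc : IsCompact (({y} : Set P) ×ˢ Icc a b) := isCompact_singleton.prod isCompact_Icc
  have hsub : ({y} : Set P) ×ˢ Icc a b ⊆ U ×ˢ univ :=
    prod_mono (singleton_subset_iff.2 hy) (subset_univ _)
  obtain ⟨M, hM⟩ := (hc.image_of_continuousOn (hg.mono hsub)).isBounded.exists_norm_le
  have hopen : IsOpen ((U ×ˢ univ) ∩ g ⁻¹' Metric.ball 0 (M + 1)) :=
    hg.isOpen_inter_preimage (hU.prod isOpen_univ) Metric.isOpen_ball
  have hsub2 : ({y} : Set P) ×ˢ Icc a b ⊆ (U ×ˢ univ) ∩ g ⁻¹' Metric.ball 0 (M + 1) := by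
    intro p hp
    refine ⟨hsub hp, ?_⟩
    rw [mem_preimage, mem_ball_zero_iff]
    linarith [hM _ (mem_image_of_mem g hp)]
  obtain ⟨u, w, hu, -, hyu, hw, huw⟩ :=
    generalized_tube_lemma isCompact_singleton isCompact_Icc hopen hsub2
  refine ⟨M + 1, u ∩ U, inter_mem (hu.mem_nhds (hyu rfl)) (hU.mem_nhds hy), inter_subset_right,
    fun x hx s hs => ?_⟩
  have := (huw (mk_mem_prod hx.1 (hw hs))).2
  rw [mem_preimage, mem_ball_zero_iff] at this
  exact this.le

lemma continuous_slice {P G : Type*} [NormedAddCommGroup P] [NormedAddCommGroup G]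
    {g : P × ℝ → G} {U : Set P} (hg : ContinuousOn g (U ×ˢ univ)) {y : P}
    (hy : y ∈ U) : Continuous fun s => g (y, s) := by
  rw [← continuousOn_univ]
  exact hg.comp (by fun_prop) (fun s _ => ⟨hy, mem_univ _⟩)

lemma continuousOn_integral_param {P : Type*} [NormedAddCommGroup P]
    {g : P × ℝ → G} {U : Set P} (hU : IsOpen U)
    (hg : ContinuousOn g (U ×ˢ univ)) (a b : ℝ) (hab : a ≤ b) :
    ContinuousOn (fun y => ∫ s in a..b, g (y, s)) U := by
  intro y hy
  refine ContinuousAt.continuousWithinAt ?_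
  obtain ⟨M, N, hN, hNU, hM⟩ := exists_bound_nhds_prod_Icc hU hg hy a b
  refine intervalIntegral.continuousAt_of_dominated_interval (bound := fun _ => M) ?_ ?_ ?_ ?_
  · filter_upwards [hN] with x hx
    exact (continuous_slice hg (hNU hx)).aestronglyMeasurable
  · filter_upwards [hN] with x hx
    refine Eventually.of_forall fun s hs => hM x hx s ?_
    rw [uIoc_of_le hab] at hs
    exact Ioc_subset_Icc_self hs
  · exact intervalIntegrable_const
  · refine Eventually.of_forall fun s _ => ?_
    have h : ContinuousAt g (y, s) := hg.continuousAt ((hU.prod isOpen_univ).mem_nhds ⟨hy, mem_univ _⟩)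
    exact ContinuousAt.comp (f := fun x => (x, s)) h (by fun_prop)

lemma hasFDerivAt_integral_param {g : P × ℝ → G} {U : Set P} (hU : IsOpen U)
    (hg : ContDiffOn ℝ 1 g (U ×ˢ univ)) (a b : ℝ) (hab : a ≤ b) {y : P} (hy : y ∈ U) :
    HasFDerivAt (fun y => ∫ s in a..b, g (y, s))
      (∫ s in a..b, (fderiv ℝ g (y, s)) ∘L .inl ℝ P ℝ) y := by
  have hUo : IsOpen (U ×ˢ (univ : Set ℝ)) := hU.prod isOpen_univ
  have hg' : ContinuousOn (fun p => (fderiv ℝ g p) ∘L .inl ℝ P ℝ) (U ×ˢ univ) :=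
    (hg.continuousOn_fderiv_of_isOpen hUo le_rfl).clm_comp continuousOn_const
  obtain ⟨M, N, hN, hNU, hM⟩ := exists_bound_nhds_prod_Icc hU hg' hy a b
  refine (intervalIntegral.hasFDerivAt_integral_of_dominated_of_fderiv_le (s := N)
    (bound := fun _ => M) (F := fun y s => g (y, s))
    (F' := fun y s => (fderiv ℝ g (y, s)) ∘L .inl ℝ P ℝ) hN ?_ ?_ ?_ ?_ ?_ ?_)
  · filter_upwards [hN] with x hx
    exact (continuous_slice hg.continuousOn (hNU hx)).aestronglyMeasurable
  · exact (continuous_slice hg.continuousOn hy).intervalIntegrable _ _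
  · exact (continuous_slice hg' hy).aestronglyMeasurable
  · refine Eventually.of_forall fun s hs x hx => hM x hx s ?_
    rw [uIoc_of_le hab] at hs
    exact Ioc_subset_Icc_self hs
  · exact intervalIntegrable_const
  · refine Eventually.of_forall fun s _ x hx => ?_
    have h : HasFDerivAt g (fderiv ℝ g (x, s)) (x, s) :=
      ((hg.contDiffAt (hUo.mem_nhds ⟨hNU hx, mem_univ _⟩)).differentiableAt one_ne_zero).hasFDerivAt
    exact h.comp x (hasFDerivAt_prodMk_left x s)

lemma contDiffOn_integral_param {g : P × ℝ → G} {U : Set P} (hU : IsOpen U)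
    (hg : ContDiffOn ℝ 1 g (U ×ˢ univ)) (a b : ℝ) (hab : a ≤ b) :
    ContDiffOn ℝ 1 (fun y => ∫ s in a..b, g (y, s)) U := by
  have hUo : IsOpen (U ×ˢ (univ : Set ℝ)) := hU.prod isOpen_univ
  have hg' : ContinuousOn (fun p => (fderiv ℝ g p) ∘L .inl ℝ P ℝ) (U ×ˢ univ) :=
    (hg.continuousOn_fderiv_of_isOpen hUo le_rfl).clm_comp continuousOn_const
  rw [show (1 : WithTop ℕ∞) = 0 + 1 from (zero_add 1).symm, contDiffOn_succ_iff_fderiv_of_isOpen hU]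
  refine ⟨fun y hy => (hasFDerivAt_integral_param hU hg a b hab hy).differentiableAt.differentiableWithinAt,
    by simp, ?_⟩
  rw [contDiffOn_zero]
  refine (continuousOn_integral_param hU hg' a b hab).congr fun y hy => ?_
  exact (hasFDerivAt_integral_param hU hg a b hab hy).fderiv

end Parametric

/-! ### Liouville's formula -/

lemma hasFDerivAt_comp_inl {P Q G : Type*} [NormedAddCommGroup P] [NormedSpace ℝ P]
    [NormedAddCommGroup Q] [NormedSpace ℝ Q] [NormedAddCommGroup G] [NormedSpace ℝ G]
    {f : P × Q → G} {f' : P × Q →L[ℝ] G} {x : P} {t : Q} (h : HasFDerivAt f f' (x, t)) :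
    HasFDerivAt (fun x => f (x, t)) (f' ∘L .inl ℝ P Q) x :=
  h.comp x (hasFDerivAt_prodMk_left x t)

section Liouville
variable {d : ℕ}

lemma clm_det_eq (A : E d →L[ℝ] E d) : A.det =
    (LinearMap.toMatrix (EuclideanSpace.basisFun (Fin d) ℝ).toBasis
      (EuclideanSpace.basisFun (Fin d) ℝ).toBasis (A : E d →ₗ[ℝ] E d)).det :=
  (LinearMap.det_toMatrix _ _).symm

lemma contDiff_det : ContDiff ℝ 1 (fun A : E d →L[ℝ] E d => A.det) := by
  simp_rw [clm_det_eq, Matrix.det_apply]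
  refine ContDiff.sum fun σ _ => ContDiff.const_smul _ (contDiff_prod fun i _ => ?_)
  simp only [LinearMap.toMatrix_apply, OrthonormalBasis.coe_toBasis,
    EuclideanSpace.basisFun_apply, ContinuousLinearMap.coe_coe,
    OrthonormalBasis.coe_toBasis_repr_apply, EuclideanSpace.basisFun_repr]
  fun_prop

lemma divergence_eq_trace (v : E d → E d) (x : E d) :
    divergence v x = (LinearMap.toMatrix (EuclideanSpace.basisFun (Fin d) ℝ).toBasis
      (EuclideanSpace.basisFun (Fin d) ℝ).toBasis (fderiv ℝ v x : E d →ₗ[ℝ] E d)).trace := by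
  simp [divergence, Matrix.trace, LinearMap.toMatrix_apply]

/-- The derivative of the determinant at the identity is the trace. -/
lemma hasDerivAt_det_of_eq_id {A : ℝ → E d →L[ℝ] E d} {v : E d → E d} {x : E d}
    (h0 : A 0 = .id ℝ _) (hA : HasDerivAt A (fderiv ℝ v x) 0) :
    HasDerivAt (fun t => (A t).det) (divergence v x) 0 := by
  set B := fderiv ℝ v x
  have hd : HasFDerivAt (fun A : E d →L[ℝ] E d => A.det)
      (fderiv ℝ (fun A : E d →L[ℝ] E d => A.det) (.id ℝ _)) (.id ℝ _) :=
    (contDiff_det.differentiable one_ne_zero _).hasFDerivAt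
  have h1 : HasDerivAt (fun t => (A t).det)
      (fderiv ℝ (fun A : E d →L[ℝ] E d => A.det) (.id ℝ _) B) 0 := by
    rw [← h0] at hd
    have := hd.comp_hasDerivAt (0 : ℝ) hA
    rwa [h0] at this
  have hline : HasDerivAt (fun r : ℝ => ContinuousLinearMap.id ℝ (E d) + r • B) B 0 := by
    simpa using ((hasDerivAt_id (0 : ℝ)).smul_const B).const_add (ContinuousLinearMap.id ℝ (E d))
  have h2 : HasDerivAt (fun r : ℝ => (ContinuousLinearMap.id ℝ (E d) + r • B).det)
      (fderiv ℝ (fun A : E d →L[ℝ] E d => A.det) (.id ℝ _) B) 0 := by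
    have hd' : HasFDerivAt (fun A : E d →L[ℝ] E d => A.det)
      (fderiv ℝ (fun A : E d →L[ℝ] E d => A.det) (.id ℝ _))
      (ContinuousLinearMap.id ℝ (E d) + (0 : ℝ) • B) := by
      have h0 : (0 : ℝ) • B = 0 := zero_smul ℝ B
      rwa [h0, add_zero]
    exact hd'.comp_hasDerivAt (0 : ℝ) hline
  have h3 : HasDerivAt (fun r : ℝ => (ContinuousLinearMap.id ℝ (E d) + r • B).det)
      (divergence v x) 0 := by
    set M := LinearMap.toMatrix (EuclideanSpace.basisFun (Fin d) ℝ).toBasis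
      (EuclideanSpace.basisFun (Fin d) ℝ).toBasis (B : E d →ₗ[ℝ] E d) with hM
    have e : (fun r : ℝ => (ContinuousLinearMap.id ℝ (E d) + r • B).det) = fun r : ℝ =>
        1 + M.trace * r + (Matrix.det (1 + (Polynomial.X : Polynomial ℝ) •
          M.map Polynomial.C)).divX.divX.eval r * r ^ 2 := by
      funext r
      rw [clm_det_eq, ← Matrix.det_one_add_smul]
      congr 1
      rw [hM]
      simpa using! (EuclideanSpace.basisFun (Fin d) ℝ).toBasis.toMatrix_self
    rw [e, divergence_eq_trace]
    have hp := ((Matrix.det (1 + (Polynomial.X : Polynomial ℝ) •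
          M.map Polynomial.C)).divX.divX.hasDerivAt (0 : ℝ)).mul ((hasDerivAt_id (0 : ℝ)).pow 2)
    have hq := ((((hasDerivAt_id (0 : ℝ)).const_mul M.trace).const_add 1).add hp)
    exact hq.congr_deriv (by simp [hM, B])
  rw [h3.unique h2]
  exact h1

variable {v : E d → E d} {Φ : E d × ℝ → E d} {K : ℝ≥0}

/-- The first variation of the flow at time zero. It is obtained from the integral equation, since
a flow of class `C¹` need not have the second derivatives needed to interchange them. -/
lemma IsFlow.hasDerivAt_fderiv_zero (hΦ : IsFlow v Φ) (hc : ContDiff ℝ 1 Φ) (hv : ContDiff ℝ 1 v)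
    (y : E d) :
    HasDerivAt (fun t => fderiv ℝ Φ (y, t) ∘L .inl ℝ (E d) ℝ) (fderiv ℝ v y) 0 := by
  set g : E d × ℝ → E d := fun p => v (Φ p) with hg
  have hgc : ContDiff ℝ 1 g := hv.comp hc
  set I : ℝ → E d →L[ℝ] E d := fun t => ∫ s in (0 : ℝ)..1, fderiv ℝ g (y, t * s) ∘L .inl ℝ (E d) ℝ
    with hI
  -- The orbit solves `Φ(x, t) = x + t ∫₀¹ v(Φ(x, ts)) ds`, which is differentiated in `x`.
  have h1 : ∀ x t, Φ (x, t) = x + t • ∫ s in (0 : ℝ)..1, g (x, t * s) := by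
    intro x t
    have hd : ∀ s : ℝ, HasDerivAt (fun s : ℝ => Φ (x, t * s)) (t • v (Φ (x, t * s))) s := by
      intro s
      have := (hΦ.hasDerivAt x (t * s)).scomp s ((hasDerivAt_id s).const_mul t)
      simpa [Function.comp_def] using this
    have hcont : Continuous fun s : ℝ => t • v (Φ (x, t * s)) := by
      have h1 := hc.continuous
      have h2 := hv.continuous
      fun_prop
    have h2 := intervalIntegral.integral_eq_sub_of_hasDerivAt (fun s _ => hd s)
      (hcont.intervalIntegrable 0 1)
    rw [intervalIntegral.integral_smul] at h2
    rw [hg]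
    simp only [h2, mul_one, mul_zero, hΦ.apply_zero]
    abel
  have h2 : ∀ t, fderiv ℝ Φ (y, t) ∘L .inl ℝ (E d) ℝ = .id ℝ _ + t • I t := by
    intro t
    have hgt : ContDiff ℝ 1 (fun p : E d × ℝ => g (p.1, t * p.2)) := by fun_prop
    have e1 := hasFDerivAt_integral_param isOpen_univ (g := fun p : E d × ℝ => g (p.1, t * p.2))
      hgt.contDiffOn 0 1 zero_le_one (mem_univ y)
    have e2 : ∀ s, fderiv ℝ (fun p : E d × ℝ => g (p.1, t * p.2)) (y, s) ∘L .inl ℝ (E d) ℝ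
        = fderiv ℝ g (y, t * s) ∘L .inl ℝ (E d) ℝ := by
      intro s
      have f1 : HasFDerivAt (fun x => g (x, t * s))
          (fderiv ℝ (fun p : E d × ℝ => g (p.1, t * p.2)) (y, s) ∘L .inl ℝ (E d) ℝ) y :=
        hasFDerivAt_comp_inl (f := fun p : E d × ℝ => g (p.1, t * p.2))
          (hgt.differentiable one_ne_zero (y, s)).hasFDerivAt
      have f2 : HasFDerivAt (fun x => g (x, t * s))
          (fderiv ℝ g (y, t * s) ∘L .inl ℝ (E d) ℝ) y :=
        hasFDerivAt_comp_inl (hgc.differentiable one_ne_zero (y, t * s)).hasFDerivAt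
      exact f1.unique f2
    simp only [e2] at e1
    have e3 : HasFDerivAt (fun x => Φ (x, t)) (.id ℝ _ + t • I t) y := by
      have := (hasFDerivAt_id (𝕜 := ℝ) y).add (e1.const_smul t)
      refine this.congr_of_eventuallyEq (Eventually.of_forall fun x => ?_)
      exact h1 x t
    have e4 : HasFDerivAt (fun x => Φ (x, t)) (fderiv ℝ Φ (y, t) ∘L .inl ℝ (E d) ℝ) y :=
      hasFDerivAt_comp_inl (hc.differentiable one_ne_zero (y, t)).hasFDerivAt
    exact e4.unique e3
  have h3 : Continuous I := by
    have hg1 : Continuous (fderiv ℝ g) := hgc.continuous_fderiv one_ne_zero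
    refine intervalIntegral.continuous_parametric_intervalIntegral_of_continuous' ?_ 0 1
    change Continuous fun p : ℝ × ℝ => fderiv ℝ g (y, p.1 * p.2) ∘L .inl ℝ (E d) ℝ
    have : Continuous fun p : ℝ × ℝ => fderiv ℝ g (y, p.1 * p.2) := by fun_prop
    exact this.clm_comp continuous_const
  have h4 : I 0 = fderiv ℝ v y := by
    have f1 : HasFDerivAt (fun x => g (x, 0)) (fderiv ℝ g (y, 0) ∘L .inl ℝ (E d) ℝ) y :=
      hasFDerivAt_comp_inl (hgc.differentiable one_ne_zero (y, 0)).hasFDerivAt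
    have f2 : (fun x => g (x, 0)) = v := funext fun x => by rw [hg]; simp only [hΦ.apply_zero]
    rw [f2] at f1
    rw [f1.fderiv, hI]
    simp
  rw [hasDerivAt_iff_tendsto_slope_zero]
  have h5 : Tendsto I (𝓝[≠] 0) (𝓝 (fderiv ℝ v y)) := by
    rw [← h4]
    exact h3.continuousAt.tendsto.mono_left nhdsWithin_le_nhds
  refine h5.congr' ?_
  filter_upwards [self_mem_nhdsWithin] with t ht
  have h0 : (0 : ℝ) • I 0 = 0 := zero_smul ℝ (I 0)
  rw [h2, h2, zero_add, h0, add_zero, add_sub_cancel_left]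
  exact (inv_smul_smul₀ ht (I t)).symm

lemma IsFlow.fderiv_apply_zero (hΦ : IsFlow v Φ) (hc : ContDiff ℝ 1 Φ) (y : E d) :
    fderiv ℝ Φ (y, 0) ∘L .inl ℝ (E d) ℝ = .id ℝ _ := by
  have e4 : HasFDerivAt (fun x => Φ (x, 0)) (fderiv ℝ Φ (y, 0) ∘L .inl ℝ (E d) ℝ) y :=
    hasFDerivAt_comp_inl (hc.differentiable one_ne_zero (y, 0)).hasFDerivAt
  simp only [hΦ.apply_zero] at e4
  exact e4.unique (hasFDerivAt_id y)

lemma IsFlow.fderiv_add (hΦ : IsFlow v Φ) (hK : LipschitzWith K v) (hc : ContDiff ℝ 1 Φ)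
    (x : E d) (s t : ℝ) :
    fderiv ℝ Φ (x, s + t) ∘L .inl ℝ (E d) ℝ =
      (fderiv ℝ Φ (Φ (x, s), t) ∘L .inl ℝ (E d) ℝ) ∘L (fderiv ℝ Φ (x, s) ∘L .inl ℝ (E d) ℝ) := by
  have h : ∀ y t, HasFDerivAt (fun x => Φ (x, t)) (fderiv ℝ Φ (y, t) ∘L .inl ℝ (E d) ℝ) y :=
    fun y t => hasFDerivAt_comp_inl (hc.differentiable one_ne_zero (y, t)).hasFDerivAt
  have h1 := HasFDerivAt.comp x (h (Φ (x, s)) t) (h x s)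
  have h2 := h x (s + t)
  simp only [hΦ.apply_add hK] at h2
  exact h2.unique h1

/-- **Liouville's formula**: the Jacobian determinant of a flow satisfies `δ' = (div v) δ`. -/
lemma IsFlow.hasDerivAt_det (hΦ : IsFlow v Φ) (hK : LipschitzWith K v) (hc : ContDiff ℝ 1 Φ)
    (hv : ContDiff ℝ 1 v) (x : E d) (t : ℝ) :
    HasDerivAt (fun t => (fderiv ℝ Φ (x, t) ∘L .inl ℝ (E d) ℝ).det)
      (divergence v (Φ (x, t)) * (fderiv ℝ Φ (x, t) ∘L .inl ℝ (E d) ℝ).det) t := by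
  have h1 := hasDerivAt_det_of_eq_id (hΦ.fderiv_apply_zero hc (Φ (x, t)))
    (hΦ.hasDerivAt_fderiv_zero hc hv (Φ (x, t)))
  have h2 : HasDerivAt (fun s => (fderiv ℝ Φ (x, t + (s - t)) ∘L .inl ℝ (E d) ℝ).det)
      (divergence v (Φ (x, t)) * (fderiv ℝ Φ (x, t) ∘L .inl ℝ (E d) ℝ).det) t := by
    have e : (fun s => (fderiv ℝ Φ (x, t + (s - t)) ∘L .inl ℝ (E d) ℝ).det) = fun s =>
        (fderiv ℝ Φ (Φ (x, t), s - t) ∘L .inl ℝ (E d) ℝ).det *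
          (fderiv ℝ Φ (x, t) ∘L .inl ℝ (E d) ℝ).det := by
      funext s
      rw [hΦ.fderiv_add hK hc]
      exact LinearMap.det_comp _ _
    rw [e]
    refine HasDerivAt.mul_const ?_ _
    have h3 : HasDerivAt (fun s => s - t) 1 t := (hasDerivAt_id t).sub_const t
    have := HasDerivAt.comp_of_eq t h1 h3 (sub_self t).symm
    simpa [Function.comp_def] using this
  simpa using h2

/-- A smooth compactly supported field has a `C¹` flow, and the logarithm of the Jacobian
determinant of the flow is again of class `C¹`. It is the last component of the flow of the
augmented field `(v, div v)`. -/
theorem exists_flow_of_hasCompactSupport (hv : ContDiff ℝ ∞ v) (hs : HasCompactSupport v) :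
    ∃ (K : ℝ≥0) (Φ : E d × ℝ → E d) (z : E d × ℝ → ℝ), LipschitzWith K v ∧ IsFlow v Φ ∧
      ContDiff ℝ 1 Φ ∧ ContDiff ℝ 1 z ∧
      (∀ x t, HasDerivAt (fun t => z (x, t)) (divergence v (Φ (x, t))) t) ∧
      ∀ x t, (fderiv ℝ Φ (x, t) ∘L .inl ℝ (E d) ℝ).det = Real.exp (z (x, t)) := by
  have hv1 : ContDiff ℝ 1 v := hv.of_le (by exact_mod_cast le_top)
  have hdiv : ContDiff ℝ 1 (divergence v) := by
    have : ContDiff ℝ 1 (fderiv ℝ v) := (contDiff_infty.1 hv 2).fderiv_right (by norm_num)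
    unfold divergence
    fun_prop
  have hdivs : HasCompactSupport (divergence v) :=
    (hs.fderiv (𝕜 := ℝ)).comp_left
      (g := fun A : E d →L[ℝ] E d => ∑ i : Fin d, (A (EuclideanSpace.single i 1)) i) (by simp)
  obtain ⟨K, hK⟩ := hv1.lipschitzWith_of_hasCompactSupport hs one_ne_zero
  obtain ⟨K', hK'⟩ := hdiv.lipschitzWith_of_hasCompactSupport hdivs one_ne_zero
  obtain ⟨B, hB⟩ := hs.exists_bound_of_continuous hv1.continuous
  obtain ⟨B', hB'⟩ := hdivs.exists_bound_of_continuous hdiv.continuous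
  set V : E d × ℝ → E d × ℝ := fun p => (v p.1, divergence v p.1) with hV
  have hV1 : ContDiff ℝ 1 V := (hv1.comp contDiff_fst).prodMk (hdiv.comp contDiff_fst)
  have hVK := (hK.comp (LipschitzWith.prod_fst (α := E d) (β := ℝ))).prodMk
    (hK'.comp (LipschitzWith.prod_fst (α := E d) (β := ℝ)))
  change LipschitzWith _ V at hVK
  have hVB : ∀ p, ‖V p‖ ≤ (max B.toNNReal B'.toNNReal : ℝ≥0) := by
    intro p
    rw [Prod.norm_def, NNReal.coe_max]
    exact max_le_max ((hB _).trans (Real.le_coe_toNNReal _)) ((hB' _).trans (Real.le_coe_toNNReal _))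
  obtain ⟨Ψ, hΨ⟩ := exists_isFlow hVK hVB
  have hΨc := hΨ.contDiff hVK hV1
  have hΦ : IsFlow v (fun p : E d × ℝ => (Ψ ((p.1, 0), p.2)).1) :=
    ⟨fun x => by simp [hΨ.apply_zero], fun x t => by
      have := (ContinuousLinearMap.fst ℝ (E d) ℝ).hasFDerivAt.comp_hasDerivAt t
        (hΨ.hasDerivAt (x, 0) t)
      exact this⟩
  have hΦc : ContDiff ℝ 1 (fun p : E d × ℝ => (Ψ ((p.1, 0), p.2)).1) := by fun_prop
  have hz : ∀ x t, HasDerivAt (fun t => (Ψ ((x, 0), t)).2)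
      (divergence v (Ψ ((x, 0), t)).1) t := fun x t =>
    (ContinuousLinearMap.snd ℝ (E d) ℝ).hasFDerivAt.comp_hasDerivAt t (hΨ.hasDerivAt (x, 0) t)
  refine ⟨K, fun p => (Ψ ((p.1, 0), p.2)).1, fun p => (Ψ ((p.1, 0), p.2)).2, hK, hΦ, hΦc,
    by fun_prop, hz, fun x t => ?_⟩
  set Φ : E d × ℝ → E d := fun p => (Ψ ((p.1, 0), p.2)).1
  -- `δ e^{-z}` is constant along the orbit.
  have h1 : ∀ t, HasDerivAt (fun t => (fderiv ℝ Φ (x, t) ∘L .inl ℝ (E d) ℝ).det *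
      Real.exp (-(Ψ ((x, 0), t)).2)) 0 t := by
    intro t
    have := (hΦ.hasDerivAt_det hK hΦc hv1 x t).mul ((hz x t).neg.exp)
    refine this.congr_deriv ?_
    change divergence v (Φ (x, t)) * _ * _ + _ * (_ * -divergence v (Φ (x, t))) = 0
    simp only [Pi.neg_apply]
    ring
  have h2 := is_const_of_deriv_eq_zero (fun t => (h1 t).differentiableAt)
    (fun t => (h1 t).deriv) t 0
  simp only [hΦ.fderiv_apply_zero hΦc, hΨ.apply_zero, neg_zero, Real.exp_zero, mul_one] at h2
  have h3 : (ContinuousLinearMap.id ℝ (E d)).det = 1 := LinearMap.det_id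
  rw [h3, Real.exp_neg] at h2
  have := Real.exp_pos (Ψ ((x, 0), t)).2
  field_simp at h2
  exact h2

end Liouville

/-! ### Outward normals and transversality -/

section Normal
variable {d : ℕ} {Ω : Set (E d)}

/-- A local defining function of `Ω` near a regular boundary point; it is nonpositive on the closure
and hence vanishes on the frontier. -/
lemma IsOuterNormal.exists_defining {x n : E d} (h : IsOuterNormal Ω x n) :
    ∃ (ρ : E d → ℝ) (c : ℝ), 0 < c ∧ ContDiffAt ℝ 1 ρ x ∧ ρ x = 0 ∧
      (∀ w, fderiv ℝ ρ x w = c * ⟪n, w⟫) ∧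
      ∀ᶠ y in 𝓝 x, (y ∈ Ω ↔ ρ y < 0) ∧ (y ∈ closure Ω → ρ y ≤ 0) := by
  obtain ⟨-, ρ, hρ, h0, ⟨c, hc, hgrad⟩, hloc⟩ := h
  refine ⟨ρ, c, hc, hρ, h0, fun w => ?_, ?_⟩
  · rw [← real_inner_smul_left, ← hgrad]
    simp [gradient]
  · have hcont : ∀ᶠ y in 𝓝 x, ContinuousAt ρ y := by
      filter_upwards [hρ.eventually (by simp)] with y hy using hy.continuousAt
    filter_upwards [hloc, hloc.eventually_nhds, hcont] with y hy1 hy2 hy3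
    refine ⟨hy1, fun hy => ?_⟩
    by_contra hlt
    have h1 : ∀ᶠ z in 𝓝 y, 0 < ρ z := hy3.eventually_const_lt (not_le.1 hlt)
    obtain ⟨z, hz, hzΩ⟩ := mem_closure_iff_nhds.1 hy _ (h1.and hy2)
    exact absurd (hz.2.1 hzΩ) (not_lt.2 hz.1.le)

/-- A function of class `C¹` with positive last partial derivative at a point is strictly monotone in
the last variable near this point. -/
lemma exists_strictMonoOn_of_fderiv_pos {P : Type*} [NormedAddCommGroup P] [NormedSpace ℝ P]
    {G : P × ℝ → ℝ} {p : P × ℝ} (hG : ContDiffAt ℝ 1 G p) (hpos : 0 < fderiv ℝ G p (0, 1)) :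
    ∃ δ > 0, ∀ ξ ∈ Metric.ball p.1 δ, StrictMonoOn (fun t => G (ξ, t)) (Ioo (p.2 - δ) (p.2 + δ)) := by
  have h1 : ∀ᶠ q in 𝓝 p, ContDiffAt ℝ 1 G q := hG.eventually (by simp)
  have h2 : ∀ᶠ q in 𝓝 p, 0 < fderiv ℝ G q (0, 1) := by
    have : ContinuousAt (fun q => fderiv ℝ G q (0, 1)) p :=
      (hG.continuousAt_fderiv one_ne_zero).clm_apply continuousAt_const
    exact this.eventually_const_lt hpos
  obtain ⟨δ, hδ, h3⟩ := Metric.eventually_nhds_iff_ball.1 (h1.and h2)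
  refine ⟨δ, hδ, fun ξ hξ => ?_⟩
  have hmem : ∀ t ∈ Ioo (p.2 - δ) (p.2 + δ), (ξ, t) ∈ Metric.ball p δ := by
    intro t ht
    rw [← Real.ball_eq_Ioo] at ht
    rw [Metric.mem_ball, Prod.dist_eq]
    exact max_lt hξ ht
  have hder : ∀ t ∈ Ioo (p.2 - δ) (p.2 + δ),
      HasDerivAt (fun t => G (ξ, t)) (fderiv ℝ G (ξ, t) (0, 1)) t := by
    intro t ht
    have hd := ((h3 _ (hmem t ht)).1.differentiableAt one_ne_zero).hasFDerivAt
    exact hd.comp_hasDerivAt t ((hasDerivAt_const t ξ).prodMk (hasDerivAt_id t))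
  refine strictMonoOn_of_deriv_pos (convex_Ioo _ _)
    (fun t ht => (hder t ht).continuousAt.continuousWithinAt) (fun t ht => ?_)
  rw [interior_Ioo] at ht
  rw [(hder t ht).deriv]
  exact (h3 _ (hmem t ht)).2

variable {m : ℕ} {Ω : Set (E (m + 1))}

/-- If `n` is normal to a parametrized hypersurface and `w` is transversal to it, then `w` is
independent of the tangent vectors. -/
lemma injective_of_transversal {D : E m →L[ℝ] E (m + 1)} {n w : E (m + 1)}
    (hind : LinearIndependent ℝ
      (Fin.snoc (fun i : Fin m => D (EuclideanSpace.single i 1)) n : Fin (m + 1) → E (m + 1)))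
    (horth : ∀ u, ⟪n, D u⟫ = 0) (hw : ⟪w, n⟫ ≠ 0) :
    Function.Injective (fun p : E m × ℝ => D p.1 + p.2 • w) := by
  have hD : ∀ u, D u = 0 → u = 0 := by
    intro u hu
    have h1 : u = ∑ i, u i • EuclideanSpace.single i (1 : ℝ) := by
      have := (EuclideanSpace.basisFun (Fin m) ℝ).sum_repr u
      simpa using this.symm
    have h2 : ∑ i, u i • D (EuclideanSpace.single i (1 : ℝ)) = 0 := by
      rw [← hu]
      conv_rhs => rw [h1]
      rw [map_sum]
      simp
    have h3 : LinearIndependent ℝ (fun i : Fin m => D (EuclideanSpace.single i (1 : ℝ))) := by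
      have := hind.comp Fin.castSucc (Fin.castSucc_injective m)
      simpa [Function.comp_def] using this
    have h4 := Fintype.linearIndependent_iff.1 h3 (fun i => u i) h2
    ext i
    exact h4 i
  have h : ∀ p : E m × ℝ, D p.1 + p.2 • w = 0 → p = 0 := by
    intro p hp
    have h1 : ⟪n, D p.1 + p.2 • w⟫ = 0 := by rw [hp, inner_zero_right]
    rw [inner_add_right, horth, zero_add, inner_smul_right, real_inner_comm] at h1
    have h2 : p.2 = 0 := (mul_eq_zero.1 h1).resolve_right hw
    rw [h2, zero_smul, add_zero] at hp
    exact Prod.ext (hD _ hp) h2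
  intro p q hpq
  rw [← sub_eq_zero]
  refine h _ ?_
  simp only at hpq
  rw [Prod.fst_sub, Prod.snd_sub, map_sub, sub_smul]
  rw [← sub_eq_zero] at hpq
  rw [← hpq]
  abel

/-- A `C²` parametrization of a piece of the boundary, together with the continuous normal field, to
which the field `b` is uniformly transversal. -/
structure IsParam (Ω S : Set (E (m + 1))) (b : E (m + 1) → E (m + 1)) (Γ : Set (E m))
    (h n : E m → E (m + 1)) (α : ℝ) : Prop where
  isOpen_dom : IsOpen Ω
  isOpen : IsOpen Γ
  isConnected : IsConnected Γ
  isBounded : Bornology.IsBounded Γ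
  contDiff : ContDiff ℝ 2 h
  injOn : InjOn h Γ
  image_eq : h '' Γ = S
  continuousOn_normal : ContinuousOn n (closure Γ)
  isOuterNormal : ∀ ξ ∈ Γ, IsOuterNormal Ω (h ξ) (n ξ)
  linearIndependent : ∀ ξ ∈ closure Γ, LinearIndependent ℝ
      (Fin.snoc (fun i : Fin m => fderiv ℝ h ξ (EuclideanSpace.single i 1)) (n ξ) :
        Fin (m + 1) → E (m + 1))
  subset_frontier : S ⊆ frontier Ω
  pos : 0 < α
  le_abs_inner : ∀ ξ ∈ Γ, α ≤ |⟪b (h ξ), n ξ⟫|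

namespace IsParam
variable {S : Set (E (m + 1))} {b : E (m + 1) → E (m + 1)} {Γ : Set (E m)}
    {h n : E m → E (m + 1)} {α : ℝ}

lemma isCompact_closure (hp : IsParam Ω S b Γ h n α) : IsCompact (closure Γ) :=
  hp.isBounded.isCompact_closure

lemma continuous_fderiv (hp : IsParam Ω S b Γ h n α) : Continuous (fderiv ℝ h) :=
  hp.contDiff.continuous_fderiv (by norm_num)

lemma hasFDerivAt (hp : IsParam Ω S b Γ h n α) (ξ : E m) : HasFDerivAt h (fderiv ℝ h ξ) ξ :=
  (hp.contDiff.differentiable (by norm_num) ξ).hasFDerivAt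

lemma mem {ξ : E m} (hp : IsParam Ω S b Γ h n α) (hξ : ξ ∈ Γ) : h ξ ∈ S :=
  hp.image_eq ▸ mem_image_of_mem h hξ

lemma inner_fderiv_eq_zero_of_mem (hp : IsParam Ω S b Γ h n α) {ξ : E m} (hξ : ξ ∈ Γ) (u : E m) :
    ⟪n ξ, fderiv ℝ h ξ u⟫ = 0 := by
  obtain ⟨ρ, c, hc, hρ, h0, hd, hloc⟩ := (hp.isOuterNormal ξ hξ).exists_defining
  have h1 : (fun η => ρ (h η)) =ᶠ[𝓝 ξ] fun _ => 0 := by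
    have := (hp.contDiff.continuous.continuousAt (x := ξ)).eventually hloc
    filter_upwards [this, hp.isOpen.mem_nhds hξ] with η hη hηΓ
    have hf : h η ∈ frontier Ω := hp.subset_frontier (hp.mem hηΓ)
    rw [hp.isOpen_dom.frontier_eq] at hf
    exact le_antisymm (hη.2 hf.1) (not_lt.1 fun hlt => hf.2 (hη.1.2 hlt))
  have h2 : HasFDerivAt (fun η => ρ (h η)) ((fderiv ℝ ρ (h ξ)).comp (fderiv ℝ h ξ)) ξ :=
    (hρ.differentiableAt one_ne_zero).hasFDerivAt.comp ξ (hp.hasFDerivAt ξ)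
  have h3 := (h2.congr_of_eventuallyEq h1.symm).unique (hasFDerivAt_const (0 : ℝ) ξ)
  have h4 : fderiv ℝ ρ (h ξ) (fderiv ℝ h ξ u) = 0 := by
    have := congrArg (fun A : E m →L[ℝ] ℝ => A u) h3
    simpa using this
  rw [hd] at h4
  exact (mul_eq_zero.1 h4).resolve_left hc.ne'

lemma inner_fderiv_eq_zero (hp : IsParam Ω S b Γ h n α) {ξ : E m} (hξ : ξ ∈ closure Γ) (u : E m) :
    ⟪n ξ, fderiv ℝ h ξ u⟫ = 0 := by
  have h1 : ContinuousOn (fun ξ => ⟪n ξ, fderiv ℝ h ξ u⟫) (closure Γ) :=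
    hp.continuousOn_normal.inner
      (hp.continuous_fderiv.clm_apply continuous_const).continuousOn
  exact (EqOn.of_subset_closure (s := Γ) (t := closure Γ) (g := fun _ => (0 : ℝ))
    (fun η hη => hp.inner_fderiv_eq_zero_of_mem hη u) h1 continuousOn_const subset_closure
    subset_rfl) hξ

lemma inner_ne_zero (hp : IsParam Ω S b Γ h n α) (hb : Continuous b) {ξ : E m}
    (hξ : ξ ∈ closure Γ) : ⟪b (h ξ), n ξ⟫ ≠ 0 := by
  have h1 : ContinuousOn (fun ξ => |⟪b (h ξ), n ξ⟫|) (closure Γ) :=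
    ((hb.comp hp.contDiff.continuous).continuousOn.inner hp.continuousOn_normal).abs
  have h2 : α ≤ |⟪b (h ξ), n ξ⟫| := by
    by_contra hlt
    obtain ⟨t, ht, ht2⟩ := mem_closure_iff_nhdsWithin_neBot.1 hξ |>.nonempty_of_mem
      (inter_mem (nhdsWithin_mono ξ subset_closure ((h1 ξ hξ).eventually_lt_const (not_le.1 hlt)))
        self_mem_nhdsWithin)
    exact absurd (hp.le_abs_inner t ht2) (not_le.2 ht)
  intro h0
  rw [h0, abs_zero] at h2
  linarith [hp.pos]

end IsParam
end Normal

/-! ### The orbits issuing from a hypersurface -/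

section FlowDerivative
variable {d : ℕ} {v : E d → E d} {Φ : E d × ℝ → E d} {K : ℝ≥0}

lemma IsFlow.fderiv_apply (hΦ : IsFlow v Φ) (hc : ContDiff ℝ 1 Φ) (x : E d) (t : ℝ) (u : E d)
    (τ : ℝ) : fderiv ℝ Φ (x, t) (u, τ) =
      (fderiv ℝ Φ (x, t) ∘L .inl ℝ (E d) ℝ) u + τ • v (Φ (x, t)) := by
  have h1 : fderiv ℝ Φ (x, t) (0, 1) = v (Φ (x, t)) := by
    have hd : HasFDerivAt Φ (fderiv ℝ Φ (x, t)) (x, t) :=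
      (hc.differentiable one_ne_zero (x, t)).hasFDerivAt
    have h2 := hd.comp_hasDerivAt t ((hasDerivAt_const t x).prodMk (hasDerivAt_id t))
    exact h2.unique (hΦ.hasDerivAt x t)
  have h2 : (u, τ) = (u, (0 : ℝ)) + τ • ((0 : E d), (1 : ℝ)) := by simp
  rw [h2, map_add, map_smul, h1]
  rfl

/-- The field is invariant under its flow. -/
lemma IsFlow.fderiv_apply_self (hΦ : IsFlow v Φ) (hK : LipschitzWith K v) (hc : ContDiff ℝ 1 Φ)
    (x : E d) (t : ℝ) : (fderiv ℝ Φ (x, t) ∘L .inl ℝ (E d) ℝ) (v x) = v (Φ (x, t)) := by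
  have hd : HasFDerivAt (fun y => Φ (y, t)) (fderiv ℝ Φ (x, t) ∘L .inl ℝ (E d) ℝ) x :=
    hasFDerivAt_comp_inl (hc.differentiable one_ne_zero (x, t)).hasFDerivAt
  have h1 : HasDerivAt (fun s => Φ (x, s)) (v x) 0 := by
    have := hΦ.hasDerivAt x 0
    rwa [hΦ.apply_zero] at this
  have h2 : HasDerivAt (fun s => Φ (Φ (x, s), t)) ((fderiv ℝ Φ (x, t) ∘L .inl ℝ (E d) ℝ) (v x)) 0 :=
    hd.comp_hasDerivAt_of_eq (0 : ℝ) h1 (hΦ.apply_zero x).symm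
  have h3 : HasDerivAt (fun s => Φ (Φ (x, s), t)) (v (Φ (x, t))) 0 := by
    have h4 : (fun s => Φ (Φ (x, s), t)) = fun s => Φ (x, s + t) :=
      funext fun s => (hΦ.apply_add hK x s t).symm
    rw [h4]
    have := (hΦ.hasDerivAt x (0 + t)).comp_add_const 0 t
    simpa using this
  exact h2.unique h3

lemma IsFlow.injective_fderiv (hΦ : IsFlow v Φ) (hK : LipschitzWith K v) (hc : ContDiff ℝ 1 Φ)
    (x : E d) (t : ℝ) : Function.Injective (fderiv ℝ Φ (x, t) ∘L .inl ℝ (E d) ℝ) := by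
  have h := hΦ.fderiv_add hK hc x t (-t)
  rw [add_neg_cancel, hΦ.fderiv_apply_zero hc] at h
  refine Function.LeftInverse.injective (g := fderiv ℝ Φ (Φ (x, t), -t) ∘L .inl ℝ (E d) ℝ) fun u => ?_
  have := congrArg (fun A : E d →L[ℝ] E d => A u) h
  exact this.symm

end FlowDerivative

section FlowOut
variable {m : ℕ} {Ω S : Set (E (m + 1))} {v : E (m + 1) → E (m + 1)} {Φ : E (m + 1) × ℝ → E (m + 1)}
  {K : ℝ≥0} {Γ : Set (E m)} {h n : E m → E (m + 1)} {α : ℝ}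

/-- The orbits issuing from a parametrized hypersurface. -/
def flowOut (Φ : E (m + 1) × ℝ → E (m + 1)) (h : E m → E (m + 1)) (p : E m × ℝ) : E (m + 1) :=
  Φ (h p.1, p.2)

lemma IsParam.contDiff_flowOut (hp : IsParam Ω S v Γ h n α) (hc : ContDiff ℝ 1 Φ) :
    ContDiff ℝ 1 (flowOut Φ h) := by
  have h1 : ContDiff ℝ 1 h := hp.contDiff.of_le (by norm_num)
  exact hc.comp ((h1.comp contDiff_fst).prodMk contDiff_snd)

lemma IsParam.fderiv_flowOut (hp : IsParam Ω S v Γ h n α) (hΦ : IsFlow v Φ)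
    (hK : LipschitzWith K v) (hc : ContDiff ℝ 1 Φ) (p q : E m × ℝ) :
    fderiv ℝ (flowOut Φ h) p q = (fderiv ℝ Φ (h p.1, p.2) ∘L .inl ℝ (E (m + 1)) ℝ)
      (fderiv ℝ h p.1 q.1 + q.2 • v (h p.1)) := by
  have h1 : HasFDerivAt (fun p : E m × ℝ => (h p.1, p.2))
      (((fderiv ℝ h p.1).comp (.fst ℝ (E m) ℝ)).prod (.snd ℝ (E m) ℝ)) p :=
    ((hp.hasFDerivAt p.1).comp p hasFDerivAt_fst).prodMk hasFDerivAt_snd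
  have h2 : HasFDerivAt (flowOut Φ h) _ p :=
    (hc.differentiable one_ne_zero (h p.1, p.2)).hasFDerivAt.comp p h1
  rw [h2.fderiv, map_add, map_smul, hΦ.fderiv_apply_self hK hc, ← hΦ.fderiv_apply hc]
  rfl

lemma IsParam.injective_fderiv_flowOut (hp : IsParam Ω S v Γ h n α) (hΦ : IsFlow v Φ)
    (hK : LipschitzWith K v) (hc : ContDiff ℝ 1 Φ) {ξ : E m} (hξ : ξ ∈ closure Γ) (t : ℝ) :
    Function.Injective (fderiv ℝ (flowOut Φ h) (ξ, t)) := by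
  have h1 := injective_of_transversal (hp.linearIndependent ξ hξ) (hp.inner_fderiv_eq_zero hξ)
    (hp.inner_ne_zero hK.continuous hξ)
  have h2 := (hΦ.injective_fderiv hK hc (h ξ) t).comp h1
  intro q q' hq
  refine h2 ?_
  rw [hp.fderiv_flowOut hΦ hK hc, hp.fderiv_flowOut hΦ hK hc] at hq
  exact hq

lemma IsParam.exists_equiv_flowOut (hp : IsParam Ω S v Γ h n α) (hΦ : IsFlow v Φ)
    (hK : LipschitzWith K v) (hc : ContDiff ℝ 1 Φ) {ξ : E m} (hξ : ξ ∈ closure Γ) (t : ℝ) :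
    ∃ A : (E m × ℝ) ≃L[ℝ] E (m + 1), (A : E m × ℝ →L[ℝ] E (m + 1)) = fderiv ℝ (flowOut Φ h) (ξ, t) := by
  have hi := hp.injective_fderiv_flowOut hΦ hK hc hξ t
  refine ⟨(LinearEquiv.ofInjectiveOfFinrankEq (fderiv ℝ (flowOut Φ h) (ξ, t) : E m × ℝ →ₗ[ℝ] E (m + 1))
    hi (by simp)).toContinuousLinearEquiv, ?_⟩
  exact ContinuousLinearMap.ext fun q => rfl

/-- The flow-out of a transversal hypersurface is a local `C¹` diffeomorphism. -/
lemma IsParam.exists_openPartialHomeomorph (hp : IsParam Ω S v Γ h n α) (hΦ : IsFlow v Φ)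
    (hK : LipschitzWith K v) (hc : ContDiff ℝ 1 Φ) {ξ : E m} (hξ : ξ ∈ closure Γ) (t : ℝ) :
    ∃ e : OpenPartialHomeomorph (E m × ℝ) (E (m + 1)), (ξ, t) ∈ e.source ∧ ⇑e = flowOut Φ h ∧
      ContDiffAt ℝ 1 e.symm (flowOut Φ h (ξ, t)) := by
  obtain ⟨A, hA⟩ := hp.exists_equiv_flowOut hΦ hK hc hξ t
  have hcd : ContDiffAt ℝ 1 (flowOut Φ h) (ξ, t) := (hp.contDiff_flowOut hc).contDiffAt
  have hd : HasFDerivAt (flowOut Φ h) (A : E m × ℝ →L[ℝ] E (m + 1)) (ξ, t) := by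
    rw [hA]; exact (hcd.differentiableAt one_ne_zero).hasFDerivAt
  exact ⟨hcd.toOpenPartialHomeomorph _ hd one_ne_zero,
    hcd.mem_toOpenPartialHomeomorph_source hd one_ne_zero,
    hcd.toOpenPartialHomeomorph_coe hd one_ne_zero, hcd.to_localInverse hd one_ne_zero⟩

/-- A transversal hypersurface meets an orbit only at isolated times. -/
lemma IsParam.eventually_notMem_image (hp : IsParam Ω S v Γ h n α) (hΦ : IsFlow v Φ)
    (hK : LipschitzWith K v) (hc : ContDiff ℝ 1 Φ) (x : E (m + 1)) :
    ∀ᶠ σ in 𝓝[≠] (0 : ℝ), Φ (x, σ) ∉ h '' closure Γ := by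
  by_contra hcon
  rw [not_eventually] at hcon
  simp only [not_not] at hcon
  obtain ⟨σ, hσ, hσ2⟩ := exists_seq_forall_of_frequently hcon
  choose ξ hξ hξ2 using hσ2
  obtain ⟨ξ₀, hξ₀, φ, hφ, hlim⟩ := hp.isCompact_closure.tendsto_subseq hξ
  have hσ0 : Tendsto σ atTop (𝓝 0) := hσ.mono_right nhdsWithin_le_nhds
  obtain ⟨e, hes, hee, -⟩ := hp.exists_openPartialHomeomorph hΦ hK hc hξ₀ 0
  have hx : ∀ k, flowOut Φ h (ξ k, -σ k) = x := by
    intro k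
    rw [flowOut, hξ2 k, hΦ.apply_neg_apply hK]
  have hlim2 : Tendsto (fun k => (ξ (φ k), -σ (φ k))) atTop (𝓝 (ξ₀, 0)) := by
    refine hlim.prodMk_nhds ?_
    simpa using (hσ0.comp hφ.tendsto_atTop).neg
  have hx0 : flowOut Φ h (ξ₀, 0) = x := by
    have h1 := ((hp.contDiff_flowOut hc).continuous.tendsto (ξ₀, 0)).comp hlim2
    refine tendsto_nhds_unique h1 ?_
    simp only [Function.comp_def, hx]
    exact tendsto_const_nhds
  have hev : ∀ᶠ k in atTop, (ξ (φ k), -σ (φ k)) ∈ e.source :=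
    hlim2 (e.open_source.mem_nhds hes)
  have hne : ∀ᶠ k in atTop, σ (φ k) ≠ 0 :=
    hφ.tendsto_atTop.eventually (hσ.eventually self_mem_nhdsWithin)
  obtain ⟨k, hk, hk2⟩ := (hev.and hne).exists
  have := e.injOn hk hes (by rw [hee, hx, hx0])
  exact hk2 (neg_eq_zero.1 (congrArg Prod.snd this))

end FlowOut

/-! ### The domain swept out by the field lines -/

/-- A bounded domain crossed by the field lines of `b`, together with a compactly supported
extension `v` of `b`, its flow `Φ`, the logarithm `z` of the Jacobian determinant of the flow, and
the parametrizations `h` of the inflow and `h'` of the outflow boundary. -/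
structure TubeData {m : ℕ} (Ω : Set (E (m + 1))) (b : E (m + 1) → E (m + 1)) where
  v : E (m + 1) → E (m + 1)
  Φ : E (m + 1) × ℝ → E (m + 1)
  z : E (m + 1) × ℝ → ℝ
  K : ℝ≥0
  B : ℝ
  α : ℝ
  Λ : ℝ
  Γ : Set (E m)
  h : E m → E (m + 1)
  n : E m → E (m + 1)
  Γ' : Set (E m)
  h' : E m → E (m + 1)
  n' : E m → E (m + 1)
  isOpen : IsOpen Ω
  isBounded : Bornology.IsBounded Ω
  nonempty : Ω.Nonempty
  norm_eq_one : ∀ x ∈ Ω, ‖b x‖ = 1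
  contDiff_b : ContDiff ℝ ∞ b
  frontier_eq : frontier Ω =
    closure (tangentialBdry Ω b) ∪ closure (inflowBdry Ω b) ∪ closure (outflowBdry Ω b)
  disjoint : Disjoint (closure (inflowBdry Ω b)) (closure (outflowBdry Ω b))
  disjoint_in : Disjoint (tangentialBdry Ω b) (inflowBdry Ω b)
  disjoint_out : Disjoint (tangentialBdry Ω b) (outflowBdry Ω b)
  eqOn : EqOn v b (closure Ω)
  contDiff_v : ContDiff ℝ ∞ v
  lipschitz : LipschitzWith K v
  norm_v_le : ∀ x, ‖v x‖ ≤ B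
  isFlow : IsFlow v Φ
  contDiff_Φ : ContDiff ℝ 1 Φ
  contDiff_z : ContDiff ℝ 1 z
  hasDerivAt_z : ∀ x t, HasDerivAt (fun t => z (x, t)) (divergence v (Φ (x, t))) t
  det_eq : ∀ x t, (fderiv ℝ Φ (x, t) ∘L .inl ℝ (E (m + 1)) ℝ).det = Real.exp (z (x, t))
  param_in : IsParam Ω (inflowBdry Ω b) v Γ h n α
  param_out : IsParam Ω (outflowBdry Ω b) v Γ' h' n' α
  inner_neg : ∀ ξ ∈ Γ, ⟪v (h ξ), n ξ⟫ ≤ -α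
  exists_normal_out : ∀ x ∈ outflowBdry Ω b, ∃ n, IsOuterNormal Ω x n ∧ α ≤ ⟪v x, n⟫
  lines : ∀ x ∈ Ω, ∃ (γ : ℝ → E (m + 1)) (L : ℝ),
    L ≤ Λ ∧ IsTraversingLine Ω b γ L ∧ ∃ t ∈ Ioo 0 L, γ t = x

/-- The field is cut off outside a ball containing `Ω`, so that it has a global flow. -/
lemma IsCrossedBy.nonempty_tubeData {m : ℕ} {Ω : Set (E (m + 1))} {b : E (m + 1) → E (m + 1)}
    (hb : ContDiff ℝ ∞ b) (hΩ : IsCrossedBy Ω b) : Nonempty (TubeData Ω b) := by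
  obtain ⟨α, hα, htr⟩ := hΩ.transversal
  obtain ⟨Λ, hlines⟩ := hΩ.lines
  obtain ⟨Γ, h, n, hΓo, hΓc, hΓb, hh, hinj, him, hnc, hn, hind⟩ := hΩ.param_in
  obtain ⟨Γ', h', n', hΓo', hΓc', hΓb', hh', hinj', him', hnc', hn', hind'⟩ := hΩ.param_out
  obtain ⟨R, hR⟩ := hΩ.isBounded.subset_closedBall (0 : E (m + 1))
  let f : ContDiffBump (0 : E (m + 1)) := ⟨max R 1, max R 1 + 1, by positivity, by linarith⟩
  set v : E (m + 1) → E (m + 1) := fun x => f x • b x with hv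
  have hvs : HasCompactSupport v := f.hasCompactSupport.smul_right
  have hvc : ContDiff ℝ ∞ v := f.contDiff.smul hb
  have hcl : closure Ω ⊆ Metric.closedBall 0 (max R 1) :=
    closure_minimal (hR.trans (Metric.closedBall_subset_closedBall (le_max_left _ _)))
      Metric.isClosed_closedBall
  have hev : EqOn v b (closure Ω) := fun x hx => by
    simp only [hv, f.one_of_mem_closedBall (hcl hx), one_smul]
  obtain ⟨K, Φ, z, hK, hΦ, hΦc, hzc, hzd, hdet⟩ := exists_flow_of_hasCompactSupport hvc hvs
  obtain ⟨B, hB⟩ := hvs.exists_bound_of_continuous hvc.continuous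
  have hinf : inflowBdry Ω b ⊆ frontier Ω := fun x hx => hx.1
  have houtf : outflowBdry Ω b ⊆ frontier Ω := fun x hx => hx.1
  have hin : ∀ ξ ∈ Γ, ⟪v (h ξ), n ξ⟫ ≤ -α := by
    intro ξ hξ
    have hm : h ξ ∈ inflowBdry Ω b := him ▸ mem_image_of_mem h hξ
    rw [hev (hinf hm).1]
    exact (htr _ _ (hn ξ hξ)).1 hm
  have hout : ∀ ξ ∈ Γ', α ≤ ⟪v (h' ξ), n' ξ⟫ := by
    intro ξ hξ
    have hm : h' ξ ∈ outflowBdry Ω b := him' ▸ mem_image_of_mem h' hξ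
    rw [hev (houtf hm).1]
    exact (htr _ _ (hn' ξ hξ)).2 hm
  refine ⟨{
    v := v, Φ := Φ, z := z, K := K, B := B, α := α, Λ := Λ, Γ := Γ, h := h, n := n
    Γ' := Γ', h' := h', n' := n'
    isOpen := hΩ.isOpen
    isBounded := hΩ.isBounded
    nonempty := hΩ.isConnected.nonempty
    norm_eq_one := hΩ.norm_eq_one
    contDiff_b := hb
    frontier_eq := hΩ.frontier_eq
    disjoint := hΩ.disjoint
    disjoint_in := ?_
    disjoint_out := ?_
    eqOn := hev
    contDiff_v := hvc
    lipschitz := hK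
    norm_v_le := hB
    isFlow := hΦ
    contDiff_Φ := hΦc
    contDiff_z := hzc
    hasDerivAt_z := hzd
    det_eq := hdet
    param_in := ⟨hΩ.isOpen, hΓo, hΓc, hΓb, hh, hinj, him, hnc, hn, hind, hinf, hα, fun ξ hξ => ?_⟩
    param_out := ⟨hΩ.isOpen, hΓo', hΓc', hΓb', hh', hinj', him', hnc', hn', hind', houtf, hα,
      fun ξ hξ => (hout ξ hξ).trans (le_abs_self _)⟩
    inner_neg := hin
    exists_normal_out := ?_
    lines := hlines }⟩
  · rw [Set.disjoint_left]
    rintro x ⟨-, n₀, hn₀, h0⟩ hx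
    linarith [(htr x n₀ hn₀).1 hx]
  · rw [Set.disjoint_left]
    rintro x ⟨-, n₀, hn₀, h0⟩ hx
    linarith [(htr x n₀ hn₀).2 hx]
  · rw [le_abs]
    right
    linarith [hin ξ hξ]
  · intro x hx
    obtain ⟨hxf, n₀, hn₀, -⟩ := id hx
    exact ⟨n₀, hn₀, by rw [hev hxf.1]; exact (htr x n₀ hn₀).2 hx⟩

namespace TubeData
variable {m : ℕ} {Ω : Set (E (m + 1))} {b : E (m + 1) → E (m + 1)} (𝒯 : TubeData Ω b)

/-- The point reached at time `t` on the field line which starts at `h ξ`. -/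
def X (p : E m × ℝ) : E (m + 1) := flowOut 𝒯.Φ 𝒯.h p

lemma X_def (ξ : E m) (t : ℝ) : 𝒯.X (ξ, t) = 𝒯.Φ (𝒯.h ξ, t) := rfl

lemma X_zero (ξ : E m) : 𝒯.X (ξ, 0) = 𝒯.h ξ := 𝒯.isFlow.apply_zero _

lemma contDiff_X : ContDiff ℝ 1 𝒯.X := 𝒯.param_in.contDiff_flowOut 𝒯.contDiff_Φ

lemma X_add (ξ : E m) (s t : ℝ) : 𝒯.X (ξ, s + t) = 𝒯.Φ (𝒯.X (ξ, s), t) :=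
  𝒯.isFlow.apply_add 𝒯.lipschitz _ _ _

lemma hasDerivAt_X (ξ : E m) (t : ℝ) : HasDerivAt (fun t => 𝒯.X (ξ, t)) (𝒯.v (𝒯.X (ξ, t))) t :=
  𝒯.isFlow.hasDerivAt (𝒯.h ξ) t

lemma hasFDerivAt_X (p : E m × ℝ) : HasFDerivAt 𝒯.X (fderiv ℝ 𝒯.X p) p :=
  (𝒯.contDiff_X.differentiable one_ne_zero p).hasFDerivAt

lemma fderiv_X_snd (ξ : E m) (t : ℝ) : fderiv ℝ 𝒯.X (ξ, t) (0, 1) = 𝒯.v (𝒯.X (ξ, t)) := by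
  have h2 := (𝒯.hasFDerivAt_X (ξ, t)).comp_hasDerivAt t
    ((hasDerivAt_const t ξ).prodMk (hasDerivAt_id t))
  exact h2.unique (𝒯.hasDerivAt_X ξ t)

lemma h_mem {ξ : E m} (hξ : ξ ∈ 𝒯.Γ) : 𝒯.h ξ ∈ inflowBdry Ω b := 𝒯.param_in.mem hξ

lemma inflow_notMem (𝒯 : TubeData Ω b) {x : E (m + 1)} (hx : x ∈ inflowBdry Ω b) : x ∉ Ω :=
  fun hΩ => (𝒯.isOpen.frontier_eq ▸ hx.1 : x ∈ closure Ω \ Ω).2 hΩ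

lemma outflow_notMem (𝒯 : TubeData Ω b) {x : E (m + 1)} (hx : x ∈ outflowBdry Ω b) : x ∉ Ω :=
  fun hΩ => (𝒯.isOpen.frontier_eq ▸ hx.1 : x ∈ closure Ω \ Ω).2 hΩ

/-- Near the inflow boundary the field lines enter `Ω`. -/
lemma eventually_inflow {ξ₀ : E m} (hξ₀ : ξ₀ ∈ 𝒯.Γ) :
    ∃ δ > 0, ∀ ξ ∈ Metric.ball ξ₀ δ, ξ ∈ 𝒯.Γ ∧ (∀ t ∈ Ioo 0 δ, 𝒯.X (ξ, t) ∈ Ω) ∧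
      ∀ t ∈ Ioo (-δ) 0, 𝒯.X (ξ, t) ∉ Ω := by
  obtain ⟨ρ, c, hc, hρ, h0, hd, hloc⟩ := (𝒯.param_in.isOuterNormal ξ₀ hξ₀).exists_defining
  have hX0 : 𝒯.X (ξ₀, 0) = 𝒯.h ξ₀ := 𝒯.X_zero ξ₀
  set G : E m × ℝ → ℝ := fun p => -ρ (𝒯.X p) with hG
  have hρ' : ContDiffAt ℝ 1 ρ (𝒯.X (ξ₀, 0)) := by rwa [hX0]
  have hG1 : ContDiffAt ℝ 1 G (ξ₀, 0) := (hρ'.comp (ξ₀, (0 : ℝ)) 𝒯.contDiff_X.contDiffAt).neg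
  have hG2 : 0 < fderiv ℝ G (ξ₀, 0) (0, 1) := by
    have h1 : HasFDerivAt G _ (ξ₀, (0 : ℝ)) :=
      ((hρ'.differentiableAt one_ne_zero).hasFDerivAt.comp (ξ₀, (0 : ℝ)) (𝒯.hasFDerivAt_X _)).fun_neg
    rw [h1.fderiv]
    change 0 < -(fderiv ℝ ρ (𝒯.X (ξ₀, 0)) (fderiv ℝ 𝒯.X (ξ₀, 0) (0, 1)))
    rw [fderiv_X_snd, hX0, hd, real_inner_comm]
    have h2 := 𝒯.inner_neg ξ₀ hξ₀
    have h3 := 𝒯.param_in.pos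
    nlinarith
  obtain ⟨δ₁, hδ₁, hmono⟩ := exists_strictMonoOn_of_fderiv_pos hG1 hG2
  have hloc2 : ∀ᶠ p in 𝓝 (ξ₀, (0 : ℝ)), ((𝒯.X p ∈ Ω ↔ ρ (𝒯.X p) < 0) ∧
      (𝒯.X p ∈ closure Ω → ρ (𝒯.X p) ≤ 0)) ∧ p.1 ∈ 𝒯.Γ := by
    have h1 : Tendsto 𝒯.X (𝓝 (ξ₀, (0 : ℝ))) (𝓝 (𝒯.h ξ₀)) := by
      rw [← hX0]; exact 𝒯.contDiff_X.continuous.tendsto _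
    exact (h1.eventually hloc).and (continuous_fst.continuousAt.eventually
      (𝒯.param_in.isOpen.mem_nhds hξ₀))
  obtain ⟨δ₂, hδ₂, hball⟩ := Metric.eventually_nhds_iff_ball.1 hloc2
  have hmem : ∀ ξ ∈ Metric.ball ξ₀ (min δ₁ δ₂), ∀ t ∈ Ioo (-min δ₁ δ₂) (min δ₁ δ₂),
      (ξ, t) ∈ Metric.ball (ξ₀, (0 : ℝ)) δ₂ := by
    intro ξ hξ t ht
    rw [Metric.mem_ball, Prod.dist_eq]
    refine max_lt (lt_of_lt_of_le hξ (min_le_right _ _)) ?_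
    rw [Real.dist_eq, sub_zero]
    exact lt_of_lt_of_le (abs_lt.2 ht) (min_le_right _ _)
  have hδ : 0 < min δ₁ δ₂ := lt_min hδ₁ hδ₂
  refine ⟨min δ₁ δ₂, hδ, fun ξ hξ => ?_⟩
  have hzero : ξ ∈ 𝒯.Γ ∧ G (ξ, 0) = 0 := by
    obtain ⟨⟨h1, h2⟩, h3⟩ := hball _ (hmem ξ hξ 0 ⟨by linarith, hδ⟩)
    refine ⟨h3, ?_⟩
    have h4 := 𝒯.inflow_notMem (𝒯.h_mem h3)
    have h5 := (𝒯.h_mem h3).1.1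
    rw [𝒯.X_zero] at h1 h2
    have h6 : ρ (𝒯.h ξ) = 0 := le_antisymm (h2 h5) (not_lt.1 fun h => h4 (h1.2 h))
    simp only [hG, 𝒯.X_zero, h6, neg_zero]
  have hm := hmono ξ (Metric.ball_subset_ball (min_le_left _ _) hξ)
  simp only [zero_sub, zero_add] at hm
  have hsub : Ioo (-min δ₁ δ₂) (min δ₁ δ₂) ⊆ Ioo (-δ₁) δ₁ :=
    Ioo_subset_Ioo (neg_le_neg (min_le_left _ _)) (min_le_left _ _)
  refine ⟨hzero.1, fun t ht => ?_, fun t ht => ?_⟩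
  · have ht' : t ∈ Ioo (-min δ₁ δ₂) (min δ₁ δ₂) := ⟨by linarith [ht.1], ht.2⟩
    refine (hball _ (hmem ξ hξ t ht')).1.1.2 ?_
    have := hm ⟨by linarith, hδ₁⟩ (hsub ht') ht.1
    simp only [hzero.2] at this
    simp only [hG] at this
    linarith
  · have ht' : t ∈ Ioo (-min δ₁ δ₂) (min δ₁ δ₂) := ⟨ht.1, by linarith [ht.2]⟩
    intro hcon
    have h1 := (hball _ (hmem ξ hξ t ht')).1.1.1 hcon
    have := hm (hsub ht') ⟨by linarith, hδ₁⟩ ht.2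
    simp only [hzero.2] at this
    simp only [hG] at this
    linarith

/-- A traversing line is an arc of an orbit of the flow. -/
lemma eq_of_isTraversingLine {γ : ℝ → E (m + 1)} {L : ℝ} (hγ : IsTraversingLine Ω b γ L) :
    ∀ t ∈ Icc 0 L, γ t = 𝒯.Φ (γ 0, t) := by
  obtain ⟨hL, h0, h1, hint, hd⟩ := hγ
  have hcl : ∀ t ∈ Icc 0 L, γ t ∈ closure Ω := by
    intro t ht
    rcases eq_or_lt_of_le ht.1 with h | h
    · rw [← h]; exact h0.1.1
    rcases eq_or_lt_of_le ht.2 with h' | h'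
    · rw [h']; exact h1.1.1
    · exact subset_closure (hint t ⟨h, h'⟩)
  refine 𝒯.isFlow.eqOn_of_hasDerivWithinAt 𝒯.lipschitz fun t ht => ?_
  rw [𝒯.eqOn (hcl t ht)]
  exact hd t ht

/-- The traversing line through a point of the field line shortly after its start is the whole field
line: it can begin neither earlier nor later than at `h ξ`, because that point is not in `Ω` while
the points shortly after it are. -/
lemma exists_exit {ξ : E m} (hξ : ξ ∈ 𝒯.Γ) : ∃ ℓ, 0 < ℓ ∧ ℓ ≤ 𝒯.Λ ∧
    𝒯.X (ξ, ℓ) ∈ outflowBdry Ω b ∧ ∀ t ∈ Ioo 0 ℓ, 𝒯.X (ξ, t) ∈ Ω := by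
  obtain ⟨δ, hδ, hball⟩ := 𝒯.eventually_inflow hξ
  have hin := (hball ξ (Metric.mem_ball_self hδ)).2.1
  set t₀ := δ / 2 with ht₀
  have h0 : t₀ ∈ Ioo 0 δ := ⟨by linarith, by linarith⟩
  obtain ⟨γ, L, hLΛ, hline, τ, hτ, hγτ⟩ := 𝒯.lines _ (hin t₀ h0)
  have harc := 𝒯.eq_of_isTraversingLine hline
  obtain ⟨hL, hγ0, hγL, hint, -⟩ := hline
  have h1 : 𝒯.Φ (γ 0, τ) = 𝒯.X (ξ, t₀) := by rw [← harc τ (Ioo_subset_Icc_self hτ), hγτ]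
  have h2 : γ 0 = 𝒯.X (ξ, t₀ - τ) := by
    rw [sub_eq_add_neg, X_add, ← h1, 𝒯.isFlow.apply_neg_apply 𝒯.lipschitz]
  have h3 : τ = t₀ := by
    rcases lt_trichotomy τ t₀ with h | h | h
    · exfalso
      refine 𝒯.inflow_notMem hγ0 ?_
      rw [h2]
      exact hin _ ⟨by linarith, by linarith [hτ.1, h0.2]⟩
    · exact h
    · exfalso
      refine 𝒯.inflow_notMem (𝒯.h_mem hξ) ?_
      have h4 : 𝒯.h ξ = γ (τ - t₀) := by
        rw [harc _ ⟨by linarith, by linarith [hτ.2, h0.1]⟩, h2, ← X_add]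
        simp [𝒯.X_zero]
      rw [h4]
      exact hint _ ⟨by linarith, by linarith [hτ.2, h0.1]⟩
  have h4 : γ 0 = 𝒯.h ξ := by rw [h2, h3, sub_self, X_zero]
  rw [h4] at harc
  refine ⟨L, hL, hLΛ, ?_, fun t ht => ?_⟩
  · rw [X_def, ← harc L ⟨hL.le, le_rfl⟩]; exact hγL
  · rw [X_def, ← harc t (Ioo_subset_Icc_self ht)]; exact hint t ht

open Classical in
/-- The time at which the field line starting at `h ξ` leaves `Ω` (and `1` if `ξ ∉ Γ`). -/
def L (ξ : E m) : ℝ := if hξ : ξ ∈ 𝒯.Γ then (𝒯.exists_exit hξ).choose else 1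

lemma L_spec {ξ : E m} (hξ : ξ ∈ 𝒯.Γ) : 0 < 𝒯.L ξ ∧ 𝒯.L ξ ≤ 𝒯.Λ ∧
    𝒯.X (ξ, 𝒯.L ξ) ∈ outflowBdry Ω b ∧ ∀ t ∈ Ioo 0 (𝒯.L ξ), 𝒯.X (ξ, t) ∈ Ω := by
  rw [L, dif_pos hξ]
  exact (𝒯.exists_exit hξ).choose_spec

lemma L_pos {ξ : E m} (hξ : ξ ∈ 𝒯.Γ) : 0 < 𝒯.L ξ := (𝒯.L_spec hξ).1

lemma L_le {ξ : E m} (hξ : ξ ∈ 𝒯.Γ) : 𝒯.L ξ ≤ 𝒯.Λ := (𝒯.L_spec hξ).2.1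

lemma X_L_mem {ξ : E m} (hξ : ξ ∈ 𝒯.Γ) : 𝒯.X (ξ, 𝒯.L ξ) ∈ outflowBdry Ω b := (𝒯.L_spec hξ).2.2.1

lemma X_mem {ξ : E m} (hξ : ξ ∈ 𝒯.Γ) {t : ℝ} (ht : t ∈ Ioo 0 (𝒯.L ξ)) : 𝒯.X (ξ, t) ∈ Ω :=
  (𝒯.L_spec hξ).2.2.2 t ht

lemma X_mem_closure {ξ : E m} (hξ : ξ ∈ 𝒯.Γ) {t : ℝ} (ht : t ∈ Icc 0 (𝒯.L ξ)) :
    𝒯.X (ξ, t) ∈ closure Ω := by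
  rcases eq_or_lt_of_le ht.1 with h | h
  · rw [← h, 𝒯.X_zero]; exact (𝒯.h_mem hξ).1.1
  rcases eq_or_lt_of_le ht.2 with h' | h'
  · rw [h']; exact (𝒯.X_L_mem hξ).1.1
  · exact subset_closure (𝒯.X_mem hξ ⟨h, h'⟩)

lemma L_unique {ξ : E m} (hξ : ξ ∈ 𝒯.Γ) {ℓ : ℝ} (hℓ : 0 < ℓ) (h1 : ∀ t ∈ Ioo 0 ℓ, 𝒯.X (ξ, t) ∈ Ω)
    (h2 : 𝒯.X (ξ, ℓ) ∉ Ω) : 𝒯.L ξ = ℓ := by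
  rcases lt_trichotomy (𝒯.L ξ) ℓ with h | h | h
  · exact absurd (h1 _ ⟨𝒯.L_pos hξ, h⟩) (𝒯.outflow_notMem (𝒯.X_L_mem hξ))
  · exact h
  · exact absurd (𝒯.X_mem hξ ⟨hℓ, h⟩) h2

/-- The points `(ξ, t)` with `ξ ∈ Γ` and `0 < t < L ξ`. -/
def D : Set (E m × ℝ) := {p | p.1 ∈ 𝒯.Γ ∧ p.2 ∈ Ioo 0 (𝒯.L p.1)}

lemma X_mem_of_mem_D {p : E m × ℝ} (hp : p ∈ 𝒯.D) : 𝒯.X p ∈ Ω := 𝒯.X_mem hp.1 hp.2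

lemma exists_of_mem {x : E (m + 1)} (hx : x ∈ Ω) : ∃ p ∈ 𝒯.D, 𝒯.X p = x := by
  obtain ⟨γ, L, hLΛ, hline, τ, hτ, hγτ⟩ := 𝒯.lines x hx
  have harc := 𝒯.eq_of_isTraversingLine hline
  obtain ⟨hL, hγ0, hγL, hint, -⟩ := hline
  rw [← 𝒯.param_in.image_eq] at hγ0
  obtain ⟨ξ, hξ, hξ0⟩ := hγ0
  rw [← hξ0] at harc
  have hLξ : 𝒯.L ξ = L := by
    refine 𝒯.L_unique hξ hL (fun t ht => ?_) ?_
    · rw [X_def, ← harc t (Ioo_subset_Icc_self ht)]; exact hint t ht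
    · rw [X_def, ← harc L ⟨hL.le, le_rfl⟩]; exact 𝒯.outflow_notMem hγL
  refine ⟨(ξ, τ), ⟨hξ, by rwa [hLξ]⟩, ?_⟩
  rw [X_def, ← harc τ (Ioo_subset_Icc_self hτ), hγτ]

lemma injOn_X : InjOn 𝒯.X 𝒯.D := by
  have key : ∀ p ∈ 𝒯.D, ∀ q ∈ 𝒯.D, 𝒯.X p = 𝒯.X q → p.2 ≤ q.2 → p = q := by
    rintro ⟨ξ, t⟩ ⟨hξ, ht⟩ ⟨ξ', t'⟩ ⟨hξ', ht'⟩ heq hle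
    simp only at hξ ht hξ' ht' hle
    have h1 : 𝒯.h ξ = 𝒯.X (ξ', t' - t) := by
      rw [sub_eq_add_neg, X_add, ← heq, ← X_add, add_neg_cancel, X_zero]
    rcases eq_or_lt_of_le hle with h | h
    · rw [h, sub_self, X_zero] at h1
      rw [𝒯.param_in.injOn hξ hξ' h1, h]
    · exfalso
      refine 𝒯.inflow_notMem (𝒯.h_mem hξ) ?_
      rw [h1]
      exact 𝒯.X_mem hξ' ⟨by linarith, by linarith [ht.1, ht'.2]⟩
  intro p hp q hq heq
  rcases le_total p.2 q.2 with h | h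
  · exact key p hp q hq heq h
  · exact (key q hq p hp heq.symm h).symm

lemma image_X : 𝒯.X '' 𝒯.D = Ω := by
  ext x
  constructor
  · rintro ⟨p, hp, rfl⟩
    exact 𝒯.X_mem_of_mem_D hp
  · intro hx
    obtain ⟨p, hp, h⟩ := 𝒯.exists_of_mem hx
    exact ⟨p, hp, h⟩

lemma Λ_pos : 0 < 𝒯.Λ := by
  obtain ⟨ξ, hξ⟩ := 𝒯.param_in.isConnected.nonempty
  exact (𝒯.L_pos hξ).trans_le (𝒯.L_le hξ)

/-- The inflow and the outflow boundary have a positive distance, and the speed is bounded. -/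
lemma exists_L_ge : ∃ c > 0, ∀ ξ ∈ 𝒯.Γ, c ≤ 𝒯.L ξ := by
  have hc1 : IsCompact (closure (inflowBdry Ω b)) := by
    refine 𝒯.isBounded.isCompact_closure.of_isClosed_subset isClosed_closure ?_
    exact closure_minimal (fun x hx => hx.1.1) isClosed_closure
  obtain ⟨r, hr, hdist⟩ := Metric.exists_pos_forall_lt_edist hc1 isClosed_closure 𝒯.disjoint
  refine ⟨r / (|𝒯.B| + 1), by positivity, fun ξ hξ => ?_⟩
  have h1 := hdist _ (subset_closure (𝒯.h_mem hξ)) _ (subset_closure (𝒯.X_L_mem hξ))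
  rw [edist_nndist] at h1
  have h2 : r < nndist (𝒯.h ξ) (𝒯.X (ξ, 𝒯.L ξ)) := by exact_mod_cast h1
  have h3 : ‖𝒯.X (ξ, 𝒯.L ξ) - 𝒯.X (ξ, 0)‖ ≤ (|𝒯.B| + 1) * ‖𝒯.L ξ - 0‖ :=
    Convex.norm_image_sub_le_of_norm_hasDerivWithin_le (s := univ) (f := fun t => 𝒯.X (ξ, t))
      (fun t _ => (𝒯.hasDerivAt_X ξ t).hasDerivWithinAt)
      (fun t _ => (𝒯.norm_v_le _).trans (by linarith [le_abs_self 𝒯.B])) convex_univ (mem_univ _)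
      (mem_univ _)
  rw [X_zero, sub_zero, Real.norm_of_nonneg (𝒯.L_pos hξ).le] at h3
  have h4 : (r : ℝ) < dist (𝒯.h ξ) (𝒯.X (ξ, 𝒯.L ξ)) := by exact_mod_cast h2
  rw [dist_comm, dist_eq_norm] at h4
  rw [div_le_iff₀ (by positivity)]
  linarith

end TubeData

namespace TubeData
variable {m : ℕ} {Ω : Set (E (m + 1))} {b : E (m + 1) → E (m + 1)} (𝒯 : TubeData Ω b)

/-! ### The exit time -/

/-- The exit time is of class `C¹`, and immediately after it the field lines are outside `Ω`. -/
lemma contDiffAt_L_and_eventually {ξ₀ : E m} (hξ₀ : ξ₀ ∈ 𝒯.Γ) : ContDiffAt ℝ 1 𝒯.L ξ₀ ∧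
    ∀ᶠ p in 𝓝 (ξ₀, 𝒯.L ξ₀), 𝒯.L p.1 ≤ p.2 → 𝒯.X p ∉ Ω := by
  set ℓ := 𝒯.L ξ₀ with hℓ
  obtain ⟨n, hn, hαn⟩ := 𝒯.exists_normal_out _ (𝒯.X_L_mem hξ₀)
  obtain ⟨ρ, c, hc, hρ, h0, hd, hloc⟩ := hn.exists_defining
  set G : E m × ℝ → ℝ := fun p => ρ (𝒯.X p) with hG
  have hG1 : ContDiffAt ℝ 1 G (ξ₀, ℓ) := hρ.comp (ξ₀, ℓ) 𝒯.contDiff_X.contDiffAt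
  have hG2 : 0 < fderiv ℝ G (ξ₀, ℓ) (0, 1) := by
    have h1 : HasFDerivAt G _ (ξ₀, ℓ) :=
      (hρ.differentiableAt one_ne_zero).hasFDerivAt.comp (ξ₀, ℓ) (𝒯.hasFDerivAt_X _)
    rw [h1.fderiv]
    change 0 < fderiv ℝ ρ (𝒯.X (ξ₀, ℓ)) (fderiv ℝ 𝒯.X (ξ₀, ℓ) (0, 1))
    rw [fderiv_X_snd, hd, real_inner_comm]
    exact mul_pos hc (𝒯.param_in.pos.trans_le hαn)
  -- the exit time is the implicit function of `ρ (X (ξ, t)) = 0`, which is solvable by transversality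
  have hinv : (fderiv ℝ G (ξ₀, ℓ) ∘L .inr ℝ (E m) ℝ).IsInvertible := by
    refine ⟨ContinuousLinearEquiv.unitsEquivAut ℝ (Units.mk0 _ hG2.ne'), ?_⟩
    ext
    simp
  set g := hG1.implicitFunction one_ne_zero hinv with hg
  have hg0 : g ξ₀ = ℓ := hG1.implicitFunction_apply_self one_ne_zero hinv
  have hgc : ContDiffAt ℝ 1 g ξ₀ := hG1.contDiffAt_implicitFunction one_ne_zero hinv
  have hgG : ∀ᶠ ξ in 𝓝 ξ₀, G (ξ, g ξ) = 0 := by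
    have := hG1.eventually_apply_implicitFunction one_ne_zero hinv
    simpa only [hG, hℓ, h0] using this
  obtain ⟨δ₁, hδ₁, hmono⟩ := exists_strictMonoOn_of_fderiv_pos hG1 hG2
  simp only at hmono
  obtain ⟨δ₀, hδ₀, hball₀⟩ := 𝒯.eventually_inflow hξ₀
  have hloc2 : ∀ᶠ p in 𝓝 (ξ₀, ℓ), (𝒯.X p ∈ Ω ↔ ρ (𝒯.X p) < 0) :=
    ((𝒯.contDiff_X.continuous.tendsto (ξ₀, ℓ)).eventually hloc).mono fun p hp => hp.1
  obtain ⟨δ₂, hδ₂, hball₂⟩ := Metric.eventually_nhds_iff_ball.1 hloc2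
  have hℓ0 : 0 < ℓ := 𝒯.L_pos hξ₀
  set δ := min (min δ₁ δ₂) ℓ with hδdef
  have hδ : 0 < δ := lt_min (lt_min hδ₁ hδ₂) hℓ0
  have hδ1 : δ ≤ δ₁ := (min_le_left _ _).trans (min_le_left _ _)
  have hδ2 : δ ≤ δ₂ := (min_le_left _ _).trans (min_le_right _ _)
  have hmid : ∀ᶠ ξ in 𝓝 ξ₀, ∀ t ∈ Icc (δ₀ / 2) (ℓ - δ / 2), 𝒯.X (ξ, t) ∈ Ω := by
    refine isCompact_Icc.eventually_forall_of_forall_eventually fun t ht => ?_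
    refine 𝒯.contDiff_X.continuous.continuousAt.eventually (𝒯.isOpen.mem_nhds ?_)
    exact 𝒯.X_mem hξ₀ ⟨by linarith [ht.1], by linarith [ht.2]⟩
  have hgt : ∀ᶠ ξ in 𝓝 ξ₀, g ξ ∈ Ioo (ℓ - δ / 2) (ℓ + δ / 2) :=
    hgc.continuousAt.eventually (isOpen_Ioo.mem_nhds (by rw [hg0]; constructor <;> linarith))
  have hsub : Ioo (ℓ - δ) (ℓ + δ) ⊆ Ioo (ℓ - δ₁) (ℓ + δ₁) :=
    Ioo_subset_Ioo (by linarith) (by linarith)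
  -- near the exit point, `Ω` is the region `t < g ξ`
  have hkey : ∀ᶠ ξ in 𝓝 ξ₀, ∀ t ∈ Ioo (ℓ - δ) (ℓ + δ), (𝒯.X (ξ, t) ∈ Ω ↔ t < g ξ) := by
    filter_upwards [hgt, hgG, Metric.ball_mem_nhds ξ₀ hδ] with ξ h1 h2 h3 t ht
    have hm := hmono ξ (Metric.ball_subset_ball hδ1 h3)
    have hmem : (ξ, t) ∈ Metric.ball (ξ₀, ℓ) δ₂ := by
      rw [Metric.mem_ball, Prod.dist_eq]
      refine max_lt (lt_of_lt_of_le h3 hδ2) ?_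
      rw [← Metric.mem_ball, Real.ball_eq_Ioo]
      exact ⟨by linarith [ht.1], by linarith [ht.2]⟩
    rw [hball₂ _ hmem]
    have hgm : g ξ ∈ Ioo (ℓ - δ₁) (ℓ + δ₁) := hsub ⟨by linarith [h1.1], by linarith [h1.2]⟩
    rw [← hm.lt_iff_lt (hsub ht) hgm, h2]
  have hLg : 𝒯.L =ᶠ[𝓝 ξ₀] g := by
    filter_upwards [hkey, hmid, hgt, Metric.ball_mem_nhds ξ₀ hδ₀] with ξ h1 h2 h3 h4
    have hℓδ : δ ≤ ℓ := min_le_right _ _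
    refine 𝒯.L_unique (hball₀ ξ h4).1 (by linarith [h3.1]) (fun t ht => ?_) ?_
    · rcases lt_or_ge t (δ₀ / 2) with h | h
      · exact (hball₀ ξ h4).2.1 t ⟨ht.1, by linarith⟩
      · rcases le_or_gt t (ℓ - δ / 2) with h' | h'
        · exact h2 t ⟨h, h'⟩
        · exact (h1 t ⟨by linarith, by linarith [ht.2, h3.2]⟩).2 ht.2
    · rw [h1 _ ⟨by linarith [h3.1], by linarith [h3.2]⟩]
      exact lt_irrefl _
  refine ⟨hgc.congr_of_eventuallyEq hLg, ?_⟩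
  have h1 : ∀ᶠ p in 𝓝 (ξ₀, ℓ), p.2 ∈ Ioo (ℓ - δ) (ℓ + δ) :=
    continuous_snd.continuousAt.eventually (isOpen_Ioo.mem_nhds (by constructor <;> linarith))
  have hfst : Tendsto (Prod.fst : E m × ℝ → E m) (𝓝 (ξ₀, ℓ)) (𝓝 ξ₀) :=
    continuous_fst.continuousAt
  filter_upwards [h1, hfst.eventually hkey, hfst.eventually hLg] with p h2 h3 h4 h5
  rw [h3 p.2 h2, ← h4]
  exact not_lt.2 h5

lemma contDiffOn_L : ContDiffOn ℝ 1 𝒯.L 𝒯.Γ := fun _ hξ =>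
  (𝒯.contDiffAt_L_and_eventually hξ).1.contDiffWithinAt

lemma hasFDerivAt_L {ξ : E m} (hξ : ξ ∈ 𝒯.Γ) : HasFDerivAt 𝒯.L (fderiv ℝ 𝒯.L ξ) ξ :=
  ((𝒯.contDiffAt_L_and_eventually hξ).1.differentiableAt one_ne_zero).hasFDerivAt

/-- Differentiate `ρ (X (ξ, L ξ)) = 0`, where `ρ` is a defining function of `Ω` near the exit point;
the coefficient of the derivative of `L` is at least `α` by transversality. -/
lemma norm_fderiv_L_le {ξ : E m} (hξ : ξ ∈ 𝒯.Γ) :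
    𝒯.α * ‖fderiv ℝ 𝒯.L ξ‖ ≤ ‖fderiv ℝ 𝒯.X (ξ, 𝒯.L ξ)‖ := by
  obtain ⟨n, hn, hαn⟩ := 𝒯.exists_normal_out _ (𝒯.X_L_mem hξ)
  rw [real_inner_comm] at hαn
  obtain ⟨ρ, c, hc, hρ, h0, hd, hloc⟩ := hn.exists_defining
  have hγ : HasFDerivAt (fun η => (η, 𝒯.L η)) ((ContinuousLinearMap.id ℝ (E m)).prod
      (fderiv ℝ 𝒯.L ξ)) ξ := (hasFDerivAt_id ξ).prodMk (𝒯.hasFDerivAt_L hξ)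
  have hX : HasFDerivAt (fun η => 𝒯.X (η, 𝒯.L η)) _ ξ := (𝒯.hasFDerivAt_X (ξ, 𝒯.L ξ)).comp ξ hγ
  have h1 : HasFDerivAt (fun η => ρ (𝒯.X (η, 𝒯.L η))) _ ξ :=
    (hρ.differentiableAt one_ne_zero).hasFDerivAt.comp ξ hX
  have h2 : (fun η => ρ (𝒯.X (η, 𝒯.L η))) =ᶠ[𝓝 ξ] fun _ => 0 := by
    filter_upwards [hX.continuousAt.eventually hloc, 𝒯.param_in.isOpen.mem_nhds hξ] with η h3 h4
    exact le_antisymm (h3.2 (𝒯.X_L_mem h4).1.1)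
      (not_lt.1 fun h => 𝒯.outflow_notMem (𝒯.X_L_mem h4) (h3.1.2 h))
  have h3 := (h1.congr_of_eventuallyEq h2.symm).unique (hasFDerivAt_const (0 : ℝ) ξ)
  have hX1 : ∀ (u : E m) (τ : ℝ), fderiv ℝ 𝒯.X (ξ, 𝒯.L ξ) (u, τ) =
      fderiv ℝ 𝒯.X (ξ, 𝒯.L ξ) (u, 0) + τ • 𝒯.v (𝒯.X (ξ, 𝒯.L ξ)) := by
    intro u τ
    rw [← fderiv_X_snd, ← map_smul, ← map_add]
    simp
  have hα := 𝒯.param_in.pos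
  have hle : ‖fderiv ℝ 𝒯.L ξ‖ ≤ ‖fderiv ℝ 𝒯.X (ξ, 𝒯.L ξ)‖ / 𝒯.α := by
    refine ContinuousLinearMap.opNorm_le_bound _ (by positivity) fun u => ?_
    have h4 : fderiv ℝ ρ (𝒯.X (ξ, 𝒯.L ξ)) (fderiv ℝ 𝒯.X (ξ, 𝒯.L ξ) (u, fderiv ℝ 𝒯.L ξ u)) = 0 := by
      have := congrArg (fun A : E m →L[ℝ] ℝ => A u) h3
      simpa using this
    rw [hd, hX1, inner_add_right, inner_smul_right] at h4
    have h5 := (mul_eq_zero.1 h4).resolve_left hc.ne'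
    have h6 : |⟪n, fderiv ℝ 𝒯.X (ξ, 𝒯.L ξ) (u, 0)⟫| ≤ ‖fderiv ℝ 𝒯.X (ξ, 𝒯.L ξ)‖ * ‖u‖ := by
      refine (abs_real_inner_le_norm _ _).trans ?_
      rw [hn.1, one_mul]
      refine (ContinuousLinearMap.le_opNorm _ _).trans ?_
      simp [Prod.norm_def]
    have h7 : |fderiv ℝ 𝒯.L ξ u| * 𝒯.α ≤ |fderiv ℝ 𝒯.L ξ u| * ⟪n, 𝒯.v (𝒯.X (ξ, 𝒯.L ξ))⟫ :=
      mul_le_mul_of_nonneg_left hαn (abs_nonneg _)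
    have h8 : |fderiv ℝ 𝒯.L ξ u| * ⟪n, 𝒯.v (𝒯.X (ξ, 𝒯.L ξ))⟫ =
        |⟪n, fderiv ℝ 𝒯.X (ξ, 𝒯.L ξ) (u, 0)⟫| := by
      rw [← abs_of_pos (hα.trans_le hαn), ← abs_mul, ← abs_neg ⟪n, _⟫]
      congr 1
      linarith
    rw [Real.norm_eq_abs, div_mul_eq_mul_div, le_div_iff₀ hα]
    linarith
  rw [le_div_iff₀ hα] at hle
  linarith

/-- Near the closed field lines issuing from `Γ`, the preimage of `Ω` under `X` is `D`. -/
lemma eventually_mem_D {ξ₀ : E m} (hξ₀ : ξ₀ ∈ 𝒯.Γ) {t₀ : ℝ} (ht₀ : t₀ ∈ Icc 0 (𝒯.L ξ₀)) :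
    ∀ᶠ p in 𝓝 (ξ₀, t₀), 𝒯.X p ∈ Ω → p ∈ 𝒯.D := by
  have hfst : Tendsto (Prod.fst : E m × ℝ → E m) (𝓝 (ξ₀, t₀)) (𝓝 ξ₀) :=
    continuous_fst.continuousAt
  have hsnd : Tendsto (Prod.snd : E m × ℝ → ℝ) (𝓝 (ξ₀, t₀)) (𝓝 t₀) :=
    continuous_snd.continuousAt
  have hL : Tendsto (fun p : E m × ℝ => 𝒯.L p.1) (𝓝 (ξ₀, t₀)) (𝓝 (𝒯.L ξ₀)) :=
    (𝒯.contDiffAt_L_and_eventually hξ₀).1.continuousAt.tendsto.comp hfst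
  have hΓ : ∀ᶠ p : E m × ℝ in 𝓝 (ξ₀, t₀), p.1 ∈ 𝒯.Γ := hfst (𝒯.param_in.isOpen.mem_nhds hξ₀)
  have h1 : ∀ᶠ p in 𝓝 (ξ₀, t₀), 𝒯.X p ∈ Ω → 0 < p.2 := by
    rcases eq_or_lt_of_le ht₀.1 with h | h
    · obtain ⟨δ, hδ, hball⟩ := 𝒯.eventually_inflow hξ₀
      have h2 : ∀ᶠ p : E m × ℝ in 𝓝 (ξ₀, t₀), p.2 ∈ Ioo (-δ) δ :=
        hsnd (isOpen_Ioo.mem_nhds (by rw [← h]; constructor <;> linarith))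
      filter_upwards [h2, hfst (Metric.ball_mem_nhds ξ₀ hδ)] with p h2 h3 h4
      by_contra h5
      rcases eq_or_lt_of_le (not_lt.1 h5) with h6 | h6
      · rw [show p = (p.1, 0) from Prod.ext rfl h6, 𝒯.X_zero] at h4
        exact 𝒯.inflow_notMem (𝒯.h_mem (hball _ h3).1) h4
      · exact (hball p.1 h3).2.2 p.2 ⟨h2.1, h6⟩ h4
    · filter_upwards [hsnd.eventually_const_lt h] with p hp _ using hp
  have h2 : ∀ᶠ p in 𝓝 (ξ₀, t₀), 𝒯.X p ∈ Ω → p.2 < 𝒯.L p.1 := by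
    rcases eq_or_lt_of_le ht₀.2 with h | h
    · have h3 := (𝒯.contDiffAt_L_and_eventually hξ₀).2
      rw [← h] at h3
      filter_upwards [h3] with p h4 h5
      by_contra h6
      exact h4 (not_lt.1 h6) h5
    · filter_upwards [hsnd.eventually_lt hL h] with p hp _ using hp
  filter_upwards [hΓ, h1, h2] with p h3 h4 h5 h6 using ⟨h3, h4 h6, h5 h6⟩

/-- Local inverse of `X` near a closed field line issuing from `Γ`. -/
lemma exists_localInverse {ξ₀ : E m} (hξ₀ : ξ₀ ∈ 𝒯.Γ) {t₀ : ℝ} (ht₀ : t₀ ∈ Icc 0 (𝒯.L ξ₀)) :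
    ∃ Z : E (m + 1) → E m × ℝ, ContDiffAt ℝ 1 Z (𝒯.X (ξ₀, t₀)) ∧ Z (𝒯.X (ξ₀, t₀)) = (ξ₀, t₀) ∧
      ∀ᶠ y in 𝓝 (𝒯.X (ξ₀, t₀)), 𝒯.X (Z y) = y ∧ (y ∈ Ω → Z y ∈ 𝒯.D) := by
  obtain ⟨e, hes, hee, hed⟩ := 𝒯.param_in.exists_openPartialHomeomorph 𝒯.isFlow 𝒯.lipschitz
    𝒯.contDiff_Φ (subset_closure hξ₀) t₀
  have heX : ⇑e = 𝒯.X := hee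
  have he0 : e.symm (𝒯.X (ξ₀, t₀)) = (ξ₀, t₀) := by rw [← heX]; exact e.left_inv hes
  have hmt : 𝒯.X (ξ₀, t₀) ∈ e.target := by rw [← heX]; exact e.map_source hes
  have hlim : Tendsto e.symm (𝓝 (𝒯.X (ξ₀, t₀))) (𝓝 (ξ₀, t₀)) := by
    have := (e.continuousAt_symm hmt).tendsto
    rwa [he0] at this
  refine ⟨e.symm, hed, he0, ?_⟩
  filter_upwards [e.open_target.mem_nhds hmt, hlim.eventually (𝒯.eventually_mem_D hξ₀ ht₀)]
    with y h1 h2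
  have h3 : 𝒯.X (e.symm y) = y := by rw [← heX]; exact e.right_inv h1
  exact ⟨h3, fun hy => h2 (by rwa [h3])⟩

lemma isOpen_D : IsOpen 𝒯.D := by
  rw [isOpen_iff_mem_nhds]
  rintro ⟨ξ, t⟩ ⟨hξ, ht⟩
  filter_upwards [𝒯.eventually_mem_D hξ (Ioo_subset_Icc_self ht),
    𝒯.contDiff_X.continuous.continuousAt.eventually (𝒯.isOpen.mem_nhds (𝒯.X_mem hξ ht))]
    with p h1 h2 using h1 h2

end TubeData

namespace TubeData
variable {m : ℕ} {Ω : Set (E (m + 1))} {b : E (m + 1) → E (m + 1)} (𝒯 : TubeData Ω b)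

/-! ### The density of Lebesgue measure -/

/-- The density of Lebesgue measure in the coordinates `(ξ, t)` splits into a factor which depends
on the initial point and an exponential given by Liouville's formula. -/
lemma exists_density : ∃ κ : E m → ℝ, ContDiff ℝ 1 κ ∧ (∀ ξ ∈ closure 𝒯.Γ, 0 < κ ξ) ∧
    ∀ f : E (m + 1) → ℝ≥0∞, ∫⁻ x in Ω, f x =
      ∫⁻ p in 𝒯.D, ENNReal.ofReal (κ p.1 * Real.exp (𝒯.z (𝒯.h p.1, p.2))) * f (𝒯.X p)
        ∂((volume : Measure (E m)).prod (volume : Measure ℝ)) := by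
  set μ₀ := (volume : Measure (E m)).prod (volume : Measure ℝ)
  -- the change of variables formula requires a map of a space into itself
  let A : (E m × ℝ) ≃L[ℝ] E (m + 1) := ContinuousLinearEquiv.ofFinrankEq (by simp)
  set M : E m → (E m × ℝ →L[ℝ] E (m + 1)) := fun ξ =>
    fderiv ℝ 𝒯.h ξ ∘L .fst ℝ (E m) ℝ + (ContinuousLinearMap.snd ℝ (E m) ℝ).smulRight (𝒯.v (𝒯.h ξ))
    with hM
  have hM1 : ContDiff ℝ 1 M := by
    have h1 : ContDiff ℝ 1 (fderiv ℝ 𝒯.h) := 𝒯.param_in.contDiff.fderiv_right (by norm_num)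
    have h2 : ContDiff ℝ 1 (fun ξ => 𝒯.v (𝒯.h ξ)) :=
      (𝒯.contDiff_v.of_le (by exact_mod_cast le_top)).comp
        (𝒯.param_in.contDiff.of_le (by norm_num))
    exact (h1.clm_comp contDiff_const).add (contDiff_const.smulRight h2)
  set J : E m → ℝ := fun ξ => (M ξ ∘L (A.symm : E (m + 1) →L[ℝ] E m × ℝ)).det with hJ
  have hJ1 : ContDiff ℝ 1 J := contDiff_det.comp (hM1.clm_comp contDiff_const)
  have hXM : ∀ ξ t, fderiv ℝ 𝒯.X (ξ, t) =
      (fderiv ℝ 𝒯.Φ (𝒯.h ξ, t) ∘L .inl ℝ (E (m + 1)) ℝ) ∘L M ξ := by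
    intro ξ t
    refine ContinuousLinearMap.ext fun q => ?_
    exact 𝒯.param_in.fderiv_flowOut 𝒯.isFlow 𝒯.lipschitz 𝒯.contDiff_Φ (ξ, t) q
  have hdet : ∀ ξ t, (fderiv ℝ 𝒯.X (ξ, t) ∘L (A.symm : E (m + 1) →L[ℝ] E m × ℝ)).det =
      Real.exp (𝒯.z (𝒯.h ξ, t)) * J ξ := by
    intro ξ t
    rw [hXM, ← 𝒯.det_eq]
    exact LinearMap.det_comp
      ((fderiv ℝ 𝒯.Φ (𝒯.h ξ, t) ∘L .inl ℝ (E (m + 1)) ℝ : E (m + 1) →L[ℝ] E (m + 1)) :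
        E (m + 1) →ₗ[ℝ] E (m + 1))
      ((M ξ ∘L (A.symm : E (m + 1) →L[ℝ] E m × ℝ) : E (m + 1) →L[ℝ] E (m + 1)) :
        E (m + 1) →ₗ[ℝ] E (m + 1))
  have hJne : ∀ ξ ∈ closure 𝒯.Γ, J ξ ≠ 0 := by
    intro ξ hξ
    obtain ⟨e, he⟩ := 𝒯.param_in.exists_equiv_flowOut 𝒯.isFlow 𝒯.lipschitz 𝒯.contDiff_Φ hξ 0
    have h1 := hdet ξ 0
    have h2 : fderiv ℝ 𝒯.X (ξ, 0) = (e : E m × ℝ →L[ℝ] E (m + 1)) := he.symm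
    rw [h2] at h1
    intro h0
    rw [h0, mul_zero] at h1
    exact (LinearEquiv.isUnit_det' (A.symm.trans e).toLinearEquiv).ne_zero h1
  -- the sign of the Jacobian is constant, as `Γ` is connected
  obtain ⟨ε, hε, hεJ⟩ : ∃ ε : ℝ, |ε| = 1 ∧ ∀ ξ ∈ 𝒯.Γ, 0 ≤ ε * J ξ := by
    by_cases hpos : ∀ ξ ∈ 𝒯.Γ, 0 ≤ J ξ
    · exact ⟨1, by simp, fun ξ hξ => by simpa using hpos ξ hξ⟩
    · push Not at hpos
      obtain ⟨η, hη, hη0⟩ := hpos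
      refine ⟨-1, by simp, fun ξ hξ => ?_⟩
      by_contra hcon
      have h0 : (0 : ℝ) ∈ J '' 𝒯.Γ := 𝒯.param_in.isConnected.isPreconnected.intermediate_value hη hξ
        hJ1.continuous.continuousOn ⟨hη0.le, by linarith⟩
      obtain ⟨ζ, hζ, hζ0⟩ := h0
      exact hJne ζ (subset_closure hζ) hζ0
  have hεne : ε ≠ 0 := by rintro rfl; simp at hε
  -- `A` need not preserve the volume
  set c : ℝ≥0 := (volume : Measure (E (m + 1))).addHaarScalarFactor (μ₀.map A) with hc
  have hc0 : 0 < c := Measure.addHaarScalarFactor_pos_of_isAddHaarMeasure _ _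
  have hvol : (volume : Measure (E (m + 1))) = c • μ₀.map A := Measure.isAddLeftInvariant_eq_smul _ _
  refine ⟨fun ξ => c * (ε * J ξ), contDiff_const.mul (contDiff_const.mul hJ1), fun ξ hξ => ?_,
    fun f => ?_⟩
  · refine mul_pos (by exact_mod_cast hc0) ?_
    have h1 : 0 ≤ ε * J ξ := le_on_closure (f := fun _ => (0 : ℝ)) (g := fun ξ => ε * J ξ) hεJ
      continuousOn_const (continuous_const.mul hJ1.continuous).continuousOn hξ
    exact h1.lt_of_ne' (mul_ne_zero hεne (hJne ξ hξ))
  · set s : Set (E (m + 1)) := A.symm ⁻¹' 𝒯.D with hs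
    have hsm : MeasurableSet s := A.symm.continuous.measurable 𝒯.isOpen_D.measurableSet
    have himg : (fun y => 𝒯.X (A.symm y)) '' s = Ω := by
      refine Eq.trans ?_ 𝒯.image_X
      ext x
      constructor
      · rintro ⟨y, hy, rfl⟩
        exact ⟨A.symm y, hy, rfl⟩
      · rintro ⟨p, hp, rfl⟩
        exact ⟨A p, by simpa [hs] using hp, by simp⟩
    have hinj : InjOn (fun y => 𝒯.X (A.symm y)) s := fun y hy y' hy' h =>
      A.symm.injective (𝒯.injOn_X hy hy' h)
    have hd : ∀ y ∈ s, HasFDerivWithinAt (fun y => 𝒯.X (A.symm y))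
        (fderiv ℝ 𝒯.X (A.symm y) ∘L (A.symm : E (m + 1) →L[ℝ] E m × ℝ)) s y := fun y _ =>
      ((𝒯.hasFDerivAt_X _).comp y A.symm.hasFDerivAt).hasFDerivWithinAt
    have h1 := lintegral_image_eq_lintegral_abs_det_fderiv_mul volume hsm hd hinj f
    rw [himg] at h1
    rw [h1]
    have hA : MeasurableEmbedding A := A.toHomeomorph.measurableEmbedding
    rw [hvol, Measure.restrict_smul, lintegral_smul_measure, hA.restrict_map, hA.lintegral_map]
    have h2 : A ⁻¹' s = 𝒯.D := by ext p; simp [hs]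
    rw [h2, ENNReal.smul_def, smul_eq_mul, ← lintegral_const_mul' _ _ ENNReal.coe_ne_top]
    refine setLIntegral_congr_fun 𝒯.isOpen_D.measurableSet fun p hp => ?_
    simp only [ContinuousLinearEquiv.symm_apply_apply]
    rw [hdet, ← mul_assoc, ← ENNReal.ofReal_coe_nnreal, ← ENNReal.ofReal_mul c.coe_nonneg]
    congr 2
    rw [abs_mul, abs_of_pos (Real.exp_pos _)]
    have h3 : |J p.1| = ε * J p.1 := by
      rw [← abs_of_nonneg (hεJ p.1 hp.1), abs_mul, hε, one_mul]
    rw [h3]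
    ring

/-- The factor of the density which depends on the initial point. -/
def κ : E m → ℝ := 𝒯.exists_density.choose

lemma contDiff_κ : ContDiff ℝ 1 𝒯.κ := 𝒯.exists_density.choose_spec.1

lemma κ_pos {ξ : E m} (hξ : ξ ∈ closure 𝒯.Γ) : 0 < 𝒯.κ ξ := 𝒯.exists_density.choose_spec.2.1 ξ hξ

lemma lintegral_eq (f : E (m + 1) → ℝ≥0∞) : ∫⁻ x in Ω, f x =
    ∫⁻ p in 𝒯.D, ENNReal.ofReal (𝒯.κ p.1 * Real.exp (𝒯.z (𝒯.h p.1, p.2))) * f (𝒯.X p)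
      ∂((volume : Measure (E m)).prod (volume : Measure ℝ)) :=
  𝒯.exists_density.choose_spec.2.2 f

lemma exists_fderiv_L_le : ∃ C : ℝ, 0 ≤ C ∧ ∀ ξ ∈ 𝒯.Γ, ‖fderiv ℝ 𝒯.L ξ‖ ≤ C := by
  have hK : IsCompact (closure 𝒯.Γ ×ˢ Icc 0 𝒯.Λ) := 𝒯.param_in.isCompact_closure.prod isCompact_Icc
  obtain ⟨C, hC⟩ := hK.exists_bound_of_continuousOn
    (𝒯.contDiff_X.continuous_fderiv one_ne_zero).continuousOn
  refine ⟨|C| / 𝒯.α, div_nonneg (abs_nonneg _) 𝒯.param_in.pos.le, fun ξ hξ => ?_⟩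
  rw [le_div_iff₀ 𝒯.param_in.pos, mul_comm]
  exact (𝒯.norm_fderiv_L_le hξ).trans ((hC _ ⟨subset_closure hξ, (𝒯.L_pos hξ).le, 𝒯.L_le hξ⟩).trans
    (le_abs_self C))

/-- The inverses of the differentials of `X` are uniformly bounded. -/
lemma exists_le_fderiv_X : ∃ c > 0, ∀ ξ ∈ 𝒯.Γ, ∀ t ∈ Icc 0 𝒯.Λ, ∀ q,
    c * ‖q‖ ≤ ‖fderiv ℝ 𝒯.X (ξ, t) q‖ := by
  have hK : IsCompact ((closure 𝒯.Γ ×ˢ Icc 0 𝒯.Λ) ×ˢ Metric.sphere (0 : E m × ℝ) 1) :=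
    (𝒯.param_in.isCompact_closure.prod isCompact_Icc).prod (isCompact_sphere _ _)
  have hcont : Continuous fun q : (E m × ℝ) × (E m × ℝ) => ‖fderiv ℝ 𝒯.X q.1 q.2‖ :=
    (((𝒯.contDiff_X.continuous_fderiv one_ne_zero).comp continuous_fst).clm_apply
      continuous_snd).norm
  obtain ⟨c, hc, hle⟩ : ∃ c > 0, ∀ q ∈ (closure 𝒯.Γ ×ˢ Icc 0 𝒯.Λ) ×ˢ Metric.sphere (0 : E m × ℝ) 1,
      c ≤ ‖fderiv ℝ 𝒯.X q.1 q.2‖ := by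
    refine hK.exists_forall_le' hcont.continuousOn ?_
    rintro ⟨⟨ξ, t⟩, q⟩ ⟨⟨hξ, -⟩, hq⟩
    have hi := 𝒯.param_in.injective_fderiv_flowOut 𝒯.isFlow 𝒯.lipschitz 𝒯.contDiff_Φ hξ t
    rw [norm_pos_iff]
    intro h0
    have : q = 0 := hi (h0.trans (map_zero _).symm)
    rw [this] at hq
    simp at hq
  refine ⟨c, hc, fun ξ hξ t ht q => ?_⟩
  rcases eq_or_ne q 0 with h | h
  · simp [h]
  · have hq : ‖q‖ ≠ 0 := norm_ne_zero_iff.2 h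
    have h1 := hle ((ξ, t), ‖q‖⁻¹ • q) ⟨⟨subset_closure hξ, ht⟩, by
      rw [mem_sphere_zero_iff_norm, norm_smul, norm_inv, norm_norm, inv_mul_cancel₀ hq]⟩
    rw [map_smul, norm_smul, norm_inv, norm_norm] at h1
    rw [← div_eq_inv_mul, le_div_iff₀ (by positivity)] at h1
    exact h1

/-! ### Rescaled coordinates -/

/-- The auxiliary map `(ξ, s) ↦ (ξ, L ξ, s L ξ)`. It takes the closed cylinder into a compact set, and
the coordinates and their density factor through it by functions of class `C¹` on the whole space;
this bounds them and their derivatives uniformly, although `L` is defined on `Γ` only. -/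
def S (p : E m × ℝ) : E m × ℝ × ℝ := (p.1, 𝒯.L p.1, p.2 * 𝒯.L p.1)

/-- The coordinates `(ξ, s)`, with `0 < s < 1`, in which the field lines are the lines `ξ = const`. -/
def Y (p : E m × ℝ) : E (m + 1) := 𝒯.X (p.1, p.2 * 𝒯.L p.1)

/-- The density of Lebesgue measure in the coordinates `(ξ, s)`. -/
def w (p : E m × ℝ) : ℝ := 𝒯.L p.1 * 𝒯.κ p.1 * Real.exp (𝒯.z (𝒯.h p.1, p.2 * 𝒯.L p.1))

lemma S_mem {p : E m × ℝ} (hp : p ∈ 𝒯.Γ ×ˢ Icc (0 : ℝ) 1) :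
    𝒯.S p ∈ closure 𝒯.Γ ×ˢ Icc 0 𝒯.Λ ×ˢ Icc 0 𝒯.Λ := by
  obtain ⟨h1, h2, h3⟩ := hp
  have h4 := 𝒯.L_pos h1
  have h5 := 𝒯.L_le h1
  refine ⟨subset_closure h1, ⟨h4.le, h5⟩, mul_nonneg h2 h4.le, ?_⟩
  calc p.2 * 𝒯.L p.1 ≤ 1 * 𝒯.L p.1 := by gcongr
    _ ≤ 𝒯.Λ := by linarith

lemma isOpen_Γ_prod : IsOpen (𝒯.Γ ×ˢ (univ : Set ℝ)) := 𝒯.param_in.isOpen.prod isOpen_univ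

lemma contDiffOn_S : ContDiffOn ℝ 1 𝒯.S (𝒯.Γ ×ˢ univ) := by
  have h1 : ContDiffOn ℝ 1 (fun p : E m × ℝ => 𝒯.L p.1) (𝒯.Γ ×ˢ univ) :=
    𝒯.contDiffOn_L.comp contDiff_fst.contDiffOn fun p hp => hp.1
  exact contDiff_fst.contDiffOn.prodMk (h1.prodMk (contDiff_snd.contDiffOn.mul h1))

lemma contDiffOn_comp_S {G : Type*} [NormedAddCommGroup G] [NormedSpace ℝ G]
    {F : E m × ℝ × ℝ → G} (hF : ContDiff ℝ 1 F) :
    ContDiffOn ℝ 1 (fun p => F (𝒯.S p)) (𝒯.Γ ×ˢ univ) :=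
  hF.comp_contDiffOn 𝒯.contDiffOn_S

lemma exists_bound_comp_S {G : Type*} [NormedAddCommGroup G] {F : E m × ℝ × ℝ → G}
    (hF : Continuous F) : ∃ C, 0 ≤ C ∧ ∀ p ∈ 𝒯.Γ ×ˢ Icc (0 : ℝ) 1, ‖F (𝒯.S p)‖ ≤ C := by
  have hK : IsCompact (closure 𝒯.Γ ×ˢ Icc 0 𝒯.Λ ×ˢ Icc 0 𝒯.Λ) :=
    𝒯.param_in.isCompact_closure.prod (isCompact_Icc.prod isCompact_Icc)
  obtain ⟨C, hC⟩ := hK.exists_bound_of_continuousOn hF.continuousOn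
  exact ⟨|C|, abs_nonneg _, fun p hp => (hC _ (𝒯.S_mem hp)).trans (le_abs_self C)⟩

lemma exists_fderiv_comp_S_le {G : Type*} [NormedAddCommGroup G] [NormedSpace ℝ G]
    {F : E m × ℝ × ℝ → G} (hF : ContDiff ℝ 1 F) :
    ∃ C, 0 ≤ C ∧ ∀ p ∈ 𝒯.Γ ×ˢ Icc (0 : ℝ) 1, ‖fderiv ℝ (fun p => F (𝒯.S p)) p‖ ≤ C := by
  obtain ⟨C, hC0, hC⟩ := 𝒯.exists_bound_comp_S (hF.continuous_fderiv one_ne_zero)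
  obtain ⟨C', hC0', hC'⟩ := 𝒯.exists_fderiv_L_le
  refine ⟨C * (1 + C' + 𝒯.Λ), mul_nonneg hC0 (by linarith [𝒯.Λ_pos]), fun p hp => ?_⟩
  have hL : HasFDerivAt (fun p : E m × ℝ => 𝒯.L p.1) (fderiv ℝ 𝒯.L p.1 ∘L .fst ℝ (E m) ℝ) p :=
    (𝒯.hasFDerivAt_L hp.1).comp p hasFDerivAt_fst
  have hS : HasFDerivAt 𝒯.S _ p :=
    hasFDerivAt_fst.prodMk (hL.prodMk (hasFDerivAt_snd.mul hL))
  have h1 : HasFDerivAt (fun p => F (𝒯.S p)) _ p :=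
    (hF.differentiable one_ne_zero (𝒯.S p)).hasFDerivAt.comp p hS
  rw [h1.fderiv]
  refine (ContinuousLinearMap.opNorm_comp_le _ _).trans (mul_le_mul (hC p hp) ?_ (norm_nonneg _) hC0)
  refine ContinuousLinearMap.opNorm_le_bound _ (by linarith [𝒯.Λ_pos]) fun q => ?_
  have hq1 : ‖q.1‖ ≤ ‖q‖ := norm_fst_le q
  have hq2 : ‖q.2‖ ≤ ‖q‖ := norm_snd_le q
  have hΛ := 𝒯.Λ_pos
  have hq3 : |fderiv ℝ 𝒯.L p.1 q.1| ≤ C' * ‖q‖ :=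
    (ContinuousLinearMap.le_opNorm _ _).trans (mul_le_mul (hC' _ hp.1) hq1 (norm_nonneg _) hC0')
  have h0 := norm_nonneg q
  have hp2 : |p.2| ≤ 1 := abs_le.2 ⟨by linarith [hp.2.1], hp.2.2⟩
  have hL2 : |𝒯.L p.1| ≤ 𝒯.Λ := by rw [abs_of_pos (𝒯.L_pos hp.1)]; exact 𝒯.L_le hp.1
  have hsum : |p.2 * fderiv ℝ 𝒯.L p.1 q.1 + 𝒯.L p.1 * q.2| ≤ C' * ‖q‖ + 𝒯.Λ * ‖q‖ := by
    refine (abs_add_le _ _).trans ?_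
    rw [abs_mul, abs_mul]
    have e1 : |p.2| * |fderiv ℝ 𝒯.L p.1 q.1| ≤ 1 * (C' * ‖q‖) :=
      mul_le_mul hp2 hq3 (abs_nonneg _) zero_le_one
    have e2 : |𝒯.L p.1| * |q.2| ≤ 𝒯.Λ * ‖q‖ := mul_le_mul hL2 hq2 (abs_nonneg _) hΛ.le
    linarith
  rw [Prod.norm_def, Prod.norm_def]
  refine max_le ?_ (max_le ?_ ?_)
  · change ‖q.1‖ ≤ _
    nlinarith
  · change |fderiv ℝ 𝒯.L p.1 q.1| ≤ _
    nlinarith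
  · change |p.2 * fderiv ℝ 𝒯.L p.1 q.1 + 𝒯.L p.1 * q.2| ≤ _
    nlinarith

lemma contDiff_Y_aux : ContDiff ℝ 1 (fun q : E m × ℝ × ℝ => 𝒯.X (q.1, q.2.2)) :=
  𝒯.contDiff_X.comp (contDiff_fst.prodMk (contDiff_snd.comp contDiff_snd))

lemma contDiff_w_aux : ContDiff ℝ 1
    (fun q : E m × ℝ × ℝ => q.2.1 * 𝒯.κ q.1 * Real.exp (𝒯.z (𝒯.h q.1, q.2.2))) := by
  have h1 : ContDiff ℝ 1 (fun q : E m × ℝ × ℝ => 𝒯.z (𝒯.h q.1, q.2.2)) :=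
    𝒯.contDiff_z.comp (((𝒯.param_in.contDiff.of_le (by norm_num)).comp contDiff_fst).prodMk
      (contDiff_snd.comp contDiff_snd))
  exact ((contDiff_fst.comp contDiff_snd).mul (𝒯.contDiff_κ.comp contDiff_fst)).mul h1.exp

lemma contDiffOn_Y : ContDiffOn ℝ 1 𝒯.Y (𝒯.Γ ×ˢ univ) := 𝒯.contDiffOn_comp_S 𝒯.contDiff_Y_aux

lemma contDiffOn_w : ContDiffOn ℝ 1 𝒯.w (𝒯.Γ ×ˢ univ) := 𝒯.contDiffOn_comp_S 𝒯.contDiff_w_aux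

lemma exists_fderiv_Y_le : ∃ C, 0 ≤ C ∧ ∀ p ∈ 𝒯.Γ ×ˢ Icc (0 : ℝ) 1, ‖fderiv ℝ 𝒯.Y p‖ ≤ C :=
  𝒯.exists_fderiv_comp_S_le 𝒯.contDiff_Y_aux

lemma exists_fderiv_w_le : ∃ C, 0 ≤ C ∧ ∀ p ∈ 𝒯.Γ ×ˢ Icc (0 : ℝ) 1, ‖fderiv ℝ 𝒯.w p‖ ≤ C :=
  𝒯.exists_fderiv_comp_S_le 𝒯.contDiff_w_aux

lemma exists_w_le : ∃ C, 0 ≤ C ∧ ∀ p ∈ 𝒯.Γ ×ˢ Icc (0 : ℝ) 1, 𝒯.w p ≤ C := by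
  obtain ⟨C, h0, hC⟩ := 𝒯.exists_bound_comp_S 𝒯.contDiff_w_aux.continuous
  exact ⟨C, h0, fun p hp => (le_abs_self _).trans (hC p hp)⟩

lemma w_pos {p : E m × ℝ} (hp : p.1 ∈ 𝒯.Γ) : 0 < 𝒯.w p :=
  mul_pos (mul_pos (𝒯.L_pos hp) (𝒯.κ_pos (subset_closure hp))) (Real.exp_pos _)

lemma exists_le_w : ∃ c > 0, ∀ p ∈ 𝒯.Γ ×ˢ Icc (0 : ℝ) 1, c ≤ 𝒯.w p := by
  obtain ⟨c, hc, hL⟩ := 𝒯.exists_L_ge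
  obtain ⟨c', hc', hκ⟩ := 𝒯.param_in.isCompact_closure.exists_forall_le'
    𝒯.contDiff_κ.continuous.continuousOn (fun ξ hξ => 𝒯.κ_pos hξ)
  obtain ⟨C, -, hC⟩ := 𝒯.exists_bound_comp_S (F := fun q => 𝒯.z (𝒯.h q.1, q.2.2))
    (𝒯.contDiff_z.continuous.comp ((𝒯.param_in.contDiff.continuous.comp continuous_fst).prodMk
      (continuous_snd.comp continuous_snd)))
  refine ⟨c * c' * Real.exp (-C), by positivity, fun p hp => ?_⟩
  have h1 := hL _ hp.1
  have h2 := hκ _ (subset_closure hp.1)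
  have h3 := (abs_le.1 (hC p hp)).1
  have h4 : Real.exp (-C) ≤ Real.exp (𝒯.z (𝒯.h p.1, p.2 * 𝒯.L p.1)) := Real.exp_le_exp.2 h3
  exact mul_le_mul (mul_le_mul h1 h2 hc'.le (hc.le.trans h1)) h4 (Real.exp_pos _).le
    (mul_nonneg (hc.le.trans h1) (hc'.le.trans h2))

lemma hasDerivAt_Y (ξ : E m) (s : ℝ) :
    HasDerivAt (fun s => 𝒯.Y (ξ, s)) (𝒯.L ξ • 𝒯.v (𝒯.Y (ξ, s))) s :=
  (𝒯.hasDerivAt_X ξ (s * 𝒯.L ξ)).scomp_of_eq s (hasDerivAt_mul_const (𝒯.L ξ)) rfl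

lemma hasDerivAt_w (ξ : E m) (s : ℝ) :
    HasDerivAt (fun s => 𝒯.w (ξ, s)) (𝒯.L ξ * divergence 𝒯.v (𝒯.Y (ξ, s)) * 𝒯.w (ξ, s)) s := by
  have h1 : HasDerivAt (fun s => 𝒯.z (𝒯.h ξ, s * 𝒯.L ξ)) _ s :=
    (𝒯.hasDerivAt_z (𝒯.h ξ) (s * 𝒯.L ξ)).scomp_of_eq s (hasDerivAt_mul_const (𝒯.L ξ)) rfl
  refine (h1.exp.const_mul (𝒯.L ξ * 𝒯.κ ξ)).congr_deriv ?_
  change _ = 𝒯.L ξ * divergence 𝒯.v (𝒯.Φ (𝒯.h ξ, s * 𝒯.L ξ)) *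
    (𝒯.L ξ * 𝒯.κ ξ * Real.exp (𝒯.z (𝒯.h ξ, s * 𝒯.L ξ)))
  rw [smul_eq_mul]
  ring

lemma Y_mem {p : E m × ℝ} (hp : p ∈ 𝒯.Γ ×ˢ Ioo (0 : ℝ) 1) : 𝒯.Y p ∈ Ω := by
  have h := 𝒯.L_pos hp.1
  exact 𝒯.X_mem hp.1 ⟨mul_pos hp.2.1 h, by nlinarith [hp.2.2]⟩

lemma Y_mem_closure {p : E m × ℝ} (hp : p ∈ 𝒯.Γ ×ˢ Icc (0 : ℝ) 1) : 𝒯.Y p ∈ closure Ω := by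
  have h := 𝒯.L_pos hp.1
  exact 𝒯.X_mem_closure hp.1 ⟨mul_nonneg hp.2.1 h.le, by nlinarith [hp.2.2]⟩

lemma Y_zero (ξ : E m) : 𝒯.Y (ξ, 0) = 𝒯.h ξ := by rw [Y, zero_mul, X_zero]

end TubeData

namespace TubeData
variable {m : ℕ} {Ω : Set (E (m + 1))} {b : E (m + 1) → E (m + 1)} (𝒯 : TubeData Ω b)

/-! ### The inverse coordinates -/

/-- The coordinates `(ξ, t)` of a point of `Ω`. -/
def coord (x : E (m + 1)) : E m × ℝ := Function.invFunOn 𝒯.X 𝒯.D x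

lemma coord_mem {x : E (m + 1)} (hx : x ∈ Ω) : 𝒯.coord x ∈ 𝒯.D := Function.invFunOn_mem (𝒯.exists_of_mem hx)

lemma X_coord {x : E (m + 1)} (hx : x ∈ Ω) : 𝒯.X (𝒯.coord x) = x :=
  Function.invFunOn_eq (𝒯.exists_of_mem hx)

lemma coord_X {p : E m × ℝ} (hp : p ∈ 𝒯.D) : 𝒯.coord (𝒯.X p) = p :=
  𝒯.injOn_X (𝒯.coord_mem (𝒯.X_mem_of_mem_D hp)) hp (𝒯.X_coord (𝒯.X_mem_of_mem_D hp))

/-- Near a closed field line issuing from `Γ`, the coordinates agree in `Ω` with a `C¹` function. -/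
lemma exists_coord_eq {ξ₀ : E m} (hξ₀ : ξ₀ ∈ 𝒯.Γ) {t₀ : ℝ} (ht₀ : t₀ ∈ Icc 0 (𝒯.L ξ₀)) :
    ∃ Z : E (m + 1) → E m × ℝ, ContDiffAt ℝ 1 Z (𝒯.X (ξ₀, t₀)) ∧ Z (𝒯.X (ξ₀, t₀)) = (ξ₀, t₀) ∧
      ∀ᶠ y in 𝓝 (𝒯.X (ξ₀, t₀)), 𝒯.X (Z y) = y ∧ (y ∈ Ω → Z y = 𝒯.coord y) := by
  obtain ⟨Z, h1, h2, h3⟩ := 𝒯.exists_localInverse hξ₀ ht₀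
  refine ⟨Z, h1, h2, ?_⟩
  filter_upwards [h3] with y h4
  refine ⟨h4.1, fun hy => ?_⟩
  rw [← 𝒯.coord_X (h4.2 hy), h4.1]

lemma contDiffAt_coord {x : E (m + 1)} (hx : x ∈ Ω) : ContDiffAt ℝ 1 𝒯.coord x := by
  obtain ⟨h1, h2⟩ := 𝒯.coord_mem hx
  obtain ⟨Z, h3, -, h5⟩ := 𝒯.exists_coord_eq h1 (Ioo_subset_Icc_self h2)
  rw [Prod.mk.eta, 𝒯.X_coord hx] at h3 h5
  refine h3.congr_of_eventuallyEq ?_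
  filter_upwards [h5, 𝒯.isOpen.mem_nhds hx] with y h6 h7 using (h6.2 h7).symm

lemma fderiv_X_fderiv_coord {x : E (m + 1)} (hx : x ∈ Ω) (u : E (m + 1)) :
    fderiv ℝ 𝒯.X (𝒯.coord x) (fderiv ℝ 𝒯.coord x u) = u := by
  have h1 : HasFDerivAt (fun y => 𝒯.X (𝒯.coord y)) _ x := (𝒯.hasFDerivAt_X (𝒯.coord x)).comp x
    ((𝒯.contDiffAt_coord hx).differentiableAt one_ne_zero).hasFDerivAt
  have h2 : (fun y => 𝒯.X (𝒯.coord y)) =ᶠ[𝓝 x] id := by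
    filter_upwards [𝒯.isOpen.mem_nhds hx] with y hy using 𝒯.X_coord hy
  have h3 := (h1.congr_of_eventuallyEq h2.symm).unique (hasFDerivAt_id x)
  exact congrArg (fun A : E (m + 1) →L[ℝ] E (m + 1) => A u) h3

/-- The initial point of the field line through `x`. -/
def ζ (x : E (m + 1)) : E m := (𝒯.coord x).1

/-- The second coordinate `s ∈ (0, 1)` of the point `x`. -/
def θ (x : E (m + 1)) : ℝ := (𝒯.coord x).2 / 𝒯.L (𝒯.ζ x)

lemma ζ_mem {x : E (m + 1)} (hx : x ∈ Ω) : 𝒯.ζ x ∈ 𝒯.Γ := (𝒯.coord_mem hx).1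

lemma θ_mem {x : E (m + 1)} (hx : x ∈ Ω) : 𝒯.θ x ∈ Ioo (0 : ℝ) 1 := by
  obtain ⟨h1, h2⟩ := 𝒯.coord_mem hx
  have h3 := 𝒯.L_pos h1
  exact ⟨div_pos h2.1 h3, (div_lt_one h3).2 h2.2⟩

lemma Y_ζ_θ {x : E (m + 1)} (hx : x ∈ Ω) : 𝒯.Y (𝒯.ζ x, 𝒯.θ x) = x := by
  have h3 := 𝒯.L_pos (𝒯.ζ_mem hx)
  rw [Y, θ]
  simp only
  rw [div_mul_cancel₀ _ h3.ne']
  exact 𝒯.X_coord hx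

lemma coord_Y {p : E m × ℝ} (hp : p ∈ 𝒯.Γ ×ˢ Ioo (0 : ℝ) 1) :
    𝒯.coord (𝒯.Y p) = (p.1, p.2 * 𝒯.L p.1) := by
  have h := 𝒯.L_pos hp.1
  exact 𝒯.coord_X ⟨hp.1, mul_pos hp.2.1 h, by nlinarith [hp.2.2]⟩

lemma ζ_Y {p : E m × ℝ} (hp : p ∈ 𝒯.Γ ×ˢ Ioo (0 : ℝ) 1) : 𝒯.ζ (𝒯.Y p) = p.1 := by
  rw [ζ, 𝒯.coord_Y hp]

lemma θ_Y {p : E m × ℝ} (hp : p ∈ 𝒯.Γ ×ˢ Ioo (0 : ℝ) 1) : 𝒯.θ (𝒯.Y p) = p.2 := by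
  rw [θ, 𝒯.ζ_Y hp, 𝒯.coord_Y hp]
  exact mul_div_cancel_right₀ _ (𝒯.L_pos hp.1).ne'

lemma contDiffAt_ζ {x : E (m + 1)} (hx : x ∈ Ω) : ContDiffAt ℝ 1 𝒯.ζ x :=
  contDiffAt_fst.comp x (𝒯.contDiffAt_coord hx)

lemma contDiffAt_θ {x : E (m + 1)} (hx : x ∈ Ω) : ContDiffAt ℝ 1 𝒯.θ x := by
  have h1 : ContDiffAt ℝ 1 (fun x => 𝒯.L (𝒯.ζ x)) x :=
    (𝒯.contDiffAt_L_and_eventually (𝒯.ζ_mem hx)).1.comp x (𝒯.contDiffAt_ζ hx)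
  exact (contDiffAt_snd.comp x (𝒯.contDiffAt_coord hx)).div h1 (𝒯.L_pos (𝒯.ζ_mem hx)).ne'

lemma fderiv_ζ {x : E (m + 1)} (hx : x ∈ Ω) (u : E (m + 1)) :
    fderiv ℝ 𝒯.ζ x u = (fderiv ℝ 𝒯.coord x u).1 := by
  have h1 : HasFDerivAt 𝒯.ζ _ x := hasFDerivAt_fst.comp x
    ((𝒯.contDiffAt_coord hx).differentiableAt one_ne_zero).hasFDerivAt
  rw [h1.fderiv]
  rfl

lemma exists_fderiv_ζ_le : ∃ C, 0 ≤ C ∧ ∀ x ∈ Ω, ‖fderiv ℝ 𝒯.ζ x‖ ≤ C := by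
  obtain ⟨c, hc, h⟩ := 𝒯.exists_le_fderiv_X
  refine ⟨c⁻¹, by positivity, fun x hx => ContinuousLinearMap.opNorm_le_bound _ (by positivity)
    fun u => ?_⟩
  obtain ⟨h1, h2⟩ := 𝒯.coord_mem hx
  have h3 := h _ h1 _ ⟨h2.1.le, h2.2.le.trans (𝒯.L_le h1)⟩ (fderiv ℝ 𝒯.coord x u)
  rw [Prod.mk.eta, 𝒯.fderiv_X_fderiv_coord hx] at h3
  rw [𝒯.fderiv_ζ hx, ← div_eq_inv_mul, le_div_iff₀ hc, mul_comm]
  exact (mul_le_mul_of_nonneg_left (norm_fst_le _) hc.le).trans h3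

/-- The initial point is constant along the field lines. -/
lemma fderiv_ζ_b {x : E (m + 1)} (hx : x ∈ Ω) : fderiv ℝ 𝒯.ζ x (b x) = 0 := by
  obtain ⟨h1, h2⟩ := 𝒯.coord_mem hx
  have h3 := 𝒯.fderiv_X_fderiv_coord hx (b x)
  have h4 := 𝒯.fderiv_X_snd (𝒯.coord x).1 (𝒯.coord x).2
  rw [Prod.mk.eta, 𝒯.X_coord hx, 𝒯.eqOn (subset_closure hx), ← h3] at h4
  have hi := 𝒯.param_in.injective_fderiv_flowOut 𝒯.isFlow 𝒯.lipschitz 𝒯.contDiff_Φ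
    (subset_closure h1) (𝒯.coord x).2
  have h5 : ((0 : E m), (1 : ℝ)) = fderiv ℝ 𝒯.coord x (b x) := hi h4
  rw [𝒯.fderiv_ζ hx, ← h5]

/-! ### Change of variables -/

lemma measurable_L : Measurable 𝒯.L := by
  classical
  have h1 : 𝒯.L = 𝒯.Γ.piecewise 𝒯.L (fun _ => 1) := by
    ext ξ
    by_cases hξ : ξ ∈ 𝒯.Γ
    · rw [piecewise_eq_of_mem _ _ _ hξ]
    · rw [piecewise_eq_of_notMem _ _ _ hξ, L, dif_neg hξ]
  rw [h1]
  exact 𝒯.contDiffOn_L.continuousOn.measurable_piecewise continuousOn_const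
    𝒯.param_in.isOpen.measurableSet

lemma measurable_S : Measurable 𝒯.S :=
  measurable_fst.prodMk ((𝒯.measurable_L.comp measurable_fst).prodMk
    (measurable_snd.mul (𝒯.measurable_L.comp measurable_fst)))

lemma measurable_Y : Measurable 𝒯.Y := 𝒯.contDiff_Y_aux.continuous.measurable.comp 𝒯.measurable_S

lemma measurable_w : Measurable 𝒯.w := 𝒯.contDiff_w_aux.continuous.measurable.comp 𝒯.measurable_S

/-- Lebesgue measure on `Γ × (0, 1)`. -/
def vol : Measure (E m × ℝ) :=
  ((volume : Measure (E m)).restrict 𝒯.Γ).prod ((volume : Measure ℝ).restrict (Ioo 0 1))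

instance : IsFiniteMeasure ((volume : Measure (E m)).restrict 𝒯.Γ) :=
  ⟨by rw [Measure.restrict_apply_univ]; exact 𝒯.param_in.isBounded.measure_lt_top⟩

instance : IsProbabilityMeasure ((volume : Measure ℝ).restrict (Ioo 0 1)) :=
  ⟨by rw [Measure.restrict_apply_univ]; simp⟩

instance : IsFiniteMeasure 𝒯.vol := by unfold vol; infer_instance

lemma vol_eq : 𝒯.vol = ((volume : Measure (E m)).prod (volume : Measure ℝ)).restrict
    (𝒯.Γ ×ˢ Ioo (0 : ℝ) 1) := Measure.prod_restrict _ _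

lemma measurableSet_cyl : MeasurableSet (𝒯.Γ ×ˢ Ioo (0 : ℝ) 1) :=
  𝒯.param_in.isOpen.measurableSet.prod measurableSet_Ioo

lemma ae_vol_mem : ∀ᵐ p ∂𝒯.vol, p ∈ 𝒯.Γ ×ˢ Ioo (0 : ℝ) 1 := by
  rw [vol_eq]; exact ae_restrict_mem 𝒯.measurableSet_cyl

/-- The substitution `t = s L ξ` on each fibre turns `D` into the cylinder `Γ × (0, 1)`. -/
lemma lintegral_eq_vol {f : E (m + 1) → ℝ≥0∞} (hf : Measurable f) :
    ∫⁻ x in Ω, f x = ∫⁻ p, ENNReal.ofReal (𝒯.w p) * f (𝒯.Y p) ∂𝒯.vol := by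
  rw [𝒯.lintegral_eq f]
  set G : E m × ℝ → ℝ≥0∞ := fun p =>
    ENNReal.ofReal (𝒯.κ p.1 * Real.exp (𝒯.z (𝒯.h p.1, p.2))) * f (𝒯.X p) with hG
  have hGm : Measurable G := by
    have h1 : Continuous fun p : E m × ℝ => 𝒯.κ p.1 * Real.exp (𝒯.z (𝒯.h p.1, p.2)) :=
      (𝒯.contDiff_κ.continuous.comp continuous_fst).mul (Real.continuous_exp.comp
        (𝒯.contDiff_z.continuous.comp ((𝒯.param_in.contDiff.continuous.comp continuous_fst).prodMk
          continuous_snd)))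
    exact h1.measurable.ennreal_ofReal.mul (hf.comp 𝒯.contDiff_X.continuous.measurable)
  rw [← lintegral_indicator 𝒯.isOpen_D.measurableSet, lintegral_prod _
    (hGm.indicator 𝒯.isOpen_D.measurableSet).aemeasurable, vol,
    lintegral_prod (fun p => ENNReal.ofReal (𝒯.w p) * f (𝒯.Y p))
    ((𝒯.measurable_w.ennreal_ofReal.mul (hf.comp 𝒯.measurable_Y)).aemeasurable),
    ← lintegral_indicator 𝒯.param_in.isOpen.measurableSet]
  refine lintegral_congr fun ξ => ?_
  by_cases hξ : ξ ∈ 𝒯.Γ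
  · rw [indicator_of_mem hξ]
    have hL := 𝒯.L_pos hξ
    have h1 : ∀ t, 𝒯.D.indicator G (ξ, t) = (Ioo 0 (𝒯.L ξ)).indicator (fun t => G (ξ, t)) t := by
      intro t
      by_cases ht : t ∈ Ioo 0 (𝒯.L ξ)
      · rw [indicator_of_mem ht, indicator_of_mem (show (ξ, t) ∈ 𝒯.D from ⟨hξ, ht⟩)]
      · rw [indicator_of_notMem ht, indicator_of_notMem (fun h : (ξ, t) ∈ 𝒯.D => ht h.2)]
    simp_rw [h1]
    rw [lintegral_indicator measurableSet_Ioo]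
    have h2 : (fun s : ℝ => s * 𝒯.L ξ) '' Ioo 0 1 = Ioo 0 (𝒯.L ξ) := by
      rw [image_mul_right_Ioo _ _ hL]; simp
    rw [← h2, lintegral_image_eq_lintegral_abs_deriv_mul measurableSet_Ioo
      (fun s _ => (hasDerivAt_mul_const (𝒯.L ξ)).hasDerivWithinAt)
      (mul_left_injective₀ hL.ne').injOn]
    refine lintegral_congr fun s => ?_
    rw [abs_of_pos hL, hG]
    simp only
    rw [← mul_assoc, ← ENNReal.ofReal_mul hL.le, ← mul_assoc]
    rfl
  · rw [indicator_of_notMem hξ]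
    have h1 : ∀ t, 𝒯.D.indicator G (ξ, t) = 0 := fun t =>
      indicator_of_notMem (fun h : (ξ, t) ∈ 𝒯.D => hξ h.1) _
    simp [h1]

lemma map_Y : (𝒯.vol.withDensity fun p => ENNReal.ofReal (𝒯.w p)).map 𝒯.Y = volume.restrict Ω := by
  refine Measure.ext_of_lintegral _ fun f hf => ?_
  rw [𝒯.lintegral_eq_vol hf, lintegral_map hf 𝒯.measurable_Y]
  exact lintegral_withDensity_eq_lintegral_mul _ 𝒯.measurable_w.ennreal_ofReal
    (hf.comp 𝒯.measurable_Y)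

lemma quasiMeasurePreserving_Y :
    Measure.QuasiMeasurePreserving 𝒯.Y 𝒯.vol (volume.restrict Ω) := by
  refine ⟨𝒯.measurable_Y, ?_⟩
  rw [← 𝒯.map_Y]
  refine Measure.AbsolutelyContinuous.map ?_ 𝒯.measurable_Y
  refine withDensity_absolutelyContinuous' 𝒯.measurable_w.ennreal_ofReal.aemeasurable ?_
  filter_upwards [𝒯.ae_vol_mem] with p hp
  exact (ENNReal.ofReal_pos.2 (𝒯.w_pos hp.1)).ne'

lemma integral_eq_vol {F : Type*} [NormedAddCommGroup F] [NormedSpace ℝ F] {f : E (m + 1) → F}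
    (hf : AEStronglyMeasurable f (volume.restrict Ω)) :
    ∫ x in Ω, f x = ∫ p, 𝒯.w p • f (𝒯.Y p) ∂𝒯.vol := by
  rw [← 𝒯.map_Y, integral_map 𝒯.measurable_Y.aemeasurable (by rwa [𝒯.map_Y])]
  have h1 : (fun p => ENNReal.ofReal (𝒯.w p)) = fun p => ((𝒯.w p).toNNReal : ℝ≥0∞) := rfl
  rw [h1, integral_withDensity_eq_integral_smul 𝒯.measurable_w.real_toNNReal]
  refine integral_congr_ae ?_
  filter_upwards [𝒯.ae_vol_mem] with p hp
  rw [NNReal.smul_def, Real.coe_toNNReal _ (𝒯.w_pos hp.1).le]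

/-- The `L²` norms on `Ω` and in the coordinates are equivalent. -/
lemma exists_eLpNorm_le_vol : ∃ C : ℝ≥0, ∀ {F : Type} [NormedAddCommGroup F] (f : E (m + 1) → F),
    AEStronglyMeasurable f (volume.restrict Ω) →
    eLpNorm f 2 (volume.restrict Ω) ≤ C * eLpNorm (fun p => f (𝒯.Y p)) 2 𝒯.vol := by
  obtain ⟨C, hC0, hC⟩ := 𝒯.exists_w_le
  refine ⟨NNReal.sqrt C.toNNReal, fun f hf => ?_⟩
  have hle : (𝒯.vol.withDensity fun p => ENNReal.ofReal (𝒯.w p)) ≤ (C.toNNReal : ℝ≥0∞) • 𝒯.vol := by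
    rw [← withDensity_const]
    refine withDensity_mono ?_
    filter_upwards [𝒯.ae_vol_mem] with p hp
    exact ENNReal.ofReal_le_ofReal (hC p ⟨hp.1, Ioo_subset_Icc_self hp.2⟩)
  rw [← 𝒯.map_Y, eLpNorm_map_measure (by rwa [𝒯.map_Y]) 𝒯.measurable_Y.aemeasurable]
  refine (eLpNorm_mono_measure _ hle).trans ?_
  rw [eLpNorm_smul_measure_of_ne_top (by norm_num), smul_eq_mul]
  refine le_of_eq ?_
  congr 1
  rw [NNReal.sqrt_eq_rpow, ENNReal.coe_rpow_of_nonneg _ (by norm_num)]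
  norm_num

lemma exists_eLpNorm_vol_le : ∃ C : ℝ≥0, ∀ {F : Type} [NormedAddCommGroup F] (f : E (m + 1) → F),
    AEStronglyMeasurable f (volume.restrict Ω) →
    eLpNorm (fun p => f (𝒯.Y p)) 2 𝒯.vol ≤ C * eLpNorm f 2 (volume.restrict Ω) := by
  obtain ⟨c, hc0, hc⟩ := 𝒯.exists_le_w
  refine ⟨NNReal.sqrt c⁻¹.toNNReal, fun f hf => ?_⟩
  have hle : 𝒯.vol ≤ (c⁻¹.toNNReal : ℝ≥0∞) • 𝒯.vol.withDensity fun p => ENNReal.ofReal (𝒯.w p) := by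
    rw [← withDensity_smul _ 𝒯.measurable_w.ennreal_ofReal]
    conv_lhs => rw [← withDensity_one (μ := 𝒯.vol)]
    refine withDensity_mono ?_
    filter_upwards [𝒯.ae_vol_mem] with p hp
    have h1 := hc p ⟨hp.1, Ioo_subset_Icc_self hp.2⟩
    change (1 : ℝ≥0∞) ≤ ENNReal.ofReal c⁻¹ * ENNReal.ofReal (𝒯.w p)
    rw [← ENNReal.ofReal_mul (by positivity), ← ENNReal.ofReal_one]
    refine ENNReal.ofReal_le_ofReal ?_
    rw [← div_eq_inv_mul, le_div_iff₀ hc0]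
    linarith
  refine (eLpNorm_mono_measure _ hle).trans ?_
  rw [eLpNorm_smul_measure_of_ne_top (by norm_num), smul_eq_mul]
  refine le_of_eq ?_
  conv_rhs => rw [← 𝒯.map_Y, eLpNorm_map_measure (by rwa [𝒯.map_Y]) 𝒯.measurable_Y.aemeasurable]
  refine congrArg₂ _ ?_ rfl
  rw [NNReal.sqrt_eq_rpow, ENNReal.coe_rpow_of_nonneg _ (by norm_num)]
  norm_num

end TubeData

namespace TubeData
variable {m : ℕ} {Ω : Set (E (m + 1))} {b : E (m + 1) → E (m + 1)} (𝒯 : TubeData Ω b)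

/-! ### The lateral boundary -/

/-- Field lines starting near the edge of the inflow boundary stay near the closure of the tangential
boundary: a limit of points `X (ξ k, t)` with `ξ k → ξ ∉ Γ` lies in `closure Ω` but not in `Ω`, and
the orbit of `h ξ` meets the closures of the two transversal pieces at isolated times only. -/
lemma X_mem_closure_tangentialBdry {ι : Type*} {l : Filter ι} [l.NeBot] {ξ : ι → E m} {ξ₀ : E m}
    {ℓ t : ℝ} (hξ : ∀ k, ξ k ∈ 𝒯.Γ) (hlim : Tendsto ξ l (𝓝 ξ₀)) (hξ₀ : ξ₀ ∉ 𝒯.Γ)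
    (hL : Tendsto (fun k => 𝒯.L (ξ k)) l (𝓝 ℓ)) (ht : t ∈ Icc 0 ℓ) :
    𝒯.X (ξ₀, t) ∈ closure (tangentialBdry Ω b) := by
  obtain ⟨c, hc, hcL⟩ := 𝒯.exists_L_ge
  have hℓ : 0 < ℓ := hc.trans_le (ge_of_tendsto hL (Eventually.of_forall fun k => hcL _ (hξ k)))
  have hXlim : ∀ t, Tendsto (fun k => 𝒯.X (ξ k, t)) l (𝓝 (𝒯.X (ξ₀, t))) := fun t =>
    (𝒯.contDiff_X.continuous.tendsto (ξ₀, t)).comp (hlim.prodMk_nhds tendsto_const_nhds)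
  have hev : ∀ t ∈ Ioo 0 ℓ, ∀ᶠ k in l, (ξ k, t) ∈ 𝒯.D := fun t ht => by
    filter_upwards [hL.eventually_const_lt ht.2] with k hk using ⟨hξ k, ht.1, hk⟩
  -- a limit in `Ω` would have coordinates, whose first component would be the limit `ξ₀`
  have hfr : ∀ t ∈ Ioo 0 ℓ, 𝒯.X (ξ₀, t) ∈ frontier Ω := by
    intro t ht
    rw [𝒯.isOpen.frontier_eq]
    refine ⟨mem_closure_of_tendsto (hXlim t) ((hev t ht).mono fun k hk => 𝒯.X_mem_of_mem_D hk),
      fun hmem => hξ₀ ?_⟩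
    have h1 : Tendsto (fun k => 𝒯.coord (𝒯.X (ξ k, t))) l (𝓝 (𝒯.coord (𝒯.X (ξ₀, t)))) :=
      (𝒯.contDiffAt_coord hmem).continuousAt.tendsto.comp (hXlim t)
    have h2 : Tendsto (fun k => (ξ k, t)) l (𝓝 (𝒯.coord (𝒯.X (ξ₀, t)))) :=
      h1.congr' ((hev t ht).mono fun k hk => 𝒯.coord_X hk)
    have h3 : ξ₀ = (𝒯.coord (𝒯.X (ξ₀, t))).1 :=
      tendsto_nhds_unique hlim ((continuous_fst.tendsto _).comp h2)
    rw [h3]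
    exact (𝒯.coord_mem hmem).1
  have hcl : ∀ {S : Set (E (m + 1))} {Γ : Set (E m)} {h n : E m → E (m + 1)} {α : ℝ},
      IsParam Ω S 𝒯.v Γ h n α → closure S ⊆ h '' closure Γ := by
    intro S Γ h n α hp
    refine closure_minimal ?_ (hp.isCompact_closure.image hp.contDiff.continuous).isClosed
    rw [← hp.image_eq]
    exact image_mono subset_closure
  have key : ∀ t ∈ Ioo 0 ℓ, 𝒯.X (ξ₀, t) ∈ closure (tangentialBdry Ω b) := by
    intro t ht
    have h1 : ∀ᶠ σ in 𝓝[≠] (0 : ℝ), 𝒯.X (ξ₀, t + σ) ∈ closure (tangentialBdry Ω b) := by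
      have h2 : ∀ᶠ σ in 𝓝[≠] (0 : ℝ), t + σ ∈ Ioo 0 ℓ := by
        refine nhdsWithin_le_nhds ?_
        have : Tendsto (fun σ => t + σ) (𝓝 (0 : ℝ)) (𝓝 t) := by
          have := (continuous_const_add t).tendsto 0
          rwa [add_zero] at this
        exact this (isOpen_Ioo.mem_nhds ht)
      filter_upwards [h2, 𝒯.param_in.eventually_notMem_image 𝒯.isFlow 𝒯.lipschitz 𝒯.contDiff_Φ
        (𝒯.X (ξ₀, t)), 𝒯.param_out.eventually_notMem_image 𝒯.isFlow 𝒯.lipschitz 𝒯.contDiff_Φ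
        (𝒯.X (ξ₀, t))] with σ h3 h4 h5
      have h6 := hfr _ h3
      rw [𝒯.frontier_eq, X_add] at h6
      rw [X_add]
      rcases h6 with (h6 | h6) | h6
      · exact h6
      · exact absurd (hcl 𝒯.param_in h6) h4
      · exact absurd (hcl 𝒯.param_out h6) h5
    have h2 : Tendsto (fun σ => 𝒯.X (ξ₀, t + σ)) (𝓝[≠] (0 : ℝ)) (𝓝 (𝒯.X (ξ₀, t))) := by
      have : Continuous fun σ : ℝ => 𝒯.X (ξ₀, t + σ) :=
        𝒯.contDiff_X.continuous.comp (by fun_prop)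
      have := this.tendsto 0
      rw [add_zero] at this
      exact this.mono_left nhdsWithin_le_nhds
    exact isClosed_closure.mem_of_tendsto h2 h1
  have hclosed : IsClosed {t : ℝ | 𝒯.X (ξ₀, t) ∈ closure (tangentialBdry Ω b)} :=
    isClosed_closure.preimage (𝒯.contDiff_X.continuous.comp (by fun_prop))
  have := closure_minimal (s := Ioo 0 ℓ) key hclosed
  rw [closure_Ioo hℓ.ne] at this
  exact this ht

/-- A continuous function which vanishes on the tangential boundary is small along the field lines
which start outside a suitable compact subset of `Γ`. -/
lemma exists_isCompact_of_eqOn_zero {φ : E (m + 1) → ℝ} (hφ : Continuous φ)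
    (h0 : ∀ x ∈ tangentialBdry Ω b, φ x = 0) {ε : ℝ} (hε : 0 < ε) :
    ∃ K ⊆ 𝒯.Γ, IsCompact K ∧ ∀ ξ ∈ 𝒯.Γ, ξ ∉ K → ∀ s ∈ Icc (0 : ℝ) 1, |φ (𝒯.Y (ξ, s))| ≤ ε := by
  set A : Set (E m) := {ξ | ξ ∈ 𝒯.Γ ∧ ∃ s ∈ Icc (0 : ℝ) 1, ε ≤ |φ (𝒯.Y (ξ, s))|} with hA
  refine ⟨closure A, fun ξ₀ hξ₀ => ?_, ?_, fun ξ hξ hξK s hs => ?_⟩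
  · by_contra hξΓ
    obtain ⟨ξ, hξ, hlim⟩ := mem_closure_iff_seq_limit.1 hξ₀
    choose s hs hεs using fun k => (hξ k).2
    obtain ⟨⟨s₀, ℓ⟩, ⟨hs₀, hℓ⟩, ψ, hψ, hlim2⟩ := (isCompact_Icc.prod isCompact_Icc).tendsto_subseq
      (x := fun k => (s k, 𝒯.L (ξ k))) (s := Icc (0 : ℝ) 1 ×ˢ Icc 0 𝒯.Λ)
      fun k => ⟨hs k, (𝒯.L_pos (hξ k).1).le, 𝒯.L_le (hξ k).1⟩
    have hs2 : Tendsto (fun k => s (ψ k)) atTop (𝓝 s₀) := (continuous_fst.tendsto _).comp hlim2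
    have hL2 : Tendsto (fun k => 𝒯.L (ξ (ψ k))) atTop (𝓝 ℓ) := (continuous_snd.tendsto _).comp hlim2
    have hξ2 : Tendsto (fun k => ξ (ψ k)) atTop (𝓝 ξ₀) := hlim.comp hψ.tendsto_atTop
    have h1 := 𝒯.X_mem_closure_tangentialBdry (fun k => (hξ (ψ k)).1) hξ2 hξΓ hL2
      (t := s₀ * ℓ) ⟨mul_nonneg hs₀.1 hℓ.1, by nlinarith [hs₀.2, hℓ.1]⟩
    have h2 : φ (𝒯.X (ξ₀, s₀ * ℓ)) = 0 := by
      have : IsClosed {x | φ x = 0} := isClosed_eq hφ continuous_const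
      exact closure_minimal h0 this h1
    have h3 : Tendsto (fun k => |φ (𝒯.Y (ξ (ψ k), s (ψ k)))|) atTop (𝓝 |φ (𝒯.X (ξ₀, s₀ * ℓ))|) := by
      have hc : Continuous fun p => |φ (𝒯.X p)| := (hφ.comp 𝒯.contDiff_X.continuous).abs
      exact (hc.tendsto (ξ₀, s₀ * ℓ)).comp (hξ2.prodMk_nhds (hs2.mul hL2))
    have h4 := ge_of_tendsto h3 (Eventually.of_forall fun k => hεs (ψ k))
    rw [h2, abs_zero] at h4
    linarith
  · exact (𝒯.param_in.isBounded.subset fun ξ hξ => hξ.1).isCompact_closure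
  · by_contra hcon
    exact hξK (subset_closure ⟨hξ, s, hs, (not_le.1 hcon).le⟩)

/-! ### Extension of functions given in coordinates -/

lemma continuous_Y_slice (ξ : E m) : Continuous fun s : ℝ => 𝒯.Y (ξ, s) :=
  𝒯.contDiff_X.continuous.comp (by fun_prop : Continuous fun s : ℝ => (ξ, s * 𝒯.L ξ))

/-- A `C¹` function of the coordinates `(ξ, s)` whose support lies over a compact subset of `Γ` comes
from a `C¹` function on the whole space which vanishes on the tangential boundary. It is glued from
local extensions by a partition of unity; the prescribed values form a convex condition. -/
lemma exists_extension {F : E m × ℝ → ℝ} (hF : ContDiffOn ℝ 1 F (𝒯.Γ ×ˢ univ)) {K : Set (E m)}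
    (hK : IsCompact K) (hKΓ : K ⊆ 𝒯.Γ) (hF0 : ∀ ξ ∈ 𝒯.Γ, ξ ∉ K → ∀ s, F (ξ, s) = 0) :
    ∃ φ : E (m + 1) → ℝ, ContDiff ℝ 1 φ ∧ (∀ x ∈ tangentialBdry Ω b, φ x = 0) ∧
      ∀ ξ ∈ 𝒯.Γ, ∀ s ∈ Icc (0 : ℝ) 1, φ (𝒯.Y (ξ, s)) = F (ξ, s) := by
  classical
  set f : E (m + 1) → ℝ := fun x => F (𝒯.ζ x, 𝒯.θ x) with hf
  -- the values allowed at `x`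
  set t : E (m + 1) → Set ℝ := fun x =>
    {r | (x ∈ Ω → r = f x) ∧ (x ∈ tangentialBdry Ω b → r = 0)} with ht
  have hconv : ∀ x, Convex ℝ (t x) := by
    intro x r hr r' hr' a a' ha ha' haa
    refine ⟨fun hx => ?_, fun hx => ?_⟩
    · rw [hr.1 hx, hr'.1 hx, ← add_smul, haa, one_smul]
    · rw [hr.2 hx, hr'.2 hx]; simp
  have hCK : IsCompact (𝒯.Y '' (K ×ˢ Icc (0 : ℝ) 1)) := by
    refine (hK.prod isCompact_Icc).image_of_continuousOn (𝒯.contDiffOn_Y.continuousOn.mono ?_)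
    exact prod_mono hKΓ (subset_univ _)
  have hloc : ∀ x : E (m + 1), ∃ U ∈ 𝓝 x, ∃ g : E (m + 1) → ℝ, ContDiffOn ℝ 1 g U ∧
      ∀ y ∈ U, g y ∈ t y := by
    intro x
    by_cases hx : x ∈ 𝒯.Y '' (K ×ˢ Icc (0 : ℝ) 1)
    · obtain ⟨⟨ξ₀, s₀⟩, ⟨hξK, hs₀⟩, rfl⟩ := hx
      simp only at hξK hs₀
      have hξ₀ := hKΓ hξK
      have hL0 := 𝒯.L_pos hξ₀
      have ht₀ : s₀ * 𝒯.L ξ₀ ∈ Icc 0 (𝒯.L ξ₀) :=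
        ⟨mul_nonneg hs₀.1 hL0.le, by nlinarith [hs₀.2]⟩
      obtain ⟨Z, hZ1, hZ2, hZ3⟩ := 𝒯.exists_coord_eq hξ₀ ht₀
      change ∃ U ∈ 𝓝 (𝒯.X (ξ₀, s₀ * 𝒯.L ξ₀)), _
      set x₀ := 𝒯.X (ξ₀, s₀ * 𝒯.L ξ₀) with hx₀
      set g : E (m + 1) → ℝ := fun y => F ((Z y).1, (Z y).2 / 𝒯.L (Z y).1) with hg
      have hgc : ContDiffAt ℝ 1 g x₀ := by
        have h1 : ContDiffAt ℝ 1 (fun y => (Z y).1) x₀ := contDiffAt_fst.comp x₀ hZ1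
        have hZ1' : (Z x₀).1 = ξ₀ := by rw [hZ2]
        have h2 : ContDiffAt ℝ 1 (fun y => 𝒯.L (Z y).1) x₀ := by
          refine ContDiffAt.comp (g := 𝒯.L) x₀ ?_ h1
          rw [hZ1']
          exact (𝒯.contDiffAt_L_and_eventually hξ₀).1
        have h3 : ContDiffAt ℝ 1 (fun y => (Z y).2 / 𝒯.L (Z y).1) x₀ := by
          refine (contDiffAt_snd.comp x₀ hZ1).div h2 ?_
          rw [hZ1']
          exact hL0.ne'
        refine ContDiffAt.comp (g := F) x₀ ?_ (h1.prodMk h3)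
        refine hF.contDiffAt (𝒯.isOpen_Γ_prod.mem_nhds ⟨?_, mem_univ _⟩)
        rwa [hZ1']
      obtain ⟨U, hU, hgU⟩ := hgc.contDiffOn (m := 1) le_rfl (by simp)
      have hfst : ∀ᶠ y in 𝓝 x₀, (Z y).1 ∈ 𝒯.Γ := by
        have h1 : Tendsto (fun y => (Z y).1) (𝓝 x₀) (𝓝 (Z x₀).1) :=
          ((continuous_fst.tendsto _).comp hZ1.continuousAt.tendsto)
        rw [hZ2] at h1
        exact h1 (𝒯.param_in.isOpen.mem_nhds hξ₀)
      have hcontZ : ∀ᶠ y in 𝓝 x₀, ContinuousAt Z y := by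
        filter_upwards [hZ1.eventually (by simp)] with y hy using hy.continuousAt
      -- near `x₀` there are no points of the tangential boundary
      have hnot : ∀ᶠ y in 𝓝 x₀, y ∉ tangentialBdry Ω b := by
        filter_upwards [hZ3, hZ3.eventually_nhds, hfst, hcontZ] with y h1 h2 h3 h4 hy
        have hyf := hy.1
        rw [𝒯.isOpen.frontier_eq] at hyf
        have h5 : (𝓝[Ω] y).NeBot := mem_closure_iff_nhdsWithin_neBot.1 hyf.1
        have h6 : ∀ᶠ z in 𝓝[Ω] y, Z z ∈ 𝒯.D := by
          filter_upwards [nhdsWithin_le_nhds h2, self_mem_nhdsWithin] with z hz hzΩ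
          rw [hz.2 hzΩ]
          exact 𝒯.coord_mem hzΩ
        have h7 : Tendsto (fun z => (Z z).2) (𝓝[Ω] y) (𝓝 (Z y).2) :=
          ((continuous_snd.tendsto _).comp h4.tendsto).mono_left nhdsWithin_le_nhds
        have h8 : Tendsto (fun z => 𝒯.L (Z z).1) (𝓝[Ω] y) (𝓝 (𝒯.L (Z y).1)) :=
          ((𝒯.contDiffAt_L_and_eventually h3).1.continuousAt.tendsto.comp
            ((continuous_fst.tendsto _).comp h4.tendsto)).mono_left nhdsWithin_le_nhds
        have h9 : 0 ≤ (Z y).2 := ge_of_tendsto h7 (h6.mono fun z hz => hz.2.1.le)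
        have h10 : (Z y).2 ≤ 𝒯.L (Z y).1 := le_of_tendsto_of_tendsto h7 h8
          (h6.mono fun z hz => hz.2.2.le)
        have h11 : 𝒯.X ((Z y).1, (Z y).2) = y := h1.1
        rcases eq_or_lt_of_le h9 with h | h
        · rw [← h, X_zero] at h11
          exact Set.disjoint_left.1 𝒯.disjoint_in hy (h11 ▸ 𝒯.h_mem h3)
        rcases eq_or_lt_of_le h10 with h' | h'
        · rw [h'] at h11
          exact Set.disjoint_left.1 𝒯.disjoint_out hy (h11 ▸ 𝒯.X_L_mem h3)
        · exact hyf.2 (h11 ▸ 𝒯.X_mem h3 ⟨h, h'⟩)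
      refine ⟨U ∩ {y | (𝒯.X (Z y) = y ∧ (y ∈ Ω → Z y = 𝒯.coord y)) ∧ y ∉ tangentialBdry Ω b},
        inter_mem hU (hZ3.and hnot), g, hgU.mono inter_subset_left, fun y hy => ⟨fun hyΩ => ?_,
        fun hyD => absurd hyD hy.2.2⟩⟩
      simp only [hg, hf, θ, ζ, hy.2.1.2 hyΩ]
    · refine ⟨(𝒯.Y '' (K ×ˢ Icc (0 : ℝ) 1))ᶜ, hCK.isClosed.isOpen_compl.mem_nhds hx, fun _ => 0,
        contDiffOn_const, fun y hy => ⟨fun hyΩ => ?_, fun _ => rfl⟩⟩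
      refine (hF0 _ (𝒯.ζ_mem hyΩ) (fun hζ => hy ?_) _).symm
      exact ⟨(𝒯.ζ y, 𝒯.θ y), ⟨hζ, Ioo_subset_Icc_self (𝒯.θ_mem hyΩ)⟩, 𝒯.Y_ζ_θ hyΩ⟩
  obtain ⟨φ, hφ⟩ := exists_contMDiffMap_forall_mem_convex_of_local (n := 1) 𝓘(ℝ, E (m + 1)) hconv
    (fun x => by
      obtain ⟨U, hU, g, h1, h2⟩ := hloc x
      exact ⟨U, hU, g, h1.contMDiffOn, h2⟩)
  have hφc : ContDiff ℝ 1 φ := φ.contMDiff.contDiff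
  refine ⟨φ, hφc, fun x hx => (hφ x).2 hx, fun ξ hξ => ?_⟩
  have h1 : EqOn (fun s => φ (𝒯.Y (ξ, s))) (fun s => F (ξ, s)) (Ioo 0 1) := by
    intro s hs
    have hp : (ξ, s) ∈ 𝒯.Γ ×ˢ Ioo (0 : ℝ) 1 := ⟨hξ, hs⟩
    have := (hφ (𝒯.Y (ξ, s))).1 (𝒯.Y_mem hp)
    simp only [hf, 𝒯.ζ_Y hp, 𝒯.θ_Y hp] at this
    exact this
  have hFs : Continuous fun s => F (ξ, s) :=
    hF.continuousOn.comp_continuous (by fun_prop) fun s => ⟨hξ, mem_univ _⟩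
  have h2 := h1.closure (hφc.continuous.comp (𝒯.continuous_Y_slice ξ)) hFs
  rw [closure_Ioo zero_ne_one] at h2
  exact fun s hs => h2 hs

end TubeData

/-- A `K`-Lipschitz map enlarges the `d`-dimensional area by at most the factor `K ^ d`. -/
lemma euclideanHausdorffMeasure_image_le {X Y : Type*} [MetricSpace X] [MeasurableSpace X]
    [BorelSpace X] [MetricSpace Y] [MeasurableSpace Y] [BorelSpace Y] {K : ℝ≥0} {f : X → Y}
    {s : Set X} (hf : LipschitzOnWith K f s) (d : ℕ) :
    (μHE[d] : Measure Y) (f '' s) ≤ (K : ℝ≥0∞) ^ d * (μHE[d] : Measure X) s := by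
  simp_rw [Measure.euclideanHausdorffMeasure_def, Measure.smul_apply, ENNReal.smul_def, smul_eq_mul]
  have h := hf.hausdorffMeasure_image_le (d := d) (by positivity)
  rw [ENNReal.rpow_natCast] at h
  calc _ ≤ _ * ((K : ℝ≥0∞) ^ d * μH[d] s) := mul_le_mul_right h _
    _ = _ := by ring

namespace TubeData
variable {m : ℕ} {Ω : Set (E (m + 1))} {b : E (m + 1) → E (m + 1)} (𝒯 : TubeData Ω b)

/-! ### The surface measure -/

lemma measurableEmbedding_h : MeasurableEmbedding (𝒯.Γ.domRestrict 𝒯.h) :=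
  𝒯.param_in.contDiff.continuous.continuousOn.measurableEmbedding
    𝒯.param_in.isOpen.measurableSet 𝒯.param_in.injOn

lemma measurableSet_inflowBdry (𝒯 : TubeData Ω b) : MeasurableSet (inflowBdry Ω b) := by
  have h := 𝒯.measurableEmbedding_h.measurableSet_range
  rwa [range_domRestrict, 𝒯.param_in.image_eq] at h

lemma exists_measurable_leftInverse :
    ∃ k : E (m + 1) → E m, Measurable k ∧ ∀ ξ ∈ 𝒯.Γ, k (𝒯.h ξ) = ξ := by
  obtain ⟨k, hk, hkh⟩ := 𝒯.measurableEmbedding_h.exists_measurable_extend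
    (g := ((↑) : 𝒯.Γ → E m)) measurable_subtype_coe (fun _ => ⟨0⟩)
  exact ⟨k, hk, fun ξ hξ => congrFun hkh ⟨ξ, hξ⟩⟩

/-- A measurable inverse of the parametrization of the inflow boundary. -/
def k : E (m + 1) → E m := 𝒯.exists_measurable_leftInverse.choose

lemma measurable_k : Measurable 𝒯.k := 𝒯.exists_measurable_leftInverse.choose_spec.1

lemma k_h {ξ : E m} (hξ : ξ ∈ 𝒯.Γ) : 𝒯.k (𝒯.h ξ) = ξ :=
  𝒯.exists_measurable_leftInverse.choose_spec.2 ξ hξ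

lemma ae_inflowMeasure : ∀ᵐ x ∂(inflowMeasure Ω b), 𝒯.k x ∈ 𝒯.Γ ∧ 𝒯.h (𝒯.k x) = x := by
  have h1 : ∀ᵐ x ∂(inflowMeasure Ω b), x ∈ inflowBdry Ω b :=
    ae_restrict_mem 𝒯.measurableSet_inflowBdry
  filter_upwards [h1] with x hx
  rw [← 𝒯.param_in.image_eq] at hx
  obtain ⟨ξ, hξ, rfl⟩ := hx
  rw [𝒯.k_h hξ]
  exact ⟨hξ, rfl⟩

/-- The surface measure, transported to the parameter domain. -/
def surf : Measure (E m) := (inflowMeasure Ω b).map 𝒯.k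

lemma surf_apply {B : Set (E m)} (hB : MeasurableSet B) :
    𝒯.surf B = (μHE[m] : Measure (E (m + 1))) (𝒯.h '' (𝒯.Γ ∩ B)) := by
  rw [surf, Measure.map_apply 𝒯.measurable_k hB, inflowMeasure,
    Measure.restrict_apply (𝒯.measurable_k hB)]
  congr 1
  ext x
  rw [← 𝒯.param_in.image_eq]
  constructor
  · rintro ⟨hx, ξ, hξ, rfl⟩
    rw [mem_preimage, 𝒯.k_h hξ] at hx
    exact ⟨ξ, ⟨hξ, hx⟩, rfl⟩
  · rintro ⟨ξ, ⟨hξ, hx⟩, rfl⟩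
    exact ⟨by rwa [mem_preimage, 𝒯.k_h hξ], ξ, hξ, rfl⟩

/-- The parametrization of the inflow boundary is Lipschitz continuous. -/
lemma exists_surf_le : ∃ C : ℝ≥0, 𝒯.surf ≤ (C : ℝ≥0∞) • (volume : Measure (E m)).restrict 𝒯.Γ := by
  obtain ⟨R, hR⟩ := 𝒯.param_in.isBounded.subset_closedBall (0 : E m)
  obtain ⟨C, hC⟩ := (isCompact_closedBall (0 : E m) R).exists_bound_of_continuousOn
    𝒯.param_in.continuous_fderiv.continuousOn
  have hlip : LipschitzOnWith C.toNNReal 𝒯.h (Metric.closedBall 0 R) :=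
    (convex_closedBall _ _).lipschitzOnWith_of_nnnorm_hasFDerivWithin_le
      (fun ξ _ => (𝒯.param_in.hasFDerivAt ξ).hasFDerivWithinAt) fun ξ hξ => by
        rw [← NNReal.coe_le_coe, coe_nnnorm]
        exact (hC ξ hξ).trans (Real.le_coe_toNNReal _)
  refine ⟨C.toNNReal ^ m, Measure.le_iff.2 fun B hB => ?_⟩
  rw [𝒯.surf_apply hB, Measure.smul_apply, Measure.restrict_apply hB, smul_eq_mul, inter_comm B,
    ← EuclideanSpace.euclideanHausdorffMeasure_eq_volume]
  refine (euclideanHausdorffMeasure_image_le (hlip.mono (inter_subset_left.trans hR)) m).trans ?_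
  rw [ENNReal.coe_pow]

/-- The parametrization of the inflow boundary is locally bi-Lipschitz. -/
lemma absolutelyContinuous_surf : (volume : Measure (E m)).restrict 𝒯.Γ ≪ 𝒯.surf := by
  refine Measure.AbsolutelyContinuous.mk fun B hB h0 => ?_
  rw [𝒯.surf_apply hB] at h0
  rw [Measure.restrict_apply hB, inter_comm]
  refine measure_null_of_locally_null _ fun ξ₀ hξ₀ => ?_
  -- near `h ξ₀` the inverse of `h` is Lipschitz continuous
  obtain ⟨e, hes, hee, hed⟩ := 𝒯.param_in.exists_openPartialHomeomorph 𝒯.isFlow 𝒯.lipschitz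
    𝒯.contDiff_Φ (subset_closure hξ₀.1) 0
  have heX : ⇑e = 𝒯.X := hee
  have hx : flowOut 𝒯.Φ 𝒯.h (ξ₀, 0) = 𝒯.h ξ₀ := 𝒯.X_zero ξ₀
  rw [hx] at hed
  have hed2 : ContDiffAt ℝ 1 (fun x => (e.symm x).1) (𝒯.h ξ₀) := contDiffAt_fst.comp _ hed
  obtain ⟨K, V, hV, hlip⟩ := hed2.exists_lipschitzOnWith
  have hU : ∀ᶠ ξ in 𝓝 ξ₀, 𝒯.h ξ ∈ V ∧ (ξ, (0 : ℝ)) ∈ e.source :=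
    (𝒯.param_in.contDiff.continuous.continuousAt.eventually hV).and
      ((by fun_prop : Continuous fun ξ : E m => (ξ, (0 : ℝ))).continuousAt.eventually
        (e.open_source.mem_nhds hes))
  refine ⟨(𝒯.Γ ∩ B) ∩ {ξ | 𝒯.h ξ ∈ V ∧ (ξ, (0 : ℝ)) ∈ e.source},
    inter_mem self_mem_nhdsWithin (nhdsWithin_le_nhds hU), ?_⟩
  set A := (𝒯.Γ ∩ B) ∩ {ξ | 𝒯.h ξ ∈ V ∧ (ξ, (0 : ℝ)) ∈ e.source} with hA
  have himg : (fun x => (e.symm x).1) '' (𝒯.h '' A) = A := by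
    rw [image_image]
    have : ∀ ξ ∈ A, (e.symm (𝒯.h ξ)).1 = ξ := by
      intro ξ hξ
      rw [← 𝒯.X_zero ξ, ← heX, e.left_inv hξ.2.2]
    rw [image_congr this, image_id']
  have h1 := euclideanHausdorffMeasure_image_le
    (hlip.mono (show 𝒯.h '' A ⊆ V by rintro _ ⟨ξ, hξ, rfl⟩; exact hξ.2.1)) m
  rw [himg, measure_mono_null (image_mono inter_subset_left) h0, mul_zero,
    EuclideanSpace.euclideanHausdorffMeasure_eq_volume] at h1
  exact le_antisymm h1 (zero_le)

end TubeData

/-! ### Weak derivatives -/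

section Weak
variable {d : ℕ} {Ω : Set (E d)} {F : Type*} [NormedAddCommGroup F] [InnerProductSpace ℝ F]

/-- The class in `L²(Ω)` of a continuous function with compact support. -/
def testLp (Ω : Set (E d)) (v : E d → F) (hc : Continuous v) (hs : HasCompactSupport v) :
    Lp F 2 (volume.restrict Ω) := ((hc.memLp_of_hasCompactSupport hs).restrict Ω).toLp v

lemma inner_testLp (v : E d → F) (hc : Continuous v) (hs : HasCompactSupport v)
    (G : Lp F 2 (volume.restrict Ω)) : ⟪testLp Ω v hc hs, G⟫ = ∫ x in Ω, ⟪v x, G x⟫ := by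
  rw [L2.inner_def]
  refine integral_congr_ae ?_
  filter_upwards [MemLp.coeFn_toLp ((hc.memLp_of_hasCompactSupport hs).restrict Ω)] with x hx
  rw [testLp, hx]

lemma IsTest.smul {f ψ : E d → ℝ} (hψ : IsTest Ω ψ) (hf : ContDiff ℝ ∞ f) :
    IsTest Ω (fun x => ψ x * f x) :=
  ⟨hψ.1.mul hf, hψ.2.1.mul_right, (tsupport_mul_subset_left).trans hψ.2.2⟩

lemma inner_gradient (ψ : E d → ℝ) (x e : E d) : ⟪e, ∇ ψ x⟫ = fderiv ℝ ψ x e := by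
  rw [real_inner_comm, inner_gradient_left]

/-- The definition of the weak gradient, tested against vectors. -/
lemma isWeakGradient_iff (u : L2 Ω) (G : L2V Ω) : IsWeakGradient Ω u G ↔
    ∀ ψ, IsTest Ω ψ → ∀ e : E d, ∫ x in Ω, u x * ⟪e, ∇ ψ x⟫ = -∫ x in Ω, ψ x * ⟪e, G x⟫ := by
  have key : ∀ ψ, IsTest Ω ψ → ∀ e : E d,
      ⟪e, ∫ x in Ω, u x • ∇ ψ x⟫ = ∫ x in Ω, u x * ⟪e, ∇ ψ x⟫ ∧
      ⟪e, ∫ x in Ω, ψ x • G x⟫ = ∫ x in Ω, ψ x * ⟪e, G x⟫ := by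
    intro ψ hψ e
    rw [← integral_inner (integrable_smul_of_test' hψ.continuous_gradient
      hψ.hasCompactSupport_gradient u), ← integral_inner (integrable_smul_of_test
      hψ.1.continuous hψ.2.1 G)]
    simp only [inner_smul_right, and_self]
  constructor
  · intro h ψ hψ e
    obtain ⟨h1, h2⟩ := key ψ hψ e
    rw [← h1, ← h2, h ψ hψ, inner_neg_right]
  · intro h ψ hψ
    refine ext_inner_left ℝ fun e => ?_
    obtain ⟨h1, h2⟩ := key ψ hψ e
    rw [inner_neg_right, h1, h2]
    exact h ψ hψ e

/-- Integration by parts for a `C¹` function and a test function. -/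
lemma integral_mul_gradient {φ ψ : E d → ℝ} (hφ : ContDiff ℝ 1 φ) (hψ : IsTest Ω ψ) (e : E d) :
    ∫ x in Ω, φ x * ⟪e, ∇ ψ x⟫ = -∫ x in Ω, ψ x * ⟪e, ∇ φ x⟫ := by
  simp only [inner_gradient]
  have hψ0 : ∀ x ∉ Ω, ψ x = 0 := fun x hx => by
    by_contra h
    exact hx (hψ.2.2 (subset_tsupport ψ h))
  have hdψ0 : ∀ x ∉ Ω, fderiv ℝ ψ x = 0 := fun x hx => by
    by_contra h
    exact hx (hψ.2.2 (support_fderiv_subset ℝ h))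
  rw [setIntegral_eq_integral_of_forall_compl_eq_zero (fun x hx => by simp [hdψ0 x hx]),
    setIntegral_eq_integral_of_forall_compl_eq_zero (fun x hx => by simp [hψ0 x hx])]
  have hcψ := hψ.1.continuous
  have hcdψ : Continuous fun x => fderiv ℝ ψ x e :=
    (hψ.1.continuous_fderiv (by simp)).clm_apply continuous_const
  have hcdφ : Continuous fun x => fderiv ℝ φ x e :=
    (hφ.continuous_fderiv one_ne_zero).clm_apply continuous_const
  have hsd : HasCompactSupport fun x => fderiv ℝ ψ x e :=
    hψ.2.1.fderiv_apply ℝ e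
  rw [integral_mul_fderiv_eq_neg_fderiv_mul_of_integrable
    ((hcdφ.mul hcψ).integrable_of_hasCompactSupport hψ.2.1.mul_left)
    ((hφ.continuous.mul hcdψ).integrable_of_hasCompactSupport hsd.mul_left)
    ((hφ.continuous.mul hcψ).integrable_of_hasCompactSupport hψ.2.1.mul_left)
    (fun x _ => hφ.differentiable one_ne_zero x) (fun x _ => hψ.1.differentiable (by simp) x)]
  simp only [mul_comm]

lemma isWeakGradient_of_contDiff {φ : E d → ℝ} (hφ : ContDiff ℝ 1 φ) {u : L2 Ω} {G : L2V Ω}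
    (hu : u =ᵐ[volume.restrict Ω] φ) (hG : G =ᵐ[volume.restrict Ω] ∇ φ) :
    IsWeakGradient Ω u G := by
  rw [isWeakGradient_iff]
  intro ψ hψ e
  have h1 : ∫ x in Ω, u x * ⟪e, ∇ ψ x⟫ = ∫ x in Ω, φ x * ⟪e, ∇ ψ x⟫ :=
    integral_congr_ae (hu.mono fun x hx => by simp only [hx])
  have h2 : ∫ x in Ω, ψ x * ⟪e, G x⟫ = ∫ x in Ω, ψ x * ⟪e, ∇ φ x⟫ :=
    integral_congr_ae (hG.mono fun x hx => by simp only [hx])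
  rw [h1, h2, integral_mul_gradient hφ hψ]

lemma classicalV_le_H1 (b : E d → E d) : classicalV Ω b ≤ H1 Ω := by
  rintro w ⟨φ, hφ, -, h1, h2⟩
  exact isWeakGradient_of_contDiff hφ h1 h2

lemma isClosed_H1 : IsClosed (H1 Ω : Set (WithLp 2 (L2 Ω × L2V Ω))) := by
  have h1 : (H1 Ω : Set (WithLp 2 (L2 Ω × L2V Ω))) = ⋂ (ψ : {ψ // IsTest Ω ψ}) (e : E d),
      {w | ⟪testLp Ω (fun x => ⟪e, ∇ ψ.1 x⟫)
          (continuous_const.inner ψ.2.continuous_gradient)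
          (ψ.2.hasCompactSupport_gradient.comp_left (g := fun y => ⟪e, y⟫) (inner_zero_right e)), w.fst⟫ =
        -⟪testLp Ω (fun x => ψ.1 x • e) (ψ.2.1.continuous.smul continuous_const)
          ψ.2.2.1.smul_right, w.snd⟫} := by
    ext w
    simp only [mem_iInter, mem_ofPred_eq, inner_testLp, SetLike.mem_coe]
    change IsWeakGradient Ω w.fst w.snd ↔ _
    rw [isWeakGradient_iff]
    simp only [Subtype.forall, inner_smul_left, RCLike.inner_apply, conj_trivial]
  rw [h1]
  refine isClosed_iInter fun ψ => isClosed_iInter fun e => isClosed_eq ?_ ?_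
  · exact continuous_const.inner (WithLp.fstL 2 ℝ _ _).continuous
  · exact (continuous_const.inner (WithLp.sndL 2 ℝ _ _).continuous).neg

lemma spaceV_eq (b : E d → E d) : spaceV Ω b = (classicalV Ω b).topologicalClosure := by
  refine inf_eq_right.2 ?_
  exact Submodule.topologicalClosure_minimal _ (classicalV_le_H1 b) isClosed_H1

instance (b : E d → E d) : CompleteSpace (spaceV Ω b) := by
  rw [spaceV_eq]
  exact (Submodule.isClosed_topologicalClosure _).completeSpace_coe

lemma isClosed_spaceVt {b : E d → E d} (hb : ContDiff ℝ ∞ b) :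
    IsClosed (spaceVt Ω b hb : Set (WithLp 2 (L2 Ω × L2 Ω))) := by
  have h1 : (spaceVt Ω b hb : Set (WithLp 2 (L2 Ω × L2 Ω))) = ⋂ (ψ : {ψ // IsTest Ω ψ}),
      {w | ⟪testLp Ω _ (ψ.2.continuous_div hb) (ψ.2.hasCompactSupport_div b), w.fst⟫ =
        -⟪testLp Ω ψ.1 ψ.2.1.continuous ψ.2.2.1, w.snd⟫} := by
    ext w
    simp only [mem_iInter, mem_ofPred_eq, inner_testLp, SetLike.mem_coe]
    change IsWeakDirDeriv Ω b w.fst w.snd ↔ _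
    simp only [Subtype.forall, RCLike.inner_apply, conj_trivial, IsWeakDirDeriv, mul_comm]
  rw [h1]
  refine isClosed_iInter fun ψ => isClosed_eq ?_ ?_
  · exact continuous_const.inner (WithLp.fstL 2 ℝ _ _).continuous
  · exact (continuous_const.inner (WithLp.sndL 2 ℝ _ _).continuous).neg

lemma ae_eq_of_forall_test [CompleteSpace F] (hΩ : IsOpen Ω) {G G' : Lp F 2 (volume.restrict Ω)}
    (h : ∀ ψ, IsTest Ω ψ → ∫ x in Ω, ψ x • G x = ∫ x in Ω, ψ x • G' x) : G = G' := by
  rw [← sub_eq_zero]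
  refine Lp.ext ?_
  have hloc : LocallyIntegrable (G - G' : Lp F 2 (volume.restrict Ω)) (volume.restrict Ω) :=
    (Lp.memLp (G - G')).locallyIntegrable (by norm_num)
  have h1 := hΩ.ae_eq_zero_of_integral_contDiff_smul_eq_zero
    (hloc.locallyIntegrableOn Ω) fun ψ h1 h2 h3 => by
      have e1 : ∫ x in Ω, ψ x • (G - G' : Lp F 2 (volume.restrict Ω)) x
          = (∫ x in Ω, ψ x • G x) - ∫ x in Ω, ψ x • G' x := by
        rw [← integral_sub (integrable_smul_of_test h1.continuous h2 G)
          (integrable_smul_of_test h1.continuous h2 G')]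
        refine integral_congr_ae ?_
        filter_upwards [Lp.coeFn_sub G G'] with x hx
        rw [hx, Pi.sub_apply, smul_sub]
      rw [e1, h ψ ⟨h1, h2, h3⟩, sub_self]
  filter_upwards [h1, ae_restrict_mem hΩ.measurableSet, Lp.coeFn_zero F 2 (volume.restrict Ω)]
    with x h2 h3 h4
  rw [h2 h3, h4, Pi.zero_apply]

lemma IsWeakGradient.unique (hΩ : IsOpen Ω) {u : L2 Ω} {G G' : L2V Ω} (h : IsWeakGradient Ω u G)
    (h' : IsWeakGradient Ω u G') : G = G' :=
  ae_eq_of_forall_test hΩ fun ψ hψ => by rw [← neg_inj, ← h ψ hψ, ← h' ψ hψ]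

lemma IsWeakDirDeriv.unique (hΩ : IsOpen Ω) {b : E d → E d} {u g g' : L2 Ω}
    (h : IsWeakDirDeriv Ω b u g) (h' : IsWeakDirDeriv Ω b u g') : g = g' :=
  ae_eq_of_forall_test hΩ fun ψ hψ => by
    simp only [smul_eq_mul]
    rw [← neg_inj, ← h ψ hψ, ← h' ψ hψ]

lemma divergence_smul_eq {b : E d → E d} (hb : Differentiable ℝ b) {ψ : E d → ℝ}
    (hψ : Differentiable ℝ ψ) (x : E d) :
    divergence (fun y => ψ y • b y) x =
      ∑ i, ⟪EuclideanSpace.single i (1 : ℝ), ∇ (fun y => ψ y * b y i) x⟫ := by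
  unfold divergence
  refine Finset.sum_congr rfl fun i _ => ?_
  rw [inner_gradient]
  have h1 : HasFDerivAt (fun y => ψ y • b y) (fderiv ℝ (fun y => ψ y • b y) x) x :=
    ((hψ x).smul (hb x)).hasFDerivAt
  have h2 : HasFDerivAt (fun y => ψ y * b y i)
      ((EuclideanSpace.proj i : E d →L[ℝ] ℝ) ∘L fderiv ℝ (fun y => ψ y • b y) x) x :=
    (EuclideanSpace.proj i : E d →L[ℝ] ℝ).hasFDerivAt.comp x h1
  rw [h2.fderiv]
  rfl

lemma divergence_smul {b : E d → E d} (hb : Differentiable ℝ b) {ψ : E d → ℝ}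
    (hψ : Differentiable ℝ ψ) (x : E d) :
    divergence (fun y => ψ y • b y) x = fderiv ℝ ψ x (b x) + ψ x * divergence b x := by
  have h1 : HasFDerivAt (fun y => ψ y • b y) _ x := (hψ x).hasFDerivAt.smul (hb x).hasFDerivAt
  unfold divergence
  rw [h1.fderiv]
  simp only [add_apply, smul_apply,
    ContinuousLinearMap.smulRight_apply, PiLp.add_apply, PiLp.smul_apply, smul_eq_mul,
    Finset.sum_add_distrib, ← Finset.mul_sum]
  rw [add_comm]
  congr 1
  have h2 : b x = ∑ i, b x i • EuclideanSpace.single i (1 : ℝ) := by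
    have := (EuclideanSpace.basisFun (Fin d) ℝ).sum_repr (b x)
    simpa using this.symm
  conv_rhs => rw [h2, map_sum]
  simp only [map_smul, smul_eq_mul, mul_comm]

/-- The directional derivative is the component of the gradient. -/
lemma IsWeakGradient.isWeakDirDeriv {b : E d → E d} (hb : ContDiff ℝ ∞ b) {u : L2 Ω} {G : L2V Ω}
    (h : IsWeakGradient Ω u G) {g : E d → ℝ} (hg : g =ᵐ[volume.restrict Ω] fun x => ⟪b x, G x⟫) :
    IsWeakDirDeriv Ω b u g := by
  intro ψ hψ
  rw [isWeakGradient_iff] at h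
  have hbi : ∀ i, ContDiff ℝ ∞ fun y => b y i := fun i => by fun_prop
  have hti : ∀ i, IsTest Ω (fun y => ψ y * b y i) := fun i => hψ.smul (hbi i)
  have h1 : ∀ x, u x * divergence (fun y => ψ y • b y) x =
      ∑ i, u x * ⟪EuclideanSpace.single i (1 : ℝ), ∇ (fun y => ψ y * b y i) x⟫ := fun x => by
    rw [divergence_smul_eq (hb.differentiable (by simp)) (hψ.1.differentiable (by simp)),
      Finset.mul_sum]
  have h2 : ∫ x in Ω, ψ x * g x =
      ∫ x in Ω, ∑ i, (ψ x * b x i) * ⟪EuclideanSpace.single i (1 : ℝ), G x⟫ := by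
    refine integral_congr_ae ?_
    filter_upwards [hg] with x hx
    rw [hx, PiLp.inner_apply, Finset.mul_sum]
    refine Finset.sum_congr rfl fun i _ => ?_
    rw [EuclideanSpace.inner_single_left]
    simp only [map_one, one_mul, RCLike.inner_apply, conj_trivial]
    ring
  simp_rw [h1]
  rw [h2, integral_finsetSum, integral_finsetSum, ← Finset.sum_neg_distrib]
  · exact Finset.sum_congr rfl fun i _ => h _ (hti i) _
  · intro i _
    have h3 := (integrable_smul_of_test (hti i).1.continuous (hti i).2.1 G).const_inner
      (𝕜 := ℝ) (EuclideanSpace.single i (1 : ℝ))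
    simpa only [inner_smul_right] using h3
  · intro i _
    have h3 := (integrable_smul_of_test' (hti i).continuous_gradient
      (hti i).hasCompactSupport_gradient u).const_inner (𝕜 := ℝ) (EuclideanSpace.single i (1 : ℝ))
    simpa only [inner_smul_right] using h3

end Weak

/-! ### The parallel component as an operator on `L²` -/

section Dir
variable {d : ℕ} {Ω : Set (E d)} {b : E d → E d}

/-- The properties of the field which are needed to form parallel components. -/
structure IsUnitField (Ω : Set (E d)) (b : E d → E d) : Prop where
  isOpen : IsOpen Ω
  continuous : Continuous b
  norm_eq_one : ∀ x ∈ Ω, ‖b x‖ = 1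

lemma IsUnitField.ae_norm_inner_le (hb : IsUnitField Ω b) (v : E d → E d) :
    ∀ᵐ x ∂(volume.restrict Ω), ‖⟪b x, v x⟫‖ ≤ ‖v x‖ := by
  filter_upwards [ae_restrict_mem hb.isOpen.measurableSet] with x hx
  have := norm_inner_le_norm (𝕜 := ℝ) (b x) (v x)
  rwa [hb.norm_eq_one x hx, one_mul] at this

lemma IsUnitField.memLp (hb : IsUnitField Ω b) (v : L2V Ω) :
    MemLp (fun x => ⟪b x, v x⟫) 2 (volume.restrict Ω) :=
  (Lp.memLp v).of_le (hb.continuous.aestronglyMeasurable.inner (Lp.aestronglyMeasurable v))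
    (hb.ae_norm_inner_le v)

/-- The operator `v ↦ b · v` from `L²(Ω)ᵈ` to `L²(Ω)`. -/
def dirL (hb : IsUnitField Ω b) : L2V Ω →L[ℝ] L2 Ω :=
  LinearMap.mkContinuous
    { toFun := fun v => (hb.memLp v).toLp _
      map_add' := fun v w => by
        rw [← MemLp.toLp_add (hb.memLp v) (hb.memLp w)]
        refine MemLp.toLp_congr _ _ ?_
        filter_upwards [Lp.coeFn_add v w] with x hx
        rw [hx, Pi.add_apply, inner_add_right]
        rfl
      map_smul' := fun c v => by
        rw [RingHom.id_apply, ← MemLp.toLp_const_smul c (hb.memLp v)]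
        refine MemLp.toLp_congr _ _ ?_
        filter_upwards [Lp.coeFn_smul c v] with x hx
        rw [hx, Pi.smul_apply, inner_smul_right]
        rfl } 1 fun v => by
    refine Lp.norm_le_mul_norm_of_ae_le_mul ?_
    filter_upwards [MemLp.coeFn_toLp (hb.memLp v), hb.ae_norm_inner_le v] with x h1 h2
    rw [one_mul]
    simpa only [LinearMap.coe_mk, AddHom.coe_mk, h1] using h2

lemma coeFn_dirL (hb : IsUnitField Ω b) (v : L2V Ω) :
    dirL hb v =ᵐ[volume.restrict Ω] fun x => ⟪b x, v x⟫ := MemLp.coeFn_toLp (hb.memLp v)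

lemma norm_dirL_le (hb : IsUnitField Ω b) (v : L2V Ω) : ‖dirL hb v‖ ≤ ‖v‖ := by
  have := (dirL hb).le_of_opNorm_le (LinearMap.mkContinuous_norm_le _ zero_le_one _) v
  rwa [one_mul] at this

lemma norm_par (hb : IsUnitField Ω b) (v : L2V Ω) :
    ∀ᵐ x ∂(volume.restrict Ω), ‖par b v x‖ = ‖dirL hb v x‖ := by
  filter_upwards [coeFn_dirL hb v, ae_restrict_mem hb.isOpen.measurableSet] with x h1 h2
  rw [h1, par, norm_smul, hb.norm_eq_one x h2, mul_one]

lemma eLpNorm_par (hb : IsUnitField Ω b) (v : L2V Ω) :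
    eLpNorm (par b v) 2 (volume.restrict Ω) = ‖dirL hb v‖ₑ := by
  rw [Lp.enorm_def]
  exact eLpNorm_congr_norm_ae (norm_par hb v)

lemma mem_spaceG_iff (hb : IsUnitField Ω b) (φ : spaceV Ω b) :
    φ ∈ spaceG Ω b ↔ dirL hb φ.1.snd = 0 := by
  change par b φ.1.snd =ᵐ[volume.restrict Ω] 0 ↔ _
  rw [Lp.eq_zero_iff_ae_eq_zero]
  constructor
  · intro h
    filter_upwards [h, norm_par hb φ.1.snd] with x h1 h2
    rw [h1, Pi.zero_apply, norm_zero] at h2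
    exact norm_eq_zero.1 h2.symm
  · intro h
    filter_upwards [h, norm_par hb φ.1.snd] with x h1 h2
    rw [h1, Pi.zero_apply, norm_zero] at h2
    exact norm_eq_zero.1 h2

lemma eLpNorm_perp_le (hb : IsUnitField Ω b) (v : L2V Ω) :
    eLpNorm (perp b v) 2 (volume.restrict Ω) ≤ ‖v‖ₑ := by
  rw [Lp.enorm_def]
  refine eLpNorm_mono_ae ?_
  filter_upwards [ae_restrict_mem hb.isOpen.measurableSet] with x hx
  have h1 := hb.norm_eq_one x hx
  rw [← sq_le_sq₀ (norm_nonneg _) (norm_nonneg _), perp, par, norm_sub_sq_real, inner_smul_right,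
    norm_smul, h1, real_inner_comm, mul_one, Real.norm_eq_abs, sq_abs]
  nlinarith [sq_nonneg ⟪b x, v x⟫]

end Dir

namespace TubeData
variable {m : ℕ} {Ω : Set (E (m + 1))} {b : E (m + 1) → E (m + 1)} (𝒯 : TubeData Ω b)

lemma isUnitField (𝒯 : TubeData Ω b) : IsUnitField Ω b :=
  ⟨𝒯.isOpen, 𝒯.contDiff_b.continuous, 𝒯.norm_eq_one⟩

/-! ### Averages along field lines -/

/-- A function bounded by the averages of `‖F‖` over the fibres has a smaller `L²` norm than `F`. -/
lemma eLpNorm_vol_le_of_fiber {F G : Type*} [NormedAddCommGroup F] [NormedAddCommGroup G]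
    {H : E m × ℝ → F} {f : E m × ℝ → G} (hf : AEStronglyMeasurable f 𝒯.vol)
    (h : ∀ᵐ p ∂𝒯.vol, ‖H p‖ₑ ≤ ∫⁻ s in Ioo (0 : ℝ) 1, ‖f (p.1, s)‖ₑ) :
    eLpNorm H 2 𝒯.vol ≤ eLpNorm f 2 𝒯.vol := by
  have h2 : (2 : ℝ≥0∞) ≠ 0 := by norm_num
  rw [eLpNorm_eq_lintegral_rpow_enorm_toReal h2 (by norm_num),
    eLpNorm_eq_lintegral_rpow_enorm_toReal h2 (by norm_num)]
  refine ENNReal.rpow_le_rpow ?_ (by positivity)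
  have hfm : AEMeasurable (fun p => ‖f p‖ₑ ^ (2 : ℝ≥0∞).toReal) 𝒯.vol := hf.enorm.pow_const _
  have hsec : ∀ᵐ ξ ∂((volume : Measure (E m)).restrict 𝒯.Γ), AEStronglyMeasurable
      (fun s => f (ξ, s)) ((volume : Measure ℝ).restrict (Ioo 0 1)) := hf.prodMk_left
  calc ∫⁻ p, ‖H p‖ₑ ^ (2 : ℝ≥0∞).toReal ∂𝒯.vol
      ≤ ∫⁻ p, ((fun ξ => ∫⁻ s in Ioo (0 : ℝ) 1, ‖f (ξ, s)‖ₑ ^ (2 : ℝ≥0∞).toReal) p.1) ∂𝒯.vol := by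
        have hsec2 : ∀ᵐ p ∂𝒯.vol, AEStronglyMeasurable
            (fun s => f (p.1, s)) ((volume : Measure ℝ).restrict (Ioo 0 1)) :=
          Measure.quasiMeasurePreserving_fst.ae hsec
        refine lintegral_mono_ae ?_
        filter_upwards [h, hsec2] with p hp hsp
        refine (ENNReal.rpow_le_rpow hp (by positivity)).trans ?_
        have h3 := eLpNorm_le_eLpNorm_of_exponent_le (p := 1) (q := 2) (by norm_num) hsp
        rw [eLpNorm_one_eq_lintegral_enorm,
          eLpNorm_eq_lintegral_rpow_enorm_toReal h2 (by norm_num)] at h3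
        refine (ENNReal.rpow_le_rpow h3 (by positivity)).trans ?_
        rw [← ENNReal.rpow_mul]
        simp
    _ = ∫⁻ ξ in 𝒯.Γ, ∫⁻ s in Ioo (0 : ℝ) 1, ‖f (ξ, s)‖ₑ ^ (2 : ℝ≥0∞).toReal := by
        rw [vol, lintegral_prod]
        · refine lintegral_congr fun ξ => ?_
          simp
        · exact (AEMeasurable.lintegral_prod_right' hfm).comp_quasiMeasurePreserving
            Measure.quasiMeasurePreserving_fst
    _ = ∫⁻ p, ‖f p‖ₑ ^ (2 : ℝ≥0∞).toReal ∂𝒯.vol := by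
        rw [vol, lintegral_prod _ hfm]

/-- The `L²` bound by averages over field lines, transported to `Ω`. -/
lemma exists_eLpNorm_le_of_fiber : ∃ C : ℝ≥0, ∀ {F G : Type} [NormedAddCommGroup F]
    [NormedAddCommGroup G] (H : E (m + 1) → F) (g : E (m + 1) → G),
    AEStronglyMeasurable H (volume.restrict Ω) → AEStronglyMeasurable g (volume.restrict Ω) →
    (∀ x ∈ Ω, ‖H x‖ₑ ≤ ∫⁻ s in Ioo (0 : ℝ) 1, ‖g (𝒯.Y (𝒯.ζ x, s))‖ₑ) →
    eLpNorm H 2 (volume.restrict Ω) ≤ C * eLpNorm g 2 (volume.restrict Ω) := by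
  obtain ⟨C₁, h₁⟩ := 𝒯.exists_eLpNorm_le_vol
  obtain ⟨C₂, h₂⟩ := 𝒯.exists_eLpNorm_vol_le
  refine ⟨C₁ * C₂, fun H g hH hg h => ?_⟩
  refine (h₁ H hH).trans ?_
  rw [ENNReal.coe_mul, mul_assoc]
  gcongr
  refine le_trans ?_ (h₂ g hg)
  refine 𝒯.eLpNorm_vol_le_of_fiber (hg.comp_quasiMeasurePreserving 𝒯.quasiMeasurePreserving_Y) ?_
  filter_upwards [𝒯.ae_vol_mem] with p hp
  have := h _ (𝒯.Y_mem hp)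
  rwa [𝒯.ζ_Y hp] at this

lemma enorm_le_lintegral_of_norm_le {F G : Type*} [NormedAddCommGroup F] [NormedAddCommGroup G]
    {x : F} {f : ℝ → G} (h : ‖x‖ ≤ ∫ s in (0 : ℝ)..1, ‖f s‖) :
    ‖x‖ₑ ≤ ∫⁻ s in Ioo (0 : ℝ) 1, ‖f s‖ₑ := by
  rw [intervalIntegral.integral_of_le zero_le_one, integral_Ioc_eq_integral_Ioo] at h
  have h1 : ‖x‖ₑ ≤ ‖∫ s in Ioo (0 : ℝ) 1, ‖f s‖‖ₑ := by
    rw [enorm_le_iff_norm_le, Real.norm_of_nonneg (integral_nonneg fun _ => norm_nonneg _)]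
    exact h
  refine h1.trans ((enorm_integral_le_lintegral_enorm _).trans (le_of_eq ?_))
  simp

/-! ### The weighted mean along field lines -/

/-- The integral of the density over a field line. -/
def W (ξ : E m) : ℝ := ∫ s in (0 : ℝ)..1, 𝒯.w (ξ, s)

/-- The mean value of `φ` over the field line with initial point `h ξ`, with respect to the density
of Lebesgue measure. -/
def mean (φ : E (m + 1) → ℝ) (ξ : E m) : ℝ := (∫ s in (0 : ℝ)..1, φ (𝒯.Y (ξ, s)) * 𝒯.w (ξ, s)) / 𝒯.W ξ

lemma continuous_w_slice (ξ : E m) : Continuous fun s : ℝ => 𝒯.w (ξ, s) :=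
  continuous_iff_continuousAt.2 fun s => (𝒯.hasDerivAt_w ξ s).continuousAt

lemma W_pos {ξ : E m} (hξ : ξ ∈ 𝒯.Γ) : 0 < 𝒯.W ξ :=
  intervalIntegral.intervalIntegral_pos_of_pos ((𝒯.continuous_w_slice ξ).intervalIntegrable _ _)
    (fun _ => 𝒯.w_pos hξ) zero_lt_one

lemma exists_le_W : ∃ c > 0, ∀ ξ ∈ 𝒯.Γ, c ≤ 𝒯.W ξ := by
  obtain ⟨c, hc, h⟩ := 𝒯.exists_le_w
  refine ⟨c, hc, fun ξ hξ => ?_⟩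
  have h1 : ∫ _s in (0 : ℝ)..1, c ≤ 𝒯.W ξ :=
    intervalIntegral.integral_mono_on zero_le_one (by simp)
      ((𝒯.continuous_w_slice ξ).intervalIntegrable _ _) fun s hs => h _ ⟨hξ, hs⟩
  simpa using h1

lemma contDiffOn_W : ContDiffOn ℝ 1 𝒯.W 𝒯.Γ :=
  contDiffOn_integral_param 𝒯.param_in.isOpen 𝒯.contDiffOn_w 0 1 zero_le_one

variable {φ : E (m + 1) → ℝ}

lemma contDiffOn_comp_Y (hφ : ContDiff ℝ 1 φ) : ContDiffOn ℝ 1 (fun p => φ (𝒯.Y p)) (𝒯.Γ ×ˢ univ) :=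
  hφ.comp_contDiffOn 𝒯.contDiffOn_Y

lemma contDiffOn_mean (hφ : ContDiff ℝ 1 φ) : ContDiffOn ℝ 1 (𝒯.mean φ) 𝒯.Γ :=
  (contDiffOn_integral_param (g := fun p => φ (𝒯.Y p) * 𝒯.w p) 𝒯.param_in.isOpen
    ((𝒯.contDiffOn_comp_Y hφ).mul 𝒯.contDiffOn_w) 0 1 zero_le_one).div 𝒯.contDiffOn_W
    fun _ hξ => (𝒯.W_pos hξ).ne'

lemma mean_mul_W {ξ : E m} (hξ : ξ ∈ 𝒯.Γ) :
    𝒯.mean φ ξ * 𝒯.W ξ = ∫ s in (0 : ℝ)..1, φ (𝒯.Y (ξ, s)) * 𝒯.w (ξ, s) :=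
  div_mul_cancel₀ _ (𝒯.W_pos hξ).ne'

lemma integral_sub_mean (hφ : Continuous φ) {ξ : E m} (hξ : ξ ∈ 𝒯.Γ) (c : ℝ) :
    ∫ s in (0 : ℝ)..1, (φ (𝒯.Y (ξ, s)) - c) * 𝒯.w (ξ, s) = (𝒯.mean φ ξ - c) * 𝒯.W ξ := by
  have hw := 𝒯.continuous_w_slice ξ
  have hf : Continuous fun s => φ (𝒯.Y (ξ, s)) := hφ.comp (𝒯.continuous_Y_slice ξ)
  simp_rw [sub_mul]
  have e1 : IntervalIntegrable (fun s => φ (𝒯.Y (ξ, s)) * 𝒯.w (ξ, s)) volume 0 1 :=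
    (hf.mul hw).intervalIntegrable _ _
  have e2 : IntervalIntegrable (fun s => c * 𝒯.w (ξ, s)) volume 0 1 :=
    (continuous_const.mul hw).intervalIntegrable _ _
  rw [intervalIntegral.integral_sub e1 e2, ← 𝒯.mean_mul_W hξ, intervalIntegral.integral_const_mul]
  rfl

/-- A mean value lies between any bounds of the function. -/
lemma abs_sub_mean_le (hφ : Continuous φ) {ξ : E m} (hξ : ξ ∈ 𝒯.Γ) {c r : ℝ}
    (h : ∀ s ∈ Icc (0 : ℝ) 1, |φ (𝒯.Y (ξ, s)) - c| ≤ r) : |𝒯.mean φ ξ - c| ≤ r := by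
  have hw := 𝒯.continuous_w_slice ξ
  have hf : Continuous fun s => φ (𝒯.Y (ξ, s)) := hφ.comp (𝒯.continuous_Y_slice ξ)
  have h1 : |(𝒯.mean φ ξ - c) * 𝒯.W ξ| ≤ r * 𝒯.W ξ := by
    rw [← 𝒯.integral_sub_mean hφ hξ, W, ← intervalIntegral.integral_const_mul]
    refine (intervalIntegral.abs_integral_le_integral_abs zero_le_one).trans ?_
    refine intervalIntegral.integral_mono_on zero_le_one
      (((hf.sub continuous_const).mul hw).abs.intervalIntegrable _ _)
      ((continuous_const.mul hw).intervalIntegrable _ _) fun s hs => ?_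
    rw [abs_mul, abs_of_pos (𝒯.w_pos hξ)]
    exact mul_le_mul_of_nonneg_right (h s hs) (𝒯.w_pos hξ).le
  rw [abs_mul, abs_of_pos (𝒯.W_pos hξ)] at h1
  exact le_of_mul_le_mul_right h1 (𝒯.W_pos hξ)

/-- The oscillation of `φ` along a field line is controlled by its derivative along the field. -/
lemma abs_sub_le_integral (hφ : ContDiff ℝ 1 φ) {ξ : E m} (hξ : ξ ∈ 𝒯.Γ) {s s' : ℝ}
    (hs : s ∈ Icc (0 : ℝ) 1) (hs' : s' ∈ Icc (0 : ℝ) 1) :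
    |φ (𝒯.Y (ξ, s)) - φ (𝒯.Y (ξ, s'))| ≤
      𝒯.Λ * ∫ σ in (0 : ℝ)..1, ‖fderiv ℝ φ (𝒯.Y (ξ, σ)) (b (𝒯.Y (ξ, σ)))‖ := by
  have hY := 𝒯.continuous_Y_slice ξ
  set f' : ℝ → ℝ := fun σ => fderiv ℝ φ (𝒯.Y (ξ, σ)) (b (𝒯.Y (ξ, σ))) with hf'
  have hf'c : Continuous f' := ((hφ.continuous_fderiv one_ne_zero).comp hY).clm_apply
    (𝒯.contDiff_b.continuous.comp hY)
  have hd : ∀ σ ∈ Icc (0 : ℝ) 1, HasDerivAt (fun σ => φ (𝒯.Y (ξ, σ))) (𝒯.L ξ * f' σ) σ := by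
    intro σ hσ
    have h1 := (hφ.differentiable one_ne_zero (𝒯.Y (ξ, σ))).hasFDerivAt.comp_hasDerivAt σ
      (𝒯.hasDerivAt_Y ξ σ)
    refine h1.congr_deriv ?_
    rw [map_smul, 𝒯.eqOn (𝒯.Y_mem_closure ⟨hξ, hσ⟩)]
    rfl
  have hsub : uIcc s' s ⊆ Icc (0 : ℝ) 1 := ordConnected_Icc.uIcc_subset hs' hs
  have h2 : φ (𝒯.Y (ξ, s)) - φ (𝒯.Y (ξ, s')) = ∫ σ in s'..s, 𝒯.L ξ * f' σ :=
    (intervalIntegral.integral_eq_sub_of_hasDerivAt (fun σ hσ => hd σ (hsub hσ))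
      ((continuous_const.mul hf'c).intervalIntegrable _ _)).symm
  rw [h2, intervalIntegral.integral_const_mul, abs_mul, abs_of_pos (𝒯.L_pos hξ)]
  refine mul_le_mul (𝒯.L_le hξ) ?_ (abs_nonneg _) 𝒯.Λ_pos.le
  refine (intervalIntegral.norm_integral_le_abs_integral_norm (f := f') (a := s') (b := s)
    (μ := volume)).trans ?_
  refine (intervalIntegral.abs_integral_mono_interval (a := s') (b := s) (c := 0) (d := 1) ?_
    (Eventually.of_forall fun σ => norm_nonneg (f' σ))
    (hf'c.norm.intervalIntegrable _ _)).trans (le_of_eq ?_)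
  · intro σ hσ
    rw [uIoc_of_le zero_le_one]
    exact ⟨(le_min hs'.1 hs.1).trans_lt hσ.1, hσ.2.trans (max_le hs'.2 hs.2)⟩
  · exact abs_of_nonneg (intervalIntegral.integral_nonneg zero_le_one fun _ _ => norm_nonneg _)

lemma abs_sub_mean_le_integral (hφ : ContDiff ℝ 1 φ) {ξ : E m} (hξ : ξ ∈ 𝒯.Γ) {s : ℝ}
    (hs : s ∈ Icc (0 : ℝ) 1) : |φ (𝒯.Y (ξ, s)) - 𝒯.mean φ ξ| ≤
      𝒯.Λ * ∫ σ in (0 : ℝ)..1, ‖fderiv ℝ φ (𝒯.Y (ξ, σ)) (b (𝒯.Y (ξ, σ)))‖ := by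
  rw [abs_sub_comm]
  exact 𝒯.abs_sub_mean_le hφ.continuous hξ fun s' hs' => 𝒯.abs_sub_le_integral hφ hξ hs' hs

/-- The derivative of the mean is controlled by the mean of the derivative. The derivative of the
weight is multiplied by `φ - mean φ`, which is why no values of `φ` occur on the right. -/
lemma exists_norm_fderiv_mean_le : ∃ C, 0 ≤ C ∧ ∀ {φ : E (m + 1) → ℝ}, ContDiff ℝ 1 φ →
    ∀ ξ ∈ 𝒯.Γ, ‖fderiv ℝ (𝒯.mean φ) ξ‖ ≤ C * ∫ s in (0 : ℝ)..1, ‖fderiv ℝ φ (𝒯.Y (ξ, s))‖ := by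
  obtain ⟨c, hc, hW⟩ := 𝒯.exists_le_W
  obtain ⟨Cw, hCw, hw⟩ := 𝒯.exists_w_le
  obtain ⟨CY, hCY, hY⟩ := 𝒯.exists_fderiv_Y_le
  obtain ⟨Cd, hCd, hd⟩ := 𝒯.exists_fderiv_w_le
  have hΛ := 𝒯.Λ_pos
  refine ⟨(CY * Cw + 𝒯.Λ * Cd) / c, by positivity, fun {φ} hφ ξ hξ => ?_⟩
  have hΓ := 𝒯.param_in.isOpen
  have hΓu := 𝒯.isOpen_Γ_prod
  set A := ∫ s in (0 : ℝ)..1, ‖fderiv ℝ φ (𝒯.Y (ξ, s))‖ with hA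
  set u := 𝒯.mean φ ξ with hu
  set f : E m × ℝ → ℝ := fun p => φ (𝒯.Y p) with hf
  have hfC := 𝒯.contDiffOn_comp_Y hφ
  have hYs := 𝒯.continuous_Y_slice ξ
  have hA0 : 0 ≤ A := intervalIntegral.integral_nonneg zero_le_one fun _ _ => norm_nonneg _
  have hmem : ∀ s : ℝ, (ξ, s) ∈ 𝒯.Γ ×ˢ (univ : Set ℝ) := fun s => ⟨hξ, mem_univ s⟩
  -- the function `∫ (φ ∘ Y - u) w`, with `u` frozen, has the derivative `W • D (mean φ)` at `ξ`
  set g : E m × ℝ → ℝ := fun p => (f p - u) * 𝒯.w p with hg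
  have hgC : ContDiffOn ℝ 1 g (𝒯.Γ ×ˢ univ) := (hfC.sub contDiffOn_const).mul 𝒯.contDiffOn_w
  have h1 := hasFDerivAt_integral_param hΓ hgC 0 1 zero_le_one hξ
  have hmd : HasFDerivAt (𝒯.mean φ) (fderiv ℝ (𝒯.mean φ) ξ) ξ :=
    (((𝒯.contDiffOn_mean hφ).contDiffAt (hΓ.mem_nhds hξ)).differentiableAt one_ne_zero).hasFDerivAt
  have hWd : HasFDerivAt 𝒯.W (fderiv ℝ 𝒯.W ξ) ξ :=
    ((𝒯.contDiffOn_W.contDiffAt (hΓ.mem_nhds hξ)).differentiableAt one_ne_zero).hasFDerivAt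
  have h2 : HasFDerivAt (fun η => (𝒯.mean φ η - u) * 𝒯.W η) _ ξ := (hmd.sub_const u).mul hWd
  have h3 : (fun η => ∫ s in (0 : ℝ)..1, g (η, s)) =ᶠ[𝓝 ξ] fun η => (𝒯.mean φ η - u) * 𝒯.W η := by
    filter_upwards [hΓ.mem_nhds hξ] with η hη using 𝒯.integral_sub_mean hφ.continuous hη u
  have h4 := h1.unique (h2.congr_of_eventuallyEq h3)
  rw [← hu, sub_self] at h4
  have h4' : 𝒯.W ξ • fderiv ℝ (𝒯.mean φ) ξ =
      ∫ s in (0 : ℝ)..1, fderiv ℝ g (ξ, s) ∘L .inl ℝ (E m) ℝ := by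
    rw [h4]
    have : (0 : ℝ) • fderiv ℝ 𝒯.W ξ = 0 := zero_smul ℝ _
    rw [this, zero_add]
  have hgd : ∀ s ∈ Icc (0 : ℝ) 1, ‖fderiv ℝ g (ξ, s) ∘L .inl ℝ (E m) ℝ‖ ≤
      Cw * CY * ‖fderiv ℝ φ (𝒯.Y (ξ, s))‖ + 𝒯.Λ * A * Cd := by
    intro s hs
    have hYd : HasFDerivAt 𝒯.Y (fderiv ℝ 𝒯.Y (ξ, s)) (ξ, s) :=
      ((𝒯.contDiffOn_Y.contDiffAt (hΓu.mem_nhds (hmem s))).differentiableAt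
        one_ne_zero).hasFDerivAt
    have hwd : HasFDerivAt 𝒯.w (fderiv ℝ 𝒯.w (ξ, s)) (ξ, s) :=
      ((𝒯.contDiffOn_w.contDiffAt (hΓu.mem_nhds (hmem s))).differentiableAt
        one_ne_zero).hasFDerivAt
    have hfd : HasFDerivAt f (fderiv ℝ φ (𝒯.Y (ξ, s)) ∘L fderiv ℝ 𝒯.Y (ξ, s)) (ξ, s) :=
      (hφ.differentiable one_ne_zero _).hasFDerivAt.comp (ξ, s) hYd
    have hgd : HasFDerivAt g _ (ξ, s) := (hfd.sub_const u).mul hwd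
    have hinl : ‖ContinuousLinearMap.inl ℝ (E m) ℝ‖ ≤ 1 := ContinuousLinearMap.norm_inl_le_one ℝ (E m) ℝ
    refine (ContinuousLinearMap.opNorm_comp_le _ _).trans
      ((mul_le_of_le_one_right (norm_nonneg _) hinl).trans ?_)
    rw [hgd.fderiv]
    refine (norm_add_le _ _).trans ?_
    rw [norm_smul, norm_smul, add_comm, Real.norm_of_nonneg (𝒯.w_pos hξ).le]
    refine add_le_add ?_ ?_
    · rw [mul_assoc]
      refine mul_le_mul (hw _ ⟨hξ, hs⟩) ?_ (norm_nonneg _) hCw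
      refine (ContinuousLinearMap.opNorm_comp_le _ _).trans ?_
      rw [mul_comm]
      exact mul_le_mul_of_nonneg_right (hY _ ⟨hξ, hs⟩) (norm_nonneg _)
    · refine mul_le_mul ?_ (hd _ ⟨hξ, hs⟩) (norm_nonneg _) (by positivity)
      refine (𝒯.abs_sub_mean_le_integral hφ hξ hs).trans ?_
      refine mul_le_mul_of_nonneg_left ?_ hΛ.le
      refine intervalIntegral.integral_mono_on zero_le_one
        (Continuous.intervalIntegrable ?_ _ _) (Continuous.intervalIntegrable ?_ _ _)
        fun σ hσ => ?_
      · exact (((hφ.continuous_fderiv one_ne_zero).comp hYs).clm_apply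
          (𝒯.contDiff_b.continuous.comp hYs)).norm
      · exact ((hφ.continuous_fderiv one_ne_zero).comp hYs).norm
      · have hb : ‖b (𝒯.Y (ξ, σ))‖ ≤ 1 := by
          have h5 : closure Ω ⊆ {x | ‖b x‖ ≤ 1} := closure_minimal
            (fun x hx => (𝒯.norm_eq_one x hx).le)
            (isClosed_le 𝒯.contDiff_b.continuous.norm continuous_const)
          exact h5 (𝒯.Y_mem_closure ⟨hξ, hσ⟩)
        exact ((fderiv ℝ φ (𝒯.Y (ξ, σ))).le_opNorm _).trans
          (mul_le_of_le_one_right (norm_nonneg _) hb)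
  have h6 : ‖𝒯.W ξ • fderiv ℝ (𝒯.mean φ) ξ‖ ≤ (CY * Cw + 𝒯.Λ * Cd) * A := by
    rw [h4']
    refine (intervalIntegral.norm_integral_le_of_norm_le zero_le_one
      (g := fun s => Cw * CY * ‖fderiv ℝ φ (𝒯.Y (ξ, s))‖ + 𝒯.Λ * A * Cd)
      (Eventually.of_forall fun s hs => hgd s (Ioc_subset_Icc_self hs))
      (Continuous.intervalIntegrable ?_ _ _)).trans (le_of_eq ?_)
    · exact (continuous_const.mul ((hφ.continuous_fderiv one_ne_zero).comp hYs).norm).add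
        continuous_const
    · have e1 : IntervalIntegrable (fun s => Cw * CY * ‖fderiv ℝ φ (𝒯.Y (ξ, s))‖) volume 0 1 :=
        (continuous_const.mul ((hφ.continuous_fderiv one_ne_zero).comp hYs).norm).intervalIntegrable
          _ _
      rw [intervalIntegral.integral_add e1 (by simp), intervalIntegral.integral_const_mul]
      simp only [intervalIntegral.integral_const, sub_zero, one_smul]
      ring
  rw [norm_smul, Real.norm_of_nonneg (𝒯.W_pos hξ).le] at h6
  rw [div_mul_eq_mul_div, le_div_iff₀ hc, mul_comm]
  exact (mul_le_mul_of_nonneg_right (hW ξ hξ) (norm_nonneg _)).trans h6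

end TubeData

/-! ### Truncation -/

/-- Dominated convergence in `L²`. -/
lemma tendsto_Lp_of_dominated {α F G : Type*} [MeasurableSpace α] {μ : Measure α}
    [NormedAddCommGroup F] [NormedAddCommGroup G] {f : ℕ → Lp F 2 μ} {g : Lp F 2 μ} {H : Lp G 2 μ} {C : ℝ≥0}
    (h1 : ∀ n, ∀ᵐ x ∂μ, ‖f n x‖ ≤ C * ‖H x‖) (h2 : ∀ᵐ x ∂μ, Tendsto (fun n => f n x) atTop (𝓝 (g x))) :
    Tendsto f atTop (𝓝 g) := by
  rw [Lp.tendsto_Lp_iff_tendsto_eLpNorm']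
  have h22 : (2 : ℝ≥0∞) ≠ 0 := by norm_num
  have hexp : ∀ n, eLpNorm (⇑(f n) - ⇑g) 2 μ = (∫⁻ x, ‖f n x - g x‖ₑ ^ (2 : ℝ)∂μ) ^ (1 / 2 : ℝ) := fun n => by
    rw [eLpNorm_eq_lintegral_rpow_enorm_toReal h22 (by norm_num)]
    simp
  simp_rw [hexp]
  have hz : (0 : ℝ≥0∞) = (0 : ℝ≥0∞) ^ (1 / 2 : ℝ) := by simp
  rw [hz]
  refine ((ENNReal.continuous_rpow_const (y := (1 / 2 : ℝ))).tendsto 0).comp ?_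
  have h3 : Tendsto (fun n => ∫⁻ x, ‖f n x - g x‖ₑ ^ (2 : ℝ) ∂μ) atTop (𝓝 (∫⁻ _, 0 ∂μ)) := by
    refine tendsto_lintegral_of_dominated_convergence'
      (fun x => ‖C * ‖H x‖ + ‖g x‖‖ₑ ^ (2 : ℝ)) (fun n => ?_) (fun n => ?_) ?_ ?_
    · exact ((Lp.aestronglyMeasurable (f n)).sub (Lp.aestronglyMeasurable g)).enorm.pow_const _
    · filter_upwards [h1 n] with x hx
      refine ENNReal.rpow_le_rpow ?_ (by norm_num)
      rw [enorm_le_iff_norm_le, Real.norm_of_nonneg (by positivity)]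
      exact (norm_sub_le _ _).trans (by gcongr)
    · have hm : MemLp (fun x => C * ‖H x‖ + ‖g x‖) 2 μ :=
        ((Lp.memLp H).norm.const_mul _).add (Lp.memLp g).norm
      have := lintegral_rpow_enorm_lt_top_of_eLpNorm_lt_top h22 (by norm_num) hm.2
      simpa using this.ne
    · filter_upwards [h2] with x hx
      have h4 : Tendsto (fun n => ‖f n x - g x‖ₑ) atTop (𝓝 0) := by
        have := (hx.sub_const (g x)).enorm
        simpa using this
      have := ((ENNReal.continuous_rpow_const (y := (2 : ℝ))).tendsto 0).comp h4
      rwa [ENNReal.zero_rpow_of_pos two_pos] at this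
  simpa using h3

/-- A smooth truncation of the identity near the origin. -/
lemma exists_truncation : ∃ (χ : ℝ → ℝ) (C : ℝ), ContDiff ℝ 1 χ ∧ (∀ r, |χ r| ≤ |r|) ∧
    (∀ r, |r| ≤ 1 → χ r = 0) ∧ (∀ r, 2 ≤ |r| → χ r = r) ∧ ∀ r, |deriv χ r| ≤ C := by
  set χ : ℝ → ℝ := fun r => r * Real.smoothTransition (r ^ 2 - 1) with hχ
  have hsm : ContDiff ℝ 1 χ :=
    contDiff_id.mul (Real.smoothTransition.contDiff.comp ((contDiff_id.pow 2).sub contDiff_const))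
  have h1 : ∀ r, 2 ≤ |r| → χ r = r := fun r hr => by
    have : (1 : ℝ) ≤ r ^ 2 - 1 := by
      rw [← sq_abs]; nlinarith
    simp only [hχ, Real.smoothTransition.one_of_one_le this, mul_one]
  obtain ⟨C, hC⟩ := (isCompact_Icc (a := (-2 : ℝ)) (b := 2)).exists_bound_of_continuousOn
    (hsm.continuous_deriv le_rfl).continuousOn
  refine ⟨χ, max C 1, hsm, fun r => ?_, fun r hr => ?_, h1, fun r => ?_⟩
  · rw [hχ, abs_mul, abs_of_nonneg (Real.smoothTransition.nonneg _)]
    exact mul_le_of_le_one_right (abs_nonneg _) (Real.smoothTransition.le_one _)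
  · have : r ^ 2 - 1 ≤ 0 := by
      rw [← sq_abs]; nlinarith [abs_nonneg r]
    simp only [hχ, Real.smoothTransition.zero_of_nonpos this, mul_zero]
  · by_cases hr : |r| ≤ 2
    · exact (hC r (abs_le.1 hr)).trans (le_max_left _ _)
    · push Not at hr
      have h2 : χ =ᶠ[𝓝 r] id := by
        filter_upwards [(isOpen_lt continuous_const continuous_abs).mem_nhds hr] with t ht
        exact h1 t ht.le
      rw [h2.deriv_eq, deriv_id, abs_one]
      exact le_max_right _ _

/-- The derivative of a function vanishes almost everywhere on its zero set. -/
lemma ae_fderiv_eq_zero_of_eq_zero {d : ℕ} {Ω : Set (E (d + 1))} (hΩ : IsOpen Ω) {U : E (d + 1) → ℝ}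
    (hU : DifferentiableOn ℝ U Ω) : ∀ᵐ x ∂(volume.restrict Ω), U x = 0 → fderiv ℝ U x = 0 := by
  set s : Set (E (d + 1)) := Ω ∩ U ⁻¹' {0} with hs
  have hsm : MeasurableSet s := by
    have : s = Ω \ (Ω ∩ U ⁻¹' {0}ᶜ) := by
      ext x; simp [hs]
    rw [this]
    exact hΩ.measurableSet.diff (hU.continuousOn.isOpen_inter_preimage hΩ
      isOpen_compl_singleton).measurableSet
  set e : E (d + 1) := EuclideanSpace.single 0 1 with he
  have hen : ‖e‖ = 1 := by simp [he]
  have h1 : ApproximatesLinearOn (fun x => U x • e) (0 : E (d + 1) →L[ℝ] E (d + 1)) s 0 := by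
    intro x hx y hy
    have hx0 : U x = 0 := hx.2
    have hy0 : U y = 0 := hy.2
    simp [hx0, hy0]
  have h2 := h1.norm_fderiv_sub_le volume hsm (fun x => (fderiv ℝ U x).smulRight e) fun x hx =>
    (((hU.differentiableAt (hΩ.mem_nhds hx.1)).hasFDerivAt.smul_const e).hasFDerivWithinAt)
  rw [ae_restrict_iff' hsm] at h2
  rw [ae_restrict_iff' hΩ.measurableSet]
  filter_upwards [h2] with x hx hxΩ hx0
  have h3 := hx ⟨hxΩ, hx0⟩
  rw [sub_zero, nonpos_iff_eq_zero, nnnorm_eq_zero] at h3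
  ext v
  have h4 : fderiv ℝ U x v • e = 0 := congrArg (fun A : E (d + 1) →L[ℝ] E (d + 1) => A v) h3
  rcases smul_eq_zero.1 h4 with h5 | h5
  · exact h5
  · rw [h5, norm_zero] at hen; norm_num at hen

lemma norm_gradient {d : ℕ} (ψ : E d → ℝ) (x : E d) : ‖∇ ψ x‖ = ‖fderiv ℝ ψ x‖ := by
  simp [gradient]

namespace TubeData
variable {m : ℕ} {Ω : Set (E (m + 1))} {b : E (m + 1) → E (m + 1)} (𝒯 : TubeData Ω b)

lemma contDiffAt_comp_ζ {u : E m → ℝ} (hu : ContDiffOn ℝ 1 u 𝒯.Γ) {x : E (m + 1)} (hx : x ∈ Ω) :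
    ContDiffAt ℝ 1 (fun y => u (𝒯.ζ y)) x :=
  ContDiffAt.comp (g := u) x (hu.contDiffAt (𝒯.param_in.isOpen.mem_nhds (𝒯.ζ_mem hx)))
    (𝒯.contDiffAt_ζ hx)

/-- A function which is constant along field lines and small near the lateral boundary lies in
`𝒱`, being the limit of its truncations. -/
lemma mem_closure_classicalV {u : E m → ℝ} (hu : ContDiffOn ℝ 1 u 𝒯.Γ)
    (hK : ∀ ε > 0, ∃ K ⊆ 𝒯.Γ, IsCompact K ∧ ∀ ξ ∈ 𝒯.Γ, ξ ∉ K → |u ξ| ≤ ε)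
    {p : WithLp 2 (L2 Ω × L2V Ω)} (h1 : p.fst =ᵐ[volume.restrict Ω] fun x => u (𝒯.ζ x))
    (h2 : p.snd =ᵐ[volume.restrict Ω] ∇ (fun x => u (𝒯.ζ x))) :
    p ∈ (classicalV Ω b).topologicalClosure := by
  obtain ⟨χ, C, hχ, hχle, hχ0, hχ1, hC⟩ := exists_truncation
  set U : E (m + 1) → ℝ := fun x => u (𝒯.ζ x) with hU
  set ε : ℕ → ℝ := fun n => 1 / ((n : ℝ) + 1) with hε
  have hε0 : ∀ n, 0 < ε n := fun n => by positivity
  have hεt : Tendsto ε atTop (𝓝 0) := tendsto_one_div_add_atTop_nhds_zero_nat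
  -- truncation at the height `ε n`; its derivative is bounded independently of `n`
  set θ : ℕ → ℝ → ℝ := fun n r => ε n * χ (r / ε n) with hθ
  have hθs : ∀ n, ContDiff ℝ 1 (θ n) := fun n =>
    contDiff_const.mul (hχ.comp (contDiff_id.div_const _))
  have hθle : ∀ n r, |θ n r| ≤ |r| := fun n r => by
    rw [hθ, abs_mul, abs_of_pos (hε0 n)]
    calc ε n * |χ (r / ε n)| ≤ ε n * |r / ε n| := mul_le_mul_of_nonneg_left (hχle _) (hε0 n).le
      _ = |r| := by rw [abs_div, abs_of_pos (hε0 n), mul_div_cancel₀ _ (hε0 n).ne']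
  have hθ0 : ∀ n r, |r| ≤ ε n → θ n r = 0 := fun n r hr => by
    have : χ (r / ε n) = 0 := hχ0 _ (by rw [abs_div, abs_of_pos (hε0 n)]; exact (div_le_one (hε0 n)).2 hr)
    simp only [hθ, this, mul_zero]
  have hθ1 : ∀ n r, 2 * ε n ≤ |r| → θ n r = r := fun n r hr => by
    have : χ (r / ε n) = r / ε n :=
      hχ1 _ (by rw [abs_div, abs_of_pos (hε0 n)]; exact (le_div_iff₀ (hε0 n)).2 hr)
    simp only [hθ, this, mul_div_cancel₀ _ (hε0 n).ne']
  have hθd : ∀ n r, |deriv (θ n) r| ≤ C := fun n r => by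
    have h3 : HasDerivAt (θ n) (ε n * (deriv χ (r / ε n) * (1 / ε n))) r :=
      (HasDerivAt.comp r (hχ.differentiable one_ne_zero _).hasDerivAt
        ((hasDerivAt_id r).div_const _)).const_mul _
    rw [h3.deriv, mul_comm (deriv χ _), ← mul_assoc, mul_one_div_cancel (hε0 n).ne', one_mul]
    exact hC _
  have hlarge : ∀ r : ℝ, r ≠ 0 → ∀ᶠ n in atTop, 2 * ε n < |r| := fun r hr => by
    have h3 := hεt.const_mul 2
    rw [mul_zero] at h3
    exact h3.eventually (gt_mem_nhds (abs_pos.2 hr))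
  have hθt : ∀ r, Tendsto (fun n => θ n r) atTop (𝓝 r) := fun r => by
    rcases eq_or_ne r 0 with rfl | hr
    · refine tendsto_const_nhds.congr fun n => (hθ0 n 0 ?_).symm
      rw [abs_zero]; exact (hε0 n).le
    · refine tendsto_const_nhds.congr' ?_
      filter_upwards [hlarge r hr] with n hn
      exact (hθ1 n r hn.le).symm
  have hθdt : ∀ r, r ≠ 0 → Tendsto (fun n => deriv (θ n) r) atTop (𝓝 1) := fun r hr => by
    refine tendsto_const_nhds.congr' ?_
    filter_upwards [hlarge r hr] with n hn
    have h3 : θ n =ᶠ[𝓝 r] id := by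
      filter_upwards [(isOpen_lt continuous_const continuous_abs).mem_nhds hn] with t ht
      exact hθ1 n t ht.le
    rw [h3.deriv_eq, deriv_id]
  -- the truncated functions extend to the whole space
  have hext : ∀ n, ∃ φ : E (m + 1) → ℝ, ContDiff ℝ 1 φ ∧ (∀ x ∈ tangentialBdry Ω b, φ x = 0) ∧
      ∀ x ∈ Ω, φ x = θ n (U x) := by
    intro n
    obtain ⟨K, hKΓ, hKc, hKu⟩ := hK (ε n) (hε0 n)
    obtain ⟨φ, hφ1, hφ2, hφ3⟩ := 𝒯.exists_extension (F := fun q => θ n (u q.1))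
      ((hθs n).comp_contDiffOn (hu.comp contDiffOn_fst fun q hq => hq.1)) hKc hKΓ
      fun ξ hξ hξK _ => hθ0 n _ (hKu ξ hξ hξK)
    refine ⟨φ, hφ1, hφ2, fun x hx => ?_⟩
    have := hφ3 _ (𝒯.ζ_mem hx) _ (Ioo_subset_Icc_self (𝒯.θ_mem hx))
    rwa [𝒯.Y_ζ_θ hx] at this
  choose φ hφ1 hφ2 hφ3 using hext
  have hgrad : ∀ n, ∀ x ∈ Ω, ∇ (φ n) x = deriv (θ n) (U x) • ∇ U x := by
    intro n x hx
    have h3 : φ n =ᶠ[𝓝 x] fun y => θ n (U y) := by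
      filter_upwards [𝒯.isOpen.mem_nhds hx] with y hy
      exact hφ3 n y hy
    have h4 : HasFDerivAt (fun y => θ n (U y)) (deriv (θ n) (U x) • fderiv ℝ U x) x :=
      ((hθs n).differentiable one_ne_zero _).hasDerivAt.comp_hasFDerivAt x
        ((𝒯.contDiffAt_comp_ζ hu hx).differentiableAt one_ne_zero).hasFDerivAt
    rw [gradient, h3.fderiv_eq, h4.fderiv, map_smul]
    rfl
  have hΩm := ae_restrict_mem (μ := volume) 𝒯.isOpen.measurableSet
  have hC0 : 0 ≤ C := (abs_nonneg _).trans (hC 0)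
  have b1 : ∀ n, ∀ᵐ x ∂(volume.restrict Ω), ‖φ n x‖ ≤ (1 : ℝ≥0) * ‖p.fst x‖ := fun n => by
    filter_upwards [hΩm, h1] with x hx hx1
    rw [hx1, hφ3 n x hx, NNReal.coe_one, one_mul]
    exact hθle n _
  have b2 : ∀ n, ∀ᵐ x ∂(volume.restrict Ω), ‖∇ (φ n) x‖ ≤ (⟨C, hC0⟩ : ℝ≥0) * ‖p.snd x‖ := fun n => by
    filter_upwards [hΩm, h2] with x hx hx1
    rw [hx1, hgrad n x hx, norm_smul]
    exact mul_le_mul_of_nonneg_right (hθd n _) (norm_nonneg _)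
  have m1 : ∀ n, MemLp (φ n) 2 (volume.restrict Ω) := fun n =>
    (Lp.memLp p.fst).of_le_mul (hφ1 n).continuous.aestronglyMeasurable (b1 n)
  have m2 : ∀ n, MemLp (∇ (φ n)) 2 (volume.restrict Ω) := fun n => by
    refine (Lp.memLp p.snd).of_le_mul ?_ (b2 n)
    exact ((InnerProductSpace.toDual ℝ (E (m + 1))).symm.continuous.comp
      ((hφ1 n).continuous_fderiv one_ne_zero)).aestronglyMeasurable
  have t1 : Tendsto (fun n => (m1 n).toLp (φ n)) atTop (𝓝 p.fst) := by
    refine tendsto_Lp_of_dominated (H := p.fst) (C := 1) (fun n => ?_) ?_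
    · filter_upwards [b1 n, (m1 n).coeFn_toLp] with x hx1 hx2
      rwa [hx2]
    · filter_upwards [ae_all_iff.2 fun n => (m1 n).coeFn_toLp, hΩm, h1] with x hx1 hx2 hx3
      simp_rw [hx1, hx3, fun n => hφ3 n x hx2]
      exact hθt _
  have t2 : Tendsto (fun n => (m2 n).toLp (∇ (φ n))) atTop (𝓝 p.snd) := by
    refine tendsto_Lp_of_dominated (H := p.snd) (C := ⟨C, hC0⟩) (fun n => ?_) ?_
    · filter_upwards [b2 n, (m2 n).coeFn_toLp] with x hx1 hx2
      rwa [hx2]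
    · have h5 := ae_fderiv_eq_zero_of_eq_zero 𝒯.isOpen (U := U) fun x hx =>
        ((𝒯.contDiffAt_comp_ζ hu hx).differentiableAt one_ne_zero).differentiableWithinAt
      filter_upwards [ae_all_iff.2 fun n => (m2 n).coeFn_toLp, hΩm, h2, h5] with x hx1 hx2 hx3 hx4
      simp_rw [hx1, hx3, fun n => hgrad n x hx2]
      rcases eq_or_ne (U x) 0 with h6 | h6
      · have : ∇ U x = 0 := by rw [gradient, hx4 h6, map_zero]
        simp only [this, smul_zero]
        exact tendsto_const_nhds
      · have := (hθdt _ h6).smul_const (∇ U x)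
        rwa [one_smul] at this
  have t3 : Tendsto (fun n => WithLp.toLp 2 ((m1 n).toLp (φ n), (m2 n).toLp (∇ (φ n)))) atTop
      (𝓝 p) := by
    have := ((WithLp.prodContinuousLinearEquiv 2 ℝ (L2 Ω) (L2V Ω)).symm.continuous.tendsto
      (p.fst, p.snd)).comp (t1.prodMk_nhds t2)
    exact this
  exact mem_closure_of_tendsto t3 (Eventually.of_forall fun n =>
    ⟨φ n, hφ1 n, hφ2 n, (m1 n).coeFn_toLp, (m2 n).coeFn_toLp⟩)

end TubeData

namespace TubeData
variable {m : ℕ} {Ω : Set (E (m + 1))} {b : E (m + 1) → E (m + 1)} (𝒯 : TubeData Ω b)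

/-! ### Means of smooth functions -/

lemma continuousOn_comp_ζ {η : E m → ℝ} (hη : ContinuousOn η 𝒯.Γ) :
    ContinuousOn (fun x => η (𝒯.ζ x)) Ω :=
  hη.comp (fun _ hx => (𝒯.contDiffAt_ζ hx).continuousAt.continuousWithinAt) fun _ hx => 𝒯.ζ_mem hx

lemma fderiv_comp_ζ {u : E m → ℝ} (hu : ContDiffOn ℝ 1 u 𝒯.Γ) {x : E (m + 1)} (hx : x ∈ Ω) :
    fderiv ℝ (fun y => u (𝒯.ζ y)) x = fderiv ℝ u (𝒯.ζ x) ∘L fderiv ℝ 𝒯.ζ x :=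
  fderiv_comp x ((hu.contDiffAt (𝒯.param_in.isOpen.mem_nhds (𝒯.ζ_mem hx))).differentiableAt
    one_ne_zero) ((𝒯.contDiffAt_ζ hx).differentiableAt one_ne_zero)

/-- `φ - mean φ` is orthogonal to the functions which are constant along field lines. -/
lemma integral_sub_mean_mul {φ : E (m + 1) → ℝ} (hφ : ContDiff ℝ 1 φ) {η : E m → ℝ}
    (hη : ContinuousOn η 𝒯.Γ) :
    ∫ x in Ω, (φ x - 𝒯.mean φ (𝒯.ζ x)) * η (𝒯.ζ x) = 0 := by
  have hm : AEStronglyMeasurable (fun x => (φ x - 𝒯.mean φ (𝒯.ζ x)) * η (𝒯.ζ x))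
      (volume.restrict Ω) :=
    ((hφ.continuous.continuousOn.sub (𝒯.continuousOn_comp_ζ (𝒯.contDiffOn_mean hφ).continuousOn)).mul
      (𝒯.continuousOn_comp_ζ hη)).aestronglyMeasurable 𝒯.isOpen.measurableSet
  rw [𝒯.integral_eq_vol hm]
  have h1 : (fun p => 𝒯.w p • ((φ (𝒯.Y p) - 𝒯.mean φ (𝒯.ζ (𝒯.Y p))) * η (𝒯.ζ (𝒯.Y p)))) =ᵐ[𝒯.vol]
      fun p => η p.1 * ((φ (𝒯.Y p) - 𝒯.mean φ p.1) * 𝒯.w p) := by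
    filter_upwards [𝒯.ae_vol_mem] with p hp
    rw [𝒯.ζ_Y hp, smul_eq_mul]
    ring
  rw [integral_congr_ae h1]
  by_cases hi : Integrable (fun p : E m × ℝ => η p.1 * ((φ (𝒯.Y p) - 𝒯.mean φ p.1) * 𝒯.w p)) 𝒯.vol
  · rw [vol] at hi ⊢
    rw [integral_prod _ hi]
    refine (setIntegral_congr_fun (g := fun _ => 0) 𝒯.param_in.isOpen.measurableSet
      fun ξ hξ => ?_).trans (by simp)
    simp only
    rw [integral_const_mul, ← integral_Ioc_eq_integral_Ioo,
      ← intervalIntegral.integral_of_le zero_le_one, 𝒯.integral_sub_mean hφ.continuous hξ, sub_self,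
      zero_mul, mul_zero]
  · exact integral_undef hi

/-- The mean along field lines of a function in `C¹(closure Ω)` which vanishes on `∂Ω_D`: it
lies in `𝒱`, it is constant along field lines, and it obeys the two estimates. -/
lemma exists_mean_classicalV : ∃ C : ℝ, 0 ≤ C ∧ ∀ w ∈ classicalV Ω b,
    ∃ p ∈ (classicalV Ω b).topologicalClosure, dirL 𝒯.isUnitField p.snd = 0 ∧
      ‖p.snd‖ ≤ C * ‖w.snd‖ ∧ ‖w.fst - p.fst‖ ≤ C * ‖dirL 𝒯.isUnitField w.snd‖ ∧
      (∃ η, ContinuousOn η 𝒯.Γ ∧ p.fst =ᵐ[volume.restrict Ω] fun x => η (𝒯.ζ x)) ∧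
      ∀ (v : L2 Ω) (η : E m → ℝ), ContinuousOn η 𝒯.Γ →
        (v =ᵐ[volume.restrict Ω] fun x => η (𝒯.ζ x)) → ⟪w.fst - p.fst, v⟫ = 0 := by
  obtain ⟨C₀, hfib⟩ := 𝒯.exists_eLpNorm_le_of_fiber
  obtain ⟨C₁, hC₁, hmean⟩ := 𝒯.exists_norm_fderiv_mean_le
  obtain ⟨C₂, hC₂, hζ⟩ := 𝒯.exists_fderiv_ζ_le
  have hΛ := 𝒯.Λ_pos
  set M : ℝ := max (C₁ * C₂) 𝒯.Λ with hM
  have hM0 : 0 ≤ M := hΛ.le.trans (le_max_right _ _)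
  refine ⟨C₀ * M, by positivity, ?_⟩
  rintro w ⟨φ, hφ, hφ0, hw1, hw2⟩
  set u := 𝒯.mean φ with hu
  set U : E (m + 1) → ℝ := fun x => u (𝒯.ζ x) with hU
  have huC : ContDiffOn ℝ 1 u 𝒯.Γ := 𝒯.contDiffOn_mean hφ
  have hΩm := ae_restrict_mem (μ := volume) 𝒯.isOpen.measurableSet
  have hUC : ContinuousOn U Ω := 𝒯.continuousOn_comp_ζ huC.continuousOn
  have hUm : AEStronglyMeasurable U (volume.restrict Ω) :=
    hUC.aestronglyMeasurable 𝒯.isOpen.measurableSet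
  have hgc : Continuous (∇ φ) := (InnerProductSpace.toDual ℝ (E (m + 1))).symm.continuous.comp
    (hφ.continuous_fderiv one_ne_zero)
  have hUd : ContinuousOn (∇ U) Ω := by
    have h1 : ContinuousOn (fderiv ℝ U) Ω := ContDiffOn.continuousOn_fderiv_of_isOpen
      (fun x hx => (𝒯.contDiffAt_comp_ζ huC hx).contDiffWithinAt) 𝒯.isOpen le_rfl
    exact (InnerProductSpace.toDual ℝ (E (m + 1))).symm.continuous.comp_continuousOn h1
  have hUdm : AEStronglyMeasurable (∇ U) (volume.restrict Ω) :=
    hUd.aestronglyMeasurable 𝒯.isOpen.measurableSet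
  have hdm : Continuous fun x => ⟪b x, ∇ φ x⟫ := 𝒯.contDiff_b.continuous.inner hgc
  -- the two estimates
  have e1 : eLpNorm (∇ U) 2 (volume.restrict Ω) ≤ C₀ * eLpNorm (fun x => M • ∇ φ x) 2 (volume.restrict Ω) := by
    refine hfib _ _ hUdm (hgc.const_smul M).aestronglyMeasurable fun x hx => ?_
    refine enorm_le_lintegral_of_norm_le (f := fun s => M • ∇ φ (𝒯.Y (𝒯.ζ x, s))) ?_
    simp_rw [norm_smul, norm_gradient, Real.norm_of_nonneg hM0]
    rw [intervalIntegral.integral_const_mul, hU, 𝒯.fderiv_comp_ζ huC hx]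
    refine (ContinuousLinearMap.opNorm_comp_le _ _).trans ?_
    refine (mul_le_mul (hmean hφ _ (𝒯.ζ_mem hx)) (hζ x hx) (norm_nonneg _) ?_).trans ?_
    · exact mul_nonneg hC₁ (intervalIntegral.integral_nonneg zero_le_one fun _ _ => norm_nonneg _)
    · rw [mul_right_comm]
      exact mul_le_mul_of_nonneg_right (le_max_left _ _)
        (intervalIntegral.integral_nonneg zero_le_one fun _ _ => norm_nonneg _)
  have e2 : eLpNorm (fun x => φ x - U x) 2 (volume.restrict Ω) ≤
      C₀ * eLpNorm (fun x => M • ⟪b x, ∇ φ x⟫) 2 (volume.restrict Ω) := by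
    refine hfib _ _ (hφ.continuous.aestronglyMeasurable.sub hUm)
      (hdm.const_smul M).aestronglyMeasurable fun x hx => ?_
    refine enorm_le_lintegral_of_norm_le
      (f := fun s => M • ⟪b (𝒯.Y (𝒯.ζ x, s)), ∇ φ (𝒯.Y (𝒯.ζ x, s))⟫) ?_
    simp_rw [norm_smul, inner_gradient, Real.norm_of_nonneg hM0]
    rw [intervalIntegral.integral_const_mul]
    have h1 := 𝒯.abs_sub_mean_le_integral hφ (𝒯.ζ_mem hx) (Ioo_subset_Icc_self (𝒯.θ_mem hx))
    rw [𝒯.Y_ζ_θ hx] at h1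
    exact h1.trans (mul_le_mul_of_nonneg_right (le_max_right _ _)
      (intervalIntegral.integral_nonneg zero_le_one fun _ _ => norm_nonneg _))
  have e1' : eLpNorm (∇ U) 2 (volume.restrict Ω) ≤ C₀ * (‖M‖ₑ * ‖w.snd‖ₑ) := by
    refine e1.trans (le_of_eq ?_)
    rw [Lp.enorm_def, eLpNorm_congr_ae hw2]
    congr 1
    exact eLpNorm_const_smul M (∇ φ) 2 (volume.restrict Ω)
  have hdw : dirL 𝒯.isUnitField w.snd =ᵐ[volume.restrict Ω] fun x => ⟪b x, ∇ φ x⟫ := by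
    filter_upwards [coeFn_dirL 𝒯.isUnitField w.snd, hw2] with x h1 h2
    rw [h1, h2]
  have e2' : eLpNorm (fun x => φ x - U x) 2 (volume.restrict Ω) ≤
      C₀ * (‖M‖ₑ * ‖dirL 𝒯.isUnitField w.snd‖ₑ) := by
    refine e2.trans (le_of_eq ?_)
    rw [Lp.enorm_def, eLpNorm_congr_ae hdw]
    congr 1
    exact eLpNorm_const_smul M (fun x => ⟪b x, ∇ φ x⟫) 2 (volume.restrict Ω)
  have m2 : MemLp (∇ U) 2 (volume.restrict Ω) :=
    ⟨hUdm, e1'.trans_lt (ENNReal.mul_lt_top ENNReal.coe_lt_top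
      (ENNReal.mul_lt_top enorm_lt_top enorm_lt_top))⟩
  have m3 : MemLp (fun x => φ x - U x) 2 (volume.restrict Ω) :=
    ⟨hφ.continuous.aestronglyMeasurable.sub hUm, e2'.trans_lt (ENNReal.mul_lt_top ENNReal.coe_lt_top
      (ENNReal.mul_lt_top enorm_lt_top enorm_lt_top))⟩
  have mφ : MemLp φ 2 (volume.restrict Ω) := (Lp.memLp w.fst).ae_eq hw1
  have m1 : MemLp U 2 (volume.restrict Ω) := by
    refine (mφ.sub m3).ae_eq (Eventually.of_forall fun x => ?_)
    simp
  set p : WithLp 2 (L2 Ω × L2V Ω) := WithLp.toLp 2 (m1.toLp U, m2.toLp (∇ U)) with hp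
  have hp1 : p.fst =ᵐ[volume.restrict Ω] U := m1.coeFn_toLp
  have hp2 : p.snd =ᵐ[volume.restrict Ω] ∇ U := m2.coeFn_toLp
  have hsub : ((w.fst - p.fst : L2 Ω) : E (m + 1) → ℝ) =ᵐ[volume.restrict Ω] fun x => φ x - U x := by
    filter_upwards [Lp.coeFn_sub w.fst p.fst, hw1, hp1] with x h1 h2 h3
    rw [h1, Pi.sub_apply, h2, h3]
  have hconv : ∀ {F G : Type} [NormedAddCommGroup F] [NormedAddCommGroup G] (x : F) (y : G),
      ‖x‖ₑ ≤ C₀ * (‖M‖ₑ * ‖y‖ₑ) → ‖x‖ ≤ C₀ * M * ‖y‖ := by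
    intro F G _ _ x y h
    have h1 := ENNReal.toReal_mono (ENNReal.mul_ne_top ENNReal.coe_ne_top
      (ENNReal.mul_ne_top enorm_ne_top enorm_ne_top)) h
    simpa [Real.norm_of_nonneg hM0, mul_assoc] using h1
  refine ⟨p, 𝒯.mem_closure_classicalV huC ?_ hp1 hp2, ?_, ?_, ?_, ⟨u, huC.continuousOn, hp1⟩, ?_⟩
  · intro ε hε
    obtain ⟨K, hKΓ, hK, h⟩ := 𝒯.exists_isCompact_of_eqOn_zero hφ.continuous hφ0 hε
    refine ⟨K, hKΓ, hK, fun ξ hξ hξK => ?_⟩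
    have := 𝒯.abs_sub_mean_le hφ.continuous hξ (c := 0) (r := ε) fun s hs => by
      rw [sub_zero]; exact h ξ hξ hξK s hs
    rwa [sub_zero] at this
  · rw [Lp.eq_zero_iff_ae_eq_zero]
    filter_upwards [coeFn_dirL 𝒯.isUnitField p.snd, hp2, hΩm] with x h1 h2 hx
    rw [h1, h2, inner_gradient, hU, 𝒯.fderiv_comp_ζ huC hx, ContinuousLinearMap.comp_apply,
      𝒯.fderiv_ζ_b hx, map_zero, Pi.zero_apply]
  · refine hconv _ _ ?_
    rwa [Lp.enorm_def p.snd, eLpNorm_congr_ae hp2]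
  · refine hconv _ _ ?_
    rwa [Lp.enorm_def (w.fst - p.fst), eLpNorm_congr_ae hsub]
  · intro v η hη hv
    rw [← 𝒯.integral_sub_mean_mul hφ hη, L2.inner_def]
    refine integral_congr_ae ?_
    filter_upwards [hsub, hv] with x h1 h2
    rw [h1, h2, RCLike.inner_apply, conj_trivial, mul_comm]

end TubeData

/-! ### Existence and estimates of the projection -/

section
variable {F G : Type*} [NormedAddCommGroup F] [NormedAddCommGroup G]

lemma norm_fst_le_withLp (x : WithLp 2 (F × G)) : ‖x.fst‖ ≤ ‖x‖ := by
  rw [WithLp.prod_norm_eq_of_L2]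
  exact Real.le_sqrt_of_sq_le (by nlinarith [sq_nonneg ‖x.snd‖])

lemma norm_snd_le_withLp (x : WithLp 2 (F × G)) : ‖x.snd‖ ≤ ‖x‖ := by
  rw [WithLp.prod_norm_eq_of_L2]
  exact Real.le_sqrt_of_sq_le (by nlinarith [sq_nonneg ‖x.fst‖])

lemma norm_withLp_le_add (x : WithLp 2 (F × G)) : ‖x‖ ≤ ‖x.fst‖ + ‖x.snd‖ := by
  rw [WithLp.prod_norm_eq_of_L2]
  exact Real.sqrt_le_iff.2 ⟨by positivity, by nlinarith [mul_nonneg (norm_nonneg x.fst) (norm_nonneg x.snd)]⟩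

end

namespace TubeData
variable {m : ℕ} {Ω : Set (E (m + 1))} {b : E (m + 1) → E (m + 1)} (𝒯 : TubeData Ω b)

/-- The property which characterizes `P φ`. -/
def IsProjection (φ p : spaceV Ω b) : Prop :=
  p ∈ spaceG Ω b ∧ ∀ ψ ∈ spaceG Ω b, ⟪p.1.fst, ψ.1.fst⟫ = ⟪φ.1.fst, ψ.1.fst⟫

/-- An element of `𝒱` is determined by its class in `L²(Ω)`. -/
lemma eq_zero_of_fst (𝒯 : TubeData Ω b) {φ : spaceV Ω b} (h : φ.1.fst = 0) : φ = 0 := by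
  have h1 : IsWeakGradient Ω φ.1.fst φ.1.snd := φ.2.1
  have h2 : IsWeakGradient Ω (0 : spaceV Ω b).1.fst (0 : spaceV Ω b).1.snd := (0 : spaceV Ω b).2.1
  have h3 : φ.1.snd = (0 : spaceV Ω b).1.snd := by
    refine IsWeakGradient.unique 𝒯.isOpen h1 ?_
    rw [h]; exact h2
  refine Subtype.ext (WithLp.ofLp_injective 2 (Prod.ext h h3))

lemma IsProjection.unique (𝒯 : TubeData Ω b) {φ p q : spaceV Ω b} (hp : IsProjection φ p)
    (hq : IsProjection φ q) : p = q := by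
  rw [← sub_eq_zero]
  refine 𝒯.eq_zero_of_fst ?_
  have h1 : p - q ∈ spaceG Ω b := sub_mem hp.1 hq.1
  have h2 : (p - q).1.fst = p.1.fst - q.1.fst := rfl
  rw [← inner_self_eq_zero (𝕜 := ℝ)]
  conv_lhs => rw [h2, inner_sub_left]
  rw [← h2, hp.2 _ h1, hq.2 _ h1, sub_self]

/-- The projection of a function in `C¹(closure Ω)` which vanishes on `∂Ω_D`. -/
lemma exists_isProjection : ∃ C : ℝ, 0 ≤ C ∧ ∀ w : spaceV Ω b, w.1 ∈ classicalV Ω b →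
    ∃ p : spaceV Ω b, IsProjection w p ∧ ‖p.1.snd‖ ≤ C * ‖w.1.snd‖ ∧
      ‖w.1.fst - p.1.fst‖ ≤ C * ‖dirL 𝒯.isUnitField w.1.snd‖ := by
  obtain ⟨C, hC, h⟩ := 𝒯.exists_mean_classicalV
  refine ⟨C, hC, fun w hw => ?_⟩
  obtain ⟨p, hp, hpG, hp1, hp2, -, hp3⟩ := h w.1 hw
  rw [← spaceV_eq] at hp
  refine ⟨⟨p, hp⟩, ⟨(mem_spaceG_iff 𝒯.isUnitField _).2 hpG, fun ψ hψ => ?_⟩, hp1, hp2⟩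
  -- approximate `ψ` by classical functions; their means approximate `ψ` in `L²` as well
  have hψV : ψ.1 ∈ (classicalV Ω b).topologicalClosure := by rw [← spaceV_eq]; exact ψ.2
  obtain ⟨ψk, hψk, hlim⟩ := mem_closure_iff_seq_limit.1 hψV
  choose q _ _ _ hq2 hq3 _ using fun k => h (ψk k) (hψk k)
  have hl1 : Tendsto (fun k => (ψk k).fst) atTop (𝓝 ψ.1.fst) :=
    ((WithLp.fstL 2 ℝ (L2 Ω) (L2V Ω)).continuous.tendsto ψ.1).comp hlim
  have hl2 : Tendsto (fun k => dirL 𝒯.isUnitField (ψk k).snd) atTop (𝓝 0) := by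
    have := (((dirL 𝒯.isUnitField).continuous.comp
      (WithLp.sndL 2 ℝ (L2 Ω) (L2V Ω)).continuous).tendsto ψ.1).comp hlim
    rw [Function.comp_apply] at this
    have h0 : dirL 𝒯.isUnitField (WithLp.sndL 2 ℝ (L2 Ω) (L2V Ω) ψ.1) = 0 :=
      (mem_spaceG_iff 𝒯.isUnitField ψ).1 hψ
    rw [h0] at this
    exact this
  have hl3 : Tendsto (fun k => (ψk k).fst - (q k).fst) atTop (𝓝 0) := by
    refine squeeze_zero_norm hq2 ?_
    have := hl2.norm.const_mul C
    rwa [norm_zero, mul_zero] at this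
  have hl4 : Tendsto (fun k => (q k).fst) atTop (𝓝 ψ.1.fst) := by
    have := hl1.sub hl3
    simpa using this
  have hl5 : Tendsto (fun k => ⟪w.1.fst - p.fst, (q k).fst⟫) atTop (𝓝 ⟪w.1.fst - p.fst, ψ.1.fst⟫) :=
    tendsto_const_nhds.inner hl4
  have hz : ⟪w.1.fst - p.fst, ψ.1.fst⟫ = 0 := by
    refine tendsto_nhds_unique hl5 (tendsto_const_nhds.congr fun k => ?_)
    obtain ⟨η, hη, hη2⟩ := hq3 k
    exact (hp3 _ η hη hη2).symm
  rw [inner_sub_left, sub_eq_zero] at hz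
  exact hz.symm

set_option maxHeartbeats 1000000 in
/-- The projection is defined on the classical functions by their means and extended by continuity. -/
theorem exists_projection : ∃ (P : spaceV Ω b →L[ℝ] spaceV Ω b) (C : ℝ≥0), ∀ φ : spaceV Ω b,
    IsProjection φ (P φ) ∧ ‖(P φ).1.snd‖ ≤ C * ‖φ.1.snd‖ ∧
      ‖(φ - P φ).1.fst‖ ≤ C * ‖dirL 𝒯.isUnitField φ.1.snd‖ := by
  obtain ⟨C, hC, h⟩ := 𝒯.exists_isProjection
  have hle : classicalV Ω b ≤ spaceV Ω b := by
    rw [spaceV_eq]; exact Submodule.le_topologicalClosure _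
  set e : classicalV Ω b →ₗ[ℝ] spaceV Ω b := Submodule.inclusion hle with he
  choose p hp hp1 hp2 using fun w : classicalV Ω b => h (e w) w.2
  set f : classicalV Ω b →ₗ[ℝ] spaceV Ω b :=
    { toFun := p
      map_add' := fun w z => by
        refine IsProjection.unique 𝒯 (hp _) ⟨add_mem (hp w).1 (hp z).1, fun ψ hψ => ?_⟩
        have h1 : (p w + p z).1.fst = (p w).1.fst + (p z).1.fst := rfl
        have h2 : (e (w + z)).1.fst = (e w).1.fst + (e z).1.fst := rfl
        rw [h1, h2, inner_add_left, inner_add_left, (hp w).2 ψ hψ, (hp z).2 ψ hψ]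
      map_smul' := fun c w => by
        refine IsProjection.unique 𝒯 (hp _) ⟨Submodule.smul_mem _ _ (hp w).1, fun ψ hψ => ?_⟩
        have h1 : ((RingHom.id ℝ) c • p w).1.fst = c • (p w).1.fst := rfl
        have h2 : (e (c • w)).1.fst = c • (e w).1.fst := rfl
        rw [h1, h2, inner_smul_left, inner_smul_left, (hp w).2 ψ hψ] } with hf
  have hfn : ∀ w, ‖f w‖ ≤ (1 + 2 * C) * ‖e w‖ := by
    intro w
    have a1 : ‖(p w).1‖ ≤ ‖(p w).1.fst‖ + ‖(p w).1.snd‖ := norm_withLp_le_add _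
    have a2 : ‖(p w).1.fst‖ ≤ ‖(e w).1.fst‖ + ‖(e w).1.fst - (p w).1.fst‖ := by
      have := norm_sub_le (e w).1.fst ((e w).1.fst - (p w).1.fst)
      rwa [sub_sub_cancel] at this
    have a3 := norm_dirL_le 𝒯.isUnitField (e w).1.snd
    have a4 := norm_fst_le_withLp (e w).1
    have a5 := norm_snd_le_withLp (e w).1
    have a6 := hp1 w
    have a7 := hp2 w
    change ‖(p w).1‖ ≤ (1 + 2 * C) * ‖(e w).1‖
    have a8 := mul_le_mul_of_nonneg_left a5 hC
    have a9 := mul_le_mul_of_nonneg_left a3 hC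
    linarith
  have hd : DenseRange e := by
    rw [denseRange_iff_closure_range, Set.eq_univ_iff_forall]
    intro x
    rw [mem_closure_iff_seq_limit]
    have hx : x.1 ∈ (classicalV Ω b).topologicalClosure := by rw [← spaceV_eq]; exact x.2
    obtain ⟨xk, hxk, hlim⟩ := mem_closure_iff_seq_limit.1 hx
    exact ⟨fun k => e ⟨xk k, hxk k⟩, fun k => mem_range_self _, tendsto_subtype_rng.2 hlim⟩
  set P := f.extendOfNorm e with hP
  have hPe : ∀ w, P (e w) = p w := fun w => LinearMap.extendOfNorm_eq hd ⟨_, hfn⟩ w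
  have c1 : Continuous fun φ : spaceV Ω b => φ.1.fst :=
    (WithLp.fstL 2 ℝ (L2 Ω) (L2V Ω)).continuous.comp continuous_subtype_val
  have c2 : Continuous fun φ : spaceV Ω b => φ.1.snd :=
    (WithLp.sndL 2 ℝ (L2 Ω) (L2V Ω)).continuous.comp continuous_subtype_val
  have c3 := (dirL 𝒯.isUnitField).continuous
  refine ⟨P, ⟨C, hC⟩, fun φ => ⟨⟨?_, fun ψ hψ => ?_⟩, ?_, ?_⟩⟩
  · rw [mem_spaceG_iff 𝒯.isUnitField]
    refine hd.induction_on (p := fun φ => dirL 𝒯.isUnitField (P φ).1.snd = 0) φ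
      (isClosed_eq (c3.comp (c2.comp P.continuous)) continuous_const) fun w => ?_
    rw [hPe]
    exact (mem_spaceG_iff 𝒯.isUnitField _).1 (hp w).1
  · refine hd.induction_on (p := fun φ => ⟪(P φ).1.fst, ψ.1.fst⟫ = ⟪φ.1.fst, ψ.1.fst⟫) φ
      (isClosed_eq ((c1.comp P.continuous).inner continuous_const) (c1.inner continuous_const))
      fun w => ?_
    rw [hPe]
    exact (hp w).2 ψ hψ
  · refine hd.induction_on (p := fun φ => ‖(P φ).1.snd‖ ≤ C * ‖φ.1.snd‖) φ
      (isClosed_le (c2.comp P.continuous).norm (continuous_const.mul c2.norm)) fun w => ?_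
    rw [hPe]
    exact hp1 w
  · refine hd.induction_on
      (p := fun φ => ‖(φ - P φ).1.fst‖ ≤ C * ‖dirL 𝒯.isUnitField φ.1.snd‖) φ
      (isClosed_le (c1.comp (continuous_id.sub P.continuous)).norm
        (continuous_const.mul (c3.comp c2).norm)) fun w => ?_
    rw [hPe]
    exact hp2 w

/-- The decomposition of `𝒱` and the properties of the projection. -/
theorem isCompl_spaceG_spaceA_and_exists_projection (𝒯 : TubeData Ω b) :
    IsCompl (spaceG Ω b) (spaceA Ω b) ∧ ∃ P : spaceV Ω b →L[ℝ] spaceV Ω b,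
      (∀ φ, P φ ∈ spaceG Ω b ∧ ∀ ψ ∈ spaceG Ω b, ⟪(P φ).1.fst, ψ.1.fst⟫ = ⟪φ.1.fst, ψ.1.fst⟫) ∧
      (∃ C : ℝ≥0, ∀ φ : spaceV Ω b, eLpNorm (perp b (P φ).1.snd) 2 (volume.restrict Ω)
        ≤ C * eLpNorm φ.1.snd 2 (volume.restrict Ω)) ∧
      ∃ C : ℝ≥0, ∀ φ : spaceV Ω b, eLpNorm (φ - P φ).1.fst 2 (volume.restrict Ω)
        ≤ C * eLpNorm (par b φ.1.snd) 2 (volume.restrict Ω) := by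
  obtain ⟨P, C, h⟩ := 𝒯.exists_projection
  refine ⟨⟨?_, ?_⟩, P, fun φ => (h φ).1, ⟨C, fun φ => ?_⟩, ⟨C, fun φ => ?_⟩⟩
  · rw [Submodule.disjoint_def]
    intro φ h1 h2
    refine 𝒯.eq_zero_of_fst ?_
    rw [← inner_self_eq_zero (𝕜 := ℝ)]
    exact h2 φ h1
  · rw [codisjoint_iff_le_sup]
    intro φ _
    refine Submodule.mem_sup.2 ⟨P φ, (h φ).1.1, φ - P φ, fun ψ hψ => ?_, add_sub_cancel _ _⟩
    have h1 : (φ - P φ).1.fst = φ.1.fst - (P φ).1.fst := rfl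
    rw [h1, inner_sub_left, (h φ).1.2 ψ hψ, sub_self]
  · refine (eLpNorm_perp_le 𝒯.isUnitField _).trans ?_
    rw [← Lp.enorm_def]
    have := ENNReal.ofReal_le_ofReal (h φ).2.1
    rwa [ENNReal.ofReal_mul C.coe_nonneg, ENNReal.ofReal_coe_nnreal, ofReal_norm, ofReal_norm] at this
  · rw [eLpNorm_par 𝒯.isUnitField, ← Lp.enorm_def]
    have := ENNReal.ofReal_le_ofReal (h φ).2.2
    rwa [ENNReal.ofReal_mul C.coe_nonneg, ENNReal.ofReal_coe_nnreal, ofReal_norm, ofReal_norm] at this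

end TubeData

/-! ### Composition operators and test functions in `L²` -/

section CompLp
variable {α β : Type*} [MeasurableSpace α] [MeasurableSpace β] {μ : Measure α} {ν : Measure β}
  {f : α → β} {C : ℝ≥0}

lemma ae_eq_comp_of_map_le (hf : AEMeasurable f μ) (h : μ.map f ≤ (C : ℝ≥0∞) • ν) {u u' : β → ℝ}
    (hu : u =ᵐ[ν] u') : (fun x => u (f x)) =ᵐ[μ] fun x => u' (f x) :=
  ae_of_ae_map hf ((Measure.absolutelyContinuous_of_le_smul h).ae_eq hu)

lemma memLp_comp_of_map_le (hf : AEMeasurable f μ) (h : μ.map f ≤ (C : ℝ≥0∞) • ν) {u : β → ℝ}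
    (hu : MemLp u 2 ν) : MemLp (fun x => u (f x)) 2 μ :=
  (hu.of_measure_le_smul ENNReal.coe_ne_top h).comp_of_map hf

/-- The operator `u ↦ u ∘ f` on `L²`, for a map `f` which increases measures by at most a constant
factor. -/
def compLp (hf : AEMeasurable f μ) (h : μ.map f ≤ (C : ℝ≥0∞) • ν) : Lp ℝ 2 ν →L[ℝ] Lp ℝ 2 μ :=
  LinearMap.mkContinuous
    { toFun := fun u => (memLp_comp_of_map_le hf h (Lp.memLp u)).toLp _
      map_add' := fun u v => by
        rw [← MemLp.toLp_add (memLp_comp_of_map_le hf h (Lp.memLp u))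
          (memLp_comp_of_map_le hf h (Lp.memLp v))]
        exact MemLp.toLp_congr _ _ (ae_eq_comp_of_map_le hf h (Lp.coeFn_add u v))
      map_smul' := fun c u => by
        rw [RingHom.id_apply, ← MemLp.toLp_const_smul c (memLp_comp_of_map_le hf h (Lp.memLp u))]
        exact MemLp.toLp_congr _ _ (ae_eq_comp_of_map_le hf h (Lp.coeFn_smul c u)) }
    ((C : ℝ≥0∞) ^ (1 / (2 : ℝ≥0∞)).toReal).toReal fun u => by
    have h1 : eLpNorm (fun x => u (f x)) 2 μ ≤ (C : ℝ≥0∞) ^ (1 / (2 : ℝ≥0∞)).toReal * eLpNorm u 2 ν := by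
      have h2 := eLpNorm_le_of_measure_le_smul h (f := u) (p := 2)
      rwa [eLpNorm_map_measure ((Lp.aestronglyMeasurable u).mono_ac
        (Measure.absolutelyContinuous_of_le_smul h)) hf] at h2
    simp only [LinearMap.coe_mk, AddHom.coe_mk, Lp.norm_def]
    rw [← ENNReal.toReal_mul, eLpNorm_congr_ae (MemLp.coeFn_toLp _)]
    exact ENNReal.toReal_mono (ENNReal.mul_ne_top
      (ENNReal.rpow_ne_top_of_nonneg (by positivity) ENNReal.coe_ne_top) (Lp.eLpNorm_ne_top u)) h1

lemma coeFn_compLp (hf : AEMeasurable f μ) (h : μ.map f ≤ (C : ℝ≥0∞) • ν) (u : Lp ℝ 2 ν) :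
    compLp hf h u =ᵐ[μ] fun x => u (f x) := MemLp.coeFn_toLp (memLp_comp_of_map_le hf h (Lp.memLp u))

end CompLp

/-- The fundamental lemma of the calculus of variations in `L²`. -/
lemma Lp_eq_zero_of_forall_integral_mul {V : Type*} [NormedAddCommGroup V] [NormedSpace ℝ V]
    [FiniteDimensional ℝ V] [MeasurableSpace V] [BorelSpace V] {μ : Measure V} [IsFiniteMeasure μ]
    {U : Set V} (hU : IsOpen U) (hμ : ∀ᵐ x ∂μ, x ∈ U) (f : Lp ℝ 2 μ)
    (h : ∀ g : V → ℝ, ContDiff ℝ ∞ g → HasCompactSupport g → tsupport g ⊆ U →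
      ∫ x, g x * f x ∂μ = 0) : f = 0 := by
  rw [Lp.eq_zero_iff_ae_eq_zero]
  have hloc : LocallyIntegrable f μ := (Lp.memLp f).locallyIntegrable (by norm_num)
  filter_upwards [hU.ae_eq_zero_of_integral_contDiff_smul_eq_zero (hloc.locallyIntegrableOn U) h,
    hμ] with x h1 h2 using h1 h2

/-- The smooth functions with compact support in `U` are dense in `L²`. -/
lemma dense_testLp {V : Type*} [NormedAddCommGroup V] [NormedSpace ℝ V]
    [FiniteDimensional ℝ V] [MeasurableSpace V] [BorelSpace V] {μ : Measure V} [IsFiniteMeasure μ]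
    {U : Set V} (hU : IsOpen U) (hμ : ∀ᵐ x ∂μ, x ∈ U) (D : Submodule ℝ (Lp ℝ 2 μ))
    (hD : ∀ (g : V → ℝ) (hg : MemLp g 2 μ), ContDiff ℝ ∞ g → HasCompactSupport g → tsupport g ⊆ U →
      hg.toLp g ∈ D) : D.topologicalClosure = ⊤ := by
  rw [Submodule.topologicalClosure_eq_top_iff, Submodule.eq_bot_iff]
  intro f hf
  refine Lp_eq_zero_of_forall_integral_mul hU hμ f fun g h1 h2 h3 => ?_
  have hg : MemLp g 2 μ := h1.continuous.memLp_of_hasCompactSupport h2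
  have h4 := (Submodule.mem_orthogonal D f).1 hf _ (hD g hg h1 h2 h3)
  rw [L2.inner_def] at h4
  rw [← h4]
  refine integral_congr_ae ?_
  filter_upwards [hg.coeFn_toLp] with x hx
  rw [hx, RCLike.inner_apply, conj_trivial, mul_comm]

/-! ### Weak derivatives tested with functions of class `C¹` -/

section Mollify
variable {d : ℕ} {Ω : Set (E d)} {b : E d → E d}

open ContinuousLinearMap Convolution in
/-- A weak derivative along the field may be tested with functions of class `C¹`, by
mollification. -/
lemma IsWeakDirDeriv.integral_mul_divergence (hΩ : IsOpen Ω) (hbd : Bornology.IsBounded Ω)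
    (hb : ContDiff ℝ ∞ b) {u g : L2 Ω} (h : IsWeakDirDeriv Ω b u g) {ψ : E d → ℝ}
    (hψ : ContDiff ℝ 1 ψ) (hψc : HasCompactSupport ψ) (hψΩ : tsupport ψ ⊆ Ω) :
    ∫ x in Ω, u x * divergence (fun y => ψ y • b y) x = -∫ x in Ω, ψ x * g x := by
  have hfin : IsFiniteMeasure ((volume : Measure (E d)).restrict Ω) :=
    isFiniteMeasure_restrict.2 hbd.measure_lt_top.ne
  obtain ⟨δ, hδ, hδΩ⟩ := hψc.isCompact.exists_cthickening_subset_open hΩ hψΩ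
  set ε : ℕ → ℝ := fun n => δ / ((n : ℝ) + 1) with hε
  have hε0 : ∀ n, 0 < ε n := fun n => by positivity
  have hεδ : ∀ n, ε n ≤ δ := fun n => div_le_self hδ.le (by linarith [Nat.cast_nonneg (α := ℝ) n])
  have hεt : Tendsto ε atTop (𝓝 0) := by
    have := (tendsto_one_div_add_atTop_nhds_zero_nat (𝕜 := ℝ)).const_mul δ
    simpa [hε, div_eq_mul_inv] using this
  set ρ : ℕ → ContDiffBump (0 : E d) := fun n => ⟨ε n / 2, ε n, half_pos (hε0 n), half_lt_self (hε0 n)⟩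
    with hρ
  have hρt : Tendsto (fun n => (ρ n).rOut) atTop (𝓝 0) := hεt
  set ψ' : ℕ → E d → ℝ := fun n => ((ρ n).normed volume ⋆[lsmul ℝ ℝ, volume] ψ) with hψ'
  have hρi : ∀ n, LocallyIntegrable ((ρ n).normed (volume : Measure (E d))) volume := fun n =>
    (ρ n).continuous_normed.locallyIntegrable
  have hfd : ∀ n x e, fderiv ℝ (ψ' n) x e =
      ((ρ n).normed volume ⋆[lsmul ℝ ℝ, volume] fun y => fderiv ℝ ψ y e) x := by
    intro n x e
    rw [(hψc.hasFDerivAt_convolution_right (lsmul ℝ ℝ) (hρi n) hψ x).fderiv]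
    exact convolution_precompR_apply (lsmul ℝ ℝ) (hρi n) (hψc.fderiv (𝕜 := ℝ))
      (hψ.continuous_fderiv one_ne_zero) x e
  have hsm : ∀ n, ContDiff ℝ ∞ (ψ' n) := fun n =>
    (ρ n).hasCompactSupport_normed.contDiff_convolution_left _ (ρ n).contDiff_normed
      hψ.continuous.locallyIntegrable
  have htest : ∀ n, IsTest Ω (ψ' n) := by
    intro n
    have hs : Function.support (ψ' n) ⊆ Metric.cthickening δ (tsupport ψ) := by
      refine (support_convolution_subset (lsmul ℝ ℝ)).trans ?_
      rintro _ ⟨y, hy, z, hz, rfl⟩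
      rw [(ρ n).support_normed_eq, Metric.mem_ball, dist_zero_right] at hy
      refine Metric.mem_cthickening_of_dist_le _ z _ _ (subset_tsupport _ hz) ?_
      rw [dist_eq_norm, add_sub_cancel_right]
      exact hy.le.trans (hεδ n)
    have hc : IsCompact (Metric.cthickening δ (tsupport ψ)) := hψc.isCompact.cthickening
    have hs2 : tsupport (ψ' n) ⊆ Metric.cthickening δ (tsupport ψ) :=
      closure_minimal hs hc.isClosed
    exact ⟨hsm n, hc.of_isClosed_subset (isClosed_tsupport _) hs2, hs2.trans hδΩ⟩
  -- convergence and bounds for convolutions with continuous functions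
  have hbound : ∀ (F : E d → ℝ) (M : ℝ), Continuous F → (∀ x, |F x| ≤ M) → ∀ n x,
      |((ρ n).normed volume ⋆[lsmul ℝ ℝ, volume] F) x| ≤ 3 * M := by
    intro F M hF hM n x
    have h1 := (ρ n).dist_normed_convolution_le (μ := (volume : Measure (E d))) (g := F) (x₀ := x) (ε := 2 * M)
      hF.aestronglyMeasurable fun y _ => by
        rw [Real.dist_eq]
        exact (abs_sub _ _).trans (by linarith [hM x, hM y])
    rw [Real.dist_eq] at h1
    have h2 := abs_sub_abs_le_abs_sub (((ρ n).normed volume ⋆[lsmul ℝ ℝ, volume] F) x) (F x)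
    linarith [hM x]
  obtain ⟨M₀, hM₀⟩ := hψc.exists_bound_of_continuous hψ.continuous
  obtain ⟨M₁, hM₁⟩ := (hψc.fderiv (𝕜 := ℝ)).exists_bound_of_continuous
    (hψ.continuous_fderiv one_ne_zero)
  have hdivc : Continuous (divergence b) := by
    have h1 : Continuous (fderiv ℝ b) := hb.continuous_fderiv (by simp)
    unfold divergence
    fun_prop
  obtain ⟨B₀, hB₀⟩ := hbd.isCompact_closure.exists_bound_of_continuousOn hb.continuous.continuousOn
  obtain ⟨B₁, hB₁⟩ := hbd.isCompact_closure.exists_bound_of_continuousOn hdivc.continuousOn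
  have hM₁0 : 0 ≤ M₁ := (norm_nonneg _).trans (hM₁ 0)
  have hM₀0 : 0 ≤ M₀ := (norm_nonneg _).trans (hM₀ 0)
  have hdiv : ∀ n x, divergence (fun y => ψ' n y • b y) x =
      fderiv ℝ (ψ' n) x (b x) + ψ' n x * divergence b x := fun n x =>
    divergence_smul (hb.differentiable (by simp)) ((hsm n).differentiable (by simp)) x
  have hψt : ∀ x, Tendsto (fun n => ψ' n x) atTop (𝓝 (ψ x)) := fun x =>
    ContDiffBump.convolution_tendsto_right_of_continuous hρt hψ.continuous x
  have hdt : ∀ x, Tendsto (fun n => divergence (fun y => ψ' n y • b y) x) atTop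
      (𝓝 (divergence (fun y => ψ y • b y) x)) := by
    intro x
    simp_rw [hdiv]
    rw [divergence_smul (hb.differentiable (by simp)) (hψ.differentiable one_ne_zero) x]
    refine Tendsto.add ?_ ((hψt x).mul_const _)
    simp_rw [hfd]
    exact ContDiffBump.convolution_tendsto_right_of_continuous hρt
      ((hψ.continuous_fderiv one_ne_zero).clm_apply continuous_const) x
  have hu : Integrable u (volume.restrict Ω) := (Lp.memLp u).integrable (by norm_num)
  have hg : Integrable g (volume.restrict Ω) := (Lp.memLp g).integrable (by norm_num)
  have l1 : Tendsto (fun n => ∫ x in Ω, u x * divergence (fun y => ψ' n y • b y) x) atTop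
      (𝓝 (∫ x in Ω, u x * divergence (fun y => ψ y • b y) x)) := by
    refine tendsto_integral_of_dominated_convergence
      (fun x => ‖u x‖ * (3 * (M₁ * B₀) + 3 * M₀ * B₁)) (fun n => ?_) (hu.norm.mul_const _)
      (fun n => ?_) (Eventually.of_forall fun x => (hdt x).const_mul _)
    · exact (Lp.aestronglyMeasurable u).mul ((htest n).continuous_div hb).aestronglyMeasurable
    · filter_upwards [ae_restrict_mem hΩ.measurableSet] with x hx
      rw [norm_mul]
      refine mul_le_mul_of_nonneg_left ?_ (norm_nonneg _)
      rw [hdiv]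
      refine (norm_add_le _ _).trans (add_le_add ?_ ?_)
      · rw [hfd]
        refine hbound (fun y => fderiv ℝ ψ y (b x)) _
          ((hψ.continuous_fderiv one_ne_zero).clm_apply continuous_const) (fun y => ?_) n x
        exact ((fderiv ℝ ψ y).le_opNorm _).trans
          (mul_le_mul (hM₁ y) (hB₀ x (subset_closure hx)) (norm_nonneg _) hM₁0)
      · rw [norm_mul]
        exact mul_le_mul (hbound ψ _ hψ.continuous hM₀ n x) (hB₁ x (subset_closure hx))
          (norm_nonneg _) (by positivity)
  have l2 : Tendsto (fun n => ∫ x in Ω, ψ' n x * g x) atTop (𝓝 (∫ x in Ω, ψ x * g x)) := by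
    refine tendsto_integral_of_dominated_convergence
      (fun x => (3 * M₀) * ‖g x‖) (fun n => ?_) (hg.norm.const_mul _)
      (fun n => Eventually.of_forall fun x => ?_) (Eventually.of_forall fun x => (hψt x).mul_const _)
    · exact (hsm n).continuous.aestronglyMeasurable.mul (Lp.aestronglyMeasurable g)
    · rw [norm_mul]
      exact mul_le_mul_of_nonneg_right (hbound ψ _ hψ.continuous hM₀ n x) (norm_nonneg _)
  refine tendsto_nhds_unique l1 (l2.neg.congr fun n => ?_)
  exact (h _ (htest n)).symm

end Mollify

lemma contDiffOn_primitive {P : Type*} [NormedAddCommGroup P] [NormedSpace ℝ P]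
    {U : Set P} (hU : IsOpen U) {G : P × ℝ → ℝ}
    (hG : ContDiffOn ℝ 1 G (U ×ˢ univ)) :
    ContDiffOn ℝ 1 (fun p : P × ℝ => ∫ σ in (0 : ℝ)..p.2, G (p.1, σ)) (U ×ˢ univ) := by
  have h1 : ContDiffOn ℝ 1 (fun p : P × ℝ => ∫ τ in (0 : ℝ)..1, G (p.1, p.2 * τ)) (U ×ˢ univ) := by
    refine contDiffOn_integral_param (g := fun q : (P × ℝ) × ℝ => G (q.1.1, q.1.2 * q.2))
      (hU.prod isOpen_univ) ?_ 0 1 zero_le_one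
    have h2 : ContDiff ℝ 1 fun q : (P × ℝ) × ℝ => (q.1.1, q.1.2 * q.2) := by fun_prop
    exact hG.comp h2.contDiffOn fun q hq => ⟨hq.1.1, mem_univ _⟩
  refine (contDiffOn_snd.mul h1).congr fun p _ => ?_
  have := intervalIntegral.mul_integral_comp_mul_left (a := 0) (b := 1) (f := fun σ => G (p.1, σ)) p.2
  rw [mul_zero, mul_one] at this
  exact this.symm

namespace TubeData
variable {m : ℕ} {Ω : Set (E (m + 1))} {b : E (m + 1) → E (m + 1)} (𝒯 : TubeData Ω b)

/-! ### Functions whose derivative along the field vanishes -/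

/-- `L²` of the parameter domain of the inflow boundary. -/
abbrev L2Γ : Type := Lp ℝ 2 ((volume : Measure (E m)).restrict 𝒯.Γ)

lemma aemeasurable_ζ : AEMeasurable 𝒯.ζ (volume.restrict Ω) :=
  ContinuousOn.aemeasurable (fun _ hx => (𝒯.contDiffAt_ζ hx).continuousAt.continuousWithinAt)
    𝒯.isOpen.measurableSet

lemma map_fst_vol : 𝒯.vol.map Prod.fst = (volume : Measure (E m)).restrict 𝒯.Γ := by
  rw [vol, Measure.map_fst_prod, measure_univ, one_smul]

lemma exists_map_ζ_le : ∃ C : ℝ≥0, (volume.restrict Ω).map 𝒯.ζ ≤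
    (C : ℝ≥0∞) • (volume : Measure (E m)).restrict 𝒯.Γ := by
  obtain ⟨C, hC0, hC⟩ := 𝒯.exists_w_le
  refine ⟨C.toNNReal, ?_⟩
  set ν := 𝒯.vol.withDensity fun p => ENNReal.ofReal (𝒯.w p) with hν
  have hle : ν ≤ (C.toNNReal : ℝ≥0∞) • 𝒯.vol := by
    rw [← withDensity_const]
    refine withDensity_mono ?_
    filter_upwards [𝒯.ae_vol_mem] with p hp
    exact ENNReal.ofReal_le_ofReal (hC p ⟨hp.1, Ioo_subset_Icc_self hp.2⟩)
  have h1 : (fun p => 𝒯.ζ (𝒯.Y p)) =ᵐ[ν] Prod.fst := by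
    refine (withDensity_absolutelyContinuous _ _).ae_eq ?_
    filter_upwards [𝒯.ae_vol_mem] with p hp using 𝒯.ζ_Y hp
  have h2 : (volume.restrict Ω).map 𝒯.ζ = ν.map Prod.fst := by
    rw [← Measure.map_congr h1, ← 𝒯.map_Y]
    exact AEMeasurable.map_map_of_aemeasurable (by rw [𝒯.map_Y]; exact 𝒯.aemeasurable_ζ)
      𝒯.measurable_Y.aemeasurable
  rw [h2]
  refine (Measure.map_mono hle measurable_fst).trans ?_
  rw [Measure.map_smul, 𝒯.map_fst_vol]

/-- The operator `a ↦ a ∘ ζ` which extends a function on the inflow boundary to be constant along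
field lines. -/
def liftL : 𝒯.L2Γ →L[ℝ] L2 Ω := compLp 𝒯.aemeasurable_ζ 𝒯.exists_map_ζ_le.choose_spec

lemma coeFn_liftL (a : 𝒯.L2Γ) : 𝒯.liftL a =ᵐ[volume.restrict Ω] fun x => a (𝒯.ζ x) :=
  coeFn_compLp _ _ a

lemma map_fst_vol_le : 𝒯.vol.map Prod.fst ≤
    ((1 : ℝ≥0) : ℝ≥0∞) • (volume : Measure (E m)).restrict 𝒯.Γ := by
  rw [𝒯.map_fst_vol, ENNReal.coe_one, one_smul]

/-- The operator `a ↦ a ∘ fst`. -/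
def fstL : 𝒯.L2Γ →L[ℝ] Lp ℝ 2 𝒯.vol := compLp measurable_fst.aemeasurable 𝒯.map_fst_vol_le

lemma coeFn_fstL (a : 𝒯.L2Γ) : 𝒯.fstL a =ᵐ[𝒯.vol] fun p => a p.1 := coeFn_compLp _ _ a

lemma L2_eq_of_comp_Y {u v : L2 Ω} (h : (fun p => u (𝒯.Y p)) =ᵐ[𝒯.vol] fun p => v (𝒯.Y p)) :
    u = v := by
  obtain ⟨C, hC⟩ := 𝒯.exists_eLpNorm_le_vol
  have hm : AEStronglyMeasurable (fun x => u x - v x) (volume.restrict Ω) :=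
    (Lp.aestronglyMeasurable u).sub (Lp.aestronglyMeasurable v)
  have h1 := hC _ hm
  have h2 : (fun p => u (𝒯.Y p) - v (𝒯.Y p)) =ᵐ[𝒯.vol] fun _ => 0 := by
    filter_upwards [h] with p hp
    rw [hp, sub_self]
  rw [eLpNorm_congr_ae h2, eLpNorm_zero', mul_zero, nonpos_iff_eq_zero,
    eLpNorm_eq_zero_iff hm (by norm_num)] at h1
  refine Lp.ext ?_
  filter_upwards [h1] with x hx
  exact sub_eq_zero.1 hx

lemma memLp_comp_Y (u : L2 Ω) : MemLp (fun p => u (𝒯.Y p)) 2 𝒯.vol := by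
  obtain ⟨C, hC⟩ := 𝒯.exists_eLpNorm_vol_le
  exact ⟨(Lp.aestronglyMeasurable u).comp_quasiMeasurePreserving 𝒯.quasiMeasurePreserving_Y,
    (hC u (Lp.aestronglyMeasurable u)).trans_lt
      (ENNReal.mul_lt_top ENNReal.coe_lt_top (Lp.eLpNorm_lt_top u))⟩

/-- A vanishing weak derivative along the field, expressed in the coordinates. The test function is
chosen such that the divergence on `Ω` becomes the derivative of `q` divided by the density. -/
lemma integral_comp_Y_mul_deriv {u : L2 Ω} (hu : IsWeakDirDeriv Ω b u (0 : L2 Ω))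
    {q q' : E m × ℝ → ℝ} (hq : ContDiffOn ℝ 1 q (𝒯.Γ ×ˢ univ)) {K : Set (E m × ℝ)} (hK : IsCompact K)
    (hKΓ : K ⊆ 𝒯.Γ ×ˢ Ioo 0 1) (hq0 : ∀ p ∈ 𝒯.Γ ×ˢ (univ : Set ℝ), p ∉ K → q p = 0)
    (hq' : ∀ p ∈ 𝒯.Γ ×ˢ Ioo (0 : ℝ) 1, HasDerivAt (fun s => q (p.1, s)) (q' p) p.2) :
    ∫ p, u (𝒯.Y p) * q' p ∂𝒯.vol = 0 := by
  classical
  have hΓu := 𝒯.isOpen_Γ_prod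
  have hb := 𝒯.contDiff_b
  -- `∂ₛ w = L w div b` by Liouville's formula, so `w div (ψ b) = ∂ₛ q` for `ψ = q L / w`
  set f : E (m + 1) → ℝ := fun x => q (𝒯.ζ x, 𝒯.θ x) * 𝒯.L (𝒯.ζ x) / 𝒯.w (𝒯.ζ x, 𝒯.θ x) with hf
  set ψ : E (m + 1) → ℝ := fun x => if x ∈ Ω then f x else 0 with hψ
  have hψf : ∀ x ∈ Ω, ψ x = f x := fun x hx => if_pos hx
  set K' := 𝒯.Y '' K with hK'
  have hK'c : IsCompact K' := hK.image_of_continuousOn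
    (𝒯.contDiffOn_Y.continuousOn.mono fun p hp => ⟨(hKΓ hp).1, mem_univ _⟩)
  have hK'Ω : K' ⊆ Ω := by
    rintro _ ⟨p, hp, rfl⟩
    exact 𝒯.Y_mem (hKΓ hp)
  have hψ0 : ∀ x ∉ K', ψ x = 0 := by
    intro x hx
    by_cases hxΩ : x ∈ Ω
    · have h1 : (𝒯.ζ x, 𝒯.θ x) ∉ K := fun h => hx ⟨_, h, 𝒯.Y_ζ_θ hxΩ⟩
      have h2 : q (𝒯.ζ x, 𝒯.θ x) = 0 := hq0 (𝒯.ζ x, 𝒯.θ x) ⟨𝒯.ζ_mem hxΩ, mem_univ _⟩ h1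
      rw [hψf x hxΩ, hf]
      simp only [h2, zero_mul, zero_div]
    · exact if_neg hxΩ
  have hψC : ContDiff ℝ 1 ψ := by
    refine contDiff_iff_contDiffAt.2 fun x => ?_
    by_cases hx : x ∈ Ω
    · have hζθ : ContDiffAt ℝ 1 (fun y => (𝒯.ζ y, 𝒯.θ y)) x :=
        (𝒯.contDiffAt_ζ hx).prodMk (𝒯.contDiffAt_θ hx)
      have hm : 𝒯.Γ ×ˢ (univ : Set ℝ) ∈ 𝓝 (𝒯.ζ x, 𝒯.θ x) :=
        hΓu.mem_nhds ⟨𝒯.ζ_mem hx, mem_univ _⟩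
      have h1 : ContDiffAt ℝ 1 f x := by
        refine ContDiffAt.div (ContDiffAt.mul ?_ (𝒯.contDiffAt_comp_ζ 𝒯.contDiffOn_L hx)) ?_
          (𝒯.w_pos (p := (𝒯.ζ x, 𝒯.θ x)) (𝒯.ζ_mem hx)).ne'
        · exact ContDiffAt.comp (g := q) x (hq.contDiffAt hm) hζθ
        · exact ContDiffAt.comp (g := 𝒯.w) x (𝒯.contDiffOn_w.contDiffAt hm) hζθ
      refine h1.congr_of_eventuallyEq ?_
      filter_upwards [𝒯.isOpen.mem_nhds hx] with y hy using hψf y hy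
    · have h1 : ψ =ᶠ[𝓝 x] fun _ => 0 := by
        filter_upwards [hK'c.isClosed.isOpen_compl.mem_nhds fun h => hx (hK'Ω h)] with y hy
          using hψ0 y hy
      exact contDiffAt_const.congr_of_eventuallyEq h1
  have hsupp : tsupport ψ ⊆ K' := closure_minimal
    (fun x hx => by_contra fun h => hx (hψ0 x h)) hK'c.isClosed
  have h1 := hu.integral_mul_divergence 𝒯.isOpen 𝒯.isBounded hb hψC
    (hK'c.of_isClosed_subset (isClosed_tsupport _) hsupp) (hsupp.trans hK'Ω)
  have h2 : ∫ x in Ω, ψ x * (0 : L2 Ω) x = 0 := by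
    rw [← integral_zero (E (m + 1)) ℝ (μ := volume.restrict Ω)]
    refine integral_congr_ae ?_
    filter_upwards [Lp.coeFn_zero ℝ 2 (volume.restrict Ω)] with x hx
    rw [hx, Pi.zero_apply, mul_zero]
  have hdc : Continuous (divergence fun y => ψ y • b y) := by
    have h3 : Continuous (fderiv ℝ fun y => ψ y • b y) :=
      (hψC.smul (hb.of_le (by simp))).continuous_fderiv one_ne_zero
    unfold divergence
    fun_prop
  have hum : AEStronglyMeasurable (fun x => u x * divergence (fun y => ψ y • b y) x)
      (volume.restrict Ω) := (Lp.aestronglyMeasurable u).mul hdc.aestronglyMeasurable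
  rw [h2, neg_zero, 𝒯.integral_eq_vol hum] at h1
  rw [← h1]
  refine integral_congr_ae ?_
  filter_upwards [𝒯.ae_vol_mem] with p hp
  obtain ⟨ξ, s⟩ := p
  have hξ : ξ ∈ 𝒯.Γ := hp.1
  have hL := 𝒯.L_pos hξ
  have hw := 𝒯.w_pos (p := (ξ, s)) hξ
  have hYΩ := 𝒯.Y_mem hp
  set y := 𝒯.Y (ξ, s) with hy
  have hvb : 𝒯.v =ᶠ[𝓝 y] b := by
    filter_upwards [𝒯.isOpen.mem_nhds hYΩ] with x hx using 𝒯.eqOn (subset_closure hx)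
  have hdv : divergence 𝒯.v y = divergence b y := by
    unfold divergence
    rw [hvb.fderiv_eq]
  have d0 : HasFDerivAt ψ (fderiv ℝ ψ y) (𝒯.Y (ξ, s)) :=
    (hψC.differentiable one_ne_zero y).hasFDerivAt
  have d1 := d0.comp_hasDerivAt s (𝒯.hasDerivAt_Y ξ s)
  have d2 : HasDerivAt (fun s' => q (ξ, s') * 𝒯.L ξ / 𝒯.w (ξ, s')) _ s :=
    ((hq' (ξ, s) hp).mul_const (𝒯.L ξ)).div (𝒯.hasDerivAt_w ξ s) hw.ne'
  have e1 : (fun s' => ψ (𝒯.Y (ξ, s'))) =ᶠ[𝓝 s] fun s' => q (ξ, s') * 𝒯.L ξ / 𝒯.w (ξ, s') := by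
    filter_upwards [Ioo_mem_nhds hp.2.1 hp.2.2] with s' hs'
    have hp' : (ξ, s') ∈ 𝒯.Γ ×ˢ Ioo (0 : ℝ) 1 := ⟨hξ, hs'⟩
    rw [hψf _ (𝒯.Y_mem hp')]
    simp only [hf, 𝒯.ζ_Y hp', 𝒯.θ_Y hp']
  have e2 := d1.unique (d2.congr_of_eventuallyEq e1)
  rw [map_smul, smul_eq_mul, hvb.eq_of_nhds, ← hy, hdv] at e2
  have e3 : ψ y = q (ξ, s) * 𝒯.L ξ / 𝒯.w (ξ, s) := e1.eq_of_nhds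
  rw [divergence_smul (hb.differentiable (by simp)) (hψC.differentiable one_ne_zero), e3]
  have e4 : fderiv ℝ ψ y (b y) = q' (ξ, s) / 𝒯.w (ξ, s) -
      q (ξ, s) * 𝒯.L ξ / 𝒯.w (ξ, s) * divergence b y := by
    refine mul_left_cancel₀ hL.ne' (e2.trans ?_)
    field_simp
  rw [e4, smul_eq_mul]
  field_simp
  ring

end TubeData

namespace TubeData
variable {m : ℕ} {Ω : Set (E (m + 1))} {b : E (m + 1) → E (m + 1)} (𝒯 : TubeData Ω b)

/-- A function in `L²(Ω)` whose weak derivative along the field vanishes is constant along field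
lines: the lemma of du Bois-Reymond on each of them, with the parameter carried along in the test
functions. -/
theorem exists_liftL_eq {u : L2 Ω} (hu : IsWeakDirDeriv Ω b u (0 : L2 Ω)) :
    ∃ a : 𝒯.L2Γ, 𝒯.liftL a = u := by
  -- a fixed function with integral one
  set ρ : ContDiffBump (1 / 2 : ℝ) := ⟨1 / 8, 1 / 4, by norm_num, by norm_num⟩ with hρ
  set η₀ : ℝ → ℝ := ρ.normed volume with hη₀
  have hη₀C : ContDiff ℝ ∞ η₀ := ρ.contDiff_normed
  have hη₀s : ∀ s, s ∉ Icc (1 / 4 : ℝ) (3 / 4) → η₀ s = 0 := by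
    intro s hs
    by_contra h
    have h1 : s ∈ Function.support η₀ := h
    rw [hη₀, ρ.support_normed_eq, Metric.mem_ball, Real.dist_eq, abs_lt] at h1
    refine hs ⟨?_, ?_⟩ <;> [have := h1.1; have := h1.2] <;> norm_num [hρ] at this <;> linarith
  have hη₀1 : ∫ s in (0 : ℝ)..1, η₀ s = 1 := by
    rw [intervalIntegral.integral_eq_integral_of_support_subset]
    · exact ρ.integral_normed
    · intro s hs
      have : s ∈ Icc (1 / 4 : ℝ) (3 / 4) := by_contra fun h => hs (hη₀s s h)
      exact ⟨by linarith [this.1], by linarith [this.2]⟩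
  obtain ⟨M, hM⟩ := ρ.hasCompactSupport_normed.exists_bound_of_continuous
    (f := η₀) hη₀C.continuous
  have hUm := 𝒯.memLp_comp_Y u
  have hVm : MemLp (fun p => η₀ p.2 * u (𝒯.Y p)) 2 𝒯.vol := by
    refine hUm.of_le_mul (c := M) ((hη₀C.continuous.comp continuous_snd).aestronglyMeasurable.mul
      hUm.1) (Eventually.of_forall fun p => ?_)
    rw [norm_mul]
    exact mul_le_mul_of_nonneg_right (hM _) (norm_nonneg _)
  -- `a ξ` is the integral of `η₀ · u ∘ Y` over the fibre of `ξ`, obtained by duality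
  set a : 𝒯.L2Γ := ContinuousLinearMap.adjoint 𝒯.fstL (hVm.toLp _) with ha
  refine ⟨a, (𝒯.L2_eq_of_comp_Y ?_).symm⟩
  have hcyl : IsOpen (𝒯.Γ ×ˢ Ioo (0 : ℝ) 1) := 𝒯.param_in.isOpen.prod isOpen_Ioo
  have hbor : BorelSpace (E m × ℝ) := Prod.borelSpace
  suffices hz : hUm.toLp _ - 𝒯.fstL a = 0 by
    have h1 : (fun p => 𝒯.liftL a (𝒯.Y p)) =ᵐ[𝒯.vol] fun p => a (𝒯.ζ (𝒯.Y p)) :=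
      𝒯.quasiMeasurePreserving_Y.ae_eq_comp (𝒯.coeFn_liftL a)
    have h2 : 𝒯.fstL a =ᵐ[𝒯.vol] fun p => u (𝒯.Y p) := by
      rw [← sub_eq_zero.1 hz]; exact hUm.coeFn_toLp
    filter_upwards [h1, h2, 𝒯.coeFn_fstL a, 𝒯.ae_vol_mem] with p e1 e2 e3 hp
    rw [e1, ← e2, e3, 𝒯.ζ_Y hp]
  refine Lp_eq_zero_of_forall_integral_mul hcyl 𝒯.ae_vol_mem _ fun η hηC hηc hηs => ?_
  -- the primitive of `η - η₀ N`, where `N` is the integral of `η` over the fibre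
  set N : E m → ℝ := fun ξ => ∫ τ in (0 : ℝ)..1, η (ξ, τ) with hN
  have hNC : ContDiff ℝ 1 N := by
    rw [← contDiffOn_univ]
    exact contDiffOn_integral_param isOpen_univ ((hηC.of_le (by simp)).contDiffOn) 0 1 zero_le_one
  set K₁ : Set (E m) := Prod.fst '' tsupport η with hK₁
  have hK₁c : IsCompact K₁ := hηc.isCompact.image continuous_fst
  have hη0 : ∀ ξ ∉ K₁, ∀ s, η (ξ, s) = 0 := fun ξ hξ s => by
    by_contra h
    exact hξ ⟨_, subset_tsupport η h, rfl⟩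
  have hN0 : ∀ ξ ∉ K₁, N ξ = 0 := fun ξ hξ => by simp [hN, hη0 ξ hξ]
  set K₂ : Set ℝ := Prod.snd '' tsupport η ∪ Icc (1 / 4) (3 / 4) with hK₂
  have hK₂c : IsCompact K₂ := (hηc.isCompact.image continuous_snd).union isCompact_Icc
  have hK₂n : K₂.Nonempty := ⟨1 / 2, Or.inr ⟨by norm_num, by norm_num⟩⟩
  have hK₂s : K₂ ⊆ Ioo 0 1 := by
    rintro s (⟨p, hp, rfl⟩ | hs)
    · exact (hηs hp).2
    · exact ⟨by linarith [hs.1], by linarith [hs.2]⟩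
  set α := sInf K₂ with hα
  set β := sSup K₂ with hβ
  have hα0 : 0 < α := (hK₂s (hK₂c.sInf_mem hK₂n)).1
  have hβ1 : β < 1 := (hK₂s (hK₂c.sSup_mem hK₂n)).2
  set g : E m × ℝ → ℝ := fun p => η p - η₀ p.2 * N p.1 with hg
  have hgC : ContDiff ℝ 1 g := (hηC.of_le (by simp)).sub
    (((hη₀C.of_le (by simp)).comp contDiff_snd).mul (hNC.comp contDiff_fst))
  have hg0 : ∀ ξ, ∀ s ∉ Icc α β, g (ξ, s) = 0 := by
    intro ξ s hs
    have hs2 : s ∉ K₂ := fun h => hs ⟨csInf_le hK₂c.bddBelow h, le_csSup hK₂c.bddAbove h⟩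
    have h1 : η (ξ, s) = 0 := by
      by_contra h
      exact hs2 (Or.inl ⟨_, subset_tsupport η h, rfl⟩)
    have h2 : η₀ s = 0 := hη₀s s fun h => hs2 (Or.inr h)
    simp only [hg, h1, h2, zero_mul, sub_zero]
  have hgs : ∀ ξ, Continuous fun s => g (ξ, s) := fun ξ => hgC.continuous.comp (by fun_prop)
  have hg1 : ∀ ξ, ∫ s in (0 : ℝ)..1, g (ξ, s) = 0 := by
    intro ξ
    have e1 : IntervalIntegrable (fun s => η (ξ, s)) volume 0 1 :=
      (hηC.continuous.comp (by fun_prop)).intervalIntegrable _ _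
    have e2 : IntervalIntegrable (fun s => η₀ s * N ξ) volume 0 1 :=
      (hη₀C.continuous.mul continuous_const).intervalIntegrable _ _
    simp only [hg]
    rw [intervalIntegral.integral_sub e1 e2, intervalIntegral.integral_mul_const, hη₀1, one_mul,
      sub_self]
  have hq := 𝒯.integral_comp_Y_mul_deriv hu (q := fun p => ∫ σ in (0 : ℝ)..p.2, g (p.1, σ)) (q' := g)
    (contDiffOn_primitive 𝒯.param_in.isOpen hgC.contDiffOn) (K := K₁ ×ˢ Icc α β)
    (hK₁c.prod isCompact_Icc) ?_ ?_ ?_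
  rotate_left
  · rintro ⟨ξ, s⟩ ⟨⟨p, hp, hpξ⟩, hs⟩
    exact ⟨hpξ ▸ (hηs hp).1, hα0.trans_le hs.1, hs.2.trans_lt hβ1⟩
  · rintro ⟨ξ, s⟩ - hp
    change ∫ σ in (0 : ℝ)..s, g (ξ, σ) = 0
    by_cases hξ : ξ ∈ K₁
    · have hs : s ∉ Icc α β := fun h => hp ⟨hξ, h⟩
      rcases not_and_or.1 hs with h | h
      · push Not at h
        refine (intervalIntegral.integral_congr (g := fun _ => 0) fun σ hσ => ?_).trans (by simp)
        refine hg0 ξ σ fun h' => ?_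
        have := hσ.2.trans_lt (max_lt hα0 h)
        exact this.not_ge h'.1
      · push Not at h
        rw [← intervalIntegral.integral_add_adjacent_intervals
          ((hgs ξ).intervalIntegrable 0 1) ((hgs ξ).intervalIntegrable 1 s), hg1, zero_add]
        refine (intervalIntegral.integral_congr (g := fun _ => 0) fun σ hσ => ?_).trans (by simp)
        refine hg0 ξ σ fun h' => ?_
        have := (lt_min hβ1 h).trans_le hσ.1
        exact this.not_ge h'.2
    · have h1 : ∀ σ, g (ξ, σ) = 0 := fun σ => by
        simp only [hg, hη0 ξ hξ, hN0 ξ hξ, mul_zero, sub_zero]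
      simp [h1]
  · rintro ⟨ξ, s⟩ -
    exact intervalIntegral.integral_hasDerivAt_right ((hgs ξ).intervalIntegrable _ _)
      ((hgs ξ).stronglyMeasurableAtFilter _ _) (hgs ξ).continuousAt
  -- rewrite the two parts of the integral
  have hNm : MemLp N 2 ((volume : Measure (E m)).restrict 𝒯.Γ) :=
    (hNC.continuous.memLp_of_hasCompactSupport
      (HasCompactSupport.intro hK₁c hN0)).restrict _
  have hηm : MemLp η 2 𝒯.vol := hηC.continuous.memLp_of_hasCompactSupport hηc
  have i1 : Integrable (fun p => η p * u (𝒯.Y p)) 𝒯.vol := hηm.integrable_mul hUm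
  have i2 : Integrable (fun p => η p * 𝒯.fstL a p) 𝒯.vol := hηm.integrable_mul (Lp.memLp _)
  have i3 : Integrable (fun p => N p.1 * (η₀ p.2 * u (𝒯.Y p))) 𝒯.vol :=
    (memLp_comp_of_map_le measurable_fst.aemeasurable 𝒯.map_fst_vol_le hNm).integrable_mul hVm
  have j1 : ∫ p, η p * u (𝒯.Y p) ∂𝒯.vol = ∫ p, N p.1 * (η₀ p.2 * u (𝒯.Y p)) ∂𝒯.vol := by
    rw [← sub_eq_zero, ← integral_sub i1 i3, ← hq]
    refine integral_congr_ae (Eventually.of_forall fun p => ?_)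
    simp only [hg]
    ring
  have j2 : ∫ p, N p.1 * (η₀ p.2 * u (𝒯.Y p)) ∂𝒯.vol = ∫ ξ in 𝒯.Γ, N ξ * a ξ := by
    have h1 : ⟪hVm.toLp _, 𝒯.fstL (hNm.toLp N)⟫ = ⟪a, hNm.toLp N⟫ := by
      rw [ha, ContinuousLinearMap.adjoint_inner_left]
    rw [L2.inner_def, L2.inner_def] at h1
    refine Eq.trans ?_ (h1.trans ?_)
    · refine integral_congr_ae ?_
      have e1 := ae_eq_comp_of_map_le measurable_fst.aemeasurable 𝒯.map_fst_vol_le hNm.coeFn_toLp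
      filter_upwards [hVm.coeFn_toLp, 𝒯.coeFn_fstL (hNm.toLp N), e1] with p h2 h3 h4
      rw [h2, h3, h4, RCLike.inner_apply, conj_trivial]
    · refine integral_congr_ae ?_
      filter_upwards [hNm.coeFn_toLp] with ξ h2
      rw [h2, RCLike.inner_apply, conj_trivial]
  have j3 : ∫ p, η p * 𝒯.fstL a p ∂𝒯.vol = ∫ ξ in 𝒯.Γ, N ξ * a ξ := by
    have h1 : (fun p => η p * 𝒯.fstL a p) =ᵐ[𝒯.vol] fun p => η p * a p.1 := by
      filter_upwards [𝒯.coeFn_fstL a] with p hp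
      rw [hp]
    rw [integral_congr_ae h1]
    have i4 := i2.congr h1
    rw [vol] at i4 ⊢
    rw [integral_prod _ i4]
    refine integral_congr_ae (Eventually.of_forall fun ξ => ?_)
    simp only [hN]
    rw [integral_mul_const, intervalIntegral.integral_of_le zero_le_one,
      integral_Ioc_eq_integral_Ioo]
  have j4 : ∫ p, η p * (hUm.toLp _ - 𝒯.fstL a : Lp ℝ 2 𝒯.vol) p ∂𝒯.vol =
      ∫ p, η p * u (𝒯.Y p) - η p * 𝒯.fstL a p ∂𝒯.vol := by
    refine integral_congr_ae ?_
    filter_upwards [Lp.coeFn_sub (hUm.toLp _) (𝒯.fstL a), hUm.coeFn_toLp] with p h1 h2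
    rw [h1, Pi.sub_apply, h2, mul_sub]
  rw [j4, integral_sub i1 i2, j1, j2, j3, sub_self]

end TubeData

/-! ### Density of the smooth functions in `𝒱̃` -/

section
variable {d : ℕ}

/-- The pairs `(φ, b · ∇φ)` with `φ ∈ C¹(closure Ω)` and `φ = 0` on `S`. -/
def classicalVt (Ω : Set (E d)) (b : E d → E d) (S : Set (E d)) :
    Submodule ℝ (WithLp 2 (L2 Ω × L2 Ω)) where
  carrier := {w | ∃ φ : E d → ℝ, ContDiff ℝ 1 φ ∧ (∀ x ∈ S, φ x = 0) ∧
    w.fst =ᵐ[volume.restrict Ω] φ ∧ w.snd =ᵐ[volume.restrict Ω] fun x => fderiv ℝ φ x (b x)}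
  zero_mem' := by
    refine ⟨fun _ => 0, contDiff_const, fun _ _ => rfl, Lp.coeFn_zero ℝ 2 (volume.restrict Ω), ?_⟩
    filter_upwards [Lp.coeFn_zero ℝ 2 (volume.restrict Ω)] with x hx
    rw [WithLp.zero_snd, hx]; simp
  add_mem' := by
    rintro w z ⟨φ, h1, h2, h3, h4⟩ ⟨η, k1, k2, k3, k4⟩
    refine ⟨φ + η, h1.add k1, fun x hx => by simp [h2 x hx, k2 x hx],
      (Lp.coeFn_add w.fst z.fst).trans (h3.add k3), ?_⟩
    rw [WithLp.add_snd]
    filter_upwards [Lp.coeFn_add w.snd z.snd, h4, k4] with x hx hx1 hx2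
    rw [hx, Pi.add_apply, hx1, hx2,
      fderiv_add (h1.differentiable one_ne_zero x) (k1.differentiable one_ne_zero x)]
    rfl
  smul_mem' := by
    rintro c w ⟨φ, h1, h2, h3, h4⟩
    refine ⟨c • φ, h1.const_smul c, fun x hx => by simp [h2 x hx],
      (Lp.coeFn_smul c w.fst).trans (h3.const_smul c), ?_⟩
    rw [WithLp.smul_snd]
    filter_upwards [Lp.coeFn_smul c w.snd, h4] with x hx hx1
    rw [hx, Pi.smul_apply, hx1, fderiv_const_smul (h1.differentiable one_ne_zero x)]
    rfl

lemma memLp_of_continuous {d' : ℕ} {Ω : Set (E d')} (hΩ : MeasurableSet Ω)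
    (hbd : Bornology.IsBounded Ω) {F : Type*} [NormedAddCommGroup F] {f : E d' → F}
    (hf : Continuous f) : MemLp f 2 (volume.restrict Ω) := by
  have hfin : IsFiniteMeasure ((volume : Measure (E d')).restrict Ω) :=
    isFiniteMeasure_restrict.2 hbd.measure_lt_top.ne
  obtain ⟨C, hC⟩ := hbd.isCompact_closure.exists_bound_of_continuousOn hf.continuousOn
  refine MemLp.of_bound hf.aestronglyMeasurable C ?_
  filter_upwards [ae_restrict_mem hΩ] with x hx using hC x (subset_closure hx)

end

namespace TubeData
variable {m : ℕ} {Ω : Set (E (m + 1))} {b : E (m + 1) → E (m + 1)} (𝒯 : TubeData Ω b)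
  {φ : E (m + 1) → ℝ}

lemma continuous_gradient (hφ : ContDiff ℝ 1 φ) : Continuous (∇ φ) :=
  (InnerProductSpace.toDual ℝ (E (m + 1))).symm.continuous.comp (hφ.continuous_fderiv one_ne_zero)

lemma continuous_fderiv_b (𝒯 : TubeData Ω b) (hφ : ContDiff ℝ 1 φ) :
    Continuous fun x => fderiv ℝ φ x (b x) :=
  (hφ.continuous_fderiv one_ne_zero).clm_apply 𝒯.contDiff_b.continuous

lemma memLp_domain (𝒯 : TubeData Ω b) {F : Type*} [NormedAddCommGroup F] {f : E (m + 1) → F}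
    (hf : Continuous f) : MemLp f 2 (volume.restrict Ω) :=
  memLp_of_continuous 𝒯.isOpen.measurableSet 𝒯.isBounded hf

/-- The pair `(φ, b · ∇φ)`. -/
def pairVt (hφ : ContDiff ℝ 1 φ) : WithLp 2 (L2 Ω × L2 Ω) :=
  WithLp.toLp 2 ((𝒯.memLp_domain hφ.continuous).toLp φ,
    (𝒯.memLp_domain (𝒯.continuous_fderiv_b hφ)).toLp _)

lemma pairVt_mem (hφ : ContDiff ℝ 1 φ) {S : Set (E (m + 1))} (hS : ∀ x ∈ S, φ x = 0) :
    𝒯.pairVt hφ ∈ classicalVt Ω b S := ⟨φ, hφ, hS, (𝒯.memLp_domain hφ.continuous).coeFn_toLp,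
    (𝒯.memLp_domain (𝒯.continuous_fderiv_b hφ)).coeFn_toLp⟩

lemma isWeakDirDeriv_of_contDiff (𝒯 : TubeData Ω b) (hφ : ContDiff ℝ 1 φ) {u : L2 Ω}
    (hu : u =ᵐ[volume.restrict Ω] φ) {g : L2 Ω}
    (hg : g =ᵐ[volume.restrict Ω] fun x => fderiv ℝ φ x (b x)) : IsWeakDirDeriv Ω b u g := by
  have hG := 𝒯.memLp_domain (continuous_gradient hφ)
  refine (isWeakGradient_of_contDiff hφ hu hG.coeFn_toLp).isWeakDirDeriv 𝒯.contDiff_b ?_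
  filter_upwards [hg, hG.coeFn_toLp] with x h1 h2
  rw [h1, h2, inner_gradient]

lemma classicalVt_le (𝒯 : TubeData Ω b) (S : Set (E (m + 1))) :
    classicalVt Ω b S ≤ spaceVt Ω b 𝒯.contDiff_b := by
  rintro w ⟨φ, hφ, -, h1, h2⟩
  exact 𝒯.isWeakDirDeriv_of_contDiff hφ h1 h2

lemma topologicalClosure_classicalVt_le (𝒯 : TubeData Ω b) (S : Set (E (m + 1))) :
    (classicalVt Ω b S).topologicalClosure ≤ spaceVt Ω b 𝒯.contDiff_b :=
  Submodule.topologicalClosure_minimal _ (𝒯.classicalVt_le S) (isClosed_spaceVt 𝒯.contDiff_b)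

/-- Functions which vanish on the inflow boundary are controlled by their derivative along the
field. -/
lemma exists_eLpNorm_le_of_eqOn_zero : ∃ C : ℝ≥0, ∀ {φ : E (m + 1) → ℝ}, ContDiff ℝ 1 φ →
    (∀ ξ ∈ 𝒯.Γ, φ (𝒯.h ξ) = 0) → eLpNorm φ 2 (volume.restrict Ω) ≤
      C * eLpNorm (fun x => fderiv ℝ φ x (b x)) 2 (volume.restrict Ω) := by
  obtain ⟨C, hC⟩ := 𝒯.exists_eLpNorm_le_of_fiber
  refine ⟨C * 𝒯.Λ.toNNReal, fun {φ} hφ h0 => ?_⟩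
  have hc := 𝒯.continuous_fderiv_b hφ
  have hc' : Continuous fun x => 𝒯.Λ • fderiv ℝ φ x (b x) := hc.const_smul 𝒯.Λ
  have h1 := hC φ (fun x => 𝒯.Λ • fderiv ℝ φ x (b x)) hφ.continuous.aestronglyMeasurable
    hc'.aestronglyMeasurable fun x hx => by
      refine enorm_le_lintegral_of_norm_le
        (f := fun s => 𝒯.Λ • fderiv ℝ φ (𝒯.Y (𝒯.ζ x, s)) (b (𝒯.Y (𝒯.ζ x, s)))) ?_
      have h2 := 𝒯.abs_sub_le_integral hφ (𝒯.ζ_mem hx) (Ioo_subset_Icc_self (𝒯.θ_mem hx))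
        (left_mem_Icc.2 zero_le_one)
      rw [𝒯.Y_ζ_θ hx, 𝒯.Y_zero, h0 _ (𝒯.ζ_mem hx), sub_zero] at h2
      simp_rw [norm_smul, Real.norm_of_nonneg 𝒯.Λ_pos.le]
      rwa [intervalIntegral.integral_const_mul]
  refine h1.trans (le_of_eq ?_)
  rw [ENNReal.coe_mul, mul_assoc]
  congr 1
  refine (eLpNorm_const_smul 𝒯.Λ (fun x => fderiv ℝ φ x (b x)) 2 (volume.restrict Ω)).trans ?_
  rw [Real.enorm_eq_ofReal 𝒯.Λ_pos.le]
  rfl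

/-- The values on the inflow boundary are controlled by the norm of `𝒱̃`. -/
lemma exists_eLpNorm_comp_h_le : ∃ C : ℝ≥0, ∀ {φ : E (m + 1) → ℝ}, ContDiff ℝ 1 φ →
    eLpNorm (fun ξ => φ (𝒯.h ξ)) 2 ((volume : Measure (E m)).restrict 𝒯.Γ) ≤
      C * (eLpNorm φ 2 (volume.restrict Ω) +
        eLpNorm (fun x => fderiv ℝ φ x (b x)) 2 (volume.restrict Ω)) := by
  obtain ⟨C, hC⟩ := 𝒯.exists_eLpNorm_vol_le
  refine ⟨C * max 1 𝒯.Λ.toNNReal, fun {φ} hφ => ?_⟩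
  have hΛ := 𝒯.Λ_pos
  have hc := 𝒯.continuous_fderiv_b hφ
  set f : E (m + 1) → ℝ := fun x => ‖φ x‖ + 𝒯.Λ * ‖fderiv ℝ φ x (b x)‖ with hf
  have hfc : Continuous f := hφ.continuous.norm.add (continuous_const.mul hc.norm)
  have h1 : eLpNorm (fun p : E m × ℝ => φ (𝒯.h p.1)) 2 𝒯.vol ≤ eLpNorm (fun p => f (𝒯.Y p)) 2 𝒯.vol := by
    refine 𝒯.eLpNorm_vol_le_of_fiber (hfc.measurable.comp 𝒯.measurable_Y).aestronglyMeasurable ?_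
    filter_upwards [𝒯.ae_vol_mem] with p hp
    obtain ⟨ξ, s⟩ := p
    have hξ : ξ ∈ 𝒯.Γ := hp.1
    have hY := 𝒯.continuous_Y_slice ξ
    refine enorm_le_lintegral_of_norm_le (f := fun s => f (𝒯.Y (ξ, s))) ?_
    set A := ∫ σ in (0 : ℝ)..1, ‖fderiv ℝ φ (𝒯.Y (ξ, σ)) (b (𝒯.Y (ξ, σ)))‖ with hA
    have e1 : IntervalIntegrable (fun s => ‖φ (𝒯.Y (ξ, s))‖) volume 0 1 :=
      (hφ.continuous.comp hY).norm.intervalIntegrable _ _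
    have e2 : IntervalIntegrable (fun s => 𝒯.Λ * ‖fderiv ℝ φ (𝒯.Y (ξ, s)) (b (𝒯.Y (ξ, s)))‖)
        volume 0 1 := (continuous_const.mul (hc.comp hY).norm).intervalIntegrable _ _
    have h2 : ∫ s in (0 : ℝ)..1, ‖f (𝒯.Y (ξ, s))‖ = (∫ s in (0 : ℝ)..1, ‖φ (𝒯.Y (ξ, s))‖) + 𝒯.Λ * A := by
      rw [hA, ← intervalIntegral.integral_const_mul, ← intervalIntegral.integral_add e1 e2]
      refine intervalIntegral.integral_congr fun s _ => ?_
      exact Real.norm_of_nonneg (by positivity)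
    rw [h2]
    have h3 : ∫ _s in (0 : ℝ)..1, (‖φ (𝒯.h ξ)‖ - 𝒯.Λ * A) ≤ ∫ s in (0 : ℝ)..1, ‖φ (𝒯.Y (ξ, s))‖ := by
      refine intervalIntegral.integral_mono_on zero_le_one (by simp) e1 fun s hs => ?_
      have h4 := 𝒯.abs_sub_le_integral hφ hξ (left_mem_Icc.2 zero_le_one) hs
      rw [𝒯.Y_zero] at h4
      have h5 := abs_sub_abs_le_abs_sub (φ (𝒯.h ξ)) (φ (𝒯.Y (ξ, s)))
      rw [Real.norm_eq_abs, Real.norm_eq_abs]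
      linarith
    rw [intervalIntegral.integral_const, sub_zero, one_smul] at h3
    linarith
  have h2 : eLpNorm (fun ξ => φ (𝒯.h ξ)) 2 ((volume : Measure (E m)).restrict 𝒯.Γ) =
      eLpNorm (fun p : E m × ℝ => φ (𝒯.h p.1)) 2 𝒯.vol := by
    rw [← 𝒯.map_fst_vol]
    exact eLpNorm_map_measure
      (hφ.continuous.comp 𝒯.param_in.contDiff.continuous).aestronglyMeasurable
      measurable_fst.aemeasurable
  rw [h2]
  refine h1.trans ((hC f hfc.aestronglyMeasurable).trans ?_)
  rw [ENNReal.coe_mul, mul_assoc]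
  gcongr
  refine (eLpNorm_add_le hφ.continuous.norm.aestronglyMeasurable
    (continuous_const.mul hc.norm).aestronglyMeasurable (by norm_num)).trans ?_
  rw [mul_add, eLpNorm_norm]
  refine add_le_add (le_mul_of_one_le_left' ?_) ?_
  · exact_mod_cast le_max_left (1 : ℝ≥0) _
  · have h3 : eLpNorm (fun x => 𝒯.Λ * ‖fderiv ℝ φ x (b x)‖) 2 (volume.restrict Ω) =
        ‖𝒯.Λ‖ₑ * eLpNorm (fun x => ‖fderiv ℝ φ x (b x)‖) 2 (volume.restrict Ω) :=
      eLpNorm_const_smul 𝒯.Λ (fun x => ‖fderiv ℝ φ x (b x)‖) 2 (volume.restrict Ω)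
    refine h3.le.trans ?_
    rw [eLpNorm_norm, Real.enorm_eq_ofReal hΛ.le]
    gcongr
    exact ENNReal.coe_le_coe.2 (le_max_right _ _)

/-- Every function in `L²(Ω)` is approximated by derivatives `b · ∇φ`, where `φ ∈ C¹(closure Ω)`
vanishes on the inflow boundary. -/
lemma dense_snd : ((classicalVt Ω b (𝒯.h '' 𝒯.Γ)).map
    (WithLp.sndL 2 ℝ (L2 Ω) (L2 Ω)).toLinearMap).topologicalClosure = ⊤ := by
  rw [Submodule.topologicalClosure_eq_top_iff, Submodule.eq_bot_iff]
  intro f hf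
  obtain ⟨cL, hcL, hL⟩ := 𝒯.exists_L_ge
  obtain ⟨Cw, hCw, hw⟩ := 𝒯.exists_w_le
  have hbor : BorelSpace (E m × ℝ) := Prod.borelSpace
  have hcyl : IsOpen (𝒯.Γ ×ˢ Ioo (0 : ℝ) 1) := 𝒯.param_in.isOpen.prod isOpen_Ioo
  have hfm := 𝒯.memLp_comp_Y f
  have hgm : MemLp (fun p => 𝒯.w p / 𝒯.L p.1 * f (𝒯.Y p)) 2 𝒯.vol := by
    refine hfm.of_le_mul (c := Cw / cL) (AEStronglyMeasurable.mul ?_ hfm.1) ?_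
    · exact (𝒯.measurable_w.div (𝒯.measurable_L.comp measurable_fst)).aestronglyMeasurable
    · filter_upwards [𝒯.ae_vol_mem] with p hp
      rw [norm_mul, Real.norm_of_nonneg (div_nonneg (𝒯.w_pos hp.1).le (𝒯.L_pos hp.1).le)]
      refine mul_le_mul_of_nonneg_right ?_ (norm_nonneg _)
      exact div_le_div₀ hCw (hw p ⟨hp.1, Ioo_subset_Icc_self hp.2⟩) hcL (hL _ hp.1)
  -- the test functions are the derivatives `∂ₛ` of their primitives, which extend to `C¹` functions
  have hz : hgm.toLp _ = 0 := by
    refine Lp_eq_zero_of_forall_integral_mul hcyl 𝒯.ae_vol_mem _ fun G hGC hGc hGs => ?_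
    have hGC1 : ContDiff ℝ 1 G := hGC.of_le (by simp)
    have hGsl : ∀ ξ, Continuous fun s => G (ξ, s) := fun ξ => hGC.continuous.comp (by fun_prop)
    set K : Set (E m) := Prod.fst '' tsupport G with hK
    have hG0 : ∀ ξ ∉ K, ∀ s, G (ξ, s) = 0 := fun ξ hξ s => by
      by_contra h
      exact hξ ⟨_, subset_tsupport G h, rfl⟩
    have hKΓ : K ⊆ 𝒯.Γ := by
      rintro _ ⟨p, hp, rfl⟩
      exact (hGs hp).1
    obtain ⟨φ, hφ, -, hφF⟩ := 𝒯.exists_extension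
      (F := fun p => ∫ σ in (0 : ℝ)..p.2, G (p.1, σ))
      (contDiffOn_primitive 𝒯.param_in.isOpen hGC1.contDiffOn) (hGc.isCompact.image continuous_fst)
      hKΓ fun ξ _ hξK s => by simp [hG0 ξ hξK]
    have hφ0 : ∀ x ∈ 𝒯.h '' 𝒯.Γ, φ x = 0 := by
      rintro _ ⟨ξ, hξ, rfl⟩
      have := hφF ξ hξ 0 (left_mem_Icc.2 zero_le_one)
      rwa [𝒯.Y_zero, intervalIntegral.integral_same] at this
    have hd : ∀ p ∈ 𝒯.Γ ×ˢ Ioo (0 : ℝ) 1,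
        𝒯.L p.1 * fderiv ℝ φ (𝒯.Y p) (b (𝒯.Y p)) = G p := by
      rintro ⟨ξ, s⟩ hp
      have hξ : ξ ∈ 𝒯.Γ := hp.1
      have d1 := (hφ.differentiable one_ne_zero (𝒯.Y (ξ, s))).hasFDerivAt.comp_hasDerivAt s
        (𝒯.hasDerivAt_Y ξ s)
      have d2 : HasDerivAt (fun s' => ∫ σ in (0 : ℝ)..s', G (ξ, σ)) (G (ξ, s)) s :=
        intervalIntegral.integral_hasDerivAt_right ((hGsl ξ).intervalIntegrable _ _)
          ((hGsl ξ).stronglyMeasurableAtFilter _ _) (hGsl ξ).continuousAt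
      have e1 : (fun s' => φ (𝒯.Y (ξ, s'))) =ᶠ[𝓝 s] fun s' => ∫ σ in (0 : ℝ)..s', G (ξ, σ) := by
        filter_upwards [Icc_mem_nhds hp.2.1 hp.2.2] with s' hs' using hφF ξ hξ s' hs'
      have e2 := d1.unique (d2.congr_of_eventuallyEq e1)
      rwa [map_smul, smul_eq_mul, 𝒯.eqOn (subset_closure (𝒯.Y_mem hp))] at e2
    have h1 := (Submodule.mem_orthogonal _ f).1 hf (𝒯.pairVt hφ).snd
      ⟨_, 𝒯.pairVt_mem hφ hφ0, rfl⟩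
    rw [L2.inner_def] at h1
    have hc := 𝒯.continuous_fderiv_b hφ
    have h2 : ∫ x in Ω, fderiv ℝ φ x (b x) * f x = 0 := by
      rw [← h1]
      refine integral_congr_ae ?_
      filter_upwards [(𝒯.memLp_domain hc).coeFn_toLp] with x hx
      have hx' : (𝒯.pairVt hφ).snd x = fderiv ℝ φ x (b x) := hx
      rw [hx', RCLike.inner_apply, conj_trivial, mul_comm]
    have hm : AEStronglyMeasurable (fun x => fderiv ℝ φ x (b x) * f x) (volume.restrict Ω) :=
      hc.aestronglyMeasurable.mul (Lp.aestronglyMeasurable f)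
    rw [← h2, 𝒯.integral_eq_vol hm]
    refine integral_congr_ae ?_
    filter_upwards [hgm.coeFn_toLp, 𝒯.ae_vol_mem] with p h3 hp
    have hLp := 𝒯.L_pos hp.1
    rw [h3, ← hd p hp, smul_eq_mul]
    field_simp
  refine 𝒯.L2_eq_of_comp_Y ?_
  have h0 : (fun p => (0 : L2 Ω) (𝒯.Y p)) =ᵐ[𝒯.vol] fun _ => 0 :=
    𝒯.quasiMeasurePreserving_Y.ae_eq_comp (Lp.coeFn_zero ℝ 2 (volume.restrict Ω))
  have h1 := hgm.coeFn_toLp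
  rw [hz] at h1
  filter_upwards [h0, h1, Lp.coeFn_zero ℝ 2 𝒯.vol, 𝒯.ae_vol_mem] with p e0 e1 e2 hp
  rw [e2, Pi.zero_apply] at e1
  rw [e0]
  rcases mul_eq_zero.1 e1.symm with h | h
  · exact absurd h (div_pos (𝒯.w_pos hp.1) (𝒯.L_pos hp.1)).ne'
  · exact h

/-- The equation `b · ∇u = g` has a solution in `𝒱̃` which vanishes at the inflow: the operator
`b · ∇` is bounded below on the functions with this property, so its dense range is closed. -/
lemma exists_snd_eq (g : L2 Ω) :
    ∃ w ∈ (classicalVt Ω b (𝒯.h '' 𝒯.Γ)).topologicalClosure, w.snd = g := by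
  obtain ⟨C, hC⟩ := 𝒯.exists_eLpNorm_le_of_eqOn_zero
  set D := (classicalVt Ω b (𝒯.h '' 𝒯.Γ)).topologicalClosure with hD
  have hcl : IsClosed {w : WithLp 2 (L2 Ω × L2 Ω) | ‖w.fst‖ ≤ C * ‖w.snd‖} :=
    isClosed_le (WithLp.fstL 2 ℝ (L2 Ω) (L2 Ω)).continuous.norm
      (continuous_const.mul (WithLp.sndL 2 ℝ (L2 Ω) (L2 Ω)).continuous.norm)
  have hle : ∀ w ∈ D, ‖w.fst‖ ≤ C * ‖w.snd‖ := by
    intro w hw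
    refine closure_minimal (fun w hw => ?_) hcl hw
    obtain ⟨φ, hφ, h0, h1, h2⟩ := hw
    have h3 := hC hφ fun ξ hξ => h0 _ ⟨ξ, hξ, rfl⟩
    rw [← eLpNorm_congr_ae h1, ← eLpNorm_congr_ae h2] at h3
    have h4 := ENNReal.toReal_mono (ENNReal.mul_ne_top ENNReal.coe_ne_top (Lp.eLpNorm_ne_top _)) h3
    rwa [ENNReal.toReal_mul, ENNReal.coe_toReal] at h4
  set T : D →L[ℝ] L2 Ω := (WithLp.sndL 2 ℝ (L2 Ω) (L2 Ω)).comp D.subtypeL with hT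
  have hcomp : CompleteSpace D := (Submodule.isClosed_topologicalClosure _).completeSpace_coe
  have hanti : AntilipschitzWith (C + 1) T := by
    refine ContinuousLinearMap.antilipschitz_of_bound T fun w => ?_
    have h1 : ‖w.1‖ ≤ ‖w.1.fst‖ + ‖w.1.snd‖ := norm_withLp_le_add _
    have h2 := hle w.1 w.2
    change ‖w.1‖ ≤ ((C + 1 : ℝ≥0) : ℝ) * ‖w.1.snd‖
    push_cast
    linarith
  have hclr : IsClosed (range T) := hanti.isClosed_range T.uniformContinuous
  have h1 : g ∈ ((classicalVt Ω b (𝒯.h '' 𝒯.Γ)).map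
      (WithLp.sndL 2 ℝ (L2 Ω) (L2 Ω)).toLinearMap).topologicalClosure := by
    rw [𝒯.dense_snd]; trivial
  have h2 : g ∈ range T := by
    refine closure_minimal ?_ hclr h1
    rintro _ ⟨w, hw, rfl⟩
    exact ⟨⟨w, Submodule.le_topologicalClosure _ hw⟩, rfl⟩
  obtain ⟨w, hw⟩ := h2
  exact ⟨w.1, w.2, hw⟩

/-- A test function on the parameter domain, continued to be constant along field lines. -/
lemma exists_contDiff_eq_comp_ζ {χ : E m → ℝ} (hχ : ContDiff ℝ 1 χ) (hχc : HasCompactSupport χ)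
    (hχΓ : tsupport χ ⊆ 𝒯.Γ) : ∃ φ : E (m + 1) → ℝ, ContDiff ℝ 1 φ ∧
      (∀ x ∈ tangentialBdry Ω b, φ x = 0) ∧ (∀ x ∈ Ω, φ x = χ (𝒯.ζ x)) ∧
      (∀ x ∈ Ω, fderiv ℝ φ x (b x) = 0) ∧ ∀ ξ ∈ 𝒯.Γ, φ (𝒯.h ξ) = χ ξ := by
  obtain ⟨φ, hφ, hφ0, hφF⟩ := 𝒯.exists_extension (F := fun p => χ p.1)
    (hχ.comp contDiff_fst).contDiffOn hχc.isCompact hχΓ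
    fun ξ _ hξ _ => image_eq_zero_of_notMem_tsupport hξ
  have h1 : ∀ x ∈ Ω, φ x = χ (𝒯.ζ x) := fun x hx => by
    have := hφF _ (𝒯.ζ_mem hx) _ (Ioo_subset_Icc_self (𝒯.θ_mem hx))
    rwa [𝒯.Y_ζ_θ hx] at this
  refine ⟨φ, hφ, hφ0, h1, fun x hx => ?_, fun ξ hξ => ?_⟩
  · have h2 : φ =ᶠ[𝓝 x] fun y => χ (𝒯.ζ y) := by
      filter_upwards [𝒯.isOpen.mem_nhds hx] with y hy using h1 y hy
    rw [h2.fderiv_eq, 𝒯.fderiv_comp_ζ hχ.contDiffOn hx, ContinuousLinearMap.comp_apply,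
      𝒯.fderiv_ζ_b hx, map_zero]
  · have := hφF ξ hξ 0 (left_mem_Icc.2 zero_le_one)
    rwa [𝒯.Y_zero] at this

end TubeData

namespace TubeData
variable {m : ℕ} {Ω : Set (E (m + 1))} {b : E (m + 1) → E (m + 1)} (𝒯 : TubeData Ω b)
  {φ : E (m + 1) → ℝ}

/-- The pair `(a ∘ ζ, 0)`. -/
def liftPair (a : 𝒯.L2Γ) : WithLp 2 (L2 Ω × L2 Ω) := WithLp.toLp 2 (𝒯.liftL a, 0)

lemma continuous_liftPair : Continuous 𝒯.liftPair :=
  (WithLp.prodContinuousLinearEquiv 2 ℝ (L2 Ω) (L2 Ω)).symm.continuous.comp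
    (𝒯.liftL.continuous.prodMk continuous_const)

/-- A closed condition on functions on the parameter domain has to be verified for test functions
only. -/
lemma L2Γ_induction {p : 𝒯.L2Γ → Prop} (D : Submodule ℝ 𝒯.L2Γ) (hD : IsClosed (D : Set 𝒯.L2Γ))
    (hp : ∀ a, a ∈ D ↔ p a)
    (h : ∀ (χ : E m → ℝ) (hχ : MemLp χ 2 ((volume : Measure (E m)).restrict 𝒯.Γ)), ContDiff ℝ 1 χ →
      HasCompactSupport χ → tsupport χ ⊆ 𝒯.Γ → p (hχ.toLp χ)) (a : 𝒯.L2Γ) : p a := by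
  have h1 : D.topologicalClosure = ⊤ :=
    dense_testLp 𝒯.param_in.isOpen (ae_restrict_mem 𝒯.param_in.isOpen.measurableSet) D
      fun χ hχ h1 h2 h3 => (hp _).2 (h χ hχ (h1.of_le (by simp)) h2 h3)
  rw [hD.submodule_topologicalClosure_eq] at h1
  exact (hp a).1 (h1 ▸ Submodule.mem_top)

lemma liftL_toLp {χ : E m → ℝ} (hχ : MemLp χ 2 ((volume : Measure (E m)).restrict 𝒯.Γ)) :
    𝒯.liftL (hχ.toLp χ) =ᵐ[volume.restrict Ω] fun x => χ (𝒯.ζ x) :=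
  (𝒯.coeFn_liftL _).trans
    (ae_eq_comp_of_map_le 𝒯.aemeasurable_ζ 𝒯.exists_map_ζ_le.choose_spec hχ.coeFn_toLp)

lemma liftPair_mem (a : 𝒯.L2Γ) : 𝒯.liftPair a ∈ (classicalVt Ω b ∅).topologicalClosure := by
  set J : 𝒯.L2Γ →ₗ[ℝ] WithLp 2 (L2 Ω × L2 Ω) :=
    { toFun := 𝒯.liftPair
      map_add' := fun a a' => by
        refine WithLp.ofLp_injective 2 (Prod.ext (map_add 𝒯.liftL a a') (add_zero _).symm)
      map_smul' := fun c a => by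
        refine WithLp.ofLp_injective 2 (Prod.ext (map_smul 𝒯.liftL c a) (smul_zero _).symm) } with hJ
  refine 𝒯.L2Γ_induction ((classicalVt Ω b ∅).topologicalClosure.comap J)
    ((Submodule.isClosed_topologicalClosure _).preimage 𝒯.continuous_liftPair) (fun _ => Iff.rfl)
    (fun χ hχ h1 h2 h3 => ?_) a
  refine Submodule.le_topologicalClosure _ ?_
  obtain ⟨φ, hφ, -, hφ1, hφ2, -⟩ := 𝒯.exists_contDiff_eq_comp_ζ h1 h2 h3
  refine ⟨φ, hφ, fun x hx => absurd hx (notMem_empty x), ?_, ?_⟩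
  · filter_upwards [𝒯.liftL_toLp hχ, ae_restrict_mem 𝒯.isOpen.measurableSet] with x e1 hx
    rw [hφ1 x hx, ← e1]
    rfl
  · filter_upwards [Lp.coeFn_zero ℝ 2 (volume.restrict Ω),
      ae_restrict_mem 𝒯.isOpen.measurableSet] with x e1 hx
    rw [hφ2 x hx]
    exact e1

/-- The functions in `C¹(closure Ω)` are dense in `𝒱̃`. -/
theorem spaceVt_eq (𝒯 : TubeData Ω b) :
    spaceVt Ω b 𝒯.contDiff_b = (classicalVt Ω b ∅).topologicalClosure := by
  refine le_antisymm (fun u hu => ?_) (𝒯.topologicalClosure_classicalVt_le ∅)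
  obtain ⟨w, hw, hwu⟩ := 𝒯.exists_snd_eq u.snd
  have h1 : u - w ∈ spaceVt Ω b 𝒯.contDiff_b := sub_mem hu (𝒯.topologicalClosure_classicalVt_le _ hw)
  have h2 : (u - w).snd = 0 := by rw [WithLp.sub_snd, hwu, sub_self]
  have h3 : IsWeakDirDeriv Ω b (u - w).fst (u - w).snd := h1
  rw [h2] at h3
  obtain ⟨a, ha⟩ := 𝒯.exists_liftL_eq h3
  have h4 : u - w = 𝒯.liftPair a := WithLp.ofLp_injective 2 (Prod.ext ha.symm h2)
  have h5 : classicalVt Ω b (𝒯.h '' 𝒯.Γ) ≤ classicalVt Ω b ∅ := by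
    rintro w ⟨φ, h1, -, h2, h3⟩
    exact ⟨φ, h1, fun x hx => absurd hx (notMem_empty x), h2, h3⟩
  rw [← sub_add_cancel u w, h4]
  exact add_mem (𝒯.liftPair_mem a) (Submodule.topologicalClosure_mono h5 hw)

/-! ### The inflow trace -/

lemma eqOn_Γ_of_ae_eq {φ φ' : E (m + 1) → ℝ} (hφ : Continuous φ) (hφ' : Continuous φ')
    (h : φ =ᵐ[volume.restrict Ω] φ') : ∀ ξ ∈ 𝒯.Γ, φ (𝒯.h ξ) = φ' (𝒯.h ξ) := by
  have h1 : EqOn φ φ' Ω := Measure.eqOn_open_of_ae_eq h 𝒯.isOpen hφ.continuousOn hφ'.continuousOn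
  intro ξ hξ
  have h2 := 𝒯.Y_mem_closure (p := (ξ, 0)) ⟨hξ, left_mem_Icc.2 zero_le_one⟩
  rw [𝒯.Y_zero] at h2
  exact h1.closure hφ hφ' h2

lemma memLp_comp_h (hφ : Continuous φ) :
    MemLp (fun ξ => φ (𝒯.h ξ)) 2 ((volume : Measure (E m)).restrict 𝒯.Γ) :=
  memLp_of_continuous 𝒯.param_in.isOpen.measurableSet 𝒯.param_in.isBounded
    (hφ.comp 𝒯.param_in.contDiff.continuous)

lemma toLp_comp_h_congr {φ φ' : E (m + 1) → ℝ} (hφ : Continuous φ) (hφ' : Continuous φ')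
    (h : φ =ᵐ[volume.restrict Ω] φ') :
    (𝒯.memLp_comp_h hφ).toLp _ = (𝒯.memLp_comp_h hφ').toLp _ := by
  refine MemLp.toLp_congr _ _ ?_
  filter_upwards [ae_restrict_mem 𝒯.param_in.isOpen.measurableSet] with ξ hξ
  exact 𝒯.eqOn_Γ_of_ae_eq hφ hφ' h ξ hξ

/-- The inclusion of the classical functions into `𝒱̃`. -/
def inclVt (𝒯 : TubeData Ω b) : classicalVt Ω b ∅ →ₗ[ℝ] spaceVt Ω b 𝒯.contDiff_b :=
  Submodule.inclusion (𝒯.classicalVt_le ∅)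

lemma denseRange_inclVt (𝒯 : TubeData Ω b) : DenseRange 𝒯.inclVt := by
  rw [denseRange_iff_closure_range, Set.eq_univ_iff_forall]
  intro x
  rw [mem_closure_iff_seq_limit]
  have hx : x.1 ∈ (classicalVt Ω b ∅).topologicalClosure := by rw [← 𝒯.spaceVt_eq]; exact x.2
  obtain ⟨xk, hxk, hlim⟩ := mem_closure_iff_seq_limit.1 hx
  exact ⟨fun k => 𝒯.inclVt ⟨xk k, hxk k⟩, fun k => mem_range_self _, tendsto_subtype_rng.2 hlim⟩

set_option maxHeartbeats 1000000 in
/-- The trace is the continuous extension of the restriction from the dense subspace of classical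
functions. -/
lemma exists_trace : ∃ tr : spaceVt Ω b 𝒯.contDiff_b →L[ℝ] 𝒯.L2Γ,
    ∀ (φ : E (m + 1) → ℝ) (hφ : ContDiff ℝ 1 φ) (u : spaceVt Ω b 𝒯.contDiff_b),
      u.1.fst =ᵐ[volume.restrict Ω] φ → tr u = (𝒯.memLp_comp_h hφ.continuous).toLp _ := by
  choose Φ hΦ _ hΦ1 hΦ2 using fun w : classicalVt Ω b ∅ => w.2
  set f : classicalVt Ω b ∅ →ₗ[ℝ] 𝒯.L2Γ :=
    { toFun := fun w => (𝒯.memLp_comp_h (hΦ w).continuous).toLp _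
      map_add' := fun w z => by
        rw [← MemLp.toLp_add]
        refine 𝒯.toLp_comp_h_congr (hΦ _).continuous
          ((hΦ w).continuous.add (hΦ z).continuous) ?_
        filter_upwards [hΦ1 (w + z), hΦ1 w, hΦ1 z, Lp.coeFn_add w.1.fst z.1.fst] with x h1 h2 h3 h4
        have h5 : (w + z).1.fst x = (w.1.fst + z.1.fst) x := rfl
        rw [← h1, h5, h4, Pi.add_apply, h2, h3]
        rfl
      map_smul' := fun c w => by
        rw [RingHom.id_apply, ← MemLp.toLp_const_smul]
        refine 𝒯.toLp_comp_h_congr (hΦ _).continuous ((hΦ w).continuous.const_smul c) ?_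
        filter_upwards [hΦ1 (c • w), hΦ1 w, Lp.coeFn_smul c w.1.fst] with x h1 h2 h4
        have h5 : (c • w).1.fst x = (c • w.1.fst) x := rfl
        rw [← h1, h5, h4, Pi.smul_apply, h2]
        rfl } with hf
  obtain ⟨C, hC⟩ := 𝒯.exists_eLpNorm_comp_h_le
  have hfn : ∀ w, ‖f w‖ ≤ (2 * C) * ‖𝒯.inclVt w‖ := by
    intro w
    have h1 := hC (hΦ w)
    rw [← eLpNorm_congr_ae (hΦ1 w), ← eLpNorm_congr_ae (hΦ2 w)] at h1
    have h2 := ENNReal.toReal_mono (ENNReal.mul_ne_top ENNReal.coe_ne_top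
      (ENNReal.add_ne_top.2 ⟨Lp.eLpNorm_ne_top _, Lp.eLpNorm_ne_top _⟩)) h1
    rw [ENNReal.toReal_mul, ENNReal.coe_toReal,
      ENNReal.toReal_add (Lp.eLpNorm_ne_top _) (Lp.eLpNorm_ne_top _)] at h2
    have h3 : ‖f w‖ ≤ C * (‖w.1.fst‖ + ‖w.1.snd‖) := by
      change ‖(𝒯.memLp_comp_h (hΦ w).continuous).toLp _‖ ≤ _
      rw [Lp.norm_toLp]
      exact h2
    have h4 := norm_fst_le_withLp w.1
    have h5 := norm_snd_le_withLp w.1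
    change ‖f w‖ ≤ (2 * C) * ‖w.1‖
    refine h3.trans ?_
    have h6 : (C : ℝ) * (‖w.1.fst‖ + ‖w.1.snd‖) ≤ C * (‖w.1‖ + ‖w.1‖) :=
      mul_le_mul_of_nonneg_left (add_le_add h4 h5) C.coe_nonneg
    linarith
  refine ⟨f.extendOfNorm 𝒯.inclVt, fun φ hφ u hu => ?_⟩
  have hu2 : u.1.snd =ᵐ[volume.restrict Ω] fun x => fderiv ℝ φ x (b x) := by
    have h1 : IsWeakDirDeriv Ω b u.1.fst u.1.snd := u.2
    have hg := 𝒯.memLp_domain (𝒯.continuous_fderiv_b hφ)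
    rw [IsWeakDirDeriv.unique 𝒯.isOpen h1
      (𝒯.isWeakDirDeriv_of_contDiff hφ hu (g := hg.toLp _) hg.coeFn_toLp)]
    exact hg.coeFn_toLp
  set w : classicalVt Ω b ∅ := ⟨u.1, φ, hφ, fun x hx => absurd hx (notMem_empty x), hu, hu2⟩ with hw
  have huw : u = 𝒯.inclVt w := rfl
  rw [huw, LinearMap.extendOfNorm_eq 𝒯.denseRange_inclVt ⟨_, hfn⟩]
  exact 𝒯.toLp_comp_h_congr (hΦ w).continuous hφ.continuous ((hΦ1 w).symm.trans hu)

/-- The trace of a function in `𝒱̃` on the inflow boundary, in terms of the parameter. -/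
def traceΓ : spaceVt Ω b 𝒯.contDiff_b →L[ℝ] 𝒯.L2Γ := 𝒯.exists_trace.choose

lemma traceΓ_eq (hφ : ContDiff ℝ 1 φ) (u : spaceVt Ω b 𝒯.contDiff_b)
    (hu : u.1.fst =ᵐ[volume.restrict Ω] φ) :
    𝒯.traceΓ u = (𝒯.memLp_comp_h hφ.continuous).toLp _ := 𝒯.exists_trace.choose_spec φ hφ u hu

/-- The element `a ∘ ζ` of `𝒢̃`. -/
def liftVt (a : 𝒯.L2Γ) : spaceVt Ω b 𝒯.contDiff_b :=
  ⟨𝒯.liftPair a, 𝒯.topologicalClosure_classicalVt_le ∅ (𝒯.liftPair_mem a)⟩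

lemma liftVt_mem (a : 𝒯.L2Γ) : 𝒯.liftVt a ∈ spaceGt Ω b 𝒯.contDiff_b :=
  (rfl : (𝒯.liftPair a).snd = 0)

lemma exists_liftVt_eq {u : spaceVt Ω b 𝒯.contDiff_b} (hu : u ∈ spaceGt Ω b 𝒯.contDiff_b) :
    ∃ a, 𝒯.liftVt a = u := by
  have h1 : IsWeakDirDeriv Ω b u.1.fst u.1.snd := u.2
  have h2 : u.1.snd = 0 := hu
  rw [h2] at h1
  obtain ⟨a, ha⟩ := 𝒯.exists_liftL_eq h1
  exact ⟨a, Subtype.ext (WithLp.ofLp_injective 2 (Prod.ext ha h2.symm))⟩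

lemma traceΓ_liftVt (a : 𝒯.L2Γ) : 𝒯.traceΓ (𝒯.liftVt a) = a := by
  set J : 𝒯.L2Γ →ₗ[ℝ] spaceVt Ω b 𝒯.contDiff_b :=
    { toFun := 𝒯.liftVt
      map_add' := fun a a' => by
        refine Subtype.ext (WithLp.ofLp_injective 2 (Prod.ext (map_add 𝒯.liftL a a') (add_zero _).symm))
      map_smul' := fun c a => by
        refine Subtype.ext
          (WithLp.ofLp_injective 2 (Prod.ext (map_smul 𝒯.liftL c a) (smul_zero _).symm)) } with hJ
  have hJc : Continuous J := 𝒯.continuous_liftPair.subtype_mk _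
  refine 𝒯.L2Γ_induction (p := fun a => 𝒯.traceΓ (𝒯.liftVt a) = a)
    (LinearMap.eqLocus (𝒯.traceΓ.toLinearMap ∘ₗ J) LinearMap.id)
    (isClosed_eq (𝒯.traceΓ.continuous.comp hJc) continuous_id) (fun _ => Iff.rfl)
    (fun χ hχ h1 h2 h3 => ?_) a
  obtain ⟨φ, hφ, -, hφ1, -, hφ2⟩ := 𝒯.exists_contDiff_eq_comp_ζ h1 h2 h3
  have h4 : (𝒯.liftVt (hχ.toLp χ)).1.fst =ᵐ[volume.restrict Ω] φ := by
    filter_upwards [𝒯.liftL_toLp hχ, ae_restrict_mem 𝒯.isOpen.measurableSet] with x e1 hx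
    rw [hφ1 x hx, ← e1]
    rfl
  rw [𝒯.traceΓ_eq hφ _ h4]
  refine MemLp.toLp_congr _ _ ?_
  filter_upwards [ae_restrict_mem 𝒯.param_in.isOpen.measurableSet] with ξ hξ
  exact hφ2 ξ hξ

/-- The operator `a ↦ a ∘ h⁻¹` from functions of the parameter to functions on the inflow
boundary. -/
def surfL : 𝒯.L2Γ →L[ℝ] Lp ℝ 2 (inflowMeasure Ω b) :=
  compLp 𝒯.measurable_k.aemeasurable 𝒯.exists_surf_le.choose_spec

lemma coeFn_surfL (a : 𝒯.L2Γ) : 𝒯.surfL a =ᵐ[inflowMeasure Ω b] fun x => a (𝒯.k x) :=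
  coeFn_compLp _ _ a

lemma surfL_injective {a : 𝒯.L2Γ} (ha : 𝒯.surfL a = 0) : a = 0 := by
  rw [Lp.eq_zero_iff_ae_eq_zero]
  refine 𝒯.absolutelyContinuous_surf.ae_eq ?_
  have h1 : ∀ᵐ x ∂(inflowMeasure Ω b), a (𝒯.k x) = 0 := by
    have h2 := 𝒯.coeFn_surfL a
    rw [ha] at h2
    filter_upwards [h2, Lp.coeFn_zero ℝ 2 (inflowMeasure Ω b)] with x e1 e2
    rw [← e1, e2, Pi.zero_apply]
  rw [surf]
  have h3 : MeasurableSet {ξ | a ξ = (0 : E m → ℝ) ξ} :=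
    measurableSet_eq_fun (Lp.stronglyMeasurable a).measurable measurable_const
  exact (ae_map_iff 𝒯.measurable_k.aemeasurable h3).2 h1

lemma isInflowTrace : IsInflowTrace Ω b 𝒯.contDiff_b (𝒯.surfL.comp 𝒯.traceΓ) := by
  intro φ u hφ hu
  rw [ContinuousLinearMap.comp_apply, 𝒯.traceΓ_eq hφ u hu]
  have h1 := ae_eq_comp_of_map_le 𝒯.measurable_k.aemeasurable 𝒯.exists_surf_le.choose_spec
    (𝒯.memLp_comp_h hφ.continuous).coeFn_toLp
  filter_upwards [𝒯.coeFn_surfL ((𝒯.memLp_comp_h hφ.continuous).toLp _), h1, 𝒯.ae_inflowMeasure]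
    with x e1 e2 e3
  rw [e1, e2, e3.2]

/-- Two traces agree on the classical functions, which are dense. -/
lemma eq_of_isInflowTrace {T : spaceVt Ω b 𝒯.contDiff_b →L[ℝ] Lp ℝ 2 (inflowMeasure Ω b)}
    (hT : IsInflowTrace Ω b 𝒯.contDiff_b T) : T = 𝒯.surfL.comp 𝒯.traceΓ := by
  ext1 u
  refine 𝒯.denseRange_inclVt.induction_on (p := fun u => T u = (𝒯.surfL.comp 𝒯.traceΓ) u) u
    (isClosed_eq T.continuous (ContinuousLinearMap.continuous _)) fun w => ?_
  obtain ⟨φ, hφ, -, h1, -⟩ := w.2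
  exact Lp.ext ((hT φ (𝒯.inclVt w) hφ h1).trans (𝒯.isInflowTrace φ (𝒯.inclVt w) hφ h1).symm)

/-- The component of `u` in `𝒢̃` is the function which is constant along field lines and has the same
trace as `u`. -/
lemma isCompl_spaceGt_ker : IsCompl (spaceGt Ω b 𝒯.contDiff_b)
    (LinearMap.ker ((𝒯.surfL.comp 𝒯.traceΓ : spaceVt Ω b 𝒯.contDiff_b →L[ℝ] _) :
      spaceVt Ω b 𝒯.contDiff_b →ₗ[ℝ] Lp ℝ 2 (inflowMeasure Ω b))) := by
  refine ⟨?_, ?_⟩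
  · rw [Submodule.disjoint_def]
    intro u hu hu2
    obtain ⟨a, rfl⟩ := 𝒯.exists_liftVt_eq hu
    have h1 : 𝒯.surfL (𝒯.traceΓ (𝒯.liftVt a)) = 0 := hu2
    rw [𝒯.traceΓ_liftVt] at h1
    rw [𝒯.surfL_injective h1]
    exact Subtype.ext (WithLp.ofLp_injective 2 (Prod.ext (map_zero 𝒯.liftL) rfl))
  · rw [codisjoint_iff_le_sup]
    intro u _
    refine Submodule.mem_sup.2 ⟨𝒯.liftVt (𝒯.traceΓ u), 𝒯.liftVt_mem _,
      u - 𝒯.liftVt (𝒯.traceΓ u), ?_, add_sub_cancel _ _⟩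
    change 𝒯.surfL (𝒯.traceΓ (u - 𝒯.liftVt (𝒯.traceΓ u))) = 0
    rw [map_sub, 𝒯.traceΓ_liftVt, sub_self, map_zero]

/-- A test function on the parameter domain gives an element of `𝒢`. -/
lemma exists_mem_spaceG {χ : E m → ℝ} (hχ : ContDiff ℝ 1 χ) (hχc : HasCompactSupport χ)
    (hχΓ : tsupport χ ⊆ 𝒯.Γ) (hχm : MemLp χ 2 ((volume : Measure (E m)).restrict 𝒯.Γ)) :
    ∃ w ∈ spaceG Ω b, w.1.fst = (𝒯.liftVt (hχm.toLp χ)).1.fst := by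
  obtain ⟨φ, hφ, hφ0, hφ1, hφ2, -⟩ := 𝒯.exists_contDiff_eq_comp_ζ hχ hχc hχΓ
  have m1 := 𝒯.memLp_domain hφ.continuous
  have m2 := 𝒯.memLp_domain (continuous_gradient hφ)
  have hw : WithLp.toLp 2 (m1.toLp φ, m2.toLp (∇ φ)) ∈ classicalV Ω b :=
    ⟨φ, hφ, hφ0, m1.coeFn_toLp, m2.coeFn_toLp⟩
  have hle : classicalV Ω b ≤ spaceV Ω b := by
    rw [spaceV_eq]; exact Submodule.le_topologicalClosure _
  have hΩm := ae_restrict_mem (μ := volume) 𝒯.isOpen.measurableSet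
  refine ⟨⟨_, hle hw⟩, ?_, ?_⟩
  · rw [mem_spaceG_iff 𝒯.isUnitField, Lp.eq_zero_iff_ae_eq_zero]
    filter_upwards [coeFn_dirL 𝒯.isUnitField (m2.toLp (∇ φ)), m2.coeFn_toLp, hΩm] with x e1 e2 hx
    refine e1.trans ?_
    rw [e2, inner_gradient, hφ2 x hx, Pi.zero_apply]
  · change m1.toLp φ = 𝒯.liftL (hχm.toLp χ)
    refine Lp.ext ?_
    filter_upwards [m1.coeFn_toLp, 𝒯.liftL_toLp hχm, hΩm] with x e1 e2 hx
    rw [e1, e2, hφ1 x hx]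

/-- The traces of the elements of `𝒢` contain all test functions on `Γ`. -/
lemma eq_zero_of_forall_integral_eq_zero {g : spaceVt Ω b 𝒯.contDiff_b}
    (hg : g ∈ spaceGt Ω b 𝒯.contDiff_b)
    (h : ∀ η : spaceVt Ω b 𝒯.contDiff_b, (∃ w ∈ spaceG Ω b, w.1.fst = η.1.fst) →
      ∫ x, 𝒯.surfL (𝒯.traceΓ η) x * 𝒯.surfL (𝒯.traceΓ g) x ∂(inflowMeasure Ω b) = 0) : g = 0 := by
  obtain ⟨a, rfl⟩ := 𝒯.exists_liftVt_eq hg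
  obtain ⟨C, hC⟩ := 𝒯.exists_surf_le
  have hfin : IsFiniteMeasure 𝒯.surf := by
    refine ⟨(hC univ).trans_lt ?_⟩
    rw [Measure.smul_apply, smul_eq_mul]
    exact ENNReal.mul_lt_top ENNReal.coe_lt_top (measure_lt_top _ _)
  have ham : MemLp a 2 𝒯.surf := (Lp.memLp a).of_measure_le_smul ENNReal.coe_ne_top hC
  have hΓ : ∀ᵐ ξ ∂𝒯.surf, ξ ∈ 𝒯.Γ :=
    Measure.absolutelyContinuous_of_le_smul hC (ae_restrict_mem 𝒯.param_in.isOpen.measurableSet)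
  have hz : ham.toLp a = 0 := by
    refine Lp_eq_zero_of_forall_integral_mul 𝒯.param_in.isOpen hΓ _ fun χ h1 h2 h3 => ?_
    have hχm : MemLp χ 2 ((volume : Measure (E m)).restrict 𝒯.Γ) :=
      h1.continuous.memLp_of_hasCompactSupport h2
    have h4 := h (𝒯.liftVt (hχm.toLp χ)) (𝒯.exists_mem_spaceG (h1.of_le (by simp)) h2 h3 hχm)
    rw [𝒯.traceΓ_liftVt, 𝒯.traceΓ_liftVt] at h4
    have h5 : ∫ ξ, χ ξ * ham.toLp a ξ ∂𝒯.surf = ∫ ξ, χ ξ * a ξ ∂𝒯.surf := by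
      refine integral_congr_ae ?_
      filter_upwards [ham.coeFn_toLp] with ξ e1
      rw [e1]
    have hm : AEStronglyMeasurable (fun ξ => χ ξ * a ξ) ((inflowMeasure Ω b).map 𝒯.k) :=
      h1.continuous.aestronglyMeasurable.mul (Lp.stronglyMeasurable a).aestronglyMeasurable
    rw [h5, surf, integral_map 𝒯.measurable_k.aemeasurable hm, ← h4]
    refine integral_congr_ae ?_
    have e1 := ae_eq_comp_of_map_le 𝒯.measurable_k.aemeasurable 𝒯.exists_surf_le.choose_spec
      hχm.coeFn_toLp
    filter_upwards [𝒯.coeFn_surfL a, 𝒯.coeFn_surfL (hχm.toLp χ), e1] with x e2 e3 e4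
    rw [e2, e3, e4]
  have ha : a = 0 := by
    rw [Lp.eq_zero_iff_ae_eq_zero]
    refine 𝒯.absolutelyContinuous_surf.ae_eq ?_
    have h1 := ham.coeFn_toLp
    rw [hz] at h1
    exact h1.symm.trans (Lp.coeFn_zero ℝ 2 𝒯.surf)
  rw [ha]
  exact Subtype.ext (WithLp.ofLp_injective 2 (Prod.ext (map_zero 𝒯.liftL) rfl))

end TubeData

end Aligned

end

theorem mainTheorem5 (m : ℕ) (hm : m = 1 ∨ m = 2) (Ω : Set (E (m + 1)))
    (b : E (m + 1) → E (m + 1)) (hb : ContDiff ℝ ∞ b) (hΩ : IsCrossedBy Ω b) :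
    -- the decomposition of `𝒱`, the projector `P` and the Poincaré–Wirtinger inequality
    (IsCompl (spaceG Ω b) (spaceA Ω b) ∧
      ∃ P : spaceV Ω b →L[ℝ] spaceV Ω b,
        (∀ φ, P φ ∈ spaceG Ω b ∧ ∀ ψ ∈ spaceG Ω b, ⟪(P φ).1.fst, ψ.1.fst⟫ = ⟪φ.1.fst, ψ.1.fst⟫) ∧
        (∃ C : ℝ≥0, ∀ φ : spaceV Ω b,
          eLpNorm (perp b (P φ).1.snd) 2 (volume.restrict Ω)
            ≤ C * eLpNorm φ.1.snd 2 (volume.restrict Ω)) ∧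
        ∃ C : ℝ≥0, ∀ φ : spaceV Ω b,
          eLpNorm (φ - P φ).1.fst 2 (volume.restrict Ω)
            ≤ C * eLpNorm (par b φ.1.snd) 2 (volume.restrict Ω)) ∧
    -- the inflow trace on `𝒱̃` and the decomposition of `𝒱̃`, where `ℒ` is the kernel of the trace
    (∃! T : spaceVt Ω b hb →L[ℝ] Lp ℝ 2 (inflowMeasure Ω b), IsInflowTrace Ω b hb T) ∧
    ∀ T : spaceVt Ω b hb →L[ℝ] Lp ℝ 2 (inflowMeasure Ω b), IsInflowTrace Ω b hb T →
      IsCompl (spaceGt Ω b hb) (LinearMap.ker (T : spaceVt Ω b hb →ₗ[ℝ] Lp ℝ 2 (inflowMeasure Ω b))) ∧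
      ∀ g ∈ spaceGt Ω b hb,
        (∀ η : spaceVt Ω b hb, (∃ w ∈ spaceG Ω b, w.1.fst = η.1.fst) →
          ∫ x, T η x * T g x ∂(inflowMeasure Ω b) = 0) → g = 0 := by
  obtain ⟨𝒯⟩ := hΩ.nonempty_tubeData hb
  refine ⟨𝒯.isCompl_spaceG_spaceA_and_exists_projection,
    ⟨𝒯.surfL.comp 𝒯.traceΓ, 𝒯.isInflowTrace, fun T hT => 𝒯.eq_of_isInflowTrace hT⟩, fun T hT => ?_⟩
  rw [𝒯.eq_of_isInflowTrace hT]
  exact ⟨𝒯.isCompl_spaceGt_ker, fun g hg h => 𝒯.eq_zero_of_forall_integral_eq_zero hg h⟩
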